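/- Let $k$ be an algebraically closed field of characteristic $0$ and let $A=A_0\oplus A_1$ be a finite-dimensional $\mathbb Z/2$-graded associative (not necessarily unital) $k$-algebra. Write $\bar a$ for the parity of a homogeneous $a$, $\Pi A$ for $A$ with reversed parity, and $\pi a\in\Pi A$ for the element corresponding to $a$. All formulas below are for homogeneous elements. Assume: * $\beta$ is a nondegenerate symmetric bilinear form on $A$ that is odd ($\beta(a,b)=0$ when $\bar a=\bar b$), and the three-tensor $m(\pi a,\pi b,\pi c)=(-1)^{\bar b}\beta(ab,c)$ is cyclically invariant: $m(\pi a,\pi b,\pi c)=(-1)^{(\bar c+1)(\bar a+\bar b)}m(\pi c,\pi a,\pi b)$; * $I:A\to A$ is an odd linear map with $I(ab)=I(a)b+(-1)^{\bar a}aI(b)$ and $\beta(Ia,b)+(-1)^{\bar a}\beta(a,Ib)=0$; * $H:A\to A$ is an odd linear map with $\beta(Ha,b)=(-1)^{\bar a}\beta(a,Hb)$ and $I^2H=HI^2$, such that $P=\mathrm{Id}-[I,H]=\mathrm{Id}-(IH+HI)$ satisfies $P^2=P$. Let $B=P(A)$, with the form $\beta|_B$. For a basis $(e_i)$ with Gram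 matrix $G=(\beta(e_i,e_j))$, the inverse tensor is $\beta^\vee=\sum_{i,j}(G^{-1})_{ij}\,e_i\otimes e_j$. **Space and operators.** Let $\mathcal F_B$ be the space $\bigl(\mathrm{Symm}\bigl(\bigoplus_{j\ge1}((\Pi B)^{\otimes j})^{\mathbb Z/j}\bigr)\bigr)^\vee[[\hbar]]$. An element $F$ of it is a family of $k[[\hbar]]$-valued multilinear functionals $F_\sigma$ on $(\Pi B)^n$, for $n\ge0$ and $\sigma\in S_n$, where the cycles of $\sigma$ are the cyclic words along which the $n$ letters are placed; the family is invariant, with Koszul signs, under renumbering of the letters. For two letters $f,f'$ of the cyclic words $\sigma'$, *dissection-gluing* removes $f$ and $f'$ and lets the predecessor of $f$ be followed by the successor of $f'$ and the predecessor of $f'$ by the successor of $f$. It is admitted only when no empty word arises, that is, unless $f,f'$ are neighbours on the same word or are both words of length one. * $(\Delta F)_\sigma(a_1,\dots,a_n)=\frac12\sum_{\sigma'}F_{\sigma'}(\beta_B^\vee,a_1,\dots,a_n)$, where $\beta_B^\vee$ is the inverse tensor of $\beta|_B$, inserted at two additional letters $f,f'$, and $\sigma'$ runs over all cyclic words on the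 $n+2$ letters that give $\sigma$ by dissection-gluing of $f,f'$. * For even $F,G$, $\{F,G\}$ is the analogous sum, without the factor $\frac12$, of the products $F\cdot G$ in which $f$ is a letter of a word of $F$ and $f'$ a letter of a word of $G$ (the other words being distributed in all ways), with Koszul signs. * For even $F$, $(I^\vee F)_\sigma(a_1,\dots,a_n)=\sum_l(-1)^{|a_1|+\dots+|a_{l-1}|}F_\sigma(a_1,\dots,Ia_l,\dots,a_n)$, where $|\cdot|$ is the parity in $\Pi B$. **Ribbon graphs.** Let $\Gamma$ be a trivalent ribbon graph with legs labelled $1,\dots,n$. The oriented surface $\Sigma_\Gamma$ has Euler characteristic $\chi(\Sigma_\Gamma)=|Vert(\Gamma)|-|Edge(\Gamma)|$, which for connected $\Gamma$ equals $2-2g(\Sigma_\Gamma)-i(\Sigma_\Gamma)$, $i$ being the number of boundary components. Let $W_\Gamma(a_1,\dots,a_n)$ be the contraction, with Koszul signs in $\Pi A$, of $m$ at every vertex with the propagator $\beta^\vee(H^\vee\cdot,\cdot):=-(H\otimes1)\beta^\vee$ at every internal edge and with $a_l\in\Pi B$ at the leg $l$. For $\sigma\in S_n$ put $$S_\sigma(a_1,\dots,a_n)=\sum_\Gamma\hbar^{1-\chi(\Sigma_\Gamma)}W_\Gamma(a_1,\dots,a_n),$$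 the sum being over isomorphism classes of nonempty connected trivalent ribbon graphs with legs labelled $1,\dots,n$ such that every boundary component of $\Sigma_\Gamma$ carries at least one leg and the cyclic words of legs along the boundary components are the cycles of $\sigma$. **Theorem.** $W_\Gamma$ depends only on the isomorphism class of $\Gamma$, the family $S$ is an even element of $\mathcal F_B$, and it satisfies the equivariant noncommutative Batalin–Vilkovisky equation $$\hbar\Delta S+\tfrac12\{S,S\}+I^\vee S=0 .$$ In particular, if $I|_B=0$, then $\hbar\Delta S+\frac12\{S,S\}=0$. If $I^2|_B=0$, then $S+S_{0,2}$ is an even element of $\mathcal F_B$ and satisfies $$\hbar\Delta(S+S_{0,2})+\tfrac12\{S+S_{0,2},S+S_{0,2}\}=0,$$ where $S_{0,2}$ is the quadratic term, supported on a single cyclic word with two letters, $S_{0,2}(\pi a,\pi b)=(-1)^{\bar a+1}\beta(Ia,b)$. -/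

import Mathlib

open scoped PowerSeries

noncomputable section

namespace NCBV

/-! ### Super linear algebra

A super vector space is a `k`-module `A` with a `ZMod 2`-grading `𝒜`.  The parity-shifted space `ΠA`
is `A` itself with the parities reversed: `a` stands for `πa`, and `πa` has parity `|a| + 1`.  Below,
`pr i : U → U` always denotes the projection of a super space `U` onto its part of parity `i`. -/

/-- `(-1)^i` for `i` in `ZMod 2`. -/
def sgn (i : ZMod 2) : ℤ := if i = 0 then 1 else -1

/-- The projection of `A` onto its homogeneous part `𝒜 i`. -/
def parityProj {k A : Type*} [Field k] [AddCommGroup A] [Module k A]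
    (𝒜 : ZMod 2 → Submodule k A) [DirectSum.Decomposition 𝒜] (i : ZMod 2) : A →ₗ[k] A :=
  (𝒜 i).subtype ∘ₗ DirectSum.component k (ZMod 2) (fun j => 𝒜 j) i ∘ₗ
    (DirectSum.decomposeLinearEquiv 𝒜).toLinearMap

/-- The projection of `ΠA` onto its part of parity `i`. -/
def piProj {k A : Type*} [Field k] [AddCommGroup A] [Module k A]
    (𝒜 : ZMod 2 → Submodule k A) [DirectSum.Decomposition 𝒜] (i : ZMod 2) : A →ₗ[k] A :=
  parityProj 𝒜 (i + 1)

/-- The parity involution `x ↦ (-1)^{|x|} x` of a super space with parity projections `pr`. -/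
def parityInv {k U : Type*} [Field k] [AddCommGroup U] [Module k U]
    (pr : ZMod 2 → U →ₗ[k] U) : U →ₗ[k] U := pr 0 - pr 1

/-- The operator induced by `f` on the image `B` of the idempotent `P`; it is the restriction `f|_B`
whenever `f` maps `B` to itself, which is the case for all operators to which it is applied. -/
def onRange {k A : Type*} [Field k] [AddCommGroup A] [Module k A]
    (P f : A →ₗ[k] A) : LinearMap.range P →ₗ[k] LinearMap.range P :=
  P.rangeRestrict ∘ₗ f ∘ₗ (LinearMap.range P).subtype

/-- The projections of `ΠB` onto its parts of parity `i`, for the image `B` of an even idempotent `P`. -/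
def piProjRange {k A : Type*} [Field k] [AddCommGroup A] [Module k A]
    (𝒜 : ZMod 2 → Submodule k A) [DirectSum.Decomposition 𝒜] (P : A →ₗ[k] A) (i : ZMod 2) :
    LinearMap.range P →ₗ[k] LinearMap.range P :=
  onRange P (piProj 𝒜 i)

/-- The Koszul sign of rearranging factors indexed by `X`, the factor `x` having parity `q x`, from the
order in which `x` stands at place `r x` to the order in which `x` stands at place `s x`:
a factor `-1` for each pair of odd factors whose order is reversed. -/
def koszulSign {X : Type*} [Fintype X] (r s : X → ℕ) (q : X → ZMod 2) : ℤ :=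
  open Classical in
  ∏ x, ∏ y, if r x < r y ∧ s y < s x ∧ q x = 1 ∧ q y = 1 then -1 else 1

/-- For the basis `(e_i) = Module.finBasis k U`, the vector `e^i = ∑ⱼ (G⁻¹)ᵢⱼ eⱼ`, where
`G i j = β(e_i, e_j)`.  The tensor `β^∨` inverse to a nondegenerate form `β` is `∑ᵢ e_i ⊗ e^i`
(it does not depend on the basis). -/
def dualVec {k U : Type*} [Field k] [AddCommGroup U] [Module k U] [FiniteDimensional k U]
    (β : LinearMap.BilinForm k U) (i : Fin (Module.finrank k U)) : U :=
  ∑ j, (Matrix.of fun i j => β (Module.finBasis k U i) (Module.finBasis k U j))⁻¹ i j •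
    Module.finBasis k U j

/-! ### Symmetric products of cyclic words

A product of cyclic words in `n` letters is given by placing the letters `a_0, …, a_{n-1}` along the
cycles of a permutation `σ` of `{0, …, n-1}`, each cycle `(i, σ i, σ (σ i), …)` being one cyclic word.
So `⊕_j (V^{⊗j})_{ℤ/j}` has symmetric algebra `⊕_n (k[S_n] ⊗ V^{⊗n})_{S_n}`, with `S_n` acting on itself
by conjugation, and an element of its dual, with coefficients in `k⟦ħ⟧`, is a family of multilinear
functionals `F n σ` on `V^n` which is equivariant under relabelling, with Koszul signs. -/

/-- Families `F n σ (a_0, …, a_{n-1}) ∈ k⟦ħ⟧`, `ħ` being `PowerSeries.X`. -/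
abbrev WordForm (k U : Type*) [Field k] [AddCommGroup U] [Module k U] : Type _ :=
  ∀ n : ℕ, Equiv.Perm (Fin n) → (Fin n → U) → k⟦X⟧

/-- `F` is an even element of the dual of the symmetric algebra of cyclic words in the super space `U`
(with parity projections `pr`), with coefficients in `k⟦ħ⟧`. -/
structure IsEvenCyclicForm {k U : Type*} [Field k] [AddCommGroup U] [Module k U]
    (pr : ZMod 2 → U →ₗ[k] U) (F : WordForm k U) : Prop where
  multilinear : ∀ n σ, ∃ M : MultilinearMap k (fun _ : Fin n => U) k⟦X⟧, ∀ a, F n σ a = M a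
  equivariant : ∀ (n : ℕ) (σ g : Equiv.Perm (Fin n)) (a : Fin n → U) (q : Fin n → ZMod 2),
    (∀ i, pr (q i) (a i) = a i) →
      F n (g * σ * g⁻¹) (fun i => a (g⁻¹ i)) =
        koszulSign (fun i : Fin n => (i : ℕ)) (fun i : Fin n => (g i : ℕ)) q • F n σ a
  even : ∀ (n : ℕ) (σ : Equiv.Perm (Fin n)) (a : Fin n → U) (q : Fin n → ZMod 2),
    (∀ i, pr (q i) (a i) = a i) → ∑ i, q i = 1 → F n σ a = 0

/-- `τ` is the permutation of the marked points `ι 0, …, ι (n-1)` induced by the cyclic orders of the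
cycles of `π`, and every cycle of `π` contains a marked point. -/
def Induces {X : Type*} (π : Equiv.Perm X) {n : ℕ} (ι : Fin n → X) (τ : Equiv.Perm (Fin n)) : Prop :=
  (∀ x, ∃ i, ∃ r : ℕ, (π ^ r) (ι i) = x) ∧
  ∀ i, ∃ r : ℕ, 0 < r ∧ (π ^ r) (ι i) = ι (τ i) ∧
    ∀ s : ℕ, 0 < s → s < r → (π ^ s) (ι i) ∉ Set.range ι

/-- Dissection and gluing: the cyclic words `σ'` on `{0, 1, …, n+1}` are cut at the letters `0` and `1`
and reglued, so that the letter before `0` is followed by the letter after `1` and the letter before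
`1` by the letter after `0`.  The result is `σ` (on the letters `2, …, n+1`, renumbered) and no empty
word arises.  An empty word would arise exactly when `0`, `1` are neighbours on the same cyclic word or
are both cyclic words of length one. -/
def GluesTo {n : ℕ} (σ' : Equiv.Perm (Fin (n + 2))) (σ : Equiv.Perm (Fin n)) : Prop :=
  Induces (σ' * Equiv.swap 0 1) (fun i : Fin n => i.succ.succ) σ

/-- The Batalin-Vilkovisky operator: the sum over all dissection-gluings of two letters, with `β^∨`
inserted at these two letters.  The factor `1/2` makes every unordered pair of letters count once. -/
def bvDelta {k U : Type*} [Field k] [AddCommGroup U] [Module k U] [FiniteDimensional k U]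
    (β : LinearMap.BilinForm k U) (F : WordForm k U) : WordForm k U := fun n σ a =>
  open Classical in
  (2⁻¹ : k) • ∑ σ' : Equiv.Perm (Fin (n + 2)), if GluesTo σ' σ then
    ∑ i, F (n + 2) σ'
      (Matrix.vecCons (Module.finBasis k U i) (Matrix.vecCons (dualVec β i) a)) else 0

/-- The numbering of a subset `T` of `Fin m` and of its complement, in increasing order. -/
def blockEquiv {m : ℕ} (T : Finset (Fin m)) : Fin T.card ⊕ Fin Tᶜ.card ≃ Fin m :=
  finSumEquivOfFinset rfl rfl

/-- `F ⊗ G` evaluated on `x_0, …, x_{m-1}`, with the letters in `T` given to `F` along `σ₁` and the other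
letters given to `G` along `σ₂`, with the Koszul sign of this rearrangement (for even `F`, `G`). -/
def tensorAt {k U : Type*} [Field k] [AddCommGroup U] [Module k U]
    (pr : ZMod 2 → U →ₗ[k] U) (F G : WordForm k U) {m : ℕ} (T : Finset (Fin m))
    (σ₁ : Equiv.Perm (Fin T.card)) (σ₂ : Equiv.Perm (Fin Tᶜ.card)) (x : Fin m → U) : k⟦X⟧ :=
  ∑ q : Fin m → ZMod 2,
    koszulSign (fun i : Fin m => (i : ℕ))
        (fun i : Fin m => (finSumFinEquiv ((blockEquiv T).symm i) : ℕ)) q •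
      (F T.card σ₁ (fun i => pr (q (blockEquiv T (Sum.inl i))) (x (blockEquiv T (Sum.inl i)))) *
       G Tᶜ.card σ₂ (fun i => pr (q (blockEquiv T (Sum.inr i))) (x (blockEquiv T (Sum.inr i)))))

/-- The odd Poisson bracket of even elements: the sum over all dissection-gluings of a letter of a word
in `F` with a letter of a word in `G`, with `β^∨` inserted at these two letters. -/
def bvBracket {k U : Type*} [Field k] [AddCommGroup U] [Module k U] [FiniteDimensional k U]
    (pr : ZMod 2 → U →ₗ[k] U) (β : LinearMap.BilinForm k U) (F G : WordForm k U) :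
    WordForm k U := fun n σ a =>
  open Classical in
  ∑ T : Finset (Fin (n + 2)), if 0 ∈ T ∧ 1 ∉ T then
    ∑ σ₁ : Equiv.Perm (Fin T.card), ∑ σ₂ : Equiv.Perm (Fin Tᶜ.card),
      if GluesTo ((blockEquiv T).permCongr (Equiv.Perm.sumCongr σ₁ σ₂)) σ then
        ∑ i, tensorAt pr F G T σ₁ σ₂
          (Matrix.vecCons (Module.finBasis k U i) (Matrix.vecCons (dualVec β i) a))
      else 0
  else 0

/-- The action `I^∨` of an odd operator `I` on even elements:
`(I^∨ F)(a_0, …) = ∑_l (-1)^{|a_0| + … + |a_{l-1}|} F(a_0, …, I a_l, …)`. -/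
def dualAction {k U : Type*} [Field k] [AddCommGroup U] [Module k U]
    (pr : ZMod 2 → U →ₗ[k] U) (I : U →ₗ[k] U) (F : WordForm k U) : WordForm k U := fun n σ a =>
  ∑ l, F n σ (fun j => if j < l then parityInv pr (a j) else if j = l then I (a j) else a j)

/-- The left-hand side `ħ ΔF + ½ {F, F}` of the noncommutative Batalin-Vilkovisky equation. -/
def bvLHS {k U : Type*} [Field k] [AddCommGroup U] [Module k U] [FiniteDimensional k U]
    (pr : ZMod 2 → U →ₗ[k] U) (β : LinearMap.BilinForm k U) (F : WordForm k U) : WordForm k U :=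
  (PowerSeries.X : k⟦X⟧) • bvDelta β F + (2⁻¹ : k) • bvBracket pr β F F

/-- The quadratic term `S_{0,2}`, supported on a single cyclic word with two letters:
`(πa, πb) ↦ (-1)^{|πa|} β(I a, b)`, in degree `0` in `ħ`. -/
def quadraticTerm {k U : Type*} [Field k] [AddCommGroup U] [Module k U]
    (pr : ZMod 2 → U →ₗ[k] U) (β : LinearMap.BilinForm k U) (I : U →ₗ[k] U) : WordForm k U
  | 2, σ, a => if σ = Equiv.swap 0 1 then PowerSeries.C (β (I (parityInv pr (a 0))) (a 1)) else 0
  | _, _, _ => 0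

/-! ### Trivalent ribbon graphs -/

/-- The flags of a trivalent graph with vertices `0, …, N-1`: the flags at `v` are `(v, 0)`, `(v, 1)`,
`(v, 2)`. -/
abbrev Flag (N : ℕ) : Type := Fin N × Fin 3

/-- The cyclic orders at the vertices: `(v, 0) ↦ (v, 1) ↦ (v, 2) ↦ (v, 0)`. -/
def rot (N : ℕ) : Equiv.Perm (Flag N) := Equiv.prodCongr (Equiv.refl (Fin N)) (finRotate 3)

/-- A trivalent ribbon graph with `N` vertices and `n` legs labelled by `0, …, n-1`; every trivalent
ribbon graph is isomorphic to one with this set of flags.  The involution `edge` interchanges the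
two flags of each internal edge and fixes exactly the legs. -/
structure RibbonGraph (n N : ℕ) where
  edge : Equiv.Perm (Flag N)
  leg : Fin n ↪ Flag N
  edge_edge : ∀ f, edge (edge f) = f
  edge_eq_self_iff : ∀ f, edge f = f ↔ ∃ l, leg l = f

namespace RibbonGraph

/-- Isomorphism of ribbon graphs with labelled legs. -/
def Iso {n N : ℕ} (Γ Γ' : RibbonGraph n N) : Prop :=
  ∃ g : Equiv.Perm (Flag N), (∀ f, g (rot N f) = rot N (g f)) ∧
    (∀ f, g (Γ.edge f) = Γ'.edge (g f)) ∧ ∀ l, g (Γ.leg l) = Γ'.leg l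

theorem iso_equivalence (n N : ℕ) : Equivalence (Iso : RibbonGraph n N → RibbonGraph n N → Prop) where
  refl Γ := ⟨1, by simp, by simp, by simp⟩
  symm := by
    rintro Γ Γ' ⟨g, h1, h2, h3⟩
    refine ⟨g⁻¹, fun f => ?_, fun f => ?_, fun l => ?_⟩
    · rw [Equiv.Perm.inv_eq_iff_eq, h1]; simp
    · rw [Equiv.Perm.inv_eq_iff_eq, h2]; simp
    · rw [Equiv.Perm.inv_eq_iff_eq, h3]
  trans := by
    rintro Γ Γ' Γ'' ⟨g, h1, h2, h3⟩ ⟨g', h1', h2', h3'⟩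
    exact ⟨g' * g, fun f => by simp [h1, h1'], fun f => by simp [h2, h2'],
      fun l => by simp [h3, h3']⟩

/-- Isomorphism classes of trivalent ribbon graphs with `N` vertices and `n` labelled legs. -/
def IsoClass (n N : ℕ) : Type := Quotient (Setoid.mk Iso (iso_equivalence n N))

/-- The graph is nonempty, and any two flags are joined by moves around vertices and along edges. -/
def Connected {n N : ℕ} (Γ : RibbonGraph n N) : Prop :=
  0 < N ∧ ∀ f f' : Flag N, ∃ w ∈ Subgroup.closure {rot N, Γ.edge}, w f = f'

/-- The boundary components of the surface `Σ_Γ` are the cycles of `f ↦ rot (edge f)`.  Each of them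
contains a leg, and the cyclic words of legs along them are the cycles of `σ`. -/
def HasBoundary {n N : ℕ} (Γ : RibbonGraph n N) (σ : Equiv.Perm (Fin n)) : Prop :=
  Induces (rot N * Γ.edge) Γ.leg σ

/-- The chosen first flag of each internal edge (the choice does not matter). -/
def IsHead {n N : ℕ} (Γ : RibbonGraph n N) (f : Flag N) : Prop := toLex f < toLex (Γ.edge f)

/-- The Euler characteristic of `Σ_Γ`: number of vertices minus number of internal edges; it equals
`2 - 2g - i` for `Σ_Γ` connected of genus `g` with `i` boundary components. -/
def eulerChar {n N : ℕ} (Γ : RibbonGraph n N) : ℤ := (N : ℤ) - Nat.card {f // Γ.IsHead f}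

/-- All flags, vertex by vertex. -/
def vertexOrder (N : ℕ) : List (Flag N) := List.finRange N ×ˢ List.finRange 3

/-- All flags: first the two flags of each internal edge, edge by edge, then the legs in order. -/
def edgeLegOrder {n N : ℕ} (Γ : RibbonGraph n N) : List (Flag N) :=
  open Classical in
  ((vertexOrder N).filter (fun f => Γ.IsHead f)).flatMap (fun f => [f, Γ.edge f]) ++ List.ofFn Γ.leg

end RibbonGraph

/-! ### The contraction -/

/-- The three-tensor `m(πa, πb, πc) = (-1)^{|b|} β(a b, c)`. -/
def threeTensor {k A : Type*} [Field k] [NonUnitalRing A] [Module k A]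
    (𝒜 : ZMod 2 → Submodule k A) [DirectSum.Decomposition 𝒜] (β : LinearMap.BilinForm k A)
    (a b c : A) : k :=
  β (a * parityProj 𝒜 0 b) c - β (a * parityProj 𝒜 1 b) c

/-- The vectors at the flags in one summand of the contraction: the legs carry the `a l`, and an
internal edge `(f, f')` carries the summand `-(H e_i) ⊗ e^i`, `i = t f`, of the propagator
`β^∨(H^∨ ·, ·) = -(H ⊗ 1) β^∨`; the sign arises from moving the odd `H` past the odd tensor `β^∨`. -/
def flagVec {k A : Type*} [Field k] [AddCommGroup A] [Module k A] [FiniteDimensional k A]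
    (β : LinearMap.BilinForm k A) (H : A →ₗ[k] A) {n N : ℕ} (Γ : RibbonGraph n N) (a : Fin n → A)
    (t : {f // Γ.IsHead f} → Fin (Module.finrank k A)) (f : Flag N) : A :=
  open Classical in
  if h : Γ.IsHead f then -H (Module.finBasis k A (t ⟨f, h⟩))
  else if h' : Γ.IsHead (Γ.edge f) then dualVec β (t ⟨Γ.edge f, h'⟩)
  else ∑ l, if Γ.leg l = f then a l else 0

/-- The tensor `W_Γ`: the contraction of the three-tensors at the vertices with the propagators at the
edges and the elements `a l` at the legs.  The elements are listed edge by edge and then leg by leg,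
and are brought to the vertices with the Koszul sign in `ΠA`. -/
def ribbonTensor {k A : Type*} [Field k] [NonUnitalRing A] [Module k A] [FiniteDimensional k A]
    (𝒜 : ZMod 2 → Submodule k A) [DirectSum.Decomposition 𝒜] (β : LinearMap.BilinForm k A)
    (H : A →ₗ[k] A) {n N : ℕ} (Γ : RibbonGraph n N) (a : Fin n → A) : k :=
  open Classical in
  ∑ t : {f // Γ.IsHead f} → Fin (Module.finrank k A), ∑ q : Flag N → ZMod 2,
    koszulSign (fun f => Γ.edgeLegOrder.idxOf f)
        (fun f => (RibbonGraph.vertexOrder N).idxOf f) q •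
      ∏ v : Fin N, threeTensor 𝒜 β
        (piProj 𝒜 (q (v, 0)) (flagVec β H Γ a t (v, 0)))
        (piProj 𝒜 (q (v, 1)) (flagVec β H Γ a t (v, 1)))
        (piProj 𝒜 (q (v, 2)) (flagVec β H Γ a t (v, 2)))

/-- `S = ∑_Γ ħ^{1-χ(Σ_Γ)} W_Γ` on `ΠB`, `B` the image of `P`: on the cyclic words `σ`, the coefficient of
`ħ^h` is the sum of `W_Γ` over the isomorphism classes of connected trivalent ribbon graphs with
labelled legs, with `1 - χ(Σ_Γ) = h`, whose legs form the cyclic words `σ` along the boundary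
components of `Σ_Γ` and meet all of these. -/
def ribbonSum {k A : Type*} [Field k] [NonUnitalRing A] [Module k A] [FiniteDimensional k A]
    (𝒜 : ZMod 2 → Submodule k A) [DirectSum.Decomposition 𝒜] (β : LinearMap.BilinForm k A)
    (H P : A →ₗ[k] A) : WordForm k (LinearMap.range P) := fun n σ a =>
  PowerSeries.mk fun h =>
    ∑ᶠ (N : ℕ) (c : RibbonGraph.IsoClass n N)
      (_ : (Quotient.out c).Connected ∧ (Quotient.out c).HasBoundary σ ∧
        1 - (Quotient.out c).eulerChar = (h : ℤ)),
      ribbonTensor 𝒜 β H (Quotient.out c) (fun l => (a l : A))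

end NCBV

end

noncomputable section

namespace NCBV

/-! ### Koszul signs -/

/-! In a homogeneous basis of `A` the tensor `W_Γ` is a state sum over colourings of the flags by
basis indices: a Koszul sign, a product of vertex coefficients, a product of propagator
coefficients, and the coordinates of the letters at the legs. Vertices and internal edges are even,
so moving them as blocks costs no sign (`kexp_blocks`). This makes the state sum independent of all
choices and an invariant of the isomorphism class.

The Leibniz rule and the invariance of `β` say that `I` annihilates the three-tensor. Inserting `I`
at every flag of a graph in turn therefore gives zero (`contr_derivation`), and the insertions at
the legs, which make up `I^∨ S`, are minus those at the internal edges (`contr_legAct`). At an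
internal edge `I` acts on the propagator of `-H`, and the result is the tensor of `[I, H] = Id - P`
(`pairCoeff_comm`). Cutting that edge turns `I^∨ S` into one half of a sum over graphs with two more
legs, at which `Id - P` is inserted and which are then glued; the half accounts for the two
orientations of the edge (`sum_weight_legAct`).

The `Id` part vanishes by associativity. An edge carrying `β^∨` merges its two vertices into the
tensor `β(abc, d)`, which changes sign when its four arguments are cyclically rotated
(`fourTensor_anti`). Rotating the four flags passes from one resolution of the four-valent vertex to
the other and changes neither connectedness nor boundary words, so the sum equals its own negative
(`sum_weight_flip`). Loops do not occur: at a trivalent vertex a loop bounds a disc without legs.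

In the `P` part the inserted tensor is the inverse tensor of `β|_B` (`casimir_restrict`). A graph
that is connected before the gluing contributes to `ħ Δ S`, one with two components to `½ {S, S}`
(`sum_glue`). Gluing two legs multiplies the boundary permutation by a transposition, and the first
return to the remaining legs is exactly dissection-gluing; the excluded empty words are the boundary
components without legs (`glue_hasBoundary_iff`).

The multiplicities agree for two reasons. A graph all of whose boundary components carry labelled
legs has no automorphisms, so the sum over isomorphism classes is the sum over all graphs on a fixed
set of flags divided by `N! * 3 ^ N` (`sum_isoClass`); binomial coefficients make this normalisation
multiplicative for disjoint unions (`sum_card_card_compl`). The power `h` of `ħ` satisfies `N + 2 =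
n + 2 * h`, and this relation is additive in the right way for all three terms.

For the last assertion, the bracket with `S_{0,2}` is `I^∨` (`bvBracket_quadraticTerm`), the bracket
of even elements is symmetric, `Δ S_{0,2} = 0`, and `I^∨ S_{0,2} = 0` when `I²` vanishes on `B`.
Expanding the equation for `S + S_{0,2}` thus gives the equivariant equation for `S`. -/

theorem sgn_add (i j : ZMod 2) : sgn (i + j) = sgn i * sgn j := by
  revert i j; decide

/-- The exponent of the Koszul sign. -/
def kexp {X : Type*} [Fintype X] (r s : X → ℕ) (q : X → ZMod 2) : ZMod 2 :=
  ∑ x, ∑ y, if r x < r y ∧ s y < s x then q x * q y else 0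

theorem sgn_sum {X : Type*} (S : Finset X) (q : X → ZMod 2) :
    sgn (∑ x ∈ S, q x) = ∏ x ∈ S, sgn (q x) := by
  classical
  induction S using Finset.induction_on with
  | empty => simp [sgn]
  | insert a S ha ih => rw [Finset.sum_insert ha, Finset.prod_insert ha, sgn_add, ih]

theorem koszulSign_eq {X : Type*} [Fintype X] (r s : X → ℕ) (q : X → ZMod 2) :
    koszulSign r s q = sgn (kexp r s q) := by
  classical
  unfold koszulSign kexp
  rw [sgn_sum]
  refine Finset.prod_congr rfl fun x _ => ?_
  rw [sgn_sum]
  refine Finset.prod_congr rfl fun y _ => ?_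
  have key : ∀ a b : ZMod 2, sgn (a * b) = if a = 1 ∧ b = 1 then -1 else 1 := by decide
  by_cases h : r x < r y ∧ s y < s x
  · rw [if_pos h, key]
    simp [h.1, h.2]
  · rw [if_neg h, if_neg (fun h' => h ⟨h'.1, h'.2.1⟩)]
    simp [sgn]

/-- The sign `(-1)^i` in the ground field. -/
def chi (k : Type*) [Field k] (i : ZMod 2) : k := (sgn i : ℤ)

section chi
variable {k : Type*} [Field k]

theorem chi_add (i j : ZMod 2) : chi k (i + j) = chi k i * chi k j := by
  simp [chi, sgn_add]

@[simp] theorem chi_zero : chi k 0 = 1 := by simp [chi, sgn]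

@[simp] theorem chi_one : chi k 1 = -1 := by simp [chi, sgn]

theorem chi_mul_self (i : ZMod 2) : chi k i * chi k i = 1 := by
  rw [← chi_add, CharTwo.add_self_eq_zero, chi_zero]

theorem koszulSign_smul {X M : Type*} [Fintype X] [AddCommGroup M] [Module k M] (r s : X → ℕ)
    (q : X → ZMod 2) (x : M) : koszulSign r s q • x = chi k (kexp r s q) • x := by
  rw [koszulSign_eq, chi, Int.cast_smul_eq_zsmul]

end chi

/-- Indicator with values in `ZMod 2`. -/
def ind (P : Prop) [Decidable P] : ZMod 2 := if P then 1 else 0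

/-! ### Cocycle and block identities for the exponent of the Koszul sign. -/

section kexp
variable {X : Type*} [Fintype X]

/-- An auxiliary order `u` picks one representative of each unordered pair, and the weight is `1`
exactly when `r` and `s` order the pair differently. In this form the dependence on `r` and `s` is
additive, so that `kexp_trans` becomes a pointwise identity. -/
theorem kexp_eq_sum_lt {r s u : X → ℕ} (hr : r.Injective) (hs : s.Injective) (hu : u.Injective)
    (q : X → ZMod 2) :
    kexp r s q = ∑ x, ∑ y,
      if u x < u y then (ind (r x < r y) + ind (s x < s y)) * (q x * q y) else 0 := by
  classical
  have h1 : kexp r s q =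
      (∑ x, ∑ y, if u x < u y then (if r x < r y ∧ s y < s x then q x * q y else 0) else 0) +
      ∑ x, ∑ y, if u y < u x then (if r x < r y ∧ s y < s x then q x * q y else 0) else 0 := by
    unfold kexp
    rw [← Finset.sum_add_distrib]
    refine Finset.sum_congr rfl fun x _ => ?_
    rw [← Finset.sum_add_distrib]
    refine Finset.sum_congr rfl fun y _ => ?_
    rcases lt_trichotomy (u x) (u y) with h | h | h
    · simp [h, h.le.not_gt]
    · have := hu h; subst this; simp
    · simp [h, h.le.not_gt]
  rw [h1]
  conv_lhs => enter [2]; rw [Finset.sum_comm]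
  rw [← Finset.sum_add_distrib]
  refine Finset.sum_congr rfl fun x _ => ?_
  rw [← Finset.sum_add_distrib]
  refine Finset.sum_congr rfl fun y _ => ?_
  by_cases h : u x < u y
  · have hxy : x ≠ y := fun e => by subst e; exact lt_irrefl _ h
    have h2 : (1 : ZMod 2) + 1 = 0 := by decide
    rcases lt_or_gt_of_ne (hr.ne hxy) with h3 | h3 <;>
    rcases lt_or_gt_of_ne (hs.ne hxy) with h4 | h4 <;>
    simp [h, h3, h4, h3.le.not_gt, h4.le.not_gt, ind, h2, mul_comm]
  · simp [h]

theorem kexp_trans {r s t : X → ℕ} (hr : r.Injective) (hs : s.Injective) (ht : t.Injective)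
    (q : X → ZMod 2) : kexp r t q = kexp r s q + kexp s t q := by
  rw [kexp_eq_sum_lt hr ht hr, kexp_eq_sum_lt hr hs hr, kexp_eq_sum_lt hs ht hr,
    ← Finset.sum_add_distrib]
  refine Finset.sum_congr rfl fun x _ => ?_
  rw [← Finset.sum_add_distrib]
  refine Finset.sum_congr rfl fun y _ => ?_
  split_ifs
  · have : ∀ a b c d : ZMod 2, (a + b) * d = (a + c) * d + (c + b) * d := by decide
    exact this _ _ _ _
  · simp

theorem kexp_comm (r s : X → ℕ) (q : X → ZMod 2) : kexp r s q = kexp s r q := by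
  unfold kexp
  rw [Finset.sum_comm]
  simp only [and_comm, mul_comm]

theorem kexp_congr {r s r' s' : X → ℕ} (hr : ∀ x y, r x < r y ↔ r' x < r' y)
    (hs : ∀ x y, s x < s y ↔ s' x < s' y) (q : X → ZMod 2) : kexp r s q = kexp r' s' q := by
  simp only [kexp, hr, hs]

theorem kexp_comp {Y : Type*} [Fintype Y] (e : Y ≃ X) (r s : X → ℕ) (q : X → ZMod 2) :
    kexp (r ∘ e) (s ∘ e) (q ∘ e) = kexp r s q := by
  unfold kexp
  rw [← e.sum_comp]
  refine Finset.sum_congr rfl fun x _ => ?_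
  rw [← e.sum_comp]
  rfl

/-- The change of the Koszul sign when the parity of one factor changes. -/
theorem kexp_update [DecidableEq X] {r s : X → ℕ} (hr : r.Injective) (hs : s.Injective)
    (q : X → ZMod 2) (f : X) :
    kexp r s (Function.update q f (q f + 1)) = kexp r s q +
      ((∑ y, if r y < r f then q y else 0) + ∑ y, if s y < s f then q y else 0) := by
  set q' := Function.update q f (q f + 1) with hq'
  have e : ∀ x y, q' x * q' y = q x * q y + ((if x = f then q y else 0) +
      (if y = f then q x else 0) + if x = f ∧ y = f then 1 else 0) := by
    intro x y
    by_cases hx : x = f <;> by_cases hy : y = f <;> simp [hq', hx, hy] <;> ring_nf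
  rw [kexp_eq_sum_lt hr hs hr, kexp_eq_sum_lt hr hs hr]
  -- The diagonal correction in `e` drops out, because `r x < r y` excludes `x = y = f`.
  have h2 : ∀ x y, (if r x < r y then (ind (r x < r y) + ind (s x < s y)) * (q' x * q' y) else 0)
      = (if r x < r y then (ind (r x < r y) + ind (s x < s y)) * (q x * q y) else 0) +
      ((if x = f then (if r f < r y then (ind (r f < r y) + ind (s f < s y)) * q y else 0) else 0) +
       (if y = f then (if r x < r f then (ind (r x < r f) + ind (s x < s f)) * q x else 0) else 0))
      := by
    intro x y
    rw [e]
    by_cases hx : x = f <;> by_cases hy : y = f <;> by_cases h : r x < r y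
    all_goals first | subst hx | skip
    all_goals first | subst hy | skip
    all_goals simp [mul_add, *]
  simp_rw [h2, Finset.sum_add_distrib]
  congr 1
  simp only [Finset.sum_ite_eq', Finset.mem_univ, if_true]
  rw [Finset.sum_comm]
  simp only [Finset.sum_ite_eq', Finset.mem_univ, if_true]
  rw [← Finset.sum_add_distrib, ← Finset.sum_add_distrib]
  refine Finset.sum_congr rfl fun y _ => ?_
  by_cases hy : y = f
  · subst hy; simp
  · have h2 : (1 : ZMod 2) + 1 = 0 := by decide
    have h3 : q y + q y = 0 := CharTwo.add_self_eq_zero _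
    rcases lt_or_gt_of_ne (hr.ne hy) with h5 | h5 <;>
    rcases lt_or_gt_of_ne (hs.ne hy) with h4 | h4 <;>
    simp [h5, h5.le.not_gt, h4, h4.le.not_gt, ind, *]

/-- Contiguous blocks of even total parity may be moved freely. -/
theorem kexp_blocks {Y : Type*} [DecidableEq Y] {r s : X → ℕ} (κ : X → Y) (E : Y → Prop)
    [DecidablePred E]
    (hr : ∀ x y y', κ y = κ y' → κ x ≠ κ y → E (κ y) → (r x < r y ↔ r x < r y'))
    (hs : ∀ x y y', κ y = κ y' → κ x ≠ κ y → E (κ y) → (s x < s y ↔ s x < s y'))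
    (hri : r.Injective) (hsi : s.Injective)
    (q : X → ZMod 2) (hE : ∀ y, E (κ y) → ∑ x with κ x = κ y, q x = 0) :
    kexp r s q = ∑ x, ∑ y, if (κ x = κ y ∨ (¬ E (κ x) ∧ ¬ E (κ y))) ∧ r x < r y ∧ s y < s x
      then q x * q y else 0 := by
  classical
  have hr' : ∀ x y y', κ y = κ y' → κ x ≠ κ y → E (κ y) → (r y < r x ↔ r y' < r x) := by
    intro x y y' h1 h2 h3
    have a : r x ≠ r y := fun e => h2 (by rw [hri e])
    have b : r x ≠ r y' := fun e => h2 (by rw [hri e, h1])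
    have := hr x y y' h1 h2 h3
    omega
  have hs' : ∀ x y y', κ y = κ y' → κ x ≠ κ y → E (κ y) → (s y < s x ↔ s y' < s x) := by
    intro x y y' h1 h2 h3
    have a : s x ≠ s y := fun e => h2 (by rw [hsi e])
    have b : s x ≠ s y' := fun e => h2 (by rw [hsi e, h1])
    have := hs x y y' h1 h2 h3
    omega
  -- An even block contributes nothing against a letter outside it: the condition `D x` is constant
  -- on the block, and the parities of the block add up to zero.
  have zero : ∀ (D : X → X → Prop) [∀ x y, Decidable (D x y)],
      (∀ x y y', κ y = κ y' → κ x ≠ κ y → E (κ y) → (D x y ↔ D x y')) → ∀ x,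
      ∑ y, (if (E (κ y) ∧ κ x ≠ κ y) ∧ D x y then q x * q y else 0) = 0 := by
    intro D _ hD x
    rw [← Finset.sum_fiberwise_of_maps_to (s := Finset.univ) (t := Finset.univ.image κ) (g := κ)
      (fun y _ => Finset.mem_image_of_mem κ (Finset.mem_univ y))]
    refine Finset.sum_eq_zero fun b hb => ?_
    obtain ⟨y0, -, rfl⟩ := Finset.mem_image.1 hb
    by_cases h : (E (κ y0) ∧ κ x ≠ κ y0) ∧ D x y0
    · have : ∀ y ∈ Finset.univ.filter (fun y => κ y = κ y0),
          (if (E (κ y) ∧ κ x ≠ κ y) ∧ D x y then q x * q y else 0) = q x * q y := by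
        intro y hy
        have hy := (Finset.mem_filter.1 hy).2
        rw [if_pos]
        rw [hy]
        exact ⟨h.1, (hD x y0 y hy.symm h.1.2 h.1.1).1 h.2⟩
      rw [Finset.sum_congr rfl this, ← Finset.mul_sum, hE y0 h.1.1, mul_zero]
    · refine Finset.sum_eq_zero fun y hy => ?_
      have hy := (Finset.mem_filter.1 hy).2
      rw [if_neg]
      rintro ⟨⟨h1, h2⟩, h3⟩
      rw [hy] at h1 h2
      exact h ⟨⟨h1, h2⟩, (hD x y0 y hy.symm h2 h1).2 h3⟩
  have z1 := zero (fun x y => r x < r y ∧ s y < s x)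
    (fun x y y' h1 h2 h3 => by rw [hr x y y' h1 h2 h3, hs' x y y' h1 h2 h3])
  have z2 := zero (fun x y => ¬ E (κ x) ∧ r y < r x ∧ s x < s y)
    (fun x y y' h1 h2 h3 => by rw [hr' x y y' h1 h2 h3, hs x y y' h1 h2 h3])
  have z1' := Finset.sum_eq_zero (s := Finset.univ) (fun x _ => z1 x)
  have z2' := Finset.sum_eq_zero (s := Finset.univ) (fun x _ => z2 x)
  rw [Finset.sum_comm] at z2'
  -- A pair in different blocks is charged to an even block: to the second sum if the block of the
  -- second letter is even, to the third if only that of the first is. Both sums vanish by `zero`.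
  have main : kexp r s q = (∑ x, ∑ y,
      if (κ x = κ y ∨ (¬ E (κ x) ∧ ¬ E (κ y))) ∧ r x < r y ∧ s y < s x then q x * q y else 0) +
      (∑ x, ∑ y, if (E (κ y) ∧ κ x ≠ κ y) ∧ r x < r y ∧ s y < s x then q x * q y else 0) +
      ∑ y, ∑ x, if (E (κ y) ∧ κ x ≠ κ y) ∧ ¬ E (κ x) ∧ r y < r x ∧ s x < s y
        then q x * q y else 0 := ?_
  · rw [main, z1', z2', add_zero, add_zero]
  unfold kexp
  rw [← Finset.sum_add_distrib, ← Finset.sum_add_distrib]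
  refine Finset.sum_congr rfl fun x _ => ?_
  rw [← Finset.sum_add_distrib, ← Finset.sum_add_distrib]
  refine Finset.sum_congr rfl fun y _ => ?_
  by_cases h : r x < r y ∧ s y < s x
  · by_cases h1 : κ x = κ y
    · simp [h, h1]
    · by_cases h2 : E (κ x) <;> by_cases h3 : E (κ y) <;>
        simp [h, h1, h2, h3, Ne.symm h1, mul_comm]
  · have : ¬ (¬ E (κ y) ∧ r x < r y ∧ s y < s x) := fun h' => h h'.2
    simp [h]

end kexp

open RibbonGraph

/-! ### Contractions in coordinates -/

theorem fin3_cases (i : Fin 3) : i = 0 ∨ i = 1 ∨ i = 2 := by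
  fin_cases i <;> simp

/-- The place of a flag in the order vertex by vertex. -/
def vpos {N : ℕ} (f : Flag N) : ℕ := 3 * (f.1 : ℕ) + (f.2 : ℕ)

theorem vpos_injective {N : ℕ} : Function.Injective (vpos : Flag N → ℕ) := by
  rintro ⟨v, i⟩ ⟨v', i'⟩ h
  simp only [vpos] at h
  ext <;> simp <;> omega

@[simp] theorem rot_apply {N : ℕ} (v : Fin N) (i : Fin 3) : rot N (v, i) = (v, i + 1) := by
  simp [rot, finRotate_apply]

namespace RibbonGraph

variable {n N : ℕ} (Γ : RibbonGraph n N)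

theorem edge_leg (l : Fin n) : Γ.edge (Γ.leg l) = Γ.leg l := (Γ.edge_eq_self_iff _).2 ⟨l, rfl⟩

theorem sum_fixed {M : Type*} [AddCommMonoid M] (g : Flag N → M) :
    (∑ f, if Γ.edge f = f then g f else 0) = ∑ l, g (Γ.leg l) := by
  classical
  rw [← Finset.sum_filter, ← Finset.sum_map Finset.univ Γ.leg g]
  congr 1
  ext f
  simp [Γ.edge_eq_self_iff]

/-- An order of the flags in which the two flags of each internal edge are neighbours. -/
structure Adapted (r : Flag N → ℕ) : Prop where
  inj : Function.Injective r
  contig : ∀ f x, x ≠ f → x ≠ Γ.edge f → (r x < r f ↔ r x < r (Γ.edge f))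

end RibbonGraph

/-- Structure constants, in a homogeneous basis, of a cyclically invariant even three-tensor and of
an even symmetric propagator. -/
structure EvenTensors {k J : Type*} [Field k] (p : J → ZMod 2) (μ : J → J → J → k)
    (η : J → J → k) : Prop where
  vertex_even : ∀ i j l, μ i j l ≠ 0 → p i + p j + p l = 0
  vertex_cyclic : ∀ i j l, μ i j l = chi k (p l * (p i + p j)) * μ l i j
  edge_even : ∀ i j, η i j ≠ 0 → p i = p j
  edge_symm : ∀ i j, η j i = chi k (p i) * η i j

section contr

variable {k J : Type*} [Field k] (p : J → ZMod 2) (μ : J → J → J → k)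
  (η : J → J → k) {n N : ℕ}

/-- The product of the vertex tensors for a colouring of the flags. -/
def vertexProd (c : Flag N → J) : k := ∏ v, μ (c (v, 0)) (c (v, 1)) (c (v, 2))

/-- The product of the propagators for a colouring of the flags. -/
def edgeProd (Γ : RibbonGraph n N) (r : Flag N → ℕ) (c : Flag N → J) : k :=
  ∏ f, if r f < r (Γ.edge f) then η (c f) (c (Γ.edge f)) else 1

/-- The contraction of a ribbon graph with the tensor `w` at the legs, the flags being listed in
the order `r`. -/
def contr [Fintype J] (Γ : RibbonGraph n N) (r : Flag N → ℕ) (w : (Fin n → J) → k) : k :=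
  open Classical in
  ∑ c : Flag N → J, chi k (kexp r vpos (p ∘ c)) * vertexProd μ c * edgeProd η Γ r c *
    w (c ∘ Γ.leg)

variable {p μ η}

theorem edge_even_of_edgeProd_ne_zero (h : EvenTensors p μ η) (Γ : RibbonGraph n N)
    {r : Flag N → ℕ} (hr : r.Injective) (c : Flag N → J) (hc : edgeProd η Γ r c ≠ 0) (f : Flag N) :
    p (c f) = p (c (Γ.edge f)) := by
  rw [edgeProd, Finset.prod_ne_zero_iff] at hc
  by_cases hf : Γ.edge f = f
  · rw [hf]
  · rcases lt_or_gt_of_ne (hr.ne hf) with h1 | h1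
    · have := hc (Γ.edge f) (Finset.mem_univ _)
      rw [Γ.edge_edge, if_pos h1] at this
      exact (h.edge_even _ _ this).symm
    · have := hc f (Finset.mem_univ _)
      rw [if_pos h1] at this
      exact h.edge_even _ _ this

/-- An edge whose two flags are ordered differently by `r` and `r'` is reversed by `edge_symm`; each
such edge enters the exponent once, through its first flag in `r`. -/
theorem edgeProd_change (h : EvenTensors p μ η) (Γ : RibbonGraph n N)
    {r r' : Flag N → ℕ} (hr : r.Injective) (hr' : r'.Injective) (c : Flag N → J) :
    edgeProd η Γ r c = chi k (∑ f, if r f < r (Γ.edge f) ∧ r' (Γ.edge f) < r' f then p (c f) else 0)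
      * edgeProd η Γ r' c := by
  have e1 : ∀ r r' : Flag N → ℕ, r.Injective → r'.Injective → edgeProd η Γ r c =
      (∏ f, if r f < r (Γ.edge f) ∧ r' f < r' (Γ.edge f) then η (c f) (c (Γ.edge f)) else 1) *
      ∏ f, if r f < r (Γ.edge f) ∧ r' (Γ.edge f) < r' f then η (c f) (c (Γ.edge f)) else 1 := by
    intro r r' _ hr'
    rw [edgeProd, ← Finset.prod_mul_distrib]
    refine Finset.prod_congr rfl fun f _ => ?_
    by_cases hf : Γ.edge f = f
    · simp [hf]
    · rcases lt_or_gt_of_ne (hr'.ne hf) with h1 | h1 <;> by_cases h2 : r f < r (Γ.edge f) <;>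
        simp [h1, h2, h1.le.not_gt]
  have chi_sum : ∀ g : Flag N → ZMod 2, chi k (∑ f, g f) = ∏ f, chi k (g f) := by
    intro g
    simp [chi, sgn_sum]
  rw [e1 r r' hr hr', e1 r' r hr' hr, chi_sum, mul_left_comm]
  refine congrArg₂ _ ?_ ?_
  · refine Finset.prod_congr rfl fun f _ => ?_
    simp only [and_comm]
  · rw [← Equiv.prod_comp Γ.edge (fun f => if r' f < r' (Γ.edge f) ∧ r (Γ.edge f) < r f then
      η (c f) (c (Γ.edge f)) else 1), ← Finset.prod_mul_distrib]
    refine Finset.prod_congr rfl fun f _ => ?_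
    rw [Γ.edge_edge]
    by_cases h1 : r f < r (Γ.edge f) <;> by_cases h2 : r' (Γ.edge f) < r' f
    · simp only [h1, h2, and_self, if_true]
      rw [h.edge_symm (c f), ← mul_assoc, chi_mul_self, one_mul]
    all_goals simp [h1, h2]

/-- Internal edges are contiguous blocks of even total parity, so only the inversions inside an edge
and those among the legs survive. An inversion inside an edge contributes `q f * q f = q f`. -/
theorem kexp_adapted (Γ : RibbonGraph n N) {r r' : Flag N → ℕ} (hr : Γ.Adapted r)
    (hr' : Γ.Adapted r') (q : Flag N → ZMod 2) (hq : ∀ f, q f = q (Γ.edge f)) :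
    kexp r r' q = (∑ f, if r f < r (Γ.edge f) ∧ r' (Γ.edge f) < r' f then q f else 0) +
      kexp (r ∘ Γ.leg) (r' ∘ Γ.leg) (q ∘ Γ.leg) := by
  classical
  -- Blocks are indexed by the unordered pair of a flag and its partner; the legs are the diagonal
  -- pairs.
  have hκ : ∀ x y, s(x, Γ.edge x) = s(y, Γ.edge y) ↔ y = x ∨ y = Γ.edge x := by
    intro x y
    simp only [Sym2.eq, Sym2.rel_iff', Prod.mk.injEq, Prod.swap_prod_mk]
    constructor
    · rintro (h | h)
      · exact Or.inl h.1.symm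
      · exact Or.inr h.2.symm
    · rintro (rfl | rfl)
      · simp
      · simp [Γ.edge_edge]
  have hc : ∀ r : Flag N → ℕ, Γ.Adapted r → ∀ x y y', s(y, Γ.edge y) = s(y', Γ.edge y') →
      s(x, Γ.edge x) ≠ s(y, Γ.edge y) → ¬ s(y, Γ.edge y).IsDiag → (r x < r y ↔ r x < r y') := by
    intro r hr x y y' h1 h2 _
    rw [hκ] at h1
    rw [Ne, hκ, not_or] at h2
    rcases h1 with rfl | rfl
    · rfl
    · exact hr.contig y x (Ne.symm h2.1) (fun e => h2.2 (by rw [e, Γ.edge_edge]))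
  rw [kexp_blocks (fun f => s(f, Γ.edge f)) (fun b => ¬ b.IsDiag) (hc r hr) (hc r' hr')
    hr.inj hr'.inj]
  · have : kexp (r ∘ Γ.leg) (r' ∘ Γ.leg) (q ∘ Γ.leg) =
        ∑ x, ∑ y, if (Γ.edge x = x ∧ Γ.edge y = y) ∧ r x < r y ∧ r' y < r' x
          then q x * q y else 0 := by
      unfold kexp
      simp only [Function.comp]
      rw [← Γ.sum_fixed (fun f => ∑ y, if r f < r (Γ.leg y) ∧ r' (Γ.leg y) < r' f then
        q f * q (Γ.leg y) else 0)]
      refine Finset.sum_congr rfl fun x _ => ?_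
      by_cases hx : Γ.edge x = x
      · rw [if_pos hx, ← Γ.sum_fixed (fun f => if r x < r f ∧ r' f < r' x then q x * q f else 0)]
        refine Finset.sum_congr rfl fun y _ => ?_
        by_cases hy : Γ.edge y = y <;> simp [hx, hy]
      · simp [hx]
    rw [this, ← Finset.sum_add_distrib]
    refine Finset.sum_congr rfl fun x _ => ?_
    have : (if r x < r (Γ.edge x) ∧ r' (Γ.edge x) < r' x then q x else 0) =
        ∑ y, if y = Γ.edge x ∧ r x < r y ∧ r' y < r' x then q x * q y else 0 := by
      have e : ∀ y, (if y = Γ.edge x ∧ r x < r y ∧ r' y < r' x then q x * q y else 0) =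
        if y = Γ.edge x then (if r x < r (Γ.edge x) ∧ r' (Γ.edge x) < r' x then q x else 0)
          else 0 := by
        intro y
        by_cases hy : y = Γ.edge x
        · subst hy
          rw [← hq]
          have : ∀ a : ZMod 2, a * a = a := by decide
          simp [this]
        · simp [hy]
      simp_rw [e]
      simp
    rw [this, ← Finset.sum_add_distrib]
    refine Finset.sum_congr rfl fun y _ => ?_
    simp only [hκ, Sym2.mk_isDiag_iff, not_not]
    by_cases h : r x < r y ∧ r' y < r' x
    · have hxy : y ≠ x := by rintro rfl; exact lt_irrefl _ h.1
      by_cases h1 : y = Γ.edge x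
      · subst h1
        simp [h, hxy, Γ.edge_edge, hxy.symm]
      · simp only [h, hxy, h1, false_or, and_true, false_and, if_false, zero_add, and_self,
          eq_comm (a := x), eq_comm (a := y)]
    · simp [h]
  · intro y hy
    have hy' : y ≠ Γ.edge y := by simpa using hy
    have : Finset.univ.filter (fun x => s(x, Γ.edge x) = s(y, Γ.edge y)) = {y, Γ.edge y} := by
      ext x
      rw [Finset.mem_filter, eq_comm, hκ]
      simp
    rw [this, Finset.sum_pair hy', ← hq]
    exact CharTwo.add_self_eq_zero _

/-- The contraction does not depend on the order of the flags, up to the Koszul sign of the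
change of the order of the legs. -/
theorem contr_adapted [Fintype J] (h : EvenTensors p μ η) (Γ : RibbonGraph n N) {r r' : Flag N → ℕ}
    (hr : Γ.Adapted r) (hr' : Γ.Adapted r') (w : (Fin n → J) → k) :
    contr p μ η Γ r w = contr p μ η Γ r'
      (fun d => chi k (kexp (r ∘ Γ.leg) (r' ∘ Γ.leg) (p ∘ d)) * w d) := by
  classical
  unfold contr
  refine Finset.sum_congr rfl fun c _ => ?_
  -- The signs of the reversed edges occur both in `edgeProd_change` and in `kexp_adapted` and
  -- cancel. The second lemma needs the flags of an edge to have equal parities, which holds where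
  -- the product of propagators does not vanish.
  have key : chi k (kexp r vpos (p ∘ c)) * edgeProd η Γ r c = chi k (kexp r' vpos (p ∘ c)) *
      (chi k (kexp (r ∘ Γ.leg) (r' ∘ Γ.leg) (p ∘ c ∘ Γ.leg)) * edgeProd η Γ r' c) := by
    by_cases hc : edgeProd η Γ r' c = 0
    · rw [edgeProd_change h Γ hr.inj hr'.inj, hc]; simp
    · have hq := edge_even_of_edgeProd_ne_zero h Γ hr'.inj c hc
      rw [edgeProd_change h Γ hr.inj hr'.inj, kexp_trans hr.inj hr'.inj vpos_injective, chi_add,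
        kexp_adapted Γ hr hr' (p ∘ c) hq, chi_add]
      set A := ∑ f, if r f < r (Γ.edge f) ∧ r' (Γ.edge f) < r' f then p (c f) else 0
      have : (∑ f, if r f < r (Γ.edge f) ∧ r' (Γ.edge f) < r' f then (p ∘ c) f else 0) = A := rfl
      rw [this, Function.comp_assoc]
      linear_combination (chi k (kexp (r ∘ Γ.leg) (r' ∘ Γ.leg) (p ∘ c ∘ Γ.leg)) *
        chi k (kexp r' vpos (p ∘ c)) * edgeProd η Γ r' c) * chi_mul_self (k := k) A
  linear_combination (vertexProd μ c * w (c ∘ Γ.leg)) * key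

theorem kexp_self {X : Type*} [Fintype X] {r r' : X → ℕ} (h : ∀ x y, r x < r y ↔ r' x < r' y)
    (q : X → ZMod 2) : kexp r r' q = 0 := by
  unfold kexp
  refine Finset.sum_eq_zero fun x _ => Finset.sum_eq_zero fun y _ => if_neg ?_
  rintro ⟨h1, h2⟩
  rw [h] at h1
  omega

theorem contr_adapted_of_leg [Fintype J] (h : EvenTensors p μ η) (Γ : RibbonGraph n N) {r r' : Flag N → ℕ}
    (hr : Γ.Adapted r) (hr' : Γ.Adapted r')
    (hl : ∀ l l', r (Γ.leg l) < r (Γ.leg l') ↔ r' (Γ.leg l) < r' (Γ.leg l'))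
    (w : (Fin n → J) → k) : contr p μ η Γ r w = contr p μ η Γ r' w := by
  rw [contr_adapted h Γ hr hr']
  congr 1
  ext d
  rw [kexp_self (r := r ∘ Γ.leg) (r' := r' ∘ Γ.leg) hl, chi_zero, one_mul]

/-- Reordering of the vertices. -/
theorem kexp_vertex {s s' : Flag N → ℕ} (hs : s.Injective) (hs' : s'.Injective)
    (h : ∀ x v i j, x.1 ≠ v → (s x < s (v, i) ↔ s x < s (v, j)))
    (h' : ∀ x v i j, x.1 ≠ v → (s' x < s' (v, i) ↔ s' x < s' (v, j)))
    (q : Flag N → ZMod 2) (hq : ∀ v, q (v, 0) + q (v, 1) + q (v, 2) = 0) :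
    kexp s s' q = ∑ v, ∑ i : Fin 3, ∑ j : Fin 3,
      if s (v, i) < s (v, j) ∧ s' (v, j) < s' (v, i) then q (v, i) * q (v, j) else 0 := by
  have hc : ∀ s : Flag N → ℕ, (∀ x v i j, x.1 ≠ v → (s x < s (v, i) ↔ s x < s (v, j))) →
      ∀ x y y' : Flag N, y.1 = y'.1 → x.1 ≠ y.1 → True → (s x < s y ↔ s x < s y') := by
    rintro s h x ⟨v, i⟩ ⟨v', i'⟩ (rfl : v = v') h2 -
    exact h x v i i' h2
  rw [kexp_blocks (fun f => f.1) (fun _ => True) (hc s h) (hc s' h') hs hs']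
  · rw [Fintype.sum_prod_type]
    refine Finset.sum_congr rfl fun v _ => Finset.sum_congr rfl fun i _ => ?_
    rw [Fintype.sum_prod_type, Finset.sum_eq_single v]
    · simp
    · intro v' _ hv
      simp [Ne.symm hv]
    · simp
  · rintro ⟨v, i⟩ -
    rw [← hq v, Finset.sum_filter, Fintype.sum_prod_type, Finset.sum_eq_single v]
    · simp [Fin.sum_univ_three]
    · intro v' _ hv
      simp [hv]
    · simp

theorem vertex_even_of_vertexProd_ne_zero (h : EvenTensors p μ η) (c : Flag N → J)
    (hc : vertexProd μ c ≠ 0) (v : Fin N) : p (c (v, 0)) + p (c (v, 1)) + p (c (v, 2)) = 0 := by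
  rw [vertexProd, Finset.prod_ne_zero_iff] at hc
  exact h.vertex_even _ _ _ (hc v (Finset.mem_univ _))

theorem vpos_contig (x : Flag N) (v : Fin N) (i j : Fin 3) (h : x.1 ≠ v) :
    vpos x < vpos (v, i) ↔ vpos x < vpos (v, j) := by
  have : (x.1 : ℕ) ≠ v := fun e => h (Fin.ext e)
  simp only [vpos]
  omega

/-- A permutation of the flags which commutes with `rot`. -/
theorem commute_rot_apply {g : Equiv.Perm (Flag N)} (hg : ∀ f, g (rot N f) = rot N (g f))
    (v : Fin N) (i : Fin 3) : g (v, i) = ((g (v, 0)).1, (g (v, 0)).2 + i) := by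
  have h1 : g (v, 1) = ((g (v, 0)).1, (g (v, 0)).2 + 1) := by
    have := hg (v, 0)
    rwa [rot_apply, ← Prod.mk.eta (p := g (v, 0)), rot_apply] at this
  have h2 : g (v, 2) = ((g (v, 0)).1, (g (v, 0)).2 + 2) := by
    have := hg (v, 1)
    rw [rot_apply, h1, rot_apply, add_assoc] at this
    exact this
  rcases fin3_cases i with rfl | rfl | rfl
  · simp
  · exact h1
  · exact h2

theorem commute_rot_symm {g : Equiv.Perm (Flag N)} (hg : ∀ f, g (rot N f) = rot N (g f)) (f) :
    g.symm (rot N f) = rot N (g.symm f) := by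
  rw [Equiv.symm_apply_eq, hg, Equiv.apply_symm_apply]

/-- The permutation of the vertices. -/
def vertexPerm (g : Equiv.Perm (Flag N)) (hg : ∀ f, g (rot N f) = rot N (g f)) :
    Equiv.Perm (Fin N) where
  toFun v := (g (v, 0)).1
  invFun v := (g.symm (v, 0)).1
  left_inv v := by
    have := commute_rot_apply (commute_rot_symm hg) (g (v, 0)).1 (g (v, 0)).2
    rw [Prod.mk.eta, Equiv.symm_apply_apply] at this
    exact (congrArg Prod.fst this).symm
  right_inv v := by
    have := commute_rot_apply hg (g.symm (v, 0)).1 (g.symm (v, 0)).2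
    rw [Prod.mk.eta, Equiv.apply_symm_apply] at this
    exact (congrArg Prod.fst this).symm

/-- A symmetry of the cyclic orders permutes the vertices, at no cost because they are even, and
turns each of them, at the cost recorded in `vertex_cyclic`. The exponent `kexp vpos (vpos ∘ g)` is
the sum of these costs. -/
theorem vertexProd_comp (h : EvenTensors p μ η) {g : Equiv.Perm (Flag N)}
    (hg : ∀ f, g (rot N f) = rot N (g f)) (c : Flag N → J) :
    chi k (kexp vpos (vpos ∘ g) (p ∘ c)) * vertexProd μ (c ∘ g.symm) = vertexProd μ c := by
  have hvv : ∀ v, vertexPerm g hg v = (g (v, 0)).1 := fun v => rfl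
  -- The three cases are the three possible rotations of a vertex; for the rotation by `2` the
  -- cyclic rule is applied to the turned tensor instead of the original one.
  have cyc : ∀ (v : Fin N), μ (c (v, 0)) (c (v, 1)) (c (v, 2)) =
      chi k (∑ i : Fin 3, ∑ j : Fin 3, if vpos (v, i) < vpos (v, j) ∧
        vpos (g (v, j)) < vpos (g (v, i)) then p (c (v, i)) * p (c (v, j)) else 0) *
      μ (c (g.symm (vertexPerm g hg v, 0))) (c (g.symm (vertexPerm g hg v, 1)))
        (c (g.symm (vertexPerm g hg v, 2))) := by
    intro v
    have hs : ∀ i, g.symm ((g (v, 0)).1, (g (v, 0)).2 + i) = (v, i) := by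
      intro i
      rw [Equiv.symm_apply_eq, commute_rot_apply hg v i]
    simp only [hvv]
    simp only [commute_rot_apply hg v 1, commute_rot_apply hg v 2, Fin.sum_univ_three]
    rcases fin3_cases (g (v, 0)).2 with e | e | e <;> rw [e] at hs ⊢
    · have a0 := hs 0; have a1 := hs 1; have a2 := hs 2
      simp only [zero_add] at a0 a1 a2
      rw [a0, a1, a2]
      simp [vpos, e]
    · have a0 := hs 2; have a1 := hs 0; have a2 := hs 1
      simp only [show (1 : Fin 3) + 2 = 0 by rfl, show (1 : Fin 3) + 0 = 1 by rfl,
        show (1 : Fin 3) + 1 = 2 by rfl] at a0 a1 a2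
      rw [a0, a1, a2, h.vertex_cyclic]
      simp [vpos, e, add_mul, mul_comm]
    · have a0 := hs 1; have a1 := hs 2; have a2 := hs 0
      simp only [show (2 : Fin 3) + 1 = 0 by rfl, show (2 : Fin 3) + 0 = 2 by rfl,
        show (2 : Fin 3) + 2 = 1 by rfl] at a0 a1 a2
      rw [a0, a1, a2, h.vertex_cyclic (c (v, 1)), ← mul_assoc]
      simp [vpos, e]
      rw [← mul_add, chi_mul_self, one_mul]
  by_cases hc : ∀ v, p (c (v, 0)) + p (c (v, 1)) + p (c (v, 2)) = 0
  · rw [kexp_vertex vpos_injective (vpos_injective.comp g.injective) vpos_contig ?_ _ hc]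
    · have chi_sum : ∀ a : Fin N → ZMod 2, chi k (∑ f, a f) = ∏ f, chi k (a f) := by
        intro a
        simp [chi, sgn_sum]
      rw [chi_sum, vertexProd, vertexProd,
        ← Equiv.prod_comp (vertexPerm g hg) (fun v => μ ((c ∘ g.symm) (v, 0)) ((c ∘ g.symm) (v, 1))
          ((c ∘ g.symm) (v, 2))), ← Finset.prod_mul_distrib]
      exact Finset.prod_congr rfl fun v _ => (cyc v).symm
    · intro x v i j hx
      simp only [Function.comp]
      rw [commute_rot_apply hg v i, commute_rot_apply hg v j]
      refine vpos_contig _ _ _ _ fun e => hx ?_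
      have : vertexPerm g hg x.1 = vertexPerm g hg v := by
        rw [hvv, hvv, ← e]
        conv_rhs => rw [← Prod.mk.eta (p := x), commute_rot_apply hg]
      exact (vertexPerm g hg).injective this
  -- If some vertex is not even, both products vanish.
  · have h0 : vertexProd μ c = 0 := by
      by_contra h0
      exact hc (vertex_even_of_vertexProd_ne_zero h c h0)
    rw [h0]
    push Not at hc
    obtain ⟨v, hv⟩ := hc
    have h1 : μ (c (v, 0)) (c (v, 1)) (c (v, 2)) = 0 := by
      by_contra h1
      exact hv (h.vertex_even _ _ _ h1)
    rw [cyc v] at h1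
    have h2 : ∀ i : ZMod 2, chi k i ≠ 0 := fun i e => by
      have := chi_mul_self (k := k) i
      rw [e] at this
      simp at this
    rw [vertexProd, Finset.prod_eq_zero (Finset.mem_univ (vertexPerm g hg v))
      ((mul_eq_zero.1 h1).resolve_left (h2 _)), mul_zero]

/-- Colourings are transported along `g`. What remains is the sign between the two vertex orders,
and `vertexProd_comp` absorbs it. -/
theorem contr_iso [Fintype J] (h : EvenTensors p μ η) {Γ Γ' : RibbonGraph n N} {g : Equiv.Perm (Flag N)}
    (hg : ∀ f, g (rot N f) = rot N (g f)) (he : ∀ f, g (Γ.edge f) = Γ'.edge (g f))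
    (hl : ∀ l, g (Γ.leg l) = Γ'.leg l) {r : Flag N → ℕ} (hr : r.Injective)
    (w : (Fin n → J) → k) :
    contr p μ η Γ' r w = contr p μ η Γ (r ∘ g) w := by
  classical
  unfold contr
  rw [← (Equiv.arrowCongr g (Equiv.refl J)).sum_comp]
  refine Finset.sum_congr rfl fun c _ => ?_
  have e0 : (Equiv.arrowCongr g (Equiv.refl J)) c = c ∘ g.symm := rfl
  rw [e0]
  have e1 : edgeProd η Γ' r (c ∘ g.symm) = edgeProd η Γ (r ∘ g) c := by
    unfold edgeProd
    rw [← Equiv.prod_comp g]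
    refine Finset.prod_congr rfl fun f _ => ?_
    simp [← he]
  have e2 : (c ∘ g.symm) ∘ Γ'.leg = c ∘ Γ.leg := by
    ext l
    simp [← hl]
  have e3 : kexp r vpos (p ∘ c ∘ g.symm) = kexp (r ∘ g) (vpos ∘ g) (p ∘ c) := by
    rw [← kexp_comp g r vpos]
    congr 1
    ext f
    simp
  rw [e1, e2, e3, kexp_trans (hr.comp g.injective) vpos_injective
    (vpos_injective.comp g.injective), chi_add, mul_assoc (chi k _), vertexProd_comp h hg]

theorem Adapted.comp_iso {Γ Γ' : RibbonGraph n N} {g : Equiv.Perm (Flag N)}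
    (he : ∀ f, g (Γ.edge f) = Γ'.edge (g f)) {r : Flag N → ℕ} (hr : Γ'.Adapted r) :
    Γ.Adapted (r ∘ g) where
  inj := hr.inj.comp g.injective
  contig f x h1 h2 := by
    simp only [Function.comp, he]
    exact hr.contig _ _ (g.injective.ne h1) (by rw [← he]; exact g.injective.ne h2)

end contr

/-! ### Sums over colourings in which one flag is recoloured. -/

section update

variable {X J M : Type*} [Fintype X] [DecidableEq X] [Fintype J]

/-- Pairs of a colouring and a further colour carry an involution, which exchanges that colour with
the one at `f`. -/
theorem sum_update_comm [AddCommMonoid M] (f : X) (Φ : (X → J) → (X → J) → M) :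
    ∑ c, ∑ j, Φ c (Function.update c f j) = ∑ c, ∑ j, Φ (Function.update c f j) c := by
  classical
  rw [← Fintype.sum_prod_type' (f := fun c j => Φ c (Function.update c f j)),
    ← Fintype.sum_prod_type' (f := fun c j => Φ (Function.update c f j) c)]
  have hinv : Function.Involutive
      (fun x : (X → J) × J => (Function.update x.1 f x.2, x.1 f)) := by
    rintro ⟨c, j⟩
    simp
  rw [← Equiv.sum_comp hinv.toPerm]
  refine Finset.sum_congr rfl ?_
  rintro ⟨c, j⟩ -
  simp [Function.Involutive.coe_toPerm]

theorem sum_eq_zero_of_update [AddCommMonoid M] (f : X) (Φ : (X → J) → M)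
    (h : ∀ c, ∑ j, Φ (Function.update c f j) = 0) : ∑ c, Φ c = 0 := by
  rw [← Equiv.sum_comp (Equiv.funSplitAt f J).symm, Fintype.sum_prod_type, Finset.sum_comm]
  refine Finset.sum_eq_zero fun d _ => ?_
  by_cases hJ : Nonempty J
  · obtain ⟨j0⟩ := hJ
    rw [← h ((Equiv.funSplitAt f J).symm (j0, d))]
    refine Finset.sum_congr rfl fun j _ => congrArg Φ ?_
    ext x
    by_cases hx : x = f
    · subst hx; simp [Equiv.funSplitAt, Equiv.piSplitAt]
    · simp [Equiv.funSplitAt, Equiv.piSplitAt, hx]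
  · have := not_nonempty_iff.1 hJ
    simp

end update

/-! ### Inserting a derivation at the flags of a graph. -/

section derivation

variable {k J : Type*} [Field k] [Fintype J] {p : J → ZMod 2} {μ : J → J → J → k}
  {η : J → J → k} {n N : ℕ}

/-- A derivation of the vertex tensors. -/
structure VertexDerivation (p : J → ZMod 2) (μ : J → J → J → k) (ι : J → J → k) : Prop where
  odd : ∀ i j, ι i j ≠ 0 → p i = p j + 1
  inv : ∀ a b c, ∑ i, (μ i b c * ι i a + chi k (p a) * (μ a i c * ι i b) +
    chi k (p a + p b) * (μ a b i * ι i c)) = 0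

theorem chi_ne_zero (i : ZMod 2) : chi k i ≠ 0 := fun e => by
  have := chi_mul_self (k := k) i
  rw [e] at this
  simp at this

open Classical in
-- For each vertex this is the identity `inv`, multiplied by the coefficients of the other vertices.
-- Where their product is nonzero they are even, so the sign counts only the preceding flags of the
-- same vertex.
theorem vertexProd_derivation (h : EvenTensors p μ η) {ι : J → J → k}
    (hι : VertexDerivation p μ ι) (c : Flag N → J) :
    ∑ f, ∑ i, chi k (∑ y, if vpos y < vpos f then p (c y) else 0) *
      (vertexProd μ (Function.update c f i) * ι i (c f)) = 0 := by
  rw [Fintype.sum_prod_type]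
  refine Finset.sum_eq_zero fun v _ => ?_
  have hprod : ∀ t i, vertexProd μ (Function.update c (v, t) i) =
      (∏ u ∈ Finset.univ.erase v, μ (c (u, 0)) (c (u, 1)) (c (u, 2))) *
      μ (Function.update c (v, t) i (v, 0)) (Function.update c (v, t) i (v, 1))
        (Function.update c (v, t) i (v, 2)) := by
    intro t i
    rw [vertexProd, ← Finset.prod_erase_mul _ _ (Finset.mem_univ v)]
    congr 1
    refine Finset.prod_congr rfl fun u hu => ?_
    have hu := (Finset.mem_erase.1 hu).1
    simp [hu]
  by_cases h0 : (∏ u ∈ Finset.univ.erase v, μ (c (u, 0)) (c (u, 1)) (c (u, 2))) = 0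
  · simp [hprod, h0]
  · rw [← ne_eq, Finset.prod_ne_zero_iff] at h0
    have hs : ∀ t : Fin 3, (∑ y : Flag N, if vpos y < vpos (v, t) then p (c y) else 0) =
        ∑ i : Fin 3, if i < t then p (c (v, i)) else 0 := by
      intro t
      rw [Fintype.sum_prod_type, Finset.sum_eq_single v]
      · simp [vpos]
      · intro u _ hu
        have he := h.vertex_even _ _ _ (h0 u (Finset.mem_erase.2 ⟨hu, Finset.mem_univ _⟩))
        have hu' : (u : ℕ) ≠ v := fun e => hu (Fin.ext e)
        by_cases huv : (u : ℕ) < v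
        · have : ∀ i : Fin 3, vpos (u, i) < vpos (v, t) := by
            intro i; simp only [vpos]; omega
          simp [this, Fin.sum_univ_three, he]
        · have : ∀ i : Fin 3, ¬ vpos (u, i) < vpos (v, t) := by
            intro i; simp only [vpos]; omega
          simp [this]
      · simp
    simp only [hs, hprod]
    simp only [Fin.sum_univ_three]
    have := hι.inv (c (v, 0)) (c (v, 1)) (c (v, 2))
    rw [← Finset.sum_add_distrib, ← Finset.sum_add_distrib]
    rw [← mul_zero (∏ u ∈ Finset.univ.erase v, μ (c (u, 0)) (c (u, 1)) (c (u, 2))), ← this,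
      Finset.mul_sum]
    refine Finset.sum_congr rfl fun i _ => ?_
    simp [Function.update_of_ne]
    ring

open Classical in
-- The operator is transferred from the test function `w` to the vertex tensors. This changes the
-- parity at `f`, and by `kexp_update` the sign for passing the flags before `f` in `r` becomes the
-- sign for passing those before `f` in the vertex order, as `vertexProd_derivation` requires.
theorem contr_derivation (h : EvenTensors p μ η) {ι : J → J → k}
    (hι : VertexDerivation p μ ι) {r : Flag N → ℕ} (hr : r.Injective)
    (w : (Flag N → J) → k) :
    ∑ f, ∑ c, chi k (kexp r vpos (p ∘ c)) * vertexProd μ c *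
      (chi k (∑ y, if r y < r f then p (c y) else 0) *
        ∑ j, ι (c f) j * w (Function.update c f j)) = 0 := by
  have step : ∀ f, ∑ c, chi k (kexp r vpos (p ∘ c)) * vertexProd μ c *
      (chi k (∑ y, if r y < r f then p (c y) else 0) *
        ∑ j, ι (c f) j * w (Function.update c f j)) =
      ∑ c, (w c * chi k (kexp r vpos (p ∘ c))) *
        ∑ i, chi k (∑ y, if vpos y < vpos f then p (c y) else 0) *
          (vertexProd μ (Function.update c f i) * ι i (c f)) := by
    intro f
    -- The colours at `f` before and after the insertion exchange roles, so that the altered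
    -- colouring is now the one seen by the vertices.
    have := sum_update_comm f (fun c c' : Flag N → J =>
      chi k (kexp r vpos (p ∘ c)) * vertexProd μ c *
        (chi k (∑ y, if r y < r f then p (c' y) else 0) * (ι (c f) (c' f) * w c')))
    convert this using 1
    · refine Finset.sum_congr rfl fun c _ => ?_
      rw [Finset.mul_sum, Finset.mul_sum]
      refine Finset.sum_congr rfl fun j _ => ?_
      have e : (∑ y, if r y < r f then p (Function.update c f j y) else 0) =
          ∑ y, if r y < r f then p (c y) else 0 := by
        refine Finset.sum_congr rfl fun y _ => ?_
        by_cases hy : y = f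
        · subst hy; simp
        · simp [hy]
      rw [e, Function.update_self]
    · refine Finset.sum_congr rfl fun c _ => ?_
      rw [Finset.mul_sum]
      refine Finset.sum_congr rfl fun i _ => ?_
      rw [Function.update_self]
      by_cases hi : ι i (c f) = 0
      · simp [hi]
      · have hp := hι.odd _ _ hi
        have e : p ∘ Function.update c f i =
            Function.update (p ∘ c) f ((p ∘ c) f + 1) := by
          ext y
          by_cases hy : y = f
          · subst hy; simp [hp]
          · simp [hy]
        rw [e, kexp_update hr vpos_injective, chi_add, chi_add]
        have := chi_mul_self (k := k) (∑ y, if r y < r f then p (c y) else 0)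
        have e2 : (∑ y, if r y < r f then (p ∘ c) y else 0) =
          ∑ y, if r y < r f then p (c y) else 0 := rfl
        have e3 : (∑ y, if vpos y < vpos f then (p ∘ c) y else 0) =
          ∑ y, if vpos y < vpos f then p (c y) else 0 := rfl
        rw [e2, e3]
        linear_combination (-(chi k (kexp r vpos (p ∘ c)) *
          chi k (∑ y, if vpos y < vpos f then p (c y) else 0) *
          vertexProd μ (Function.update c f i) * ι i (c f) * w c)) * this
  simp_rw [step]
  rw [Finset.sum_comm]
  refine Finset.sum_eq_zero fun c _ => ?_
  rw [← Finset.mul_sum, vertexProd_derivation h hι, mul_zero]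

/-- The action of an operator on the legs. -/
def legAct (p : J → ZMod 2) (ι : J → J → k) (w : (Fin n → J) → k) (d : Fin n → J) : k :=
  ∑ l, chi k (∑ l', if l' < l then p (d l') else 0) *
    ∑ j, ι (d l) j * w (Function.update d l j)

/-- The product of the propagators of all edges but that of `f`. -/
def edgeProdErase (η : J → J → k) (Γ : RibbonGraph n N) (r : Flag N → ℕ) (f : Flag N)
    (c : Flag N → J) : k :=
  open Classical in
  ∏ f' ∈ Finset.univ.erase f, if r f' < r (Γ.edge f') then η (c f') (c (Γ.edge f')) else 1

/-- The flags satisfying `S` come in pairs of equal parity. -/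
theorem sum_even_of_edge (Γ : RibbonGraph n N) (S : Flag N → Prop) [DecidablePred S]
    (hS : ∀ f, S f → S (Γ.edge f)) (hl : ∀ f, S f → Γ.edge f ≠ f) (q : Flag N → ZMod 2)
    (hq : ∀ f, S f → q f = q (Γ.edge f)) : (∑ f, if S f then q f else 0) = 0 := by
  rw [← Finset.sum_filter]
  refine Finset.sum_involution (fun f _ => Γ.edge f) ?_ ?_ ?_ ?_
  · intro f hf
    rw [← hq f (Finset.mem_filter.1 hf).2]
    exact CharTwo.add_self_eq_zero _
  · intro f hf _
    exact hl f (Finset.mem_filter.1 hf).2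
  · intro f hf
    simpa using hS f (Finset.mem_filter.1 hf).2
  · intro f _
    exact Γ.edge_edge f

/-- The insertion of a derivation at the legs is minus its insertion at the internal edges. -/
theorem contr_legAct (h : EvenTensors p μ η) {ι δ : J → J → k}
    (hι : VertexDerivation p μ ι)
    (hδ : ∀ i j, δ i j = -((∑ a, ι i a * η a j) + chi k (p i) * ∑ a, ι j a * η i a))
    (Γ : RibbonGraph n N) {r : Flag N → ℕ} (hr : Γ.Adapted r)
    (hl : StrictMono (r ∘ Γ.leg)) (hb : ∀ f l, Γ.edge f ≠ f → r f < r (Γ.leg l))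
    (w : (Fin n → J) → k) :
    contr p μ η Γ r (legAct p ι w) = ∑ f, if r f < r (Γ.edge f) then
      ∑ c : Flag N → J, chi k (kexp r vpos (p ∘ c)) * vertexProd μ c *
        (edgeProdErase η Γ r f c * δ (c f) (c (Γ.edge f))) * w (c ∘ Γ.leg) else 0 := by
  classical
  have hD := contr_derivation h hι hr.inj (fun c => edgeProd η Γ r c * w (c ∘ Γ.leg))
  set T : Flag N → k := fun f => ∑ c, chi k (kexp r vpos (p ∘ c)) * vertexProd μ c *
      (chi k (∑ y, if r y < r f then p (c y) else 0) *
        ∑ j, ι (c f) j * (edgeProd η Γ r (Function.update c f j) *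
          w (Function.update c f j ∘ Γ.leg))) with hT
  have hsplit : ∀ f, T f = (if Γ.edge f = f then T f else 0) +
      ((if r f < r (Γ.edge f) then T f else 0) + if r (Γ.edge f) < r f then T f else 0) := by
    intro f
    by_cases hf : Γ.edge f = f
    · simp [hf]
    · rcases lt_or_gt_of_ne (hr.inj.ne hf) with h1 | h1 <;> simp [hf, h1, h1.le.not_gt]
  have hD' : ∑ f, T f = 0 := hD
  -- The vanishing sum over all flags is split into legs, first flags and second flags of edges;
  -- reindexing by `edge` attaches the second flags to the first ones.
  rw [Finset.sum_congr rfl fun f _ => hsplit f, Finset.sum_add_distrib, Finset.sum_add_distrib,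
    Γ.sum_fixed, ← Equiv.sum_comp Γ.edge (fun f => if r (Γ.edge f) < r f then T f else 0)] at hD'
  simp only [Γ.edge_edge] at hD'
  rw [← Finset.sum_add_distrib] at hD'
  have hnl : ∀ f l, Γ.edge f ≠ f → f ≠ Γ.leg l := fun f l hf e => hf (by rw [e, Γ.edge_leg])
  have hlegs : ∀ l, T (Γ.leg l) = ∑ c : Flag N → J, chi k (kexp r vpos (p ∘ c)) *
      vertexProd μ c * edgeProd η Γ r c * (chi k (∑ l', if l' < l then p (c (Γ.leg l')) else 0) *
      ∑ j, ι (c (Γ.leg l)) j * w (Function.update (c ∘ Γ.leg) l j)) := by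
    intro l
    rw [hT]
    refine Finset.sum_congr rfl fun c _ => ?_
    have e1 : ∀ j, edgeProd η Γ r (Function.update c (Γ.leg l) j) = edgeProd η Γ r c := by
      intro j
      refine Finset.prod_congr rfl fun f _ => ?_
      by_cases hf : r f < r (Γ.edge f)
      · have hf' : Γ.edge f ≠ f := fun e => by rw [e] at hf; exact lt_irrefl _ hf
        have hf2 : Γ.edge (Γ.edge f) ≠ Γ.edge f := by rw [Γ.edge_edge]; exact hf'.symm
        rw [if_pos hf, if_pos hf, Function.update_of_ne (hnl _ _ hf'),
          Function.update_of_ne (hnl _ _ hf2)]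
      · rw [if_neg hf, if_neg hf]
    have e2 : ∀ j, Function.update c (Γ.leg l) j ∘ Γ.leg = Function.update (c ∘ Γ.leg) l j := by
      intro j
      exact Function.update_comp_eq_of_injective _ Γ.leg.injective _ _
    simp only [e1, e2]
    by_cases h0 : edgeProd η Γ r c = 0
    · simp [h0]
    -- Before a leg stand all internal edges, whose parities cancel in pairs, and the earlier legs.
    · have e3 : (∑ y, if r y < r (Γ.leg l) then p (c y) else 0) =
          ∑ l', if l' < l then p (c (Γ.leg l')) else 0 := by
        have hx : ∀ y, (if r y < r (Γ.leg l) then p (c y) else 0) =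
            (if Γ.edge y = y then (if r y < r (Γ.leg l) then p (c y) else 0) else 0) +
            if Γ.edge y ≠ y then p (c y) else 0 := by
          intro y
          by_cases hy : Γ.edge y = y
          · simp [hy]
          · simp [hy, hb y l hy]
        rw [Finset.sum_congr rfl fun y _ => hx y, Finset.sum_add_distrib, Γ.sum_fixed,
          sum_even_of_edge Γ (fun y => Γ.edge y ≠ y) (fun y hy => by
            rw [Γ.edge_edge]; exact hy.symm) (fun y hy => hy) (fun y => p (c y))
            (fun y _ => edge_even_of_edgeProd_ne_zero h Γ hr.inj c h0 y), add_zero]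
        refine Finset.sum_congr rfl fun l' _ => ?_
        simp only [show r (Γ.leg l') < r (Γ.leg l) ↔ l' < l from hl.lt_iff_lt]
      rw [e3]
      simp only [Finset.mul_sum]
      refine Finset.sum_congr rfl fun j _ => ?_
      ring
  have hedges : ∀ f, ((if r f < r (Γ.edge f) then T f else 0) +
      if r f < r (Γ.edge f) then T (Γ.edge f) else 0) = -(if r f < r (Γ.edge f) then
      ∑ c : Flag N → J, chi k (kexp r vpos (p ∘ c)) * vertexProd μ c *
        (edgeProdErase η Γ r f c * δ (c f) (c (Γ.edge f))) * w (c ∘ Γ.leg) else 0) := by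
    intro f
    by_cases hf : r f < r (Γ.edge f)
    swap
    · simp [hf]
    rw [if_pos hf, if_pos hf, if_pos hf, hT, ← Finset.sum_add_distrib, ← Finset.sum_neg_distrib]
    have hf' : Γ.edge f ≠ f := fun e => by rw [e] at hf; exact lt_irrefl _ hf
    have hf2 : Γ.edge (Γ.edge f) ≠ Γ.edge f := by rw [Γ.edge_edge]; exact hf'.symm
    refine Finset.sum_congr rfl fun c _ => ?_
    have eprod : ∀ c', edgeProd η Γ r c' = edgeProdErase η Γ r f c' * η (c' f) (c' (Γ.edge f)) := by
      intro c'
      rw [edgeProd, edgeProdErase, ← Finset.prod_erase_mul _ _ (Finset.mem_univ f), if_pos hf]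
    have eerase : ∀ g j, (g = f ∨ g = Γ.edge f) →
        edgeProdErase η Γ r f (Function.update c g j) = edgeProdErase η Γ r f c := by
      intro g j hg
      refine Finset.prod_congr rfl fun f' h' => ?_
      have h' := (Finset.mem_erase.1 h').1
      by_cases hh : r f' < r (Γ.edge f')
      · have a1 : f' ≠ Γ.edge f := by
          rintro rfl
          rw [Γ.edge_edge] at hh
          omega
        have b1 : f' ≠ g := by rcases hg with rfl | rfl <;> assumption
        have b2 : Γ.edge f' ≠ g := by
          rcases hg with rfl | rfl
          · intro e; exact a1 (by rw [← e, Γ.edge_edge])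
          · intro e; exact h' (Γ.edge.injective e)
        rw [if_pos hh, if_pos hh, Function.update_of_ne b1, Function.update_of_ne b2]
      · rw [if_neg hh, if_neg hh]
    have eleg : ∀ g j, Γ.edge g ≠ g → Function.update c g j ∘ Γ.leg = c ∘ Γ.leg := by
      intro g j hg
      ext l
      exact Function.update_of_ne (hnl _ _ hg).symm _ _
    simp only [eprod, eleg f _ hf', eleg _ _ hf2, eerase f _ (Or.inl rfl),
      eerase (Γ.edge f) _ (Or.inr rfl), Function.update_self, Function.update_of_ne hf',
      Function.update_of_ne hf'.symm]
    by_cases h0 : edgeProdErase η Γ r f c = 0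
    · simp [h0]
    have hev : ∀ y, y ≠ f → y ≠ Γ.edge f → p (c y) = p (c (Γ.edge y)) := by
      rw [← ne_eq, edgeProdErase, Finset.prod_ne_zero_iff] at h0
      intro y hy1 hy2
      by_cases hy : Γ.edge y = y
      · rw [hy]
      · rcases lt_or_gt_of_ne (hr.inj.ne hy) with h1 | h1
        · have := h0 (Γ.edge y) (Finset.mem_erase.2 ⟨fun e => hy2 (by rw [← e, Γ.edge_edge]),
            Finset.mem_univ _⟩)
          rw [Γ.edge_edge, if_pos h1] at this
          exact (h.edge_even _ _ this).symm
        · have := h0 y (Finset.mem_erase.2 ⟨hy1, Finset.mem_univ _⟩)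
          rw [if_pos h1] at this
          exact h.edge_even _ _ this
    -- Before the first flag of an edge stand only whole edges, which are even; before its second
    -- flag there is in addition the first flag. This gives the sign `chi k (p i)` in `hδ`.
    have s1 : (∑ y, if r y < r f then p (c y) else 0) = 0 := by
      have key : ∀ y, r y < r f → y ≠ f ∧ y ≠ Γ.edge f ∧ Γ.edge y ≠ y := by
        intro y hy
        refine ⟨?_, ?_, ?_⟩
        · rintro rfl; exact lt_irrefl _ hy
        · rintro rfl; omega
        · intro e
          obtain ⟨l, rfl⟩ := (Γ.edge_eq_self_iff y).1 e
          have := hb f l hf'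
          omega
      refine sum_even_of_edge Γ (fun y => r y < r f) ?_ (fun y hy => (key y hy).2.2)
        (fun y => p (c y)) (fun y hy => hev y (key y hy).1 (key y hy).2.1)
      intro y hy
      obtain ⟨k1, k2, k3⟩ := key y hy
      have e1 : f ≠ Γ.edge y := fun e => k2 (by rw [e, Γ.edge_edge])
      have := hr.contig y f k1.symm e1
      have := hr.inj.ne e1
      show r (Γ.edge y) < r f
      omega
    have s2 : (∑ y, if r y < r (Γ.edge f) then p (c y) else 0) = p (c f) := by
      have e : ∀ y, (if r y < r (Γ.edge f) then p (c y) else 0) =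
          (if r y < r f then p (c y) else 0) + if y = f then p (c f) else 0 := by
        intro y
        by_cases hy : y = f
        · subst hy
          rw [if_pos hf, if_neg (lt_irrefl _), if_pos rfl, zero_add]
        · by_cases hy2 : y = Γ.edge f
          · subst hy2
            rw [if_neg (lt_irrefl _), if_neg (by omega), if_neg hy, add_zero]
          · simp only [hr.contig f y hy hy2, if_neg hy, add_zero]
      rw [Finset.sum_congr rfl fun y _ => e y, Finset.sum_add_distrib, s1]
      simp
    rw [s1, s2, chi_zero, hδ]
    have d1 : ∑ j, ι (c f) j * (edgeProdErase η Γ r f c * η j (c (Γ.edge f)) * w (c ∘ Γ.leg)) =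
        edgeProdErase η Γ r f c * w (c ∘ Γ.leg) * ∑ j, ι (c f) j * η j (c (Γ.edge f)) := by
      rw [Finset.mul_sum]
      refine Finset.sum_congr rfl fun j _ => ?_
      ring
    have d2 : ∑ j, ι (c (Γ.edge f)) j * (edgeProdErase η Γ r f c * η (c f) j * w (c ∘ Γ.leg)) =
        edgeProdErase η Γ r f c * w (c ∘ Γ.leg) * ∑ j, ι (c (Γ.edge f)) j * η (c f) j := by
      rw [Finset.mul_sum]
      refine Finset.sum_congr rfl fun j _ => ?_
      ring
    rw [d1, d2]
    ring
  rw [Finset.sum_congr rfl fun f _ => hedges f, Finset.sum_neg_distrib, Finset.sum_congr rfl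
    fun l _ => hlegs l, Finset.sum_comm] at hD'
  have hL : contr p μ η Γ r (legAct p ι w) = ∑ c : Flag N → J, ∑ l,
      chi k (kexp r vpos (p ∘ c)) * vertexProd μ c * edgeProd η Γ r c *
        (chi k (∑ l', if l' < l then p (c (Γ.leg l')) else 0) *
        ∑ j, ι (c (Γ.leg l)) j * w (Function.update (c ∘ Γ.leg) l j)) := by
    rw [contr]
    refine Finset.sum_congr rfl fun c _ => ?_
    rw [legAct, Finset.mul_sum]
    rfl
  rw [hL]
  linear_combination hD'

end derivation

/-! ### Associativity -/

section flip

variable {N : ℕ}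

/-- The flags at `v` and `v'` come first, in the given places, then all others. -/
def placeFirst (v v' : Fin N) (a a' : Fin 3 → ℕ) (f : Flag N) : ℕ :=
  if f.1 = v then a f.2 else if f.1 = v' then a' f.2 else vpos f + 6

theorem placeFirst_injective {v v' : Fin N} (a a' : Fin 3 → ℕ)
    (ha : a.Injective) (ha' : a'.Injective) (haa : ∀ i j, a i ≠ a' j) (h6 : ∀ i, a i < 6)
    (h6' : ∀ i, a' i < 6) : (placeFirst v v' a a').Injective := by
  rintro ⟨u, i⟩ ⟨u', j⟩ h
  simp only [placeFirst] at h
  have := h6 i; have := h6 j; have := h6' i; have := h6' j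
  have := haa i j; have := haa j i
  split_ifs at h with h1 h2 h3 h4 h5 h6 h7 h8
  · rw [ha h, h1, h2]
  all_goals first | omega | skip
  · rw [ha' h, h4, h6]
  · exact vpos_injective (by omega)

/-- The flags at `v`, `v'` in the order `(v, 0), (v', 0), (v, 1), (v, 2), (v', 1), (v', 2)`, then
all others. -/
def edgeFirst (v v' : Fin N) : Flag N → ℕ := placeFirst v v' ![0, 2, 3] ![1, 4, 5]

theorem edgeFirst_injective {v v' : Fin N} : (edgeFirst v v').Injective :=
  placeFirst_injective _ _ (by decide) (by decide) (by decide) (by decide) (by decide)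

/-- Bringing the vertices `v` and `v'` to the front is free, since vertices are even. The only other
change is that `(v', 0)` passes `(v, 1)` and `(v, 2)`. -/
theorem kexp_edgeFirst {v v' : Fin N} (hv : v ≠ v') (q : Flag N → ZMod 2)
    (hq : ∀ v, q (v, 0) + q (v, 1) + q (v, 2) = 0) :
    kexp (edgeFirst v v') vpos q = q (v', 0) * (q (v, 1) + q (v, 2)) := by
  have hi : (placeFirst v v' ![0, 1, 2] ![3, 4, 5]).Injective :=
    placeFirst_injective _ _ (by decide) (by decide) (by decide) (by decide) (by decide)
  have hlt : ∀ i : Fin 3, (![0, 1, 2] : Fin 3 → ℕ) i = i := by decide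
  have hlt' : ∀ i : Fin 3, (![3, 4, 5] : Fin 3 → ℕ) i = 3 + i := by decide
  have h0 : kexp (placeFirst v v' ![0, 1, 2] ![3, 4, 5]) vpos q = 0 := by
    rw [kexp_vertex hi vpos_injective _ vpos_contig q hq]
    · refine Finset.sum_eq_zero fun u _ => Finset.sum_eq_zero fun i _ =>
        Finset.sum_eq_zero fun j _ => if_neg ?_
      simp only [placeFirst, vpos, hlt, hlt']
      split_ifs <;> omega
    · rintro ⟨u, t⟩ u' i j h
      have h' : (u : ℕ) ≠ u' := fun e => h (Fin.ext e)
      simp only [placeFirst, vpos, hlt, hlt']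
      by_cases a1 : u = v <;> by_cases a2 : u' = v <;> by_cases a3 : u = v' <;>
        by_cases a4 : u' = v' <;> simp only [a1, a2, a3, a4, if_true, if_false] <;> subst_vars <;>
        simp_all <;> omega
  rw [kexp_trans edgeFirst_injective hi vpos_injective, h0, add_zero]
  have key : ∀ x y : Flag N, (edgeFirst v v' x < edgeFirst v v' y ∧
      placeFirst v v' ![0, 1, 2] ![3, 4, 5] y < placeFirst v v' ![0, 1, 2] ![3, 4, 5] x) ↔
      x = (v', 0) ∧ (y = (v, 1) ∨ y = (v, 2)) := by
    rintro ⟨u, i⟩ ⟨u', j⟩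
    simp only [edgeFirst, placeFirst, vpos, hlt, hlt', Prod.mk.injEq]
    have e1 : ∀ i : Fin 3, (![0, 2, 3] : Fin 3 → ℕ) i < 6 := by decide
    have e2 : ∀ i : Fin 3, (![1, 4, 5] : Fin 3 → ℕ) i < 6 := by decide
    have := e1 i; have := e1 j; have := e2 i; have := e2 j
    by_cases a1 : u = v
    · have a3 : u ≠ v' := a1 ▸ hv
      by_cases a2 : u' = v
      · simp only [a1, a2, if_true, hv, false_and, iff_false]
        revert i j; decide
      · by_cases a4 : u' = v'
        · simp only [a1, a2, a4, if_true, if_false, hv, false_and, iff_false, hv.symm]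
          omega
        · simp only [a1, a2, a4, if_true, if_false, hv, false_and, iff_false]
          omega
    · by_cases a3 : u = v'
      · by_cases a2 : u' = v
        · simp only [a3, a2, if_true, hv.symm, if_false, true_and]
          revert i j; decide
        · by_cases a4 : u' = v'
          · simp only [a3, a2, a4, if_true, if_false, hv.symm, false_and, or_self, and_false,
              iff_false]
            revert i j; decide
          · simp only [a3, a2, a4, if_true, if_false, hv.symm, false_and, or_self, and_false,
              iff_false]
            omega
      · simp only [a1, a3, if_false, false_and, iff_false]
        split_ifs <;> omega
  unfold kexp
  simp only [key]
  rw [Finset.sum_eq_single (v', 0)]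
  · rw [mul_add, ← Finset.sum_erase_add _ _ (Finset.mem_univ (v, 2)), Finset.sum_eq_single (v, 1)]
    · simp
    · intro y h1 h2
      have := (Finset.mem_erase.1 h1).1
      simp [h2, this]
    · simp
  · intro x _ hx
    simp [hx]
  · simp

/-- The cyclic rotation of the four flags which are joined to the edge from `(v, 0)` to
`(v', 0)`. -/
structure IsFlip (v v' : Fin N) (ρ : Equiv.Perm (Flag N)) : Prop where
  ne : v ≠ v'
  map_left_one : ρ (v, 1) = (v, 2)
  map_left_two : ρ (v, 2) = (v', 1)
  map_right_one : ρ (v', 1) = (v', 2)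
  map_right_two : ρ (v', 2) = (v, 1)
  map_zero : ∀ u, ρ (u, 0) = (u, 0)
  map_of_ne : ∀ u i, u ≠ v → u ≠ v' → ρ (u, i) = (u, i)

/-- After the turn the four outer flags stand in the order `(v', 2), (v, 1), (v, 2), (v', 1)`: the
last one has passed the three others. -/
theorem kexp_flip {v v' : Fin N} {ρ : Equiv.Perm (Flag N)} (hρ : IsFlip v v' ρ)
    (q : Flag N → ZMod 2) : kexp (edgeFirst v v') (edgeFirst v v' ∘ ρ) q =
      (q (v, 1) + q (v, 2) + q (v', 1)) * q (v', 2) := by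
  have hv := hρ.ne
  have val : ∀ f : Flag N, edgeFirst v v' (ρ f) = placeFirst v v' ![0, 3, 4] ![1, 5, 2] f := by
    rintro ⟨u, i⟩
    by_cases a1 : u = v
    · subst a1
      rcases fin3_cases i with rfl | rfl | rfl
      · rw [hρ.map_zero]; simp [edgeFirst, placeFirst]
      · rw [hρ.map_left_one]; simp [edgeFirst, placeFirst]
      · rw [hρ.map_left_two]; simp [edgeFirst, placeFirst, hv.symm]
    · by_cases a2 : u = v'
      · subst a2
        rcases fin3_cases i with rfl | rfl | rfl
        · rw [hρ.map_zero]; simp [edgeFirst, placeFirst]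
        · rw [hρ.map_right_one]; simp [edgeFirst, placeFirst, hv.symm]
        · rw [hρ.map_right_two]; simp [edgeFirst, placeFirst, hv.symm]
      · rw [hρ.map_of_ne _ _ a1 a2]; simp [edgeFirst, placeFirst, a1, a2]
  have key : ∀ x y : Flag N, (edgeFirst v v' x < edgeFirst v v' y ∧
      (edgeFirst v v' ∘ ρ) y < (edgeFirst v v' ∘ ρ) x) ↔
      (x = (v, 1) ∨ x = (v, 2) ∨ x = (v', 1)) ∧ y = (v', 2) := by
    rintro ⟨u, i⟩ ⟨u', j⟩
    simp only [Function.comp, val]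
    simp only [edgeFirst, placeFirst, vpos, Prod.mk.injEq]
    have e1 : ∀ i : Fin 3, (![0, 2, 3] : Fin 3 → ℕ) i < 6 := by decide
    have e2 : ∀ i : Fin 3, (![1, 4, 5] : Fin 3 → ℕ) i < 6 := by decide
    have e3 : ∀ i : Fin 3, (![0, 3, 4] : Fin 3 → ℕ) i < 6 := by decide
    have e4 : ∀ i : Fin 3, (![1, 5, 2] : Fin 3 → ℕ) i < 6 := by decide
    have := e1 i; have := e1 j; have := e2 i; have := e2 j
    have := e3 i; have := e3 j; have := e4 i; have := e4 j
    by_cases a1 : u = v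
    · by_cases a2 : u' = v
      · simp only [a1, a2, if_true, hv, false_and, and_false, iff_false]
        revert i j; decide
      · by_cases a4 : u' = v'
        · simp only [a1, a2, a4, if_true, if_false, hv, false_and, hv.symm, true_and, or_false]
          revert i j; decide
        · simp only [a1, a2, a4, if_true, if_false, false_and, and_false, iff_false]
          omega
    · by_cases a3 : u = v'
      · by_cases a2 : u' = v
        · simp only [a3, a2, if_true, hv.symm, hv, if_false, false_and, and_false, iff_false]
          revert i j; decide
        · by_cases a4 : u' = v'
          · simp only [a3, a2, a4, if_true, if_false, hv.symm, false_and, false_or, true_and]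
            revert i j; decide
          · simp only [a3, a2, a4, if_true, if_false, hv.symm, false_and, and_false, iff_false]
            omega
      · simp only [a1, a3, if_false, false_and, or_self, iff_false]
        split_ifs <;> omega
  unfold kexp
  simp only [key]
  rw [Finset.sum_comm, Finset.sum_eq_single (v', 2)]
  · have : ∀ x, (if (x = (v, 1) ∨ x = (v, 2) ∨ x = (v', 1)) ∧ (v', (2 : Fin 3)) = (v', 2) then
        q x * q (v', 2) else 0) = (if x = (v, 1) then q (v, 1) * q (v', 2) else 0) +
        (if x = (v, 2) then q (v, 2) * q (v', 2) else 0) +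
        if x = (v', 1) then q (v', 1) * q (v', 2) else 0 := by
      intro x
      by_cases b1 : x = (v, 1)
      · subst b1; simp [hv]
      · by_cases b2 : x = (v, 2)
        · subst b2; simp
        · by_cases b3 : x = (v', 1)
          · subst b3; simp [hv.symm]
          · simp [b1, b2, b3]
    refine (Finset.sum_congr rfl fun x _ => (by convert this x)).trans ?_
    rw [Finset.sum_add_distrib, Finset.sum_add_distrib]
    simp [add_mul]
  · intro x _ hx
    simp [hx]
  · simp

variable {k J : Type*} [Field k] [Fintype J] {p : J → ZMod 2} {μ : J → J → J → k}
  {η : J → J → k} {n : ℕ}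

theorem sum_eq_zero_of_update_two {X M : Type*} [Fintype X] [DecidableEq X] [AddCommMonoid M]
    {f g : X} (hfg : f ≠ g) (Φ : (X → J) → M)
    (h : ∀ c, ∑ i, ∑ j, Φ (Function.update (Function.update c f i) g j) = 0) :
    ∑ c, Φ c = 0 := by
  rw [← Equiv.sum_comp (Equiv.funSplitAt g J).symm, Fintype.sum_prod_type, Finset.sum_comm]
  by_cases hJ : Nonempty J
  · obtain ⟨j0⟩ := hJ
    refine sum_eq_zero_of_update ⟨f, hfg⟩ _ fun d => ?_
    rw [← h ((Equiv.funSplitAt g J).symm (j0, d))]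
    refine Finset.sum_congr rfl fun i _ => Finset.sum_congr rfl fun j _ => congrArg Φ ?_
    ext x
    by_cases hx : x = g
    · subst hx; simp [Equiv.funSplitAt, Equiv.piSplitAt]
    · by_cases hx' : x = f
      · subst hx'; simp [Equiv.funSplitAt, Equiv.piSplitAt, hx]
      · simp [Equiv.funSplitAt, Equiv.piSplitAt, hx, hx', Function.update_apply]
  · have := not_nonempty_iff.1 hJ
    simp

/-- The contraction of two three-tensors with a two-tensor. -/
def fourTensor (p : J → ZMod 2) (μ : J → J → J → k) (D : J → J → k) (a b c d : J) : k :=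
  ∑ i, ∑ j, D i j * (chi k (p j * (p a + p b)) * (μ i a b * μ j c d))

/-- Insertion of a two-tensor at the first two legs. -/
def insertTwo (D : J → J → k) (w : (Fin n → J) → k) (d : Fin (n + 2) → J) : k :=
  D (d 0) (d 1) * w (fun l => d l.succ.succ)

/-- The local form of associativity. Two vertices joined through `D` form a four-tensor in the
colours of the four outer flags; the flip rotates its arguments by one step and leaves the rest of
the state sum unchanged. -/
theorem contr_flip (h : EvenTensors p μ η) {D : J → J → k}
    (hD : ∀ i j, D i j ≠ 0 → p i = p j + 1)
    (hK : ∀ a b c d, fourTensor p μ D d a b c = -fourTensor p μ D a b c d)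
    {Γ Γ' : RibbonGraph (n + 2) N} {v v' : Fin N} {ρ : Equiv.Perm (Flag N)}
    (hρ : IsFlip v v' ρ) (hl0 : Γ.leg 0 = (v, 0)) (hl1 : Γ.leg 1 = (v', 0))
    (he : ∀ f, ρ (Γ.edge f) = Γ'.edge (ρ f)) (hl : ∀ l, ρ (Γ.leg l) = Γ'.leg l)
    {r r' : Flag N → ℕ} (hr : Γ.Adapted r) (hr' : Γ'.Adapted r')
    (hm : StrictMono (r ∘ Γ.leg)) (hm' : StrictMono (r' ∘ Γ'.leg)) (w : (Fin n → J) → k) :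
    contr p μ η Γ' r' (insertTwo D w) = -contr p μ η Γ r (insertTwo D w) := by
  classical
  have hv := hρ.ne
  have hvf : ((v, 0) : Flag N) ≠ (v', 0) := by simp [hv]
  -- The first two legs are put in front, so that `(v, 0)` and `(v', 0)` have the places `0` and `1`
  -- both in `r1` and in `edgeFirst`, and their colours take part in no inversion.
  set r1 : Flag N → ℕ := fun f => if f = (v, 0) then 0 else if f = (v', 0) then 1 else r f + 2
    with hr1
  have hr1i : r1.Injective := by
    intro x y hxy
    simp only [hr1] at hxy
    split_ifs at hxy with b1 b2 b3 b4 b5 b6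
    · rw [b1, b2]
    all_goals first | omega | skip
    · rw [b4, b6]
    · exact hr.inj (by omega)
  have el : ∀ f l, f ≠ Γ.leg l → Γ.edge f ≠ Γ.leg l := by
    intro f l hf e
    apply hf
    rw [← Γ.edge_leg l, ← e, Γ.edge_edge]
  have hr1a : Γ.Adapted r1 := by
    refine ⟨hr1i, fun f x h1 h2 => ?_⟩
    by_cases hf : Γ.edge f = f
    · rw [hf]
    have f0 : f ≠ (v, 0) := fun e => hf (by rw [e, ← hl0, Γ.edge_leg])
    have f1 : f ≠ (v', 0) := fun e => hf (by rw [e, ← hl1, Γ.edge_leg])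
    have g0 : Γ.edge f ≠ (v, 0) := by rw [← hl0] at f0 ⊢; exact el _ _ f0
    have g1 : Γ.edge f ≠ (v', 0) := by rw [← hl1] at f1 ⊢; exact el _ _ f1
    simp only [hr1, f0, f1, g0, g1, if_false]
    have := hr.contig f x h1 h2
    split_ifs <;> omega
  have hr1m : StrictMono (r1 ∘ Γ.leg) := by
    intro l l' hll
    have val : ∀ l, r1 (Γ.leg l) = if l = 0 then 0 else if l = 1 then 1 else r (Γ.leg l) + 2 := by
      intro l
      simp only [hr1]
      rw [← hl0, ← hl1]
      simp only [Γ.leg.injective.eq_iff]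
    have := hm hll
    simp only [Function.comp, val] at this ⊢
    have := Fin.val_fin_lt.2 hll
    simp only [Fin.ext_iff, Fin.val_zero, Fin.val_one]
    split_ifs <;> omega
  have he' : ∀ f, ρ.symm (Γ'.edge f) = Γ.edge (ρ.symm f) := by
    intro f
    rw [Equiv.symm_apply_eq, he, Equiv.apply_symm_apply]
  have hl' : ∀ l, ρ.symm (Γ'.leg l) = Γ.leg l := by
    intro l
    rw [Equiv.symm_apply_eq, hl]
  have hr2a : Γ'.Adapted (r1 ∘ ρ.symm) := Adapted.comp_iso he' hr1a
  have hr2m : StrictMono ((r1 ∘ ρ.symm) ∘ Γ'.leg) := by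
    intro l l' hll
    simp only [Function.comp, hl']
    exact hr1m hll
  rw [contr_adapted_of_leg h Γ hr hr1a
      (fun l l' => hm.lt_iff_lt.trans hr1m.lt_iff_lt.symm),
    contr_adapted_of_leg h Γ' hr' hr2a
      (fun l l' => hm'.lt_iff_lt.trans hr2m.lt_iff_lt.symm)]
  set R : (Flag N → J) → k := fun c => ∏ u ∈ (Finset.univ.erase v).erase v',
    μ (c (u, 0)) (c (u, 1)) (c (u, 2)) with hR
  set B : (Flag N → J) → k := fun c => chi k (p (c (v', 0)) * (p (c (v, 1)) + p (c (v, 2)))) *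
    (μ (c (v, 0)) (c (v, 1)) (c (v, 2)) * μ (c (v', 0)) (c (v', 1)) (c (v', 2))) with hB
  have hvp : ∀ c, vertexProd μ c = R c * (μ (c (v, 0)) (c (v, 1)) (c (v, 2)) *
      μ (c (v', 0)) (c (v', 1)) (c (v', 2))) := by
    intro c
    rw [vertexProd, ← Finset.prod_erase_mul _ _ (Finset.mem_univ v),
      ← Finset.prod_erase_mul _ _ (Finset.mem_erase.2 ⟨hv.symm, Finset.mem_univ v'⟩)]
    ring
  -- The sign is routed through `edgeFirst`; `B` combines the two distinguished vertices with the
  -- sign of separating them, and `R` is the product over the other vertices.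
  have Q : ∀ (s : Flag N → ℕ) (c : Flag N → J), s.Injective →
      chi k (kexp s vpos (p ∘ c)) * vertexProd μ c =
      chi k (kexp s (edgeFirst v v') (p ∘ c)) * R c * B c := by
    intro s c hs
    by_cases h0 : vertexProd μ c = 0
    · have : R c * B c = 0 := by
        rw [hvp] at h0
        simp only [hB]
        linear_combination chi k (p (c (v', 0)) * (p (c (v, 1)) + p (c (v, 2)))) * h0
      rw [mul_assoc, this, h0]; simp
    · have hq := vertex_even_of_vertexProd_ne_zero h c h0
      rw [kexp_trans hs edgeFirst_injective vpos_injective, chi_add,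
        kexp_edgeFirst hv (p ∘ c) hq, hvp]
      simp only [hB, Function.comp]
      ring
  set A : (Flag N → J) → k := fun c => chi k (kexp r1 (edgeFirst v v') (p ∘ c)) * R c *
    edgeProd η Γ r1 c * w (fun l => c (Γ.leg l.succ.succ)) with hA
  have E1 : contr p μ η Γ r1 (insertTwo D w) =
      ∑ c, A c * (D (c (v, 0)) (c (v', 0)) * B c) := by
    unfold contr
    refine Finset.sum_congr rfl fun c _ => ?_
    rw [Q r1 c hr1i]
    simp only [insertTwo, Function.comp, hl0, hl1, hA]
    ring
  have s0 : ∀ u, ρ.symm (u, 0) = (u, 0) := fun u => by rw [Equiv.symm_apply_eq, hρ.map_zero]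
  have E2 : contr p μ η Γ' (r1 ∘ ρ.symm) (insertTwo D w) =
      ∑ c, A c * (chi k ((p (c (v, 1)) + p (c (v, 2)) + p (c (v', 1))) * p (c (v', 2))) *
        (D (c (v, 0)) (c (v', 0)) * B (c ∘ ρ.symm))) := by
    unfold contr
    rw [← (Equiv.arrowCongr ρ (Equiv.refl J)).sum_comp]
    refine Finset.sum_congr rfl fun c _ => ?_
    have e0 : (Equiv.arrowCongr ρ (Equiv.refl J)) c = c ∘ ρ.symm := rfl
    rw [e0, Q _ _ (hr1i.comp ρ.symm.injective)]
    have e1 : edgeProd η Γ' (r1 ∘ ρ.symm) (c ∘ ρ.symm) = edgeProd η Γ r1 c := by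
      unfold edgeProd
      rw [← Equiv.prod_comp ρ]
      refine Finset.prod_congr rfl fun f _ => ?_
      simp [← he]
    have e2 : (c ∘ ρ.symm) ∘ Γ'.leg = c ∘ Γ.leg := by
      ext l
      simp [← hl]
    have e3 : kexp (r1 ∘ ρ.symm) (edgeFirst v v') (p ∘ c ∘ ρ.symm) =
        kexp r1 (edgeFirst v v' ∘ ρ) (p ∘ c) := by
      rw [← kexp_comp ρ (r1 ∘ ρ.symm)]
      congr 1
      · ext f; simp
      · ext f; simp
    have e4 : R (c ∘ ρ.symm) = R c := by
      refine Finset.prod_congr rfl fun u hu => ?_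
      have hu1 := (Finset.mem_erase.1 hu).1
      have hu2 := (Finset.mem_erase.1 (Finset.mem_erase.1 hu).2).1
      have : ∀ i, ρ.symm (u, i) = (u, i) := fun i => by
        rw [Equiv.symm_apply_eq, hρ.map_of_ne _ _ hu2 hu1]
      simp [this]
    rw [e1, e2, e3, e4, kexp_trans hr1i edgeFirst_injective
      (edgeFirst_injective.comp ρ.injective), chi_add, kexp_flip hρ]
    simp only [insertTwo, Function.comp, hl0, hl1, hA]
    ring
  rw [E1, E2, ← sub_eq_zero, sub_neg_eq_add, ← Finset.sum_add_distrib]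
  refine sum_eq_zero_of_update_two hvf _ fun c => ?_
  set a := c (v, 1) with ha
  set b := c (v, 2) with hb
  set a' := c (v', 1) with ha'
  set b' := c (v', 2) with hb'
  -- `A` collects the factors that do not see the colours of the two joined flags, so the sum over
  -- these two colours involves the four-tensor only.
  have hA' : ∀ i j, A (Function.update (Function.update c (v, 0) i) (v', 0) j) = A c := by
    intro i j
    set c' := Function.update (Function.update c (v, 0) i) (v', 0) j with hc'
    have u : ∀ f, f ≠ (v, 0) → f ≠ (v', 0) → c' f = c f := by
      intro f h1 h2
      rw [hc', Function.update_of_ne h2, Function.update_of_ne h1]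
    have e1 : kexp r1 (edgeFirst v v') (p ∘ c') = kexp r1 (edgeFirst v v') (p ∘ c) := by
      unfold kexp
      refine Finset.sum_congr rfl fun x _ => Finset.sum_congr rfl fun y _ => ?_
      by_cases hxy : r1 x < r1 y ∧ edgeFirst v v' y < edgeFirst v v' x
      · rw [if_pos hxy, if_pos hxy]
        have k0 : ∀ x, r1 x = 0 ↔ x = (v, 0) := by
          intro x
          rw [← hr1i.eq_iff (a := x)]
          simp [hr1]
        have k1 : ∀ x, r1 x = 1 ↔ x = (v', 0) := by
          intro x
          rw [← hr1i.eq_iff (a := x)]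
          simp [hr1, hv.symm]
        have l0 : ∀ x, edgeFirst v v' x = 0 ↔ x = (v, 0) := by
          intro x
          rw [← (edgeFirst_injective (v := v) (v' := v')).eq_iff (a := x) (b := (v, 0))]
          simp [edgeFirst, placeFirst]
        have l1 : ∀ x, edgeFirst v v' x = 1 ↔ x = (v', 0) := by
          intro x
          rw [← (edgeFirst_injective (v := v) (v' := v')).eq_iff (a := x) (b := (v', 0))]
          simp [edgeFirst, placeFirst, hv.symm]
        have x0 : x ≠ (v, 0) := by rw [Ne, ← l0]; omega
        have y0 : y ≠ (v, 0) := by rw [Ne, ← k0]; omega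
        have x1 : x ≠ (v', 0) := by
          intro e
          have h1 := (k1 x).2 e
          have h2 := (l1 x).2 e
          exact y0 ((l0 y).1 (by omega))
        have y1 : y ≠ (v', 0) := by
          intro e
          have h1 := (k1 y).2 e
          have h2 := (l1 y).2 e
          exact x0 ((k0 x).1 (by omega))
        simp only [Function.comp, u x x0 x1, u y y0 y1]
      · rw [if_neg hxy, if_neg hxy]
    have e2 : R c' = R c := by
      refine Finset.prod_congr rfl fun y hy => ?_
      have hu1 := (Finset.mem_erase.1 hy).1
      have hu2 := (Finset.mem_erase.1 (Finset.mem_erase.1 hy).2).1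
      have : ∀ t, c' (y, t) = c (y, t) := fun t => u _ (by simp [hu2]) (by simp [hu1])
      simp [this]
    have e3 : edgeProd η Γ r1 c' = edgeProd η Γ r1 c := by
      refine Finset.prod_congr rfl fun f _ => ?_
      by_cases hf : r1 f < r1 (Γ.edge f)
      · have hf' : Γ.edge f ≠ f := fun e => by rw [e] at hf; exact lt_irrefl _ hf
        have f0 : ∀ l, f ≠ Γ.leg l := fun l e => hf' (by rw [e, Γ.edge_leg])
        have f1 : ∀ l, Γ.edge f ≠ Γ.leg l := fun l => el f l (f0 l)
        rw [if_pos hf, if_pos hf, u f (by rw [← hl0]; exact f0 _) (by rw [← hl1]; exact f0 _),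
          u _ (by rw [← hl0]; exact f1 _) (by rw [← hl1]; exact f1 _)]
      · rw [if_neg hf, if_neg hf]
    have e4 : (fun l : Fin n => c' (Γ.leg l.succ.succ)) = fun l => c (Γ.leg l.succ.succ) := by
      ext l
      refine u _ ?_ ?_
      · rw [← hl0, Γ.leg.injective.ne_iff]; exact Fin.succ_ne_zero _
      · rw [← hl1, Γ.leg.injective.ne_iff, ← Fin.succ_zero_eq_one, (Fin.succ_injective _).ne_iff]
        exact Fin.succ_ne_zero _
    simp only [hA, e1, e2, e3, e4]
  have s1 : ρ.symm (v, 1) = (v', 2) := by rw [Equiv.symm_apply_eq, hρ.map_right_two]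
  have s2 : ρ.symm (v, 2) = (v, 1) := by rw [Equiv.symm_apply_eq, hρ.map_left_one]
  have s3 : ρ.symm (v', 1) = (v, 2) := by rw [Equiv.symm_apply_eq, hρ.map_left_two]
  have s4 : ρ.symm (v', 2) = (v', 1) := by rw [Equiv.symm_apply_eq, hρ.map_right_one]
  have hsum : ∀ i j, A (Function.update (Function.update c (v, 0) i) (v', 0) j) = A c := hA'
  -- `D` is odd and the vertices are even, so the four outer parities add up to `1`. Hence the sign
  -- of moving the last flag past the others is trivial, and only the minus sign of `hK` remains.
  have total : A c * (chi k ((p a + p b + p a') * p b') * fourTensor p μ D b' a b a' +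
      fourTensor p μ D a b a' b') = 0 := by
    by_cases h0 : fourTensor p μ D a b a' b' = 0
    · rw [hK, h0]; simp
    · have hodd : p a + p b + p a' + p b' = 1 := by
        unfold fourTensor at h0
        obtain ⟨i, -, hi⟩ := Finset.exists_ne_zero_of_sum_ne_zero h0
        obtain ⟨j, -, hj⟩ := Finset.exists_ne_zero_of_sum_ne_zero hi
        have t1 := hD i j (left_ne_zero_of_mul hj)
        have hj' := right_ne_zero_of_mul (right_ne_zero_of_mul hj)
        have t2 := h.vertex_even _ _ _ (left_ne_zero_of_mul hj')
        have t3 := h.vertex_even _ _ _ (right_ne_zero_of_mul hj')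
        have aux : ∀ x1 x2 x3 x4 x5 x6 : ZMod 2, x5 = x6 + 1 → x5 + x1 + x2 = 0 →
            x6 + x3 + x4 = 0 → x1 + x2 + x3 + x4 = 1 := by decide
        exact aux _ _ _ _ _ _ t1 t2 t3
      have hz : (p a + p b + p a') * p b' = 0 := by
        have aux : ∀ x1 x2 x3 x4 : ZMod 2, x1 + x2 + x3 + x4 = 1 → (x1 + x2 + x3) * x4 = 0 := by
          decide
        exact aux _ _ _ _ hodd
      rw [hz, hK]; simp
  rw [← total, fourTensor, fourTensor, Finset.mul_sum, ← Finset.sum_add_distrib, Finset.mul_sum]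
  refine Finset.sum_congr rfl fun i _ => ?_
  rw [Finset.mul_sum, ← Finset.sum_add_distrib, Finset.mul_sum]
  refine Finset.sum_congr rfl fun j _ => ?_
  rw [hA' i j]
  simp only [hB, Function.comp, s0, s1, s2, s3, s4]
  have u0 : Function.update (Function.update c (v, 0) i) (v', 0) j (v, 0) = i := by
    rw [Function.update_of_ne hvf, Function.update_self]
  have u1 : Function.update (Function.update c (v, 0) i) (v', 0) j (v', 0) = j := by
    rw [Function.update_self]
  have u2 : ∀ y (t : Fin 3), t ≠ 0 →
      Function.update (Function.update c (v, 0) i) (v', 0) j (y, t) = c (y, t) := by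
    intro y t ht
    rw [Function.update_of_ne (by simp [ht]), Function.update_of_ne (by simp [ht])]
  rw [u0, u1, u2 v 1 (by decide), u2 v 2 (by decide), u2 v' 1 (by decide), u2 v' 2 (by decide)]
  ring

end flip

/-! ### Induced permutations of marked points -/

/-- `τ` is the first return map of `π` to the marked points `ι y`, which meet every cycle. -/
def FirstReturn {X Y : Type*} (π : Equiv.Perm X) (ι : Y → X) (τ : Equiv.Perm Y) : Prop :=
  (∀ x, ∃ i, ∃ r : ℕ, (π ^ r) (ι i) = x) ∧
  ∀ i, ∃ r : ℕ, 0 < r ∧ (π ^ r) (ι i) = ι (τ i) ∧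
    ∀ s : ℕ, 0 < s → s < r → (π ^ s) (ι i) ∉ Set.range ι

theorem induces_iff {X : Type*} {π : Equiv.Perm X} {n : ℕ} {ι : Fin n → X}
    {τ : Equiv.Perm (Fin n)} : Induces π ι τ ↔ FirstReturn π ι τ := Iff.rfl

namespace FirstReturn

variable {X Y Z : Type*} {π : Equiv.Perm X} {ι : Y → X} {τ τ' : Equiv.Perm Y}

theorem unique (hι : ι.Injective) (h : FirstReturn π ι τ) (h' : FirstReturn π ι τ') : τ = τ' := by
  ext i
  obtain ⟨r, h1, h2, h3⟩ := h.2 i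
  obtain ⟨r', h1', h2', h3'⟩ := h'.2 i
  have : r = r' := by
    rcases lt_trichotomy r r' with hr | hr | hr
    · exact absurd ⟨_, h2.symm⟩ (h3' r h1 hr)
    · exact hr
    · exact absurd ⟨_, h2'.symm⟩ (h3 r' h1' hr)
  subst this
  exact hι (h2.symm.trans h2')

/-- The power `orderOf π` brings every marked point back, so first returns exist. If two of them
coincided, cancelling the shorter time from the longer one would exhibit an earlier return. -/
theorem exists_of_cover [Finite X] (hι : ι.Injective)
    (h : ∀ x, ∃ i, ∃ r : ℕ, (π ^ r) (ι i) = x) : ∃ τ : Equiv.Perm Y, FirstReturn π ι τ := by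
  classical
  have : Finite Y := Finite.of_injective ι hι
  have ex : ∀ i, ∃ r : ℕ, 0 < r ∧ (π ^ r) (ι i) ∈ Set.range ι := fun i =>
    ⟨orderOf π, orderOf_pos π, i, by rw [pow_orderOf_eq_one]; rfl⟩
  choose t ht using fun i => (Nat.find_spec (ex i)).2
  have hinj : t.Injective := by
    have key : ∀ i j, t i = t j → Nat.find (ex i) ≤ Nat.find (ex j) → i = j := by
      intro i j hij hle
      have e : (π ^ (Nat.find (ex i))) (ι i) = (π ^ (Nat.find (ex j))) (ι j) := by
        rw [← ht, ← ht, hij]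
      rw [← Nat.add_sub_cancel' hle, pow_add, Equiv.Perm.mul_apply] at e
      have e := (Equiv.injective _) e
      by_contra hne
      have hpos : 0 < Nat.find (ex j) - Nat.find (ex i) := by
        rcases Nat.eq_zero_or_pos (Nat.find (ex j) - Nat.find (ex i)) with h0 | h0
        · rw [h0, pow_zero] at e
          exact absurd (hι e) hne
        · exact h0
      have := Nat.find_spec (ex i)
      refine Nat.find_min (ex j) (m := Nat.find (ex j) - Nat.find (ex i)) (by omega)
        ⟨hpos, i, e⟩
    intro i j hij
    rcases le_total (Nat.find (ex i)) (Nat.find (ex j)) with hle | hle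
    · exact key i j hij hle
    · exact (key j i hij.symm hle).symm
  refine ⟨Equiv.ofBijective t (Finite.injective_iff_bijective.1 hinj), h, fun i =>
    ⟨Nat.find (ex i), (Nat.find_spec (ex i)).1, (ht i).symm, fun s h1 h2 h3 =>
      Nat.find_min (ex i) h2 ⟨h1, h3⟩⟩⟩

theorem pow_apply (h : FirstReturn π ι τ) (m : ℕ) (i : Y) :
    ∃ r : ℕ, (π ^ r) (ι i) = ι ((τ ^ m) i) := by
  induction m with
  | zero => exact ⟨0, rfl⟩
  | succ m ih =>
    obtain ⟨r, hr⟩ := ih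
    obtain ⟨r', -, hr', -⟩ := h.2 ((τ ^ m) i)
    refine ⟨r' + r, ?_⟩
    rw [pow_add, Equiv.Perm.mul_apply, hr, hr', pow_succ', Equiv.Perm.mul_apply]

theorem exists_pow_eq (hι : ι.Injective) (h : FirstReturn π ι τ) (r : ℕ) :
    ∀ i j, (π ^ r) (ι i) = ι j → ∃ m : ℕ, (τ ^ m) i = j := by
  induction r using Nat.strong_induction_on with
  | _ r ih =>
    intro i j hij
    rcases Nat.eq_zero_or_pos r with h0 | h0
    · subst h0
      exact ⟨0, hι hij⟩
    · obtain ⟨r1, h1, h2, h3⟩ := h.2 i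
      have hle : r1 ≤ r := by
        by_contra hlt
        exact h3 r h0 (by omega) ⟨j, hij.symm⟩
      rw [← Nat.sub_add_cancel hle, pow_add, Equiv.Perm.mul_apply, h2] at hij
      obtain ⟨m, hm⟩ := ih (r - r1) (by omega) _ _ hij
      exact ⟨m + 1, by rw [pow_succ, Equiv.Perm.mul_apply, hm]⟩

theorem comp {κ : Z → Y} {ρ : Equiv.Perm Z} (hι : ι.Injective)
    (h : FirstReturn π ι τ) (h' : FirstReturn τ κ ρ) : FirstReturn π (ι ∘ κ) ρ := by
  refine ⟨fun x => ?_, fun z => ?_⟩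
  · obtain ⟨i, r, rfl⟩ := h.1 x
    obtain ⟨z, m, rfl⟩ := h'.1 i
    obtain ⟨r', hr'⟩ := h.pow_apply m (κ z)
    exact ⟨z, r + r', by rw [pow_add, Equiv.Perm.mul_apply, Function.comp, hr']⟩
  · obtain ⟨m, h1, h2, h3⟩ := h'.2 z
    -- Induction on the number of returns to the larger set of marked points; `r` is the time spent
    -- so far.
    have key : ∀ m, (∀ s, 0 < s → s < m → (τ ^ s) (κ z) ∉ Set.range κ) →
        ∃ r : ℕ, (r = 0 ↔ m = 0) ∧ (π ^ r) (ι (κ z)) = ι ((τ ^ m) (κ z)) ∧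
          ∀ s, 0 < s → s < r → (π ^ s) (ι (κ z)) ∉ Set.range (ι ∘ κ) := by
      intro m
      induction m with
      | zero => exact fun _ => ⟨0, by simp, rfl, fun s h1 h2 => by omega⟩
      | succ m ih =>
        intro hm
        obtain ⟨r, hr0, hr1, hr2⟩ := ih fun s h1 h2 => hm s h1 (by omega)
        obtain ⟨r', hr', hr'', hr'''⟩ := h.2 ((τ ^ m) (κ z))
        refine ⟨r' + r, by simp; omega, ?_, ?_⟩
        · rw [pow_add, Equiv.Perm.mul_apply, hr1, hr'', pow_succ', Equiv.Perm.mul_apply]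
        · intro s hs0 hs
          rcases lt_trichotomy s r with hsr | hsr | hsr
          · exact hr2 s hs0 hsr
          · subst hsr
            rintro ⟨z', hz'⟩
            rw [hr1] at hz'
            exact hm m (by omega) (by omega) ⟨z', hι hz'⟩
          · rintro ⟨z', hz'⟩
            have := hr''' (s - r) (by omega) (by omega)
            rw [← hr1, ← Equiv.Perm.mul_apply, ← pow_add, Nat.sub_add_cancel hsr.le] at this
            exact this ⟨κ z', hz'⟩
    obtain ⟨r, hr0, hr1, hr2⟩ := key m h3
    exact ⟨r, by omega, by rw [Function.comp, hr1, h2]; rfl, hr2⟩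

theorem comp_iff [Finite X] {κ : Z → Y} {ρ : Equiv.Perm Z} (hι : ι.Injective)
    (hκ : κ.Injective) (h : FirstReturn π ι τ) :
    FirstReturn π (ι ∘ κ) ρ ↔ FirstReturn τ κ ρ := by
  refine ⟨fun h' => ?_, h.comp hι⟩
  have : Finite Y := Finite.of_injective ι hι
  obtain ⟨ρ', hρ'⟩ := exists_of_cover (π := τ) hκ fun y => by
    obtain ⟨z, r, hr⟩ := h'.1 (ι y)
    obtain ⟨m, hm⟩ := h.exists_pow_eq hι r _ _ hr
    exact ⟨z, m, hm⟩
  rwa [unique (hι.comp hκ) h' (h.comp hι hρ')]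

/-- As `g` moves only marked points, the orbit of `ι i` under `π * g` follows that of `ι (γ i)`
under `π` until the next marked point. -/
theorem mul_of_marked (h : FirstReturn π ι τ) {g : Equiv.Perm X}
    {γ : Equiv.Perm Y} (hg : ∀ y, g (ι y) = ι (γ y)) (hg' : ∀ x, x ∉ Set.range ι → g x = x) :
    FirstReturn (π * g) ι (τ * γ) := by
  have key : ∀ (i : Y) (s : ℕ), 0 < s → (∀ t, 0 < t → t < s → (π ^ t) (ι i) ∉ Set.range ι) →
      ((π * g) ^ s) (ι (γ.symm i)) = (π ^ s) (ι i) := by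
    intro i s
    induction s with
    | zero => intro h; omega
    | succ s ih =>
      intro _ hs
      rcases Nat.eq_zero_or_pos s with h0 | h0
      · subst h0
        simp [hg]
      · rw [pow_succ', Equiv.Perm.mul_apply, ih h0 fun t h1 h2 => hs t h1 (by omega),
          Equiv.Perm.mul_apply, hg' _ (hs s h0 (by omega)), pow_succ', Equiv.Perm.mul_apply]
  refine ⟨fun x => ?_, fun i => ?_⟩
  · classical
    have hx : ∃ r : ℕ, ∃ i, (π ^ r) (ι i) = x := by
      obtain ⟨i, r, h⟩ := h.1 x
      exact ⟨r, i, h⟩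
    obtain ⟨i, hi⟩ := Nat.find_spec hx
    rcases Nat.eq_zero_or_pos (Nat.find hx) with h0 | h0
    · rw [h0] at hi
      exact ⟨i, 0, hi⟩
    · refine ⟨γ.symm i, Nat.find hx, ?_⟩
      rw [key i _ h0, hi]
      rintro t h1 h2 ⟨j, hj⟩
      refine Nat.find_min hx (m := Nat.find hx - t) (by omega) ⟨j, ?_⟩
      rw [hj, ← Equiv.Perm.mul_apply, ← pow_add, Nat.sub_add_cancel h2.le, hi]
  · obtain ⟨r, h1, h2, h3⟩ := h.2 (γ i)
    have e : ∀ s, 0 < s → s ≤ r → ((π * g) ^ s) (ι i) = (π ^ s) (ι (γ i)) := by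
      intro s hs hsr
      have := key (γ i) s hs fun t h1 h2 => h3 t h1 (by omega)
      rwa [Equiv.symm_apply_apply] at this
    refine ⟨r, h1, by rw [e r h1 le_rfl, h2]; rfl, fun s hs hsr => ?_⟩
    rw [e s hs hsr.le]
    exact h3 s hs hsr

theorem mul_swap [DecidableEq X] [DecidableEq Y] (hι : ι.Injective) (h : FirstReturn π ι τ)
    (i j : Y) : FirstReturn (π * Equiv.swap (ι i) (ι j)) ι (τ * Equiv.swap i j) :=
  h.mul_of_marked (fun y => by rw [hι.map_swap])
    fun x hx => Equiv.swap_apply_of_ne_of_ne (fun e => hx ⟨i, e.symm⟩) (fun e => hx ⟨j, e.symm⟩)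

theorem permCongr_pow {X X' : Type*} (e : X ≃ X') (π : Equiv.Perm X) (r : ℕ) (x : X') :
    ((e.permCongr π) ^ r) x = e ((π ^ r) (e.symm x)) := by
  induction r with
  | zero => simp
  | succ r ih => rw [pow_succ', Equiv.Perm.mul_apply, ih, pow_succ']; simp

theorem congr {X' Y' : Type*} (e : X ≃ X') (f : Y ≃ Y') (h : FirstReturn π ι τ) :
    FirstReturn (e.permCongr π) (e ∘ ι ∘ f.symm) (f.permCongr τ) := by
  refine ⟨fun x => ?_, fun i => ?_⟩
  · obtain ⟨i, r, hr⟩ := h.1 (e.symm x)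
    exact ⟨f i, r, by rw [permCongr_pow]; simp [hr]⟩
  · obtain ⟨r, h1, h2, h3⟩ := h.2 (f.symm i)
    refine ⟨r, h1, by rw [permCongr_pow]; simp [h2], fun s hs hsr => ?_⟩
    rw [permCongr_pow]
    rintro ⟨j, hj⟩
    exact h3 s hs hsr ⟨f.symm j, by simpa using hj⟩

theorem congr_iff {X' Y' : Type*} (e : X ≃ X') (f : Y ≃ Y') :
    FirstReturn (e.permCongr π) (e ∘ ι ∘ f.symm) (f.permCongr τ) ↔ FirstReturn π ι τ := by
  refine ⟨fun h => ?_, congr e f⟩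
  have := h.congr e.symm f.symm
  convert this using 1
  · ext x; simp
  · ext x; simp
  · ext x; simp

theorem sumCongr_pow {X X' : Type*} (π : Equiv.Perm X) (π' : Equiv.Perm X') (r : ℕ) :
    (Equiv.Perm.sumCongr π π') ^ r = Equiv.Perm.sumCongr (π ^ r) (π' ^ r) := by
  induction r with
  | zero => simp
  | succ r ih => rw [pow_succ, ih, pow_succ, pow_succ, Equiv.Perm.sumCongr_mul]

theorem sumCongr {X' Y' : Type*} {π' : Equiv.Perm X'} {ι' : Y' → X'} {τ' : Equiv.Perm Y'}
    (h : FirstReturn π ι τ) (h' : FirstReturn π' ι' τ') :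
    FirstReturn (Equiv.Perm.sumCongr π π') (Sum.map ι ι') (Equiv.Perm.sumCongr τ τ') := by
  refine ⟨?_, ?_⟩
  · rintro (x | x)
    · obtain ⟨i, r, hr⟩ := h.1 x
      exact ⟨Sum.inl i, r, by rw [sumCongr_pow]; simp [hr]⟩
    · obtain ⟨i, r, hr⟩ := h'.1 x
      exact ⟨Sum.inr i, r, by rw [sumCongr_pow]; simp [hr]⟩
  · rintro (i | i)
    · obtain ⟨r, h1, h2, h3⟩ := h.2 i
      refine ⟨r, h1, by rw [sumCongr_pow]; simp [h2], fun s hs hsr => ?_⟩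
      rw [sumCongr_pow]
      rintro ⟨j | j, hj⟩
      · exact h3 s hs hsr ⟨j, by simpa using hj⟩
      · simp at hj
    · obtain ⟨r, h1, h2, h3⟩ := h'.2 i
      refine ⟨r, h1, by rw [sumCongr_pow]; simp [h2], fun s hs hsr => ?_⟩
      rw [sumCongr_pow]
      rintro ⟨j | j, hj⟩
      · simp at hj
      · exact h3 s hs hsr ⟨j, by simpa using hj⟩

/-- A permutation which preserves a partition into two parts, each cycle of which contains a
marked point, induces a permutation which preserves the parts. -/
theorem exists_sumCongr [Finite X] {X' Y' : Type*} [Finite X'] {π' : Equiv.Perm X'}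
    {ι' : Y' → X'} (hι : ι.Injective) (hι' : ι'.Injective) {σ : Equiv.Perm (Y ⊕ Y')}
    (h : FirstReturn (Equiv.Perm.sumCongr π π') (Sum.map ι ι') σ) :
    ∃ τ τ', σ = Equiv.Perm.sumCongr τ τ' ∧ FirstReturn π ι τ ∧ FirstReturn π' ι' τ' := by
  obtain ⟨τ, hτ⟩ := exists_of_cover (π := π) hι fun x => by
    obtain ⟨i | i, r, hr⟩ := h.1 (Sum.inl x)
    · exact ⟨i, r, by rw [sumCongr_pow] at hr; simpa using hr⟩
    · rw [sumCongr_pow] at hr; simp at hr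
  obtain ⟨τ', hτ'⟩ := exists_of_cover (π := π') hι' fun x => by
    obtain ⟨i | i, r, hr⟩ := h.1 (Sum.inr x)
    · rw [sumCongr_pow] at hr; simp at hr
    · exact ⟨i, r, by rw [sumCongr_pow] at hr; simpa using hr⟩
  exact ⟨τ, τ', unique (Sum.map_injective.2 ⟨hι, hι'⟩) h (hτ.sumCongr hτ'), hτ, hτ'⟩

end FirstReturn

/-- Gluing two marked points. -/
theorem induces_mul_swap_iff {X : Type*} [Finite X] [DecidableEq X] {π : Equiv.Perm X} {n : ℕ}
    {ι : Fin (n + 2) → X} (hι : ι.Injective) {σ : Equiv.Perm (Fin n)} :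
    Induces (π * Equiv.swap (ι 0) (ι 1)) (fun l => ι l.succ.succ) σ ↔
      ∃ σ', Induces π ι σ' ∧ GluesTo σ' σ := by
  have hs : Function.Injective (fun i : Fin n => i.succ.succ) :=
    (Fin.succ_injective _).comp (Fin.succ_injective _)
  constructor
  · intro h
    -- If the points `ι l.succ.succ` already meet every cycle, so do all the marked points, and a
    -- first return `τ` to these exists. Undoing the transposition in `τ` gives the boundary words
    -- before gluing.
    obtain ⟨τ, hτ⟩ := FirstReturn.exists_of_cover (π := π * Equiv.swap (ι 0) (ι 1)) hι fun x => by
      obtain ⟨i, r, hr⟩ := h.1 x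
      exact ⟨_, r, hr⟩
    have h2 := hτ.mul_swap hι 0 1
    rw [mul_assoc, Equiv.swap_mul_self, mul_one] at h2
    refine ⟨_, h2, ?_⟩
    rw [GluesTo, mul_assoc, Equiv.swap_mul_self, mul_one]
    exact (hτ.comp_iff hι hs).1 h
  · rintro ⟨σ', h1, h2⟩
    exact (FirstReturn.mul_swap hι h1 0 1).comp hι h2

/-! ### Operations on ribbon graphs -/

namespace RibbonGraph

variable {n N : ℕ}

@[ext] theorem ext' {Γ Γ' : RibbonGraph n N} (h : ∀ f, Γ.edge f = Γ'.edge f)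
    (h' : ∀ l, Γ.leg l = Γ'.leg l) : Γ = Γ' := by
  cases Γ; cases Γ'
  congr 1
  · exact Equiv.ext h
  · exact DFunLike.ext _ _ h'

instance : Finite (RibbonGraph n N) :=
  Finite.of_injective (fun Γ : RibbonGraph n N => (Γ.edge, Γ.leg)) fun Γ Γ' h => by
    cases Γ; cases Γ'; simp_all

instance : Fintype (RibbonGraph n N) := Fintype.ofFinite _

/-- The image of a ribbon graph under a permutation of the flags. -/
def mapFlags (g : Equiv.Perm (Flag N)) (Γ : RibbonGraph n N) : RibbonGraph n N where
  edge := g.permCongr Γ.edge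
  leg := Γ.leg.trans g.toEmbedding
  edge_edge f := by simp [Γ.edge_edge]
  edge_eq_self_iff f := by
    rw [Equiv.permCongr_apply, ← Equiv.eq_symm_apply, Γ.edge_eq_self_iff]
    simp [Equiv.eq_symm_apply]

@[simp] theorem mapFlags_edge (g : Equiv.Perm (Flag N)) (Γ : RibbonGraph n N) (f : Flag N) :
    (mapFlags g Γ).edge f = g (Γ.edge (g.symm f)) := rfl

@[simp] theorem mapFlags_leg (g : Equiv.Perm (Flag N)) (Γ : RibbonGraph n N) (l : Fin n) :
    (mapFlags g Γ).leg l = g (Γ.leg l) := rfl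

theorem mapFlags_mul (g g' : Equiv.Perm (Flag N)) (Γ : RibbonGraph n N) :
    mapFlags (g * g') Γ = mapFlags g (mapFlags g' Γ) := by
  ext f <;> simp [Equiv.Perm.mul_def]

@[simp] theorem mapFlags_one (Γ : RibbonGraph n N) : mapFlags 1 Γ = Γ := by
  ext f <;> simp [Equiv.Perm.one_def]

/-- The bijection of ribbon graphs given by a permutation of the flags. -/
def mapFlagsEquiv (g : Equiv.Perm (Flag N)) : RibbonGraph n N ≃ RibbonGraph n N where
  toFun := mapFlags g
  invFun := mapFlags g⁻¹
  left_inv Γ := by rw [← mapFlags_mul]; simp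
  right_inv Γ := by rw [← mapFlags_mul]; simp

theorem iso_iff {Γ Γ' : RibbonGraph n N} : Γ.Iso Γ' ↔
    ∃ g : Equiv.Perm (Flag N), (∀ f, g (rot N f) = rot N (g f)) ∧ mapFlags g Γ = Γ' := by
  constructor
  · rintro ⟨g, h1, h2, h3⟩
    refine ⟨g, h1, ext' (fun f => ?_) h3⟩
    rw [mapFlags_edge, h2, Equiv.apply_symm_apply]
  · rintro ⟨g, h1, rfl⟩
    exact ⟨g, h1, by simp, by simp⟩

/-- Renumbering of the legs. -/
def relabel {m : ℕ} (e : Fin n ≃ Fin m) (Γ : RibbonGraph n N) : RibbonGraph m N where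
  edge := Γ.edge
  leg := e.symm.toEmbedding.trans Γ.leg
  edge_edge := Γ.edge_edge
  edge_eq_self_iff f := by
    rw [Γ.edge_eq_self_iff]
    exact ⟨fun ⟨l, hl⟩ => ⟨e l, by simp [hl]⟩, fun ⟨l, hl⟩ => ⟨e.symm l, hl⟩⟩

@[simp] theorem relabel_edge {m : ℕ} (e : Fin n ≃ Fin m) (Γ : RibbonGraph n N) :
    (relabel e Γ).edge = Γ.edge := rfl

@[simp] theorem relabel_leg {m : ℕ} (e : Fin n ≃ Fin m) (Γ : RibbonGraph n N) (l : Fin m) :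
    (relabel e Γ).leg l = Γ.leg (e.symm l) := rfl

/-- The bijection of ribbon graphs given by a renumbering of the legs. -/
def relabelEquiv (e : Equiv.Perm (Fin n)) : RibbonGraph n N ≃ RibbonGraph n N where
  toFun := relabel e
  invFun := relabel e.symm
  left_inv Γ := by ext f <;> simp
  right_inv Γ := by ext f <;> simp

theorem leg_zero_ne_one (Γ : RibbonGraph (n + 2) N) : Γ.leg 0 ≠ Γ.leg 1 :=
  Γ.leg.injective.ne (by simp [Fin.ext_iff])

theorem succ_succ_ne_zero (l : Fin n) : l.succ.succ ≠ 0 := Fin.succ_ne_zero _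

theorem succ_succ_ne_one (l : Fin n) : l.succ.succ ≠ 1 := by
  simp [Fin.ext_iff]

theorem fin_cases_two {P : Fin (n + 2) → Prop} (h0 : P 0) (h1 : P 1) (h : ∀ l : Fin n, P l.succ.succ)
    (l : Fin (n + 2)) : P l := by
  refine Fin.cases h0 (fun l => ?_) l
  refine Fin.cases ?_ (fun l => h l) l
  exact h1

/-- The graph in which the first two legs are joined to an edge. -/
def glue (Γ : RibbonGraph (n + 2) N) : RibbonGraph n N where
  edge := Γ.edge * Equiv.swap (Γ.leg 0) (Γ.leg 1)
  leg := ((Fin.succEmb n).trans (Fin.succEmb (n + 1))).trans Γ.leg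
  edge_edge f := by
    have h0 := Γ.edge_leg 0
    have h1 := Γ.edge_leg 1
    simp only [Equiv.Perm.mul_apply]
    by_cases f0 : f = Γ.leg 0
    · subst f0; simp [h0, h1]
    · by_cases f1 : f = Γ.leg 1
      · subst f1; simp [h0, h1]
      · rw [Equiv.swap_apply_of_ne_of_ne f0 f1, Equiv.swap_apply_of_ne_of_ne, Γ.edge_edge]
        · intro e; exact f0 (by rw [← Γ.edge_edge f, e, h0])
        · intro e; exact f1 (by rw [← Γ.edge_edge f, e, h1])
  edge_eq_self_iff f := by
    have h0 := Γ.edge_leg 0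
    have h1 := Γ.edge_leg 1
    have h01 := Γ.leg_zero_ne_one
    simp only [Equiv.Perm.mul_apply]
    by_cases f0 : f = Γ.leg 0
    · subst f0
      simp only [Equiv.swap_apply_left, h1, h01.symm, false_iff, not_exists]
      exact fun l => Γ.leg.injective.ne (succ_succ_ne_zero l)
    · by_cases f1 : f = Γ.leg 1
      · subst f1
        simp only [Equiv.swap_apply_right, h0, h01, false_iff, not_exists]
        exact fun l => Γ.leg.injective.ne (succ_succ_ne_one l)
      · rw [Equiv.swap_apply_of_ne_of_ne f0 f1, Γ.edge_eq_self_iff]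
        constructor
        · rintro ⟨l, rfl⟩
          revert f0 f1
          exact fin_cases_two (P := fun l => Γ.leg l ≠ Γ.leg 0 → Γ.leg l ≠ Γ.leg 1 →
            ∃ l' : Fin n, Γ.leg l'.succ.succ = Γ.leg l)
            (by simp) (by simp) (fun l _ _ => ⟨l, rfl⟩) l
        · rintro ⟨l, rfl⟩
          exact ⟨_, rfl⟩

@[simp] theorem glue_leg (Γ : RibbonGraph (n + 2) N) (l : Fin n) :
    (glue Γ).leg l = Γ.leg l.succ.succ := rfl

theorem glue_edge (Γ : RibbonGraph (n + 2) N) :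
    (glue Γ).edge = Γ.edge * Equiv.swap (Γ.leg 0) (Γ.leg 1) := rfl

theorem glue_edge_leg_zero (Γ : RibbonGraph (n + 2) N) : (glue Γ).edge (Γ.leg 0) = Γ.leg 1 := by
  simp [glue_edge, Γ.edge_leg]

theorem glue_edge_leg_one (Γ : RibbonGraph (n + 2) N) : (glue Γ).edge (Γ.leg 1) = Γ.leg 0 := by
  simp [glue_edge, Γ.edge_leg]

theorem glue_edge_of_ne (Γ : RibbonGraph (n + 2) N) {f : Flag N} (h0 : f ≠ Γ.leg 0)
    (h1 : f ≠ Γ.leg 1) : (glue Γ).edge f = Γ.edge f := by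
  simp [glue_edge, Equiv.swap_apply_of_ne_of_ne h0 h1]

/-- The graph in which the edge of `f` is cut into the first two legs. -/
def cut (Γ : RibbonGraph n N) (f : Flag N) (hf : Γ.edge f ≠ f) : RibbonGraph (n + 2) N where
  edge := Γ.edge * Equiv.swap f (Γ.edge f)
  leg := ⟨Fin.cons f (Fin.cons (Γ.edge f) Γ.leg), by
    have h1 : ∀ l, Γ.leg l ≠ f := fun l e => hf (by rw [← e, Γ.edge_leg])
    have h2 : ∀ l, Γ.leg l ≠ Γ.edge f := fun l e => h1 l (by rw [← Γ.edge_leg, e, Γ.edge_edge])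
    rw [Fin.cons_injective_iff, Fin.cons_injective_iff]
    refine ⟨?_, ?_, Γ.leg.injective⟩
    · rintro ⟨l, hl⟩
      revert hl
      refine Fin.cases ?_ (fun l => ?_) l
      · simpa using hf
      · simpa using h1 l
    · rintro ⟨l, hl⟩
      exact h2 l hl⟩
  edge_edge x := by
    simp only [Equiv.Perm.mul_apply]
    by_cases f0 : x = f
    · subst f0; simp [Γ.edge_edge]
    · by_cases f1 : x = Γ.edge f
      · subst f1; simp [Γ.edge_edge]
      · rw [Equiv.swap_apply_of_ne_of_ne f0 f1, Equiv.swap_apply_of_ne_of_ne, Γ.edge_edge]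
        · intro e; exact f1 (by rw [← e, Γ.edge_edge])
        · intro e; exact f0 (Γ.edge.injective e)
  edge_eq_self_iff x := by
    simp only [Equiv.Perm.mul_apply]
    by_cases f0 : x = f
    · subst f0
      simp only [Equiv.swap_apply_left, Γ.edge_edge, true_iff]
      exact ⟨0, rfl⟩
    · by_cases f1 : x = Γ.edge f
      · subst f1
        simp only [Equiv.swap_apply_right, true_iff]
        exact ⟨1, rfl⟩
      · rw [Equiv.swap_apply_of_ne_of_ne f0 f1, Γ.edge_eq_self_iff]
        constructor
        · rintro ⟨l, rfl⟩
          exact ⟨l.succ.succ, rfl⟩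
        · rintro ⟨l, rfl⟩
          revert f0 f1
          exact fin_cases_two (P := fun l => (Fin.cons f (Fin.cons (Γ.edge f) Γ.leg) : Fin (n + 2) →
            Flag N) l ≠ f → (Fin.cons f (Fin.cons (Γ.edge f) Γ.leg) : Fin (n + 2) → Flag N) l ≠
            Γ.edge f → ∃ l', Γ.leg l' = (Fin.cons f (Fin.cons (Γ.edge f) Γ.leg) : Fin (n + 2) →
            Flag N) l)
            (fun h => absurd rfl h) (fun _ h => absurd rfl h) (fun l _ _ => ⟨l, rfl⟩) l

/-- A graph with two additional legs is the same as a graph with an oriented edge. -/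
def cutEquiv : (Σ Γ : RibbonGraph n N, {f // Γ.edge f ≠ f}) ≃ RibbonGraph (n + 2) N where
  toFun x := cut x.1 x.2.1 x.2.2
  invFun Γ := ⟨glue Γ, Γ.leg 0, by rw [glue_edge_leg_zero]; exact Γ.leg_zero_ne_one.symm⟩
  left_inv := by
    rintro ⟨Γ, f, hf⟩
    have h : glue (cut Γ f hf) = Γ := by
      refine ext' (fun x => ?_) fun l => rfl
      have : (glue (cut Γ f hf)).edge = Γ.edge * Equiv.swap f (Γ.edge f) *
        Equiv.swap f (Γ.edge f) := rfl
      rw [this, mul_assoc, Equiv.swap_mul_self, mul_one]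
    have key : ∀ (Γ' : RibbonGraph n N) (h : Γ' = Γ) (h' : Γ'.edge f ≠ f),
        (⟨Γ', f, h'⟩ : Σ Γ : RibbonGraph n N, {f // Γ.edge f ≠ f}) = ⟨Γ, f, hf⟩ := by
      rintro _ rfl _; rfl
    exact key _ h _
  right_inv Γ := by
    refine ext' (fun x => ?_) ?_
    · have : (cut (glue Γ) (Γ.leg 0) (by rw [glue_edge_leg_zero]; exact
        Γ.leg_zero_ne_one.symm)).edge = Γ.edge * Equiv.swap (Γ.leg 0) (Γ.leg 1) *
          Equiv.swap (Γ.leg 0) ((glue Γ).edge (Γ.leg 0)) := rfl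
      rw [this, glue_edge_leg_zero, mul_assoc, Equiv.swap_mul_self, mul_one]
    · exact fin_cases_two rfl (glue_edge_leg_zero Γ) fun l => rfl

theorem sum_cut {M : Type*} [AddCommMonoid M] (G : (Γ : RibbonGraph n N) → Flag N → M) :
    ∑ Γ : RibbonGraph n N, ∑ f, (if Γ.edge f ≠ f then G Γ f else 0) =
      ∑ Γ : RibbonGraph (n + 2) N, G (glue Γ) (Γ.leg 0) := by
  refine Eq.trans ?_ (Equiv.sum_comp cutEquiv.symm
    (fun x : Σ Γ : RibbonGraph n N, {f // Γ.edge f ≠ f} => G x.1 x.2.1)).symm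
  rw [Fintype.sum_sigma]
  refine Finset.sum_congr rfl fun Γ _ => ?_
  rw [← Finset.sum_filter]
  exact (Finset.sum_subtype _ (fun f => by simp) _)

/-- A set of vertices which is a union of connected components. -/
def Closed (Γ : RibbonGraph n N) (C : Set (Fin N)) : Prop :=
  ∀ f, f.1 ∈ C → (Γ.edge f).1 ∈ C

theorem closed_iff {Γ : RibbonGraph n N} {C : Set (Fin N)} :
    Γ.Closed C ↔ ∀ f, (Γ.edge f).1 ∈ C ↔ f.1 ∈ C :=
  ⟨fun h f => ⟨fun h' => by have := h _ h'; rwa [Γ.edge_edge] at this, h f⟩,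
    fun h f => (h f).2⟩

theorem Closed.compl {Γ : RibbonGraph n N} {C : Set (Fin N)} (h : Γ.Closed C) : Γ.Closed Cᶜ := by
  rw [closed_iff] at h ⊢
  intro f
  simp only [Set.mem_compl_iff, h]

/-- Rotations connect all flags at one vertex, so orbits of flags correspond to sets of vertices
that no edge leaves. In this form connectedness can be compared under gluing, flips and disjoint
unions. -/
theorem connected_iff {Γ : RibbonGraph n N} :
    Γ.Connected ↔ 0 < N ∧ ∀ C, Γ.Closed C → C.Nonempty → C = Set.univ := by
  refine and_congr_right fun _ => ⟨fun h C hC hne => ?_, fun h f f' => ?_⟩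
  · obtain ⟨v, hv⟩ := hne
    refine Set.eq_univ_of_forall fun u => ?_
    obtain ⟨w, hw, hwf⟩ := h (v, 0) (u, 0)
    have key : ∀ f : Flag N, (w f).1 ∈ C ↔ f.1 ∈ C := by
      clear hwf
      induction hw using Subgroup.closure_induction with
      | mem x hx =>
        rcases hx with rfl | rfl
        · intro f; rfl
        · exact closed_iff.1 hC
      | one => intro f; rfl
      | mul x y _ _ h1 h2 => intro f; rw [Equiv.Perm.mul_apply, h1, h2]
      | inv x _ h1 => intro f; rw [← h1, ← Equiv.Perm.mul_apply, mul_inv_cancel, Equiv.Perm.one_apply]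
    have := key (v, 0)
    rw [hwf] at this
    exact this.2 hv
  · have hrot : rot N ∈ Subgroup.closure {rot N, Γ.edge} :=
      Subgroup.subset_closure (by simp)
    have hedge : Γ.edge ∈ Subgroup.closure {rot N, Γ.edge} :=
      Subgroup.subset_closure (by simp)
    have hv : ∀ x y : Flag N, x.1 = y.1 → ∃ w ∈ Subgroup.closure {rot N, Γ.edge}, w x = y := by
      rintro ⟨v, i⟩ ⟨v', j⟩ (rfl : v = v')
      have : j = i ∨ j = i + 1 ∨ j = i + 1 + 1 := by revert i j; decide
      rcases this with rfl | rfl | rfl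
      · exact ⟨1, one_mem _, rfl⟩
      · exact ⟨rot N, hrot, by simp⟩
      · exact ⟨rot N * rot N, mul_mem hrot hrot, by simp⟩
    have hC := h {v | ∃ w ∈ Subgroup.closure {rot N, Γ.edge}, (w f).1 = v} (by
      rintro x ⟨w, hw, hwx⟩
      obtain ⟨w', hw', hx⟩ := hv _ _ hwx
      exact ⟨Γ.edge * w' * w, mul_mem (mul_mem hedge hw') hw, by
        simp [Equiv.Perm.mul_apply, hx]⟩) ⟨f.1, 1, one_mem _, rfl⟩
    have : f'.1 ∈ (Set.univ : Set (Fin N)) := trivial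
    rw [← hC] at this
    obtain ⟨w, hw, hwx⟩ := this
    obtain ⟨w', hw', hx⟩ := hv _ _ hwx
    exact ⟨w' * w, mul_mem hw' hw, hx⟩

theorem glue_closed_iff {Γ : RibbonGraph (n + 2) N} {C : Set (Fin N)} :
    (glue Γ).Closed C ↔ Γ.Closed C ∧ ((Γ.leg 0).1 ∈ C ↔ (Γ.leg 1).1 ∈ C) := by
  simp only [closed_iff]
  constructor
  · intro h
    have h01 := h (Γ.leg 0)
    rw [glue_edge_leg_zero] at h01
    refine ⟨fun f => ?_, h01.symm⟩
    by_cases f0 : f = Γ.leg 0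
    · rw [f0, Γ.edge_leg]
    · by_cases f1 : f = Γ.leg 1
      · rw [f1, Γ.edge_leg]
      · rw [← glue_edge_of_ne Γ f0 f1, h]
  · rintro ⟨h, h01⟩ f
    by_cases f0 : f = Γ.leg 0
    · rw [f0, glue_edge_leg_zero, h01]
    · by_cases f1 : f = Γ.leg 1
      · rw [f1, glue_edge_leg_one, h01]
      · rw [glue_edge_of_ne Γ f0 f1, h]

/-- Gluing multiplies `rot * edge` on the right by the transposition of the two legs; on boundary
words this is the formula that defines `GluesTo`. -/
theorem glue_hasBoundary_iff {Γ : RibbonGraph (n + 2) N} {σ : Equiv.Perm (Fin n)} :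
    (glue Γ).HasBoundary σ ↔ ∃ σ', Γ.HasBoundary σ' ∧ GluesTo σ' σ := by
  unfold HasBoundary
  rw [glue_edge, ← mul_assoc]
  exact induces_mul_swap_iff Γ.leg.injective

theorem HasBoundary.unique {Γ : RibbonGraph n N} {σ σ' : Equiv.Perm (Fin n)}
    (h : Γ.HasBoundary σ) (h' : Γ.HasBoundary σ') : σ = σ' :=
  FirstReturn.unique Γ.leg.injective h h'

/-- The edge of a loop bounds a disc without legs. -/
theorem not_glue_hasBoundary_of_loop {Γ : RibbonGraph (n + 2) N} {σ : Equiv.Perm (Fin n)}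
    (h : (Γ.leg 0).1 = (Γ.leg 1).1) : ¬ (glue Γ).HasBoundary σ := by
  intro hb
  -- A fixed point of the boundary permutation that is not a leg is a boundary component without
  -- legs.
  have key : ∀ f, (∀ l : Fin n, f ≠ Γ.leg l.succ.succ) → rot N ((glue Γ).edge f) ≠ f := by
    intro f hf hfix
    obtain ⟨l, r, hr⟩ := hb.1 f
    have : ∀ r : ℕ, ((rot N * (glue Γ).edge) ^ r) f = f := by
      intro r
      induction r with
      | zero => rfl
      | succ r ih => rw [pow_succ', Equiv.Perm.mul_apply, ih]; exact hfix
    rw [← this r] at hr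
    exact hf l ((Equiv.injective _) hr).symm
  rcases h0 : Γ.leg 0 with ⟨v, i⟩
  rcases h1 : Γ.leg 1 with ⟨v', j⟩
  rw [h0, h1] at h
  obtain rfl : v = v' := h
  have hne := Γ.leg_zero_ne_one
  have hij : i ≠ j := fun e => hne (by rw [h0, h1, e])
  -- Any two flags at a trivalent vertex are neighbours in its cyclic order, so one side of the loop
  -- is a fixed point.
  have aux : ∀ i j : Fin 3, i ≠ j → j = i + 1 ∨ i = j + 1 := by decide
  have := aux i j hij
  rcases this with e | e
  · refine key (Γ.leg 1) (fun l => Γ.leg.injective.ne (succ_succ_ne_one l).symm) ?_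
    rw [glue_edge_leg_one, h0, h1, rot_apply, e]
  · refine key (Γ.leg 0) (fun l => Γ.leg.injective.ne (succ_succ_ne_zero l).symm) ?_
    rw [glue_edge_leg_zero, h0, h1, rot_apply, e]

/-- The graphs which contribute to the cyclic words `σ`. -/
def Contributes (Γ : RibbonGraph n N) (σ : Equiv.Perm (Fin n)) : Prop :=
  Γ.Connected ∧ Γ.HasBoundary σ

theorem mapFlags_hasBoundary_iff {g : Equiv.Perm (Flag N)} (hg : ∀ f, g (rot N f) = rot N (g f))
    {Γ : RibbonGraph n N} {σ : Equiv.Perm (Fin n)} :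
    (mapFlags g Γ).HasBoundary σ ↔ Γ.HasBoundary σ := by
  have := FirstReturn.congr_iff (π := rot N * Γ.edge) (ι := Γ.leg) (τ := σ) g (Equiv.refl _)
  refine Iff.trans (Iff.of_eq ?_) this
  unfold HasBoundary
  rw [induces_iff]
  congr 1
  ext f <;> simp [hg]

theorem mapFlags_closed_iff {g : Equiv.Perm (Flag N)} {Γ : RibbonGraph n N} {C C' : Set (Fin N)}
    (h : ∀ f, (g f).1 ∈ C ↔ f.1 ∈ C') : (mapFlags g Γ).Closed C ↔ Γ.Closed C' := by
  simp only [closed_iff, mapFlags_edge, h]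
  rw [← g.forall_congr_right]
  simp only [h, Equiv.symm_apply_apply]

theorem mapFlags_connected_iff {g : Equiv.Perm (Flag N)} (hg : ∀ f, g (rot N f) = rot N (g f))
    {Γ : RibbonGraph n N} : (mapFlags g Γ).Connected ↔ Γ.Connected := by
  rw [connected_iff, connected_iff]
  refine and_congr_right fun _ => ?_
  set e := vertexPerm g hg
  have he : ∀ f : Flag N, (g f).1 = e f.1 := by
    rintro ⟨v, i⟩
    rw [commute_rot_apply hg]
    rfl
  have hcl : ∀ C, (mapFlags g Γ).Closed C ↔ Γ.Closed (e ⁻¹' C) := fun C =>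
    mapFlags_closed_iff fun f => by rw [he]; rfl
  constructor
  · intro h C hC hne
    have hp : e ⁻¹' (e '' C) = C := Set.preimage_image_eq C e.injective
    have := h (e '' C) ((hcl _).2 (by rwa [hp])) (hne.image e)
    rw [← hp, this, Set.preimage_univ]
  · intro h C hC hne
    have := h _ ((hcl C).1 hC) (hne.preimage e.surjective)
    rw [← Set.image_preimage_eq C e.surjective, this, Set.image_univ, e.range_eq_univ]

theorem relabel_connected_iff {e : Equiv.Perm (Fin n)} {Γ : RibbonGraph n N} :
    (relabel e Γ).Connected ↔ Γ.Connected := Iff.rfl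

theorem relabel_hasBoundary_iff {e : Equiv.Perm (Fin n)} {Γ : RibbonGraph n N}
    {σ : Equiv.Perm (Fin n)} :
    (relabel e Γ).HasBoundary (e * σ * e⁻¹) ↔ Γ.HasBoundary σ := by
  have := FirstReturn.congr_iff (π := rot N * Γ.edge) (ι := Γ.leg) (τ := σ) (Equiv.refl _) e
  exact this

end RibbonGraph

theorem FirstReturn.apply_one {X Y : Type*} {π : Equiv.Perm X} {ι : Y → X} {τ : Equiv.Perm Y}
    (hι : ι.Injective) (h : FirstReturn π ι τ) {i j : Y} (hij : π (ι i) = ι j) : τ i = j := by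
  obtain ⟨r, h1, h2, h3⟩ := h.2 i
  have : r = 1 := by
    by_contra hr
    exact h3 1 one_pos (by omega) ⟨j, by rw [pow_one, hij]⟩
  subst this
  rw [pow_one, hij] at h2
  exact (hι h2).symm

theorem FirstReturn.apply_two {X Y : Type*} {π : Equiv.Perm X} {ι : Y → X} {τ : Equiv.Perm Y}
    (hι : ι.Injective) (h : FirstReturn π ι τ) {i j : Y} (hi : π (ι i) ∉ Set.range ι)
    (hij : π (π (ι i)) = ι j) : τ i = j := by
  obtain ⟨r, h1, h2, h3⟩ := h.2 i
  have h11 : r ≠ 1 := by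
    rintro rfl
    rw [pow_one] at h2
    exact hi ⟨_, h2.symm⟩
  have : r = 2 := by
    by_contra hr
    exact h3 2 two_pos (by omega) ⟨j, by rw [sq, Equiv.Perm.mul_apply, hij]⟩
  subst this
  rw [sq, Equiv.Perm.mul_apply, hij] at h2
  exact (hι h2).symm

/-! ### The effect of a flip on the topology; the standard order. -/

namespace RibbonGraph

variable {n N : ℕ}

theorem glue_mapFlags (g : Equiv.Perm (Flag N)) (Γ : RibbonGraph (n + 2) N) :
    glue (mapFlags g Γ) = mapFlags g (glue Γ) := by
  refine ext' (fun f => ?_) fun l => rfl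
  simp only [glue_edge, mapFlags_edge, mapFlags_leg, Equiv.Perm.mul_apply]
  congr 2
  rw [Equiv.symm_apply_eq, g.injective.map_swap]
  simp

/-- A flip moves flags only between `v` and `v'`, and these lie in the same component both before
and after, because the edge between them is kept. -/
theorem flip_connected_iff {v v' : Fin N} {ρ : Equiv.Perm (Flag N)} (hρ : IsFlip v v' ρ)
    {Γ : RibbonGraph n N} (h : Γ.edge (v, 0) = (v', 0)) :
    (mapFlags ρ Γ).Connected ↔ Γ.Connected := by
  rw [connected_iff, connected_iff]
  refine and_congr_right fun _ => forall_congr' fun C => ?_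
  have key : (v ∈ C ↔ v' ∈ C) → ((mapFlags ρ Γ).Closed C ↔ Γ.Closed C) := by
    intro hC
    refine mapFlags_closed_iff ?_
    rintro ⟨u, i⟩
    by_cases a1 : u = v
    · subst a1
      rcases fin3_cases i with rfl | rfl | rfl
      · rw [hρ.map_zero]
      · rw [hρ.map_left_one]
      · rw [hρ.map_left_two]; exact hC.symm
    · by_cases a2 : u = v'
      · subst a2
        rcases fin3_cases i with rfl | rfl | rfl
        · rw [hρ.map_zero]
        · rw [hρ.map_right_one]
        · rw [hρ.map_right_two]; exact hC
      · rw [hρ.map_of_ne _ _ a1 a2]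
  have h1 : (mapFlags ρ Γ).Closed C → (v ∈ C ↔ v' ∈ C) := by
    intro hC
    have := closed_iff.1 hC (v, 0)
    have e : ρ.symm (v, 0) = (v, 0) := by rw [Equiv.symm_apply_eq, hρ.map_zero]
    rw [mapFlags_edge, e, h, hρ.map_zero] at this
    exact this.symm
  have h2 : Γ.Closed C → (v ∈ C ↔ v' ∈ C) := by
    intro hC
    have := closed_iff.1 hC (v, 0)
    rw [h] at this
    exact this.symm
  exact ⟨fun a b => a ((key (h2 b)).2 b), fun a b => a ((key (h1 b)).1 b)⟩

/-- The glued edge is contracted. On the flags other than its ends, the boundary permutation has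
first return `ψ * γ`, where `γ` is the remaining edge involution and `ψ` is the cyclic order after
`v` and `v'` have merged into a four-valent vertex. As `ψ` commutes with the turn of the four flags
there, the flip merely conjugates `ψ * γ`. -/
theorem flip_hasBoundary_iff {v v' : Fin N} {ρ : Equiv.Perm (Flag N)} (hρ : IsFlip v v' ρ)
    {Γ : RibbonGraph (n + 2) N} (h0 : Γ.leg 0 = (v, 0)) (h1 : Γ.leg 1 = (v', 0))
    {σ : Equiv.Perm (Fin n)} :
    (glue (mapFlags ρ Γ)).HasBoundary σ ↔ (glue Γ).HasBoundary σ := by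
  classical
  have hv := hρ.ne
  set f : Flag N := (v, 0) with hf
  set f' : Flag N := (v', 0) with hf'
  have hff : f ≠ f' := by simp [hf, hf', hv]
  set R : Equiv.Perm (Flag N) := rot N * Equiv.swap f f' with hR
  let Y := {x : Flag N // x ≠ f ∧ x ≠ f'}
  let i0 : Y → Flag N := Subtype.val
  have hi0 : i0.Injective := Subtype.val_injective
  have hr0 : ∀ x, x ∉ Set.range i0 ↔ x = f ∨ x = f' := by
    intro x
    have : Set.range i0 = {x | x ≠ f ∧ x ≠ f'} := Subtype.range_val
    rw [this]
    simp only [Set.mem_ofPred_eq, not_and_or, not_not]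
  have hRne : ∀ x, x ≠ f → x ≠ f' → R x = rot N x := by
    intro x hx hx'
    rw [hR, Equiv.Perm.mul_apply, Equiv.swap_apply_of_ne_of_ne hx hx']
  have hRf : R f = (v', 1) := by simp [hR, hf']
  have hRf' : R f' = (v, 1) := by simp [hR, hf]
  have hR2 : R (v, 2) = f := by rw [hRne _ (by simp [hf]) (by simp [hf'])]; rfl
  have hR2' : R (v', 2) = f' := by rw [hRne _ (by simp [hf]) (by simp [hf'])]; rfl
  have hYi : ∀ u (i : Fin 3), i ≠ 0 → ((u, i) : Flag N) ≠ f ∧ ((u, i) : Flag N) ≠ f' := by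
    intro u i hi
    simp [hf, hf', hi]
  obtain ⟨ψ, hψ⟩ := FirstReturn.exists_of_cover (π := R) hi0 fun x => by
    by_cases hx : x = f
    · exact ⟨⟨(v, 2), hYi _ _ (by decide)⟩, 1, by rw [pow_one, hx]; exact hR2⟩
    · by_cases hx' : x = f'
      · exact ⟨⟨(v', 2), hYi _ _ (by decide)⟩, 1, by rw [pow_one, hx']; exact hR2'⟩
      · exact ⟨⟨x, hx, hx'⟩, 0, rfl⟩
  have restrict : ∀ g : Equiv.Perm (Flag N), g f = f → g f' = f' →
      ∃ γ : Equiv.Perm Y, ∀ y, g (i0 y) = i0 (γ y) := by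
    intro g hg hg'
    refine ⟨g.subtypePerm fun x => ?_, fun y => rfl⟩
    constructor
    · rintro ⟨a, b⟩
      exact ⟨fun e => a (by rw [e, hg]), fun e => b (by rw [e, hg'])⟩
    · rintro ⟨a, b⟩
      exact ⟨fun e => a (g.injective (by rw [e, hg])), fun e => b (g.injective (by rw [e, hg']))⟩
  have ef : Γ.edge f = f := by rw [← h0, Γ.edge_leg]
  have ef' : Γ.edge f' = f' := by rw [← h1, Γ.edge_leg]
  have ρf : ρ f = f := hρ.map_zero v
  have ρf' : ρ f' = f' := hρ.map_zero v'
  obtain ⟨γ, hγ⟩ := restrict Γ.edge ef ef'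
  obtain ⟨ρY, hρY⟩ := restrict ρ ρf ρf'
  have hcomm : ∀ y, ψ (ρY y) = ρY (ψ y) := by
    -- At the merged vertex `ψ` is the turn itself. From `(v, 2)` and `(v', 2)` it takes two steps,
    -- through an end of the contracted edge.
    have ha : ∀ y : Y, (i0 y).1 = v ∨ (i0 y).1 = v' → ψ y = ρY y := by
      rintro ⟨⟨u, i⟩, hy, hy'⟩ huv
      rcases huv with (rfl : u = v) | (rfl : u = v')
      · rcases fin3_cases i with rfl | rfl | rfl
        · exact absurd rfl hy
        · refine hψ.apply_one hi0 ?_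
          rw [← hρY]
          exact (hRne _ hy hy').trans hρ.map_left_one.symm
        · refine hψ.apply_two hi0 ?_ ?_
          · rw [hr0]; exact Or.inl hR2
          · rw [← hρY]
            exact (congrArg R hR2).trans (hRf.trans hρ.map_left_two.symm)
      · rcases fin3_cases i with rfl | rfl | rfl
        · exact absurd rfl hy'
        · refine hψ.apply_one hi0 ?_
          rw [← hρY]
          exact (hRne _ hy hy').trans hρ.map_right_one.symm
        · refine hψ.apply_two hi0 ?_ ?_
          · rw [hr0]; exact Or.inr hR2'
          · rw [← hρY]
            exact (congrArg R hR2').trans (hRf'.trans hρ.map_right_two.symm)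
    have ρV : ∀ x : Flag N, (x.1 = v ∨ x.1 = v') → ((ρ x).1 = v ∨ (ρ x).1 = v') := by
      rintro ⟨u, i⟩ (rfl | rfl)
      · rcases fin3_cases i with rfl | rfl | rfl
        · rw [hρ.map_zero]; exact Or.inl rfl
        · rw [hρ.map_left_one]; exact Or.inl rfl
        · rw [hρ.map_left_two]; exact Or.inr rfl
      · rcases fin3_cases i with rfl | rfl | rfl
        · rw [hρ.map_zero]; exact Or.inr rfl
        · rw [hρ.map_right_one]; exact Or.inr rfl
        · rw [hρ.map_right_two]; exact Or.inl rfl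
    intro y
    by_cases hy : (i0 y).1 = v ∨ (i0 y).1 = v'
    · rw [ha y hy, ha (ρY y) (by rw [← hρY]; exact ρV _ hy)]
    · have hfix : ∀ y : Y, ¬((i0 y).1 = v ∨ (i0 y).1 = v') → ρY y = y := by
        intro y hy
        rw [not_or] at hy
        apply hi0
        rw [← hρY, ← Prod.mk.eta (p := i0 y), hρ.map_of_ne _ _ hy.1 hy.2]
      rw [hfix y hy, hfix]
      have hrot : R (i0 y) = rot N (i0 y) := hRne _ y.2.1 y.2.2
      have hne : rot N (i0 y) ≠ f ∧ rot N (i0 y) ≠ f' := by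
        rw [not_or] at hy
        constructor
        · intro e; exact hy.1 (congrArg Prod.fst e)
        · intro e; exact hy.2 (congrArg Prod.fst e)
      rw [hψ.apply_one hi0 (j := ⟨rot N (i0 y), hne⟩) hrot]
      exact hy
  have general : ∀ (Δ : RibbonGraph (n + 2) N) (δ : Equiv.Perm Y) (κ : Fin n → Y),
      Δ.leg 0 = f → Δ.leg 1 = f' → (∀ y, Δ.edge (i0 y) = i0 (δ y)) →
      (∀ l : Fin n, Δ.leg l.succ.succ = i0 (κ l)) →
      ((glue Δ).HasBoundary σ ↔ FirstReturn (ψ * δ) κ σ) := by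
    intro Δ δ κ g0 g1 hδ hκ
    have e1 : rot N * (glue Δ).edge = R * Δ.edge := by
      have c0 : Δ.edge f = f := by rw [← g0, Δ.edge_leg]
      have c1 : Δ.edge f' = f' := by rw [← g1, Δ.edge_leg]
      rw [glue_edge, g0, g1, hR, mul_assoc]
      congr 1
      rw [Equiv.mul_swap_eq_swap_mul, c0, c1]
    have e2 : ⇑(glue Δ).leg = i0 ∘ κ := funext hκ
    have hm : FirstReturn (R * Δ.edge) i0 (ψ * δ) := hψ.mul_of_marked hδ fun x hx => by
      rcases (hr0 x).1 hx with rfl | rfl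
      · rw [← g0, Δ.edge_leg]
      · rw [← g1, Δ.edge_leg]
    unfold HasBoundary
    rw [e1, e2, induces_iff]
    refine hm.comp_iff hi0 ?_
    intro l l' hll
    have : Δ.leg l.succ.succ = Δ.leg l'.succ.succ := by rw [hκ, hκ, hll]
    exact Fin.succ_injective _ (Fin.succ_injective _ (Δ.leg.injective this))
  have hY : ∀ l : Fin n, Γ.leg l.succ.succ ≠ f ∧ Γ.leg l.succ.succ ≠ f' := fun l =>
    ⟨by rw [← h0]; exact Γ.leg.injective.ne (succ_succ_ne_zero l),
      by rw [← h1]; exact Γ.leg.injective.ne (succ_succ_ne_one l)⟩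
  rw [general Γ γ (fun l => ⟨Γ.leg l.succ.succ, hY l⟩) h0 h1 hγ fun l => rfl,
    general (mapFlags ρ Γ) (ρY.permCongr γ) (ρY ∘ fun l => ⟨Γ.leg l.succ.succ, hY l⟩)
      (by rw [mapFlags_leg, h0, ρf]) (by rw [mapFlags_leg, h1, ρf']) ?_ ?_]
  · rw [← FirstReturn.congr_iff (π := ψ * γ) (τ := σ) ρY (Equiv.refl _)]
    refine Iff.of_eq ?_
    congr 1
    ext1 y
    simp only [Equiv.Perm.mul_apply, Equiv.permCongr_apply, ← hcomm]
  · intro y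
    rw [mapFlags_edge, Equiv.permCongr_apply, ← hρY, ← hγ]
    congr 2
    rw [Equiv.symm_apply_eq, hρY, Equiv.apply_symm_apply]
  · intro l
    rw [mapFlags_leg, Function.comp, ← hρY]

/-! ### The standard order of the flags -/

theorem idxOf_lt_iff {X : Type*} [BEq X] [LawfulBEq X] {L : List X} {v : X → ℕ}
    (hL : L.Pairwise fun x y => v x < v y) {x y : X} (hx : x ∈ L) (hy : y ∈ L) :
    L.idxOf x < L.idxOf y ↔ v x < v y := by
  have hx' := List.idxOf_lt_length_of_mem hx
  have hy' := List.idxOf_lt_length_of_mem hy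
  have key := List.pairwise_iff_getElem.1 hL
  have ex : L[L.idxOf x] = x := List.getElem_idxOf hx'
  have ey : L[L.idxOf y] = y := List.getElem_idxOf hy'
  constructor
  · intro h
    have := key _ _ hx' hy' h
    rwa [ex, ey] at this
  · intro h
    by_contra hlt
    rcases Nat.eq_or_lt_of_le (not_lt.1 hlt) with e | e
    · have : x = y := by
        have h2 : L[L.idxOf y] = L[L.idxOf x] := by simp only [e]
        rw [← ex, ← h2, ey]
      subst this
      exact lt_irrefl _ h
    · have := key _ _ hy' hx' e
      rw [ex, ey] at this
      omega

theorem vertexOrder_pairwise : (vertexOrder N).Pairwise fun x y => vpos x < vpos y := by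
  have : vertexOrder N = (List.finRange N).flatMap fun a => (List.finRange 3).map (Prod.mk a) := rfl
  rw [this, List.pairwise_flatMap]
  constructor
  · intro v _
    rw [List.pairwise_map]
    refine (List.pairwise_lt_finRange 3).imp ?_
    intro i j h
    simp only [vpos]
    omega
  · refine (List.pairwise_lt_finRange N).imp ?_
    intro v v' h x hx y hy
    simp only [List.mem_map] at hx hy
    obtain ⟨i, -, rfl⟩ := hx
    obtain ⟨j, -, rfl⟩ := hy
    have : (v : ℕ) < v' := h
    simp only [vpos]
    omega

theorem mem_vertexOrder (f : Flag N) : f ∈ vertexOrder N := by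
  have : vertexOrder N = (List.finRange N).flatMap fun a => (List.finRange 3).map (Prod.mk a) := rfl
  rw [this]
  simp only [List.mem_flatMap, List.mem_map]
  exact ⟨f.1, List.mem_finRange _, f.2, List.mem_finRange _, rfl⟩

theorem vertexOrder_idxOf_lt_iff (x y : Flag N) :
    (vertexOrder N).idxOf x < (vertexOrder N).idxOf y ↔ vpos x < vpos y :=
  idxOf_lt_iff vertexOrder_pairwise (mem_vertexOrder x) (mem_vertexOrder y)

theorem vertexOrder_nodup : (vertexOrder N).Nodup :=
  vertexOrder_pairwise.imp fun {x y} h e => by subst e; exact lt_irrefl _ h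

variable (Γ : RibbonGraph n N)

/-- The place of a flag in the order edge by edge, then leg by leg. -/
def ord (f : Flag N) : ℕ := Γ.edgeLegOrder.idxOf f

theorem isHead_edge_iff {f : Flag N} (hf : Γ.edge f ≠ f) :
    Γ.IsHead (Γ.edge f) ↔ ¬ Γ.IsHead f := by
  unfold IsHead
  rw [Γ.edge_edge, not_lt]
  refine ⟨le_of_lt, fun h => lt_of_le_of_ne h fun e => hf (toLex.injective e)⟩

theorem IsHead.ne {f : Flag N} (h : Γ.IsHead f) : Γ.edge f ≠ f := fun e => by
  unfold IsHead at h
  rw [e] at h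
  exact lt_irrefl _ h

open Classical in
/-- The chosen flags of the internal edges, in order. -/
def heads : List (Flag N) := (vertexOrder N).filter (fun f => Γ.IsHead f)

theorem mem_heads {f : Flag N} : f ∈ Γ.heads ↔ Γ.IsHead f := by
  simp [heads, mem_vertexOrder]

theorem edgeLegOrder_eq : Γ.edgeLegOrder =
    Γ.heads.flatMap (fun f => [f, Γ.edge f]) ++ List.ofFn Γ.leg := rfl

theorem mem_edgePart {f : Flag N} :
    f ∈ Γ.heads.flatMap (fun f => [f, Γ.edge f]) ↔ Γ.edge f ≠ f := by
  simp only [List.mem_flatMap, List.mem_cons, List.not_mem_nil, or_false, mem_heads]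
  constructor
  · rintro ⟨g, hg, rfl | rfl⟩
    · exact IsHead.ne Γ hg
    · rw [Γ.edge_edge]
      exact (IsHead.ne Γ hg).symm
  · intro hf
    by_cases h : Γ.IsHead f
    · exact ⟨f, h, Or.inl rfl⟩
    · exact ⟨Γ.edge f, (Γ.isHead_edge_iff hf).2 h, Or.inr (Γ.edge_edge f).symm⟩

theorem mem_legPart {f : Flag N} : f ∈ List.ofFn Γ.leg ↔ Γ.edge f = f := by
  rw [List.mem_ofFn, Γ.edge_eq_self_iff]

theorem mem_edgeLegOrder (f : Flag N) : f ∈ Γ.edgeLegOrder := by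
  rw [edgeLegOrder_eq, List.mem_append, mem_edgePart, mem_legPart]
  exact (em _).symm

theorem edgeLegOrder_nodup : Γ.edgeLegOrder.Nodup := by
  rw [edgeLegOrder_eq]
  refine List.Nodup.append ?_ (List.nodup_ofFn.2 Γ.leg.injective) ?_
  · rw [List.nodup_flatMap]
    refine ⟨fun f hf => ?_, ?_⟩
    · have := IsHead.ne Γ (Γ.mem_heads.1 hf)
      simp [this.symm]
    · refine List.Pairwise.imp_of_mem ?_ (vertexOrder_nodup.filter _ : Γ.heads.Nodup)
      intro x y hx hy hxy
      have hx := Γ.mem_heads.1 hx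
      have hy := Γ.mem_heads.1 hy
      have h1 : x ≠ Γ.edge y := by
        rintro rfl
        exact (Γ.isHead_edge_iff (IsHead.ne Γ hy)).1 hx hy
      have h2 : y ≠ Γ.edge x := by
        rintro rfl
        exact (Γ.isHead_edge_iff (IsHead.ne Γ hx)).1 hy hx
      simp [Function.onFun, hxy.symm, h1.symm, h2, Ne.symm]
  · intro f hf hf'
    exact (Γ.mem_edgePart.1 hf) (Γ.mem_legPart.1 hf')

theorem ord_injective : Function.Injective Γ.ord := fun x y h => by
  have := List.idxOf_inj (Γ.mem_edgeLegOrder x) |>.1 h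
  exact this

theorem ord_edge {f : Flag N} (hf : Γ.IsHead f) : Γ.ord (Γ.edge f) = Γ.ord f + 1 := by
  obtain ⟨l1, l2, hl⟩ := List.append_of_mem (Γ.mem_heads.2 hf)
  have hL : Γ.edgeLegOrder = l1.flatMap (fun f => [f, Γ.edge f]) ++
      (f :: Γ.edge f :: (l2.flatMap (fun f => [f, Γ.edge f]) ++ List.ofFn Γ.leg)) := by
    rw [edgeLegOrder_eq, hl]
    simp
  have hn := Γ.edgeLegOrder_nodup
  rw [hL, List.nodup_append] at hn
  have d1 : f ∉ l1.flatMap (fun f => [f, Γ.edge f]) := fun h => hn.2.2 _ h f (by simp) rfl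
  have d2 : Γ.edge f ∉ l1.flatMap (fun f => [f, Γ.edge f]) :=
    fun h => hn.2.2 _ h (Γ.edge f) (by simp) rfl
  unfold ord
  rw [hL, List.idxOf_append_of_notMem d1, List.idxOf_append_of_notMem d2, List.idxOf_cons_self,
    List.idxOf_cons_ne _ (IsHead.ne Γ hf).symm, List.idxOf_cons_self]

theorem ord_leg (l : Fin n) : Γ.ord (Γ.leg l) =
    (Γ.heads.flatMap (fun f => [f, Γ.edge f])).length + l := by
  unfold ord
  rw [edgeLegOrder_eq, List.idxOf_append_of_notMem fun h => (Γ.mem_edgePart.1 h) (Γ.edge_leg l)]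
  congr 1
  have := (List.nodup_ofFn.2 Γ.leg.injective).idxOf_getElem l (by simp)
  simpa using this

theorem ord_leg_strictMono : StrictMono (Γ.ord ∘ Γ.leg) := fun l l' h => by
  simp only [Function.comp, ord_leg]
  have : (l : ℕ) < l' := h
  omega

theorem ord_lt_leg {f : Flag N} (l : Fin n) (hf : Γ.edge f ≠ f) : Γ.ord f < Γ.ord (Γ.leg l) := by
  rw [ord_leg]
  unfold ord
  have h := Γ.mem_edgePart.2 hf
  rw [edgeLegOrder_eq, List.idxOf_append_of_mem h]
  have := List.idxOf_lt_length_of_mem h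
  omega

theorem ord_lt_edge_iff {f : Flag N} : Γ.ord f < Γ.ord (Γ.edge f) ↔ Γ.IsHead f := by
  constructor
  · intro h
    have hf : Γ.edge f ≠ f := fun e => by rw [e] at h; exact lt_irrefl _ h
    by_contra hh
    have := Γ.ord_edge ((Γ.isHead_edge_iff hf).2 hh)
    rw [Γ.edge_edge] at this
    omega
  · intro h
    rw [Γ.ord_edge h]
    omega

theorem ord_adapted : Γ.Adapted Γ.ord where
  inj := Γ.ord_injective
  contig f x h1 h2 := by
    have h1 := Γ.ord_injective.ne h1
    have h2 := Γ.ord_injective.ne h2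
    by_cases hf : Γ.edge f = f
    · rw [hf]
    · by_cases h : Γ.IsHead f
      · have := Γ.ord_edge h
        omega
      · have := Γ.ord_edge ((Γ.isHead_edge_iff hf).2 h)
        rw [Γ.edge_edge] at this
        omega

end RibbonGraph

/-! ### Weights of ribbon graphs and the cancellation of flipped edges. -/

section weight

variable {k J : Type*} [Field k] [Fintype J] {p : J → ZMod 2} {μ : J → J → J → k}
  {η : J → J → k} {n m N : ℕ}

variable (p μ η) in
/-- The contraction over a ribbon graph, the edges and legs standing in the standard order. -/
def weight (Γ : RibbonGraph n N) (w : (Fin n → J) → k) : k := contr p μ η Γ Γ.ord w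

theorem lt_iff_of_strictMono {X : Type*} {l : Fin n → X} {r r' : X → ℕ} (h : StrictMono (r ∘ l))
    (h' : StrictMono (r' ∘ l)) (i j : Fin n) : r (l i) < r (l j) ↔ r' (l i) < r' (l j) :=
  (h.lt_iff_lt (a := i) (b := j)).trans (h'.lt_iff_lt (a := i) (b := j)).symm

theorem contr_eq_weight (h : EvenTensors p μ η) (Γ : RibbonGraph n N) {r : Flag N → ℕ}
    (hr : Γ.Adapted r) (hm : StrictMono (r ∘ Γ.leg)) (w : (Fin n → J) → k) :
    contr p μ η Γ r w = weight p μ η Γ w :=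
  contr_adapted_of_leg h Γ hr Γ.ord_adapted (lt_iff_of_strictMono hm Γ.ord_leg_strictMono) w

theorem weight_mapFlags (h : EvenTensors p μ η) (Γ : RibbonGraph n N) {g : Equiv.Perm (Flag N)}
    (hg : ∀ f, g (rot N f) = rot N (g f)) (w : (Fin n → J) → k) :
    weight p μ η (mapFlags g Γ) w = weight p μ η Γ w := by
  have he : ∀ f, g (Γ.edge f) = (mapFlags g Γ).edge (g f) := by simp
  unfold weight
  rw [contr_iso h hg he (fun l => rfl) (mapFlags g Γ).ord_injective]
  exact contr_eq_weight h Γ (Adapted.comp_iso he (mapFlags g Γ).ord_adapted)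
    (mapFlags g Γ).ord_leg_strictMono w

/-- Renumbering affects only the places of the legs in the standard order, so the sign is the one in
`contr_adapted`. -/
theorem weight_relabel (h : EvenTensors p μ η) (e : Equiv.Perm (Fin n)) (Γ : RibbonGraph n N)
    (w : (Fin n → J) → k) :
    weight p μ η (relabel e Γ) w = weight p μ η Γ fun d =>
      chi k (kexp (fun i : Fin n => (i : ℕ)) (fun i => (e i : ℕ)) (p ∘ d)) *
        w (fun i => d (e.symm i)) := by
  set r := (relabel e Γ).ord with hr
  have hA : Γ.Adapted r := ⟨(relabel e Γ).ord_adapted.inj, (relabel e Γ).ord_adapted.contig⟩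
  have h1 : weight p μ η (relabel e Γ) w = contr p μ η Γ r fun d => w (fun i => d (e.symm i)) := rfl
  rw [h1, contr_adapted h Γ hA Γ.ord_adapted]
  unfold weight
  congr 1
  funext d
  congr 2
  rw [kexp_comm]
  refine kexp_congr (fun x y => ?_) (fun x y => ?_) _
  · exact (Γ.ord_leg_strictMono.lt_iff_lt (a := x) (b := y))
  · have := (relabel e Γ).ord_leg_strictMono.lt_iff_lt (a := e x) (b := e y)
    simpa using this

theorem exists_isFlip {v v' : Fin N} (h : v ≠ v') : ∃ ρ : Equiv.Perm (Flag N), IsFlip v v' ρ := by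
  refine ⟨Equiv.swap (v, 1) (v, 2) * Equiv.swap (v, 2) (v', 1) * Equiv.swap (v', 1) (v', 2),
    h, ?_, ?_, ?_, ?_, ?_, ?_⟩
  all_goals intros
  all_goals simp [Equiv.swap_apply_def, h, h.symm, *]

/-- Turning vertices does not change weights; this reduces any edge between different vertices to
one between flags at position `0`, the normal form in which flips are described. -/
theorem exists_twist (f f' : Flag N) (h : f.1 ≠ f'.1) : ∃ g : Equiv.Perm (Flag N),
    (∀ x, g (rot N x) = rot N (g x)) ∧ g f = (f.1, 0) ∧ g f' = (f'.1, 0) := by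
  obtain ⟨v, i⟩ := f
  obtain ⟨v', i'⟩ := f'
  refine ⟨Equiv.prodShear (Equiv.refl _)
    (fun u => if u = v then Equiv.addRight (-i) else if u = v' then Equiv.addRight (-i') else
      Equiv.refl _), ?_, ?_, ?_⟩
  · rintro ⟨u, j⟩
    rw [rot_apply]
    by_cases hu : u = v
    · subst hu
      simp [rot_apply, add_right_comm]
    · by_cases hu' : u = v'
      · subst hu'
        simp [rot_apply, hu, add_right_comm]
      · simp [rot_apply, hu, hu']
  · simp
  · have : v' ≠ v := fun e => h e.symm
    simp [this]

theorem contributes_mapFlags_iff {g : Equiv.Perm (Flag N)} (hg : ∀ f, g (rot N f) = rot N (g f))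
    {Γ : RibbonGraph n N} {σ : Equiv.Perm (Fin n)} :
    (mapFlags g Γ).Contributes σ ↔ Γ.Contributes σ :=
  and_congr (mapFlags_connected_iff hg) (mapFlags_hasBoundary_iff hg)

open Classical in
-- Graphs are grouped by the flags at which legs `0` and `1` sit. If these belong to the same
-- vertex, the glued edge is a loop and nothing contributes. Otherwise the vertices are turned into
-- normal position, and there the flip is a sign-reversing bijection.
theorem sum_weight_flip [CharZero k] (h : EvenTensors p μ η) {D : J → J → k}
    (hD : ∀ i j, D i j ≠ 0 → p i = p j + 1)
    (hK : ∀ a b c d, fourTensor p μ D d a b c = -fourTensor p μ D a b c d)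
    (σ : Equiv.Perm (Fin n)) (w : (Fin n → J) → k) :
    ∑ Γ : RibbonGraph (n + 2) N,
      (if (glue Γ).Contributes σ then weight p μ η Γ (insertTwo D w) else 0) = 0 := by
  set F : RibbonGraph (n + 2) N → k := fun Γ =>
    if (glue Γ).Contributes σ then weight p μ η Γ (insertTwo D w) else 0 with hF
  let S : Flag N → Flag N → k := fun f f' =>
    ∑ Γ with (Γ.leg 0, Γ.leg 1) = (f, f'), F Γ
  have move : ∀ (g : Equiv.Perm (Flag N)) (f f' : Flag N) (c : k),
      (∀ Γ : RibbonGraph (n + 2) N, Γ.leg 0 = f → Γ.leg 1 = f' → F Γ = c * F (mapFlags g Γ)) →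
      S f f' = c * S (g f) (g f') := by
    intro g f f' c hc
    rw [Finset.mul_sum]
    refine Finset.sum_equiv (mapFlagsEquiv g) (fun Γ => ?_) (fun Γ hΓ => ?_)
    · simp [mapFlagsEquiv]
    · simp only [Finset.mem_filter, Finset.mem_univ, true_and, Prod.mk.injEq] at hΓ
      exact hc Γ hΓ.1 hΓ.2
  have hS0 : ∀ v v' : Fin N, v ≠ v' → S (v, 0) (v', 0) = 0 := by
    intro v v' hv
    obtain ⟨ρ, hρ⟩ := exists_isFlip hv
    have := move ρ (v, 0) (v', 0) (-1) fun Γ h0 h1 => by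
      have hw : weight p μ η (mapFlags ρ Γ) (insertTwo D w) =
          -weight p μ η Γ (insertTwo D w) :=
        contr_flip h hD hK hρ h0 h1 (by simp) (fun l => rfl) Γ.ord_adapted
          (mapFlags ρ Γ).ord_adapted Γ.ord_leg_strictMono (mapFlags ρ Γ).ord_leg_strictMono w
      have hc : (glue (mapFlags ρ Γ)).Contributes σ ↔ (glue Γ).Contributes σ := by
        refine and_congr ?_ (flip_hasBoundary_iff hρ h0 h1)
        rw [glue_mapFlags]
        refine flip_connected_iff hρ ?_
        rw [← h0, ← h1, glue_edge_leg_zero]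
      simp only [hF, hc, hw]
      split_ifs <;> simp
    -- The flip fixes both ends of the edge, so it maps the group to itself and the sum is its own
    -- negative.
    rw [hρ.map_zero, hρ.map_zero, neg_one_mul, eq_neg_iff_add_eq_zero, ← two_mul] at this
    exact (mul_eq_zero.1 this).resolve_left two_ne_zero
  have hS : ∀ f f', S f f' = 0 := by
    intro f f'
    by_cases hv : f.1 = f'.1
    · refine Finset.sum_eq_zero fun Γ hΓ => ?_
      simp only [Finset.mem_filter, Finset.mem_univ, true_and, Prod.mk.injEq] at hΓ
      refine if_neg fun hc => not_glue_hasBoundary_of_loop (Γ := Γ) (σ := σ) ?_ hc.2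
      rw [hΓ.1, hΓ.2, hv]
    · obtain ⟨g, hg, h0, h1⟩ := exists_twist f f' hv
      rw [move g f f' 1 fun Γ _ _ => ?_, h0, h1, hS0 _ _ hv, mul_zero]
      simp only [hF, glue_mapFlags, contributes_mapFlags_iff hg, weight_mapFlags h Γ hg, one_mul]
  rw [← Finset.sum_fiberwise Finset.univ (fun Γ : RibbonGraph (n + 2) N => (Γ.leg 0, Γ.leg 1)) F]
  exact Finset.sum_eq_zero fun x _ => hS x.1 x.2

theorem edgeProd_glue (Γ : RibbonGraph (n + 2) N) (r : Flag N → ℕ)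
    (hr : r (Γ.leg 0) < r (Γ.leg 1)) (c : Flag N → J) :
    edgeProdErase η (glue Γ) r (Γ.leg 0) c = edgeProd η Γ r c := by
  classical
  unfold edgeProdErase edgeProd
  rw [← Finset.mul_prod_erase Finset.univ _ (Finset.mem_univ (Γ.leg 0)), Γ.edge_leg,
    if_neg (lt_irrefl _), one_mul]
  refine Finset.prod_congr (by congr) fun f hf => ?_
  by_cases h1 : f = Γ.leg 1
  · subst h1
    rw [glue_edge_leg_one, Γ.edge_leg, if_neg hr.not_gt, if_neg (lt_irrefl _)]
  · rw [glue_edge_of_ne _ (Finset.ne_of_mem_erase hf) h1]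

theorem glue_adapted {Γ : RibbonGraph (n + 2) N} {r : Flag N → ℕ} (hr : (glue Γ).Adapted r) :
    Γ.Adapted r where
  inj := hr.inj
  contig f x h1 h2 := by
    by_cases f0 : f = Γ.leg 0
    · subst f0; rw [Γ.edge_leg]
    · by_cases f1 : f = Γ.leg 1
      · subst f1; rw [Γ.edge_leg]
      · rw [← glue_edge_of_ne _ f0 f1] at h2 ⊢
        exact hr.contig f x h1 h2

/-- The new edge stands before all remaining legs, so only the order of its two ends is in question.
-/
theorem glue_ord_strictMono {Γ : RibbonGraph (n + 2) N}
    (h : (glue Γ).ord (Γ.leg 0) < (glue Γ).ord (Γ.leg 1)) :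
    StrictMono ((glue Γ).ord ∘ Γ.leg) := by
  have e0 : (glue Γ).edge (Γ.leg 0) ≠ Γ.leg 0 := by
    rw [glue_edge_leg_zero]; exact Γ.leg_zero_ne_one.symm
  have e1 : (glue Γ).edge (Γ.leg 1) ≠ Γ.leg 1 := by
    rw [glue_edge_leg_one]; exact Γ.leg_zero_ne_one
  intro l l'
  refine fin_cases_two (P := fun l => l < l' → ((glue Γ).ord ∘ Γ.leg) l < _) ?_ ?_ (fun l => ?_) l
  · refine fin_cases_two (P := fun l' => 0 < l' → _ < ((glue Γ).ord ∘ Γ.leg) l') ?_ ?_ (fun l' => ?_) l'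
    · exact fun h => absurd h (lt_irrefl _)
    · exact fun _ => h
    · exact fun _ => (glue Γ).ord_lt_leg l' e0
  · refine fin_cases_two (P := fun l' => 1 < l' → _ < ((glue Γ).ord ∘ Γ.leg) l') ?_ ?_ (fun l' => ?_) l'
    · exact fun h => absurd h (Fin.not_lt_zero _)
    · exact fun h => absurd h (lt_irrefl _)
    · exact fun _ => (glue Γ).ord_lt_leg l' e1
  · refine fin_cases_two (P := fun l' => l.succ.succ < l' → _ < ((glue Γ).ord ∘ Γ.leg) l') ?_ ?_
      (fun l' => ?_) l'
    · exact fun h => absurd h (Fin.not_lt_zero _)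
    · intro h
      have : (l.succ.succ : ℕ) < 1 := h
      simp at this
    · intro h
      exact (glue Γ).ord_leg_strictMono (Fin.succ_lt_succ_iff.1 (Fin.succ_lt_succ_iff.1 h))

theorem kexp_swap (q : Fin (n + 2) → ZMod 2) :
    kexp (fun i : Fin (n + 2) => (i : ℕ)) (fun i => (Equiv.swap 0 1 i : Fin (n + 2))) q =
      q 0 * q 1 := by
  unfold kexp
  rw [Finset.sum_eq_single 0, Finset.sum_eq_single 1]
  · simp
  · intro y _ hy
    refine if_neg ?_
    rintro ⟨h1, h2⟩
    have h0 : y ≠ 0 := by rintro rfl; simp at h1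
    dsimp only at h2
    rw [Equiv.swap_apply_of_ne_of_ne h0 hy] at h2
    simp only [Equiv.swap_apply_left, Fin.val_one] at h2
    exact h0 (Fin.ext (by rw [Fin.val_zero]; omega))
  · simp
  · intro x _ hx
    refine Finset.sum_eq_zero fun y _ => if_neg ?_
    rintro ⟨h1, h2⟩
    by_cases x1 : x = 1
    · subst x1
      simp at h2
    · dsimp only at h2
      rw [Equiv.swap_apply_of_ne_of_ne hx x1] at h2
      have y0 : y ≠ 0 := by rintro rfl; simp at h1
      by_cases y1 : y = 1
      · subst y1
        simp at h1
        exact hx h1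
      · rw [Equiv.swap_apply_of_ne_of_ne y0 y1] at h2
        dsimp only at h1
        omega
  · simp

theorem glue_relabel_swap (Γ : RibbonGraph (n + 2) N) :
    glue (relabel (Equiv.swap 0 1) Γ) = glue Γ := by
  refine ext' (fun f => ?_) fun l => ?_
  · simp [glue_edge, Equiv.swap_comm]
  · simp [Equiv.swap_apply_of_ne_of_ne (succ_succ_ne_zero l) (succ_succ_ne_one l)]

/-- The two letters have opposite parities, so exchanging them costs no sign. -/
theorem weight_insertTwo_swap (h : EvenTensors p μ η) {D : J → J → k}
    (hD : ∀ i j, D i j ≠ 0 → p i = p j + 1) (hs : ∀ i j, D i j = D j i)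
    (Γ : RibbonGraph (n + 2) N) (w : (Fin n → J) → k) :
    weight p μ η (relabel (Equiv.swap 0 1) Γ) (insertTwo D w) =
      weight p μ η Γ (insertTwo D w) := by
  rw [weight_relabel h]
  congr 1
  funext d
  rw [kexp_swap]
  have h2 : insertTwo D w (fun i => d ((Equiv.swap 0 1).symm i)) = insertTwo D w d := by
    unfold insertTwo
    rw [Equiv.symm_swap]
    dsimp only
    rw [Equiv.swap_apply_left, Equiv.swap_apply_right, hs]
    congr 2
  rw [h2]
  by_cases hd : D (d 0) (d 1) = 0
  · simp [insertTwo, hd]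
  · have := hD _ _ hd
    simp only [Function.comp]
    rw [this]
    have : ∀ a : ZMod 2, (a + 1) * a = 0 := by decide
    rw [this, chi_zero, one_mul]

open Classical in
-- By `contr_legAct` each internal edge is counted once, oriented by the standard order. By the
-- symmetry of `δ` both orientations contribute equally, whence the factor `2⁻¹` when all graphs
-- with two more legs are admitted.
theorem sum_weight_legAct [CharZero k] (h : EvenTensors p μ η) {ι δ : J → J → k}
    (hι : VertexDerivation p μ ι)
    (hδ : ∀ i j, δ i j = -((∑ a, ι i a * η a j) + chi k (p i) * ∑ a, ι j a * η i a))
    (hδo : ∀ i j, δ i j ≠ 0 → p i = p j + 1) (hδs : ∀ i j, δ i j = δ j i)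
    (σ : Equiv.Perm (Fin n)) (w : (Fin n → J) → k) :
    ∑ Γ : RibbonGraph n N, (if Γ.Contributes σ then weight p μ η Γ (legAct p ι w) else 0) =
      2⁻¹ * ∑ Γ : RibbonGraph (n + 2) N,
        (if (glue Γ).Contributes σ then weight p μ η Γ (insertTwo δ w) else 0) := by
  have hL : ∑ Γ : RibbonGraph n N, (if Γ.Contributes σ then weight p μ η Γ (legAct p ι w) else 0) =
      ∑ Γ : RibbonGraph (n + 2) N,
        (if (glue Γ).ord (Γ.leg 0) < (glue Γ).ord (Γ.leg 1) then
          (if (glue Γ).Contributes σ then weight p μ η Γ (insertTwo δ w) else 0) else 0) := by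
    let G : (Γ : RibbonGraph n N) → Flag N → k := fun Γ f =>
      if Γ.ord f < Γ.ord (Γ.edge f) then (if Γ.Contributes σ then
        ∑ c : Flag N → J, chi k (kexp Γ.ord vpos (p ∘ c)) * vertexProd μ c *
        (edgeProdErase η Γ Γ.ord f c * δ (c f) (c (Γ.edge f))) * w (c ∘ Γ.leg) else 0) else 0
    have h1 : ∀ Γ : RibbonGraph n N,
        (if Γ.Contributes σ then weight p μ η Γ (legAct p ι w) else 0) =
          ∑ f, if Γ.edge f ≠ f then G Γ f else 0 := by
      intro Γ
      by_cases hc : Γ.Contributes σ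
      · rw [if_pos hc]
        unfold weight
        rw [contr_legAct h hι hδ Γ Γ.ord_adapted Γ.ord_leg_strictMono
          (fun f l hf => Γ.ord_lt_leg l hf)]
        refine Finset.sum_congr rfl fun f _ => ?_
        simp only [G, if_pos hc]
        by_cases hf : Γ.edge f = f
        · simp [hf]
        · rw [if_pos hf]
      · simp [G, hc]
    rw [Finset.sum_congr rfl fun Γ _ => h1 Γ, sum_cut]
    refine Finset.sum_congr rfl fun Γ _ => ?_
    simp only [G, glue_edge_leg_zero]
    by_cases hlt : (glue Γ).ord (Γ.leg 0) < (glue Γ).ord (Γ.leg 1)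
    · rw [if_pos hlt, if_pos hlt]
      refine if_congr Iff.rfl ?_ rfl
      rw [← contr_eq_weight h Γ (glue_adapted (glue Γ).ord_adapted) (glue_ord_strictMono hlt)]
      unfold contr
      refine Finset.sum_congr rfl fun c _ => ?_
      rw [edgeProd_glue Γ _ hlt]
      unfold insertTwo
      simp only [Function.comp_def, glue_leg]
      ring
    · rw [if_neg hlt, if_neg hlt]
  rw [hL]
  set F : RibbonGraph (n + 2) N → k := fun Γ =>
    if (glue Γ).Contributes σ then weight p μ η Γ (insertTwo δ w) else 0 with hF
  -- Exchanging legs `0` and `1` reverses the orientation of the glued edge and keeps the weight.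
  have h2 : ∑ Γ : RibbonGraph (n + 2) N,
      (if (glue Γ).ord (Γ.leg 0) < (glue Γ).ord (Γ.leg 1) then F Γ else 0) =
      ∑ Γ : RibbonGraph (n + 2) N,
        (if (glue Γ).ord (Γ.leg 0) < (glue Γ).ord (Γ.leg 1) then 0 else F Γ) := by
    rw [← Equiv.sum_comp (relabelEquiv (Equiv.swap 0 1))]
    refine Finset.sum_congr rfl fun Γ _ => ?_
    have e1 : relabelEquiv (Equiv.swap 0 1) Γ = relabel (Equiv.swap 0 1) Γ := rfl
    have e2 : F (relabel (Equiv.swap 0 1) Γ) = F Γ := by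
      simp only [hF, glue_relabel_swap, weight_insertTwo_swap h hδo hδs]
    rw [e1, e2, glue_relabel_swap]
    simp only [relabel_leg, Equiv.symm_swap, Equiv.swap_apply_left, Equiv.swap_apply_right]
    have hne := (glue Γ).ord_injective.ne Γ.leg_zero_ne_one
    by_cases hlt : (glue Γ).ord (Γ.leg 0) < (glue Γ).ord (Γ.leg 1)
    · rw [if_pos hlt, if_neg hlt.not_gt]
    · rw [if_neg hlt, if_pos (by omega)]
  have h3 : ∑ Γ : RibbonGraph (n + 2) N, F Γ = 2 * ∑ Γ : RibbonGraph (n + 2) N,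
      (if (glue Γ).ord (Γ.leg 0) < (glue Γ).ord (Γ.leg 1) then F Γ else 0) := by
    rw [two_mul]
    nth_rewrite 2 [h2]
    rw [← Finset.sum_add_distrib]
    refine Finset.sum_congr rfl fun Γ _ => ?_
    split_ifs <;> simp
  rw [h3, ← mul_assoc, inv_mul_cancel₀ two_ne_zero, one_mul]

end weight

/-! ### Vertices, edges and automorphisms are counted. -/

section count

variable {n N : ℕ}

open Classical in
-- A flag is a head, the partner of a head, or a leg.
theorem RibbonGraph.three_mul_card (Γ : RibbonGraph n N) :
    3 * N = 2 * Nat.card {f // Γ.IsHead f} + n := by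
  have h1 : Nat.card {f // Γ.IsHead f} = ∑ f, if Γ.IsHead f then 1 else 0 := by
    rw [Nat.card_eq_fintype_card, Fintype.card_subtype, Finset.card_filter]
  have h2 : ∑ f, (if Γ.IsHead (Γ.edge f) then 1 else 0) = ∑ f, if Γ.IsHead f then 1 else 0 :=
    Equiv.sum_comp Γ.edge fun f => if Γ.IsHead f then 1 else 0
  have h3 : (∑ f, if Γ.edge f = f then 1 else 0) = n := by
    have := Γ.sum_fixed fun _ => (1 : ℕ)
    simpa using this
  have h4 : ∑ _f : Flag N, 1 = 3 * N := by simp [mul_comm]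
  have h5 : ∑ _f : Flag N, 1 = (∑ f, if Γ.IsHead f then 1 else 0) +
      (∑ f, if Γ.IsHead (Γ.edge f) then 1 else 0) + ∑ f, if Γ.edge f = f then 1 else 0 := by
    rw [← Finset.sum_add_distrib, ← Finset.sum_add_distrib]
    refine Finset.sum_congr rfl fun f _ => ?_
    by_cases hf : Γ.edge f = f
    · have : ¬ Γ.IsHead f := fun h => IsHead.ne Γ h hf
      simp [hf, this]
    · simp only [Γ.isHead_edge_iff hf, hf, if_false]
      by_cases h : Γ.IsHead f <;> simp [h]
  rw [h2, h3, h4, ← h1] at h5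
  omega

theorem RibbonGraph.one_sub_eulerChar_eq_iff (Γ : RibbonGraph n N) (h : ℕ) :
    1 - Γ.eulerChar = (h : ℤ) ↔ N + 2 = n + 2 * h := by
  have := Γ.three_mul_card
  unfold eulerChar
  omega

/-- A connected graph with `N` vertices has at least `N - 1` edges, and `3 * N` is the number of
legs plus twice the number of edges. The bound says that `1 - χ` is nonnegative, hence an admissible
exponent of `ħ`. -/
theorem RibbonGraph.Connected.legs_le {Γ : RibbonGraph n N} (h : Γ.Connected) : n ≤ N + 2 := by
  classical
  -- The adjacency graph of the vertices; it forgets loops and multiplicities, so it has at most as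
  -- many edges as `Γ`.
  let G : SimpleGraph (Fin N) :=
    { Adj := fun u v => u ≠ v ∧ ∃ f, f.1 = u ∧ (Γ.edge f).1 = v
      symm := ⟨by
        rintro u v ⟨huv, f, hf, hf'⟩
        exact ⟨huv.symm, Γ.edge f, hf', by rw [Γ.edge_edge, hf]⟩⟩
      loopless := ⟨fun u hu => hu.1 rfl⟩ }
  obtain ⟨h0, hC⟩ := connected_iff.1 h
  have hG : G.Connected := by
    have : Nonempty (Fin N) := ⟨⟨0, h0⟩⟩
    refine SimpleGraph.Connected.mk fun u v => ?_
    have hu : {x | G.Reachable u x} = Set.univ := by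
      refine hC _ ?_ ⟨u, SimpleGraph.Reachable.refl u⟩
      intro f hf
      by_cases hne : f.1 = (Γ.edge f).1
      · rw [← hne]; exact hf
      · exact SimpleGraph.Reachable.trans hf (SimpleGraph.Adj.reachable (G := G) ⟨hne, f, rfl, rfl⟩)
    have : v ∈ {x | G.Reachable u x} := by rw [hu]; exact Set.mem_univ v
    exact this
  have h1 := hG.card_vert_le_card_edgeSet_add_one
  have h2 : Nat.card G.edgeSet ≤ Nat.card {f // Γ.IsHead f} := by
    let e : {f // Γ.IsHead f} → Sym2 (Fin N) := fun f => s(f.1.1, (Γ.edge f.1).1)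
    have hsub : G.edgeSet ⊆ Set.range e := by
      intro x
      induction x using Sym2.ind with
      | _ u v =>
        rintro ⟨huv, f, rfl, rfl⟩
        have hne : Γ.edge f ≠ f := fun e => huv (by rw [e])
        by_cases hf : Γ.IsHead f
        · exact ⟨⟨f, hf⟩, rfl⟩
        · refine ⟨⟨Γ.edge f, (Γ.isHead_edge_iff hne).2 hf⟩, ?_⟩
          simp only [e, Γ.edge_edge]
          exact Sym2.eq_swap
    calc Nat.card G.edgeSet ≤ Nat.card (Set.range e) :=
          Nat.card_mono (Set.finite_range e) hsub
      _ ≤ Nat.card {f // Γ.IsHead f} := Finite.card_range_le e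
  have h3 := Γ.three_mul_card
  simp only [Nat.card_eq_fintype_card, Fintype.card_fin] at h1 h2 h3
  omega

/-- The symmetries of the cyclic orders at the vertices. -/
def vertexSymm (N : ℕ) : Type := {g : Equiv.Perm (Flag N) // ∀ f, g (rot N f) = rot N (g f)}

instance : Fintype (vertexSymm N) :=
  haveI : Finite (vertexSymm N) := Subtype.finite
  Fintype.ofFinite _

/-- A symmetry of the cyclic orders permutes the vertices and turns each of them. -/
def vertexSymmEquiv : vertexSymm N ≃ Equiv.Perm (Fin N) × (Fin N → Fin 3) where
  toFun g := (vertexPerm g.1 g.2, fun v => (g.1 (v, 0)).2)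
  invFun x := ⟨Equiv.prodShear x.1 fun v => Equiv.addLeft (x.2 v), by
    rintro ⟨v, i⟩
    simp [rot_apply, add_assoc]⟩
  left_inv g := by
    refine Subtype.ext (Equiv.ext ?_)
    rintro ⟨v, i⟩
    exact (commute_rot_apply g.2 v i).symm
  right_inv x := by
    refine Prod.ext (Equiv.ext fun v => ?_) (funext fun v => ?_)
    · rfl
    · simp

theorem card_vertexSymm : Fintype.card (vertexSymm N) = N.factorial * 3 ^ N := by
  rw [Fintype.card_congr vertexSymmEquiv, Fintype.card_prod, Fintype.card_perm, Fintype.card_fin,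
    Fintype.card_fun, Fintype.card_fin, Fintype.card_fin]

/-- An automorphism commutes with the boundary permutation and fixes the legs, and every boundary
cycle contains a leg. So it fixes every flag. -/
theorem RibbonGraph.HasBoundary.eq_one_of_mapFlags_eq {Γ : RibbonGraph n N}
    {σ : Equiv.Perm (Fin n)} (h : Γ.HasBoundary σ) {g : Equiv.Perm (Flag N)}
    (hg : ∀ f, g (rot N f) = rot N (g f)) (hΓ : mapFlags g Γ = Γ) : g = 1 := by
  have he : ∀ f, g (Γ.edge f) = Γ.edge (g f) := by
    intro f
    nth_rewrite 2 [← hΓ]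
    simp
  have hl : ∀ l, g (Γ.leg l) = Γ.leg l := by
    intro l
    nth_rewrite 2 [← hΓ]
    simp
  have hp : ∀ (r : ℕ) x, g (((rot N * Γ.edge) ^ r) x) = ((rot N * Γ.edge) ^ r) (g x) := by
    intro r
    induction r with
    | zero => intro x; simp
    | succ r ih => intro x; rw [pow_succ, Equiv.Perm.mul_apply, ih, Equiv.Perm.mul_apply,
        Equiv.Perm.mul_apply, Equiv.Perm.mul_apply, hg, he]
  ext1 x
  obtain ⟨i, r, rfl⟩ := h.1 x
  rw [hp, hl]
  rfl

variable {k : Type*} [Field k]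

open Classical in
/-- The sum over the ribbon graphs with `N` vertices which contribute to the cyclic words `σ`,
divided by the number of numberings. -/
def graphSum (σ : Equiv.Perm (Fin n)) (F : RibbonGraph n N → k) : k :=
  ((N.factorial * 3 ^ N : ℕ) : k)⁻¹ * ∑ Γ : RibbonGraph n N, if Γ.Contributes σ then F Γ else 0

instance : Finite (IsoClass n N) :=
  inferInstanceAs (Finite (Quotient (Setoid.mk Iso (iso_equivalence n N))))

instance : Fintype (IsoClass n N) := Fintype.ofFinite _

open Classical in
-- The isomorphism classes are the orbits of the symmetries of the cyclic orders. On contributing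
-- graphs the action is free, so each such orbit has `N! * 3 ^ N` elements.
theorem sum_isoClass [CharZero k] (σ : Equiv.Perm (Fin n)) {F : RibbonGraph n N → k}
    (hF : ∀ Γ Γ', Iso Γ Γ' → F Γ = F Γ') :
    ∑ c : IsoClass n N, (if (Quotient.out c).Contributes σ then F (Quotient.out c) else 0) =
      graphSum σ F := by
  have hN : ((N.factorial * 3 ^ N : ℕ) : k) ≠ 0 :=
    Nat.cast_ne_zero.2 (mul_ne_zero (Nat.factorial_ne_zero N) (by positivity))
  rw [graphSum, eq_inv_mul_iff_mul_eq₀ hN, Finset.mul_sum]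
  let cl : RibbonGraph n N → IsoClass n N := fun Γ => Quotient.mk _ Γ
  rw [← Finset.sum_fiberwise Finset.univ cl]
  refine Finset.sum_congr rfl fun c _ => ?_
  set Γ₀ : RibbonGraph n N := Quotient.out c with hΓ₀
  have hiso : ∀ Γ, cl Γ = c ↔ Iso Γ₀ Γ := by
    intro Γ
    have : c = cl Γ₀ := (Quotient.out_eq c).symm
    rw [this]
    exact ⟨fun h => Quotient.exact h.symm, fun h => (Quotient.sound h : cl Γ₀ = cl Γ).symm⟩
  have hcon : ∀ Γ, cl Γ = c → ((if Γ.Contributes σ then F Γ else 0) =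
      if Γ₀.Contributes σ then F Γ₀ else 0) := by
    intro Γ hΓ
    have hi := (hiso Γ).1 hΓ
    obtain ⟨g, hg, rfl⟩ := iso_iff.1 hi
    simp only [contributes_mapFlags_iff hg, hF _ _ hi]
  rw [Finset.sum_congr rfl fun Γ hΓ => hcon Γ (Finset.mem_filter.1 hΓ).2, Finset.sum_const,
    nsmul_eq_mul]
  by_cases hc : Γ₀.Contributes σ
  · rw [if_pos hc]
    congr 2
    rw [← card_vertexSymm, ← Finset.card_univ]
    refine Finset.card_bij (fun g _ => mapFlags g.1 Γ₀) (fun g _ => ?_) (fun g _ g' _ he => ?_)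
      fun Γ hΓ => ?_
    · simp only [Finset.mem_filter, Finset.mem_univ, true_and, hiso]
      exact iso_iff.2 ⟨g.1, g.2, rfl⟩
    · have h1 : mapFlags (g'.1⁻¹ * g.1) Γ₀ = Γ₀ := by
        rw [mapFlags_mul, he, ← mapFlags_mul]
        simp
      have h2 := hc.2.eq_one_of_mapFlags_eq (g := g'.1⁻¹ * g.1) (fun f => by
        rw [Equiv.Perm.mul_apply, Equiv.Perm.mul_apply, g.2]
        exact commute_rot_symm g'.2 _) h1
      exact Subtype.ext (inv_mul_eq_one.1 h2).symm
    · obtain ⟨g, hg, h⟩ := iso_iff.1 ((hiso Γ).1 (Finset.mem_filter.1 hΓ).2)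
      exact ⟨⟨g, hg⟩, Finset.mem_univ _, h⟩
  · simp [hc]

theorem exists_of_graphSum_ne_zero {σ : Equiv.Perm (Fin n)} {F : RibbonGraph n N → k}
    (h : graphSum σ F ≠ 0) : ∃ Γ : RibbonGraph n N, Γ.Contributes σ ∧ F Γ ≠ 0 := by
  classical
  by_contra! hc
  refine h ?_
  unfold graphSum
  rw [Finset.sum_eq_zero, mul_zero]
  intro Γ _
  split_ifs with h1
  · exact hc Γ h1
  · rfl

theorem exists_of_contributes {σ : Equiv.Perm (Fin n)} {Γ : RibbonGraph n N}
    (h : Γ.Contributes σ) : ∃ g : ℕ, N + 2 = n + 2 * g := by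
  have h1 := h.1.legs_le
  have h2 := Γ.three_mul_card
  exact ⟨(N + 2 - n) / 2, by omega⟩

theorem graphSum_eq_zero {σ : Equiv.Perm (Fin n)} {F : RibbonGraph n N → k}
    (h : ∀ g : ℕ, N + 2 ≠ n + 2 * g) : graphSum σ F = 0 := by
  by_contra hne
  obtain ⟨Γ, hΓ, -⟩ := exists_of_graphSum_ne_zero hne
  obtain ⟨g, hg⟩ := exists_of_contributes hΓ
  exact h g hg

/-- The power of `ħ` determines the number of vertices through `N + 2 = n + 2 * h`, so a single `N`
remains. The case distinction guards the truncated subtraction: for `n + 2 * h < 2` there is no such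
`N`. -/
theorem finsum_isoClass [CharZero k] (σ : Equiv.Perm (Fin n)) {F : ∀ N, RibbonGraph n N → k}
    (hF : ∀ N Γ Γ', Iso Γ Γ' → F N Γ = F N Γ') (h : ℕ) :
    (∑ᶠ (N : ℕ) (c : RibbonGraph.IsoClass n N)
      (_ : (Quotient.out c).Connected ∧ (Quotient.out c).HasBoundary σ ∧
        1 - (Quotient.out c).eulerChar = (h : ℤ)), F N (Quotient.out c)) =
      if 2 ≤ n + 2 * h then graphSum σ (F (n + 2 * h - 2)) else 0 := by
  classical
  have key : ∀ N, (∑ᶠ (c : RibbonGraph.IsoClass n N)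
      (_ : (Quotient.out c).Connected ∧ (Quotient.out c).HasBoundary σ ∧
        1 - (Quotient.out c).eulerChar = (h : ℤ)), F N (Quotient.out c)) =
      if N + 2 = n + 2 * h then graphSum σ (F N) else 0 := by
    intro N
    rw [finsum_eq_sum_of_fintype, ← sum_isoClass σ (hF N)]
    split_ifs with hN
    · refine Finset.sum_congr rfl fun c _ => ?_
      rw [finsum_eq_if]
      refine if_congr ?_ rfl rfl
      rw [one_sub_eulerChar_eq_iff]
      exact ⟨fun h => ⟨h.1, h.2.1⟩, fun h => ⟨h.1, h.2, hN⟩⟩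
    · refine Finset.sum_eq_zero fun c _ => ?_
      rw [finsum_eq_if, if_neg]
      rw [one_sub_eulerChar_eq_iff]
      exact fun h => hN h.2.2
  rw [finsum_congr key]
  split_ifs with h2
  · rw [finsum_eq_single _ (n + 2 * h - 2), if_pos (by omega)]
    intro N hN
    exact if_neg (by omega)
  · exact finsum_eq_zero_of_forall_eq_zero fun N => if_neg (by omega)

end count

/-! ### Disjoint unions of ribbon graphs. -/

namespace RibbonGraph

variable {n₁ n₂ m N₁ N₂ N : ℕ}

/-- The flags of a disjoint union. -/
def flagEquiv (eV : Fin N₁ ⊕ Fin N₂ ≃ Fin N) : Flag N₁ ⊕ Flag N₂ ≃ Flag N :=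
  (Equiv.sumProdDistrib _ _ _).symm.trans (eV.prodCongr (Equiv.refl _))

@[simp] theorem flagEquiv_inl (eV : Fin N₁ ⊕ Fin N₂ ≃ Fin N) (f : Flag N₁) :
    flagEquiv eV (Sum.inl f) = (eV (Sum.inl f.1), f.2) := rfl

@[simp] theorem flagEquiv_inr (eV : Fin N₁ ⊕ Fin N₂ ≃ Fin N) (f : Flag N₂) :
    flagEquiv eV (Sum.inr f) = (eV (Sum.inr f.1), f.2) := rfl

/-- The disjoint union of ribbon graphs. -/
def union (eL : Fin n₁ ⊕ Fin n₂ ≃ Fin m) (eV : Fin N₁ ⊕ Fin N₂ ≃ Fin N)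
    (Γ₁ : RibbonGraph n₁ N₁) (Γ₂ : RibbonGraph n₂ N₂) : RibbonGraph m N where
  edge := (flagEquiv eV).permCongr (Equiv.Perm.sumCongr Γ₁.edge Γ₂.edge)
  leg := eL.symm.toEmbedding.trans
    ((Function.Embedding.sumMap Γ₁.leg Γ₂.leg).trans (flagEquiv eV).toEmbedding)
  edge_edge f := by
    obtain ⟨f, rfl⟩ := (flagEquiv eV).surjective f
    cases f <;> simp [Equiv.permCongr_apply, Γ₁.edge_edge, Γ₂.edge_edge, -flagEquiv_inl,
      -flagEquiv_inr]
  edge_eq_self_iff f := by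
    obtain ⟨f, rfl⟩ := (flagEquiv eV).surjective f
    rw [Equiv.permCongr_apply, Equiv.symm_apply_apply, Equiv.apply_eq_iff_eq]
    rw [← eL.exists_congr_right]
    cases f <;> simp [Γ₁.edge_eq_self_iff, Γ₂.edge_eq_self_iff, -flagEquiv_inl, -flagEquiv_inr]

section
variable (eL : Fin n₁ ⊕ Fin n₂ ≃ Fin m) (eV : Fin N₁ ⊕ Fin N₂ ≃ Fin N)
    (Γ₁ : RibbonGraph n₁ N₁) (Γ₂ : RibbonGraph n₂ N₂)

theorem union_edge (f : Flag N₁ ⊕ Flag N₂) : (union eL eV Γ₁ Γ₂).edge (flagEquiv eV f) =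
    flagEquiv eV (Sum.map Γ₁.edge Γ₂.edge f) := by
  simp [union, Equiv.permCongr_apply]

theorem union_leg (l : Fin n₁ ⊕ Fin n₂) : (union eL eV Γ₁ Γ₂).leg (eL l) =
    flagEquiv eV (Sum.map Γ₁.leg Γ₂.leg l) := by
  simp [union]

/-- The boundary permutation preserves the two parts, so its first return splits by
`exists_sumCongr`. -/
theorem union_hasBoundary_iff {σ : Equiv.Perm (Fin m)} : (union eL eV Γ₁ Γ₂).HasBoundary σ ↔
    ∃ σ₁ σ₂, σ = eL.permCongr (Equiv.Perm.sumCongr σ₁ σ₂) ∧ Γ₁.HasBoundary σ₁ ∧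
      Γ₂.HasBoundary σ₂ := by
  have h1 : rot N * (union eL eV Γ₁ Γ₂).edge = (flagEquiv eV).permCongr
      (Equiv.Perm.sumCongr (rot N₁ * Γ₁.edge) (rot N₂ * Γ₂.edge)) := by
    ext1 f
    obtain ⟨f, rfl⟩ := (flagEquiv eV).surjective f
    rw [Equiv.Perm.mul_apply, union_edge, Equiv.permCongr_apply, Equiv.symm_apply_apply]
    cases f <;> rfl
  have h2 : ⇑(union eL eV Γ₁ Γ₂).leg = flagEquiv eV ∘ Sum.map Γ₁.leg Γ₂.leg ∘ eL.symm := by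
    funext l
    obtain ⟨l, rfl⟩ := eL.surjective l
    simp [union_leg]
  have h3 : (union eL eV Γ₁ Γ₂).HasBoundary σ ↔
      FirstReturn (Equiv.Perm.sumCongr (rot N₁ * Γ₁.edge) (rot N₂ * Γ₂.edge))
        (Sum.map Γ₁.leg Γ₂.leg) (eL.symm.permCongr σ) := by
    rw [← FirstReturn.congr_iff (flagEquiv eV) eL, ← h1, ← h2]
    unfold HasBoundary
    rw [induces_iff]
    refine Iff.of_eq ?_
    congr 1
    ext1 l
    simp [Equiv.permCongr_apply]
  rw [h3]
  constructor
  · intro h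
    obtain ⟨σ₁, σ₂, e, hσ₁, hσ₂⟩ := h.exists_sumCongr Γ₁.leg.injective Γ₂.leg.injective
    refine ⟨σ₁, σ₂, ?_, hσ₁, hσ₂⟩
    rw [← e]
    ext1 l
    simp [Equiv.permCongr_apply]
  · rintro ⟨σ₁, σ₂, rfl, hσ₁, hσ₂⟩
    have : eL.symm.permCongr (eL.permCongr (Equiv.Perm.sumCongr σ₁ σ₂)) =
        Equiv.Perm.sumCongr σ₁ σ₂ := by
      ext1 l
      simp [Equiv.permCongr_apply]
    rw [this]
    exact FirstReturn.sumCongr hσ₁ hσ₂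

theorem union_closed_iff {C : Set (Fin N)} : (union eL eV Γ₁ Γ₂).Closed C ↔
    Γ₁.Closed {v | eV (Sum.inl v) ∈ C} ∧ Γ₂.Closed {v | eV (Sum.inr v) ∈ C} := by
  unfold Closed
  rw [← (flagEquiv eV).forall_congr_right]
  simp only [union_edge, Sum.forall]
  exact Iff.rfl

variable {eL eV Γ₁ Γ₂}

theorem Connected.eq_empty_or_univ {n N : ℕ} {Γ : RibbonGraph n N} (h : Γ.Connected)
    {C : Set (Fin N)} (hC : Γ.Closed C) : C = ∅ ∨ C = Set.univ := by
  rcases C.eq_empty_or_nonempty with e | e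
  · exact Or.inl e
  · exact Or.inr ((connected_iff.1 h).2 C hC e)

/-- A closed set contains all or nothing of each connected part. This recovers the partition of the
vertices from the union. -/
theorem eq_range_of_closed_union (h₁ : Γ₁.Connected) (h₂ : Γ₂.Connected) {C : Set (Fin N)}
    (hC : (union eL eV Γ₁ Γ₂).Closed C) {v : Fin N₁} {v' : Fin N₂} (hv : eV (Sum.inl v) ∈ C)
    (hv' : eV (Sum.inr v') ∉ C) : C = Set.range fun v => eV (Sum.inl v) := by
  obtain ⟨c₁, c₂⟩ := (union_closed_iff eL eV Γ₁ Γ₂).1 hC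
  have e₁ := (h₁.eq_empty_or_univ c₁).resolve_left fun e => by
    have : v ∈ {v | eV (Sum.inl v) ∈ C} := hv
    rw [e] at this; exact this
  have e₂ := (h₂.eq_empty_or_univ c₂).resolve_right fun e => by
    have : v' ∈ {v | eV (Sum.inr v) ∈ C} := by rw [e]; exact Set.mem_univ _
    exact hv' this
  ext x
  obtain ⟨x, rfl⟩ := eV.surjective x
  cases x with
  | inl x =>
    have : x ∈ {v | eV (Sum.inl v) ∈ C} := by rw [e₁]; exact Set.mem_univ _
    exact ⟨fun _ => ⟨x, rfl⟩, fun _ => this⟩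
  | inr x =>
    refine ⟨fun h => ?_, ?_⟩
    · have : x ∈ {v | eV (Sum.inr v) ∈ C} := h
      rw [e₂] at this
      exact absurd this (Set.notMem_empty x)
    · rintro ⟨y, hy⟩
      exact absurd (eV.injective hy) (by simp)

theorem exists_union {Γ : RibbonGraph m N}
    (hΓ : Γ.Closed (Set.range fun v => eV (Sum.inl v)))
    (hL : ∀ l, (Γ.leg (eL l)).1 ∈ (Set.range fun v => eV (Sum.inl v)) ↔ l.isLeft) :
    ∃ Γ₁ Γ₂, union eL eV Γ₁ Γ₂ = Γ := by
  set C := Set.range fun v => eV (Sum.inl v) with hCdef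
  have hC : ∀ x : Flag N₁ ⊕ Flag N₂, (flagEquiv eV x).1 ∈ C ↔ x.isLeft := by
    rintro (x | x)
    · simp [hCdef]
    · simp [hCdef]
  -- No edge leaves the closed set of vertices, so `edge` is a block sum of two involutions.
  obtain ⟨⟨e₁, e₂⟩, he⟩ := Equiv.Perm.mem_sumCongrHom_range_of_perm_mapsTo_inl
    (σ := (flagEquiv eV).symm.permCongr Γ.edge) (by
      rintro _ ⟨f, rfl⟩
      have h1 := hΓ (flagEquiv eV (Sum.inl f)) ((hC _).2 rfl)
      obtain ⟨y, hy⟩ := (flagEquiv eV).surjective (Γ.edge (flagEquiv eV (Sum.inl f)))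
      rw [← hy, hC] at h1
      obtain ⟨y, rfl⟩ := Sum.isLeft_iff.1 h1
      exact ⟨y, by rw [Equiv.permCongr_apply, Equiv.symm_symm, ← hy, Equiv.symm_apply_apply]⟩)
  have he' : ∀ x, Γ.edge (flagEquiv eV x) = flagEquiv eV (Sum.map e₁ e₂ x) := by
    intro x
    have := congrArg (fun s : Equiv.Perm (Flag N₁ ⊕ Flag N₂) => flagEquiv eV (s x)) he
    simp only [Equiv.permCongr_apply, Equiv.symm_symm, Equiv.apply_symm_apply] at this
    rw [← this]
    rfl
  have l₁ : ∀ l : Fin n₁, ∃ f : Flag N₁, Γ.leg (eL (Sum.inl l)) = flagEquiv eV (Sum.inl f) := by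
    intro l
    have h1 := (hL (Sum.inl l)).2 rfl
    obtain ⟨y, hy⟩ := (flagEquiv eV).surjective (Γ.leg (eL (Sum.inl l)))
    rw [← hy, hC] at h1
    obtain ⟨y, rfl⟩ := Sum.isLeft_iff.1 h1
    exact ⟨y, hy.symm⟩
  have l₂ : ∀ l : Fin n₂, ∃ f : Flag N₂, Γ.leg (eL (Sum.inr l)) = flagEquiv eV (Sum.inr f) := by
    intro l
    have h1 := (hL (Sum.inr l)).not.2 (by simp)
    obtain ⟨y, hy⟩ := (flagEquiv eV).surjective (Γ.leg (eL (Sum.inr l)))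
    rw [← hy, hC] at h1
    obtain ⟨y, rfl⟩ := Sum.isRight_iff.1 (Sum.not_isLeft.1 h1)
    exact ⟨y, hy.symm⟩
  choose g₁ hg₁ using l₁
  choose g₂ hg₂ using l₂
  have hfix : ∀ x, Γ.edge (flagEquiv eV x) = flagEquiv eV x ↔
      ∃ l, flagEquiv eV (Sum.map g₁ g₂ l) = flagEquiv eV x := by
    intro x
    rw [Γ.edge_eq_self_iff, ← eL.exists_congr_right]
    refine exists_congr fun l => ?_
    cases l with
    | inl l => rw [hg₁]; rfl
    | inr l => rw [hg₂]; rfl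
  refine ⟨⟨e₁, ⟨g₁, fun l l' h => ?_⟩, fun f => ?_, fun f => ?_⟩,
    ⟨e₂, ⟨g₂, fun l l' h => ?_⟩, fun f => ?_, fun f => ?_⟩, ext' (fun x => ?_) fun l => ?_⟩
  · have : Γ.leg (eL (Sum.inl l)) = Γ.leg (eL (Sum.inl l')) := by rw [hg₁, hg₁, h]
    exact Sum.inl_injective (eL.injective (Γ.leg.injective this))
  · have := Γ.edge_edge (flagEquiv eV (Sum.inl f))
    rw [he', he'] at this
    exact Sum.inl_injective ((flagEquiv eV).injective this)
  · have := hfix (Sum.inl f)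
    rw [he'] at this
    exact (by simpa [-flagEquiv_inl, -flagEquiv_inr] using this : e₁ f = f ↔ ∃ l, g₁ l = f)
  · have : Γ.leg (eL (Sum.inr l)) = Γ.leg (eL (Sum.inr l')) := by rw [hg₂, hg₂, h]
    exact Sum.inr_injective (eL.injective (Γ.leg.injective this))
  · have := Γ.edge_edge (flagEquiv eV (Sum.inr f))
    rw [he', he'] at this
    exact Sum.inr_injective ((flagEquiv eV).injective this)
  · have := hfix (Sum.inr f)
    rw [he'] at this
    exact (by simpa [-flagEquiv_inl, -flagEquiv_inr] using this : e₂ f = f ↔ ∃ l, g₂ l = f)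
  · obtain ⟨x, rfl⟩ := (flagEquiv eV).surjective x
    rw [union_edge, he']
  · obtain ⟨l, rfl⟩ := eL.surjective l
    rw [union_leg]
    cases l with
    | inl l => rw [hg₁]; rfl
    | inr l => rw [hg₂]; rfl

theorem union_injective {Γ₁' : RibbonGraph n₁ N₁} {Γ₂' : RibbonGraph n₂ N₂}
    (h : union eL eV Γ₁ Γ₂ = union eL eV Γ₁' Γ₂') : Γ₁ = Γ₁' ∧ Γ₂ = Γ₂' := by
  have he : ∀ x, Sum.map Γ₁.edge Γ₂.edge x = Sum.map Γ₁'.edge Γ₂'.edge x := fun x =>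
    (flagEquiv eV).injective (by rw [← union_edge eL, h, union_edge])
  have hl : ∀ x, Sum.map Γ₁.leg Γ₂.leg x = Sum.map Γ₁'.leg Γ₂'.leg x := fun x =>
    (flagEquiv eV).injective (by rw [← union_leg eL, h, union_leg])
  exact ⟨ext' (fun f => Sum.inl_injective (he (Sum.inl f)))
      fun l => Sum.inl_injective (hl (Sum.inl l)),
    ext' (fun f => Sum.inr_injective (he (Sum.inr f)))
      fun l => Sum.inr_injective (hl (Sum.inr l))⟩

end

section glue

variable {n : ℕ} {eL : Fin n₁ ⊕ Fin n₂ ≃ Fin (n + 2)} {eV : Fin N₁ ⊕ Fin N₂ ≃ Fin N}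
  {Γ₁ : RibbonGraph n₁ N₁} {Γ₂ : RibbonGraph n₂ N₂} {l₁ : Fin n₁} {l₂ : Fin n₂}

theorem glue_union_connected_iff (h0 : eL (Sum.inl l₁) = 0) (h1 : eL (Sum.inr l₂) = 1) :
    (glue (union eL eV Γ₁ Γ₂)).Connected ↔ Γ₁.Connected ∧ Γ₂.Connected := by
  have e0 : ((union eL eV Γ₁ Γ₂).leg 0).1 = eV (Sum.inl (Γ₁.leg l₁).1) := by
    rw [← h0, union_leg]; rfl
  have e1 : ((union eL eV Γ₁ Γ₂).leg 1).1 = eV (Sum.inr (Γ₂.leg l₂).1) := by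
    rw [← h1, union_leg]; rfl
  have p₁ : 0 < N₁ := ((Γ₁.leg l₁).1).pos
  have p₂ : 0 < N₂ := ((Γ₂.leg l₂).1).pos
  constructor
  · intro h
    have hc := (connected_iff.1 h).2
    simp only [glue_closed_iff, union_closed_iff, e0, e1] at hc
    constructor
    · refine connected_iff.2 ⟨p₁, fun D hD hne => ?_⟩
      obtain ⟨d, hd⟩ := hne
      -- A closed set `D` of the first graph is completed by all or none of the vertices of the
      -- second, according to whether `D` contains the end of the glued edge. The result is closed
      -- in the glued graph.
      have key := hc {x | Sum.elim (· ∈ D) (fun _ => (Γ₁.leg l₁).1 ∈ D) (eV.symm x)}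
        ⟨⟨by simpa using hD, by simp [Closed]⟩, by simp⟩ ⟨eV (Sum.inl d), by simpa using hd⟩
      ext x
      have : eV (Sum.inl x) ∈ {x | Sum.elim (· ∈ D) (fun _ => (Γ₁.leg l₁).1 ∈ D) (eV.symm x)} := by
        rw [key]; exact Set.mem_univ _
      simpa using this
    · refine connected_iff.2 ⟨p₂, fun D hD hne => ?_⟩
      obtain ⟨d, hd⟩ := hne
      have key := hc {x | Sum.elim (fun _ => (Γ₂.leg l₂).1 ∈ D) (· ∈ D) (eV.symm x)}
        ⟨⟨by simp [Closed], by simpa using hD⟩, by simp⟩ ⟨eV (Sum.inr d), by simpa using hd⟩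
      ext x
      have : eV (Sum.inr x) ∈ {x | Sum.elim (fun _ => (Γ₂.leg l₂).1 ∈ D) (· ∈ D) (eV.symm x)} := by
        rw [key]; exact Set.mem_univ _
      simpa using this
  · rintro ⟨c₁, c₂⟩
    refine connected_iff.2 ⟨(eV (Sum.inl (Γ₁.leg l₁).1)).pos, fun C hC hne => ?_⟩
    rw [glue_closed_iff, union_closed_iff, e0, e1] at hC
    obtain ⟨⟨d₁, d₂⟩, h01⟩ := hC
    have i₁ : eV (Sum.inl (Γ₁.leg l₁).1) ∈ C ↔ (Γ₁.leg l₁).1 ∈ {v | eV (Sum.inl v) ∈ C} := Iff.rfl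
    have i₂ : eV (Sum.inr (Γ₂.leg l₂).1) ∈ C ↔ (Γ₂.leg l₂).1 ∈ {v | eV (Sum.inr v) ∈ C} := Iff.rfl
    rw [i₁, i₂] at h01
    obtain ⟨c, hc⟩ := hne
    obtain ⟨c, rfl⟩ := eV.surjective c
    have both : {v | eV (Sum.inl v) ∈ C} = Set.univ ∧ {v | eV (Sum.inr v) ∈ C} = Set.univ := by
      rcases c₁.eq_empty_or_univ d₁ with a | a <;> rcases c₂.eq_empty_or_univ d₂ with b | b
      · exfalso
        cases c with
        | inl c => have : c ∈ {v | eV (Sum.inl v) ∈ C} := hc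
                   rw [a] at this; exact this
        | inr c => have : c ∈ {v | eV (Sum.inr v) ∈ C} := hc
                   rw [b] at this; exact this
      · rw [a, b] at h01; simp at h01
      · rw [a, b] at h01; simp at h01
      · exact ⟨a, b⟩
    ext x
    obtain ⟨x, rfl⟩ := eV.surjective x
    refine ⟨fun _ => Set.mem_univ _, fun _ => ?_⟩
    cases x with
    | inl x => have : x ∈ {v | eV (Sum.inl v) ∈ C} := by rw [both.1]; exact Set.mem_univ x
               exact this
    | inr x => have : x ∈ {v | eV (Sum.inr v) ∈ C} := by rw [both.2]; exact Set.mem_univ x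
               exact this

theorem union_not_connected (l₁ : Fin n₁) (l₂ : Fin n₂) : ¬ (union eL eV Γ₁ Γ₂).Connected := by
  intro h
  have hc := (connected_iff.1 h).2 {x | (eV.symm x).isLeft} ((union_closed_iff _ _ _ _).2
    ⟨by simp [Closed], by simp [Closed]⟩) ⟨eV (Sum.inl (Γ₁.leg l₁).1), by simp⟩
  have : eV (Sum.inr (Γ₂.leg l₂).1) ∈ {x | (eV.symm x).isLeft} := by rw [hc]; exact Set.mem_univ _
  simp at this

end glue

/-! ### Graphs which become connected by gluing two legs -/

theorem blockEquiv_inl_mem {m : ℕ} (T : Finset (Fin m)) (i : Fin T.card) :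
    blockEquiv T (Sum.inl i) ∈ T := by
  simp [blockEquiv]

theorem blockEquiv_inr_notMem {m : ℕ} (T : Finset (Fin m)) (i : Fin Tᶜ.card) :
    blockEquiv T (Sum.inr i) ∉ T := by
  rw [← Finset.mem_compl]
  simp only [blockEquiv, finSumEquivOfFinset_inr]
  exact Finset.orderEmbOfFin_mem _ _ _

theorem blockEquiv_mem_iff {m : ℕ} (T : Finset (Fin m)) (x : Fin T.card ⊕ Fin Tᶜ.card) :
    blockEquiv T x ∈ T ↔ x.isLeft := by
  cases x with
  | inl x => simp [blockEquiv_inl_mem]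
  | inr x => simp [blockEquiv_inr_notMem]

theorem range_blockEquiv {m : ℕ} (T : Finset (Fin m)) :
    (Set.range fun i => blockEquiv T (Sum.inl i)) = T := by
  ext x
  obtain ⟨x, rfl⟩ := (blockEquiv T).surjective x
  rw [Finset.mem_coe, blockEquiv_mem_iff]
  cases x <;> simp

open Classical in
-- If gluing makes the graph connected, it had exactly two components, separated by legs `0` and
-- `1`. Taking `V` and `T` to be the vertices and the legs of the component of leg `0` makes the
-- presentation as a disjoint union unique.
theorem sum_not_connected {M : Type*} [AddCommMonoid M] {n : ℕ} (σ : Equiv.Perm (Fin n))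
    (F : RibbonGraph (n + 2) N → M) :
    ∑ Γ : RibbonGraph (n + 2) N,
      (if (glue Γ).Contributes σ ∧ ¬ Γ.Connected then F Γ else 0) =
    ∑ T : Finset (Fin (n + 2)), if 0 ∈ T ∧ 1 ∉ T then
      ∑ V : Finset (Fin N), ∑ Γ₁ : RibbonGraph T.card V.card, ∑ Γ₂ : RibbonGraph Tᶜ.card Vᶜ.card,
        (if (glue (union (blockEquiv T) (blockEquiv V) Γ₁ Γ₂)).Contributes σ then
          F (union (blockEquiv T) (blockEquiv V) Γ₁ Γ₂) else 0) else 0 := by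
  let I := Σ T : Finset (Fin (n + 2)), Σ V : Finset (Fin N),
    RibbonGraph T.card V.card × RibbonGraph Tᶜ.card Vᶜ.card
  let u : I → RibbonGraph (n + 2) N := fun x =>
    union (blockEquiv x.1) (blockEquiv x.2.1) x.2.2.1 x.2.2.2
  have hR : (∑ T : Finset (Fin (n + 2)), if 0 ∈ T ∧ 1 ∉ T then
      ∑ V : Finset (Fin N), ∑ Γ₁ : RibbonGraph T.card V.card, ∑ Γ₂ : RibbonGraph Tᶜ.card Vᶜ.card,
        (if (glue (union (blockEquiv T) (blockEquiv V) Γ₁ Γ₂)).Contributes σ then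
          F (union (blockEquiv T) (blockEquiv V) Γ₁ Γ₂) else 0) else 0) =
      ∑ x : I, if (0 ∈ x.1 ∧ 1 ∉ x.1) ∧ (glue (u x)).Contributes σ then F (u x) else 0 := by
    rw [Fintype.sum_sigma]
    refine Finset.sum_congr rfl fun T _ => ?_
    rw [Fintype.sum_sigma]
    simp only [Fintype.sum_prod_type]
    split_ifs with hT
    · refine Finset.sum_congr rfl fun V _ => Finset.sum_congr rfl fun Γ₁ _ =>
        Finset.sum_congr rfl fun Γ₂ _ => ?_
      exact if_congr ⟨fun h => ⟨hT, h⟩, fun h => h.2⟩ rfl rfl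
    · symm
      refine Finset.sum_eq_zero fun V _ => Finset.sum_eq_zero fun Γ₁ _ =>
        Finset.sum_eq_zero fun Γ₂ _ => if_neg fun h => hT h.1
  rw [hR, ← Finset.sum_filter, ← Finset.sum_filter]
  symm
  have legs : ∀ x : I, 0 ∈ x.1 ∧ 1 ∉ x.1 → ∃ (l₁ : Fin x.1.card) (l₂ : Fin x.1ᶜ.card),
      blockEquiv x.1 (Sum.inl l₁) = 0 ∧ blockEquiv x.1 (Sum.inr l₂) = 1 := by
    rintro x ⟨h0, h1⟩
    obtain ⟨y0, e0⟩ := (blockEquiv x.1).surjective 0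
    obtain ⟨y1, e1⟩ := (blockEquiv x.1).surjective 1
    rw [← e0, blockEquiv_mem_iff] at h0
    rw [← e1, blockEquiv_mem_iff] at h1
    obtain ⟨l₁, rfl⟩ := Sum.isLeft_iff.1 h0
    obtain ⟨l₂, rfl⟩ := Sum.isRight_iff.1 (Sum.not_isLeft.1 h1)
    exact ⟨l₁, l₂, e0, e1⟩
  refine Finset.sum_bij (fun x _ => u x) (fun x hx => ?_) (fun x hx y hy hxy => ?_)
    (fun Γ hΓ => ?_) fun x _ => rfl
  · simp only [Finset.mem_filter, Finset.mem_univ, true_and] at hx ⊢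
    obtain ⟨l₁, l₂, -, -⟩ := legs x hx.1
    exact ⟨hx.2, union_not_connected l₁ l₂⟩
  · simp only [Finset.mem_filter, Finset.mem_univ, true_and] at hx hy
    obtain ⟨l₁, l₂, a0, a1⟩ := legs x hx.1
    obtain ⟨l₁', l₂', b0, b1⟩ := legs y hy.1
    obtain ⟨T, V, Γ₁, Γ₂⟩ := x
    obtain ⟨T', V', Γ₁', Γ₂'⟩ := y
    simp only at hxy a0 a1 b0 b1
    have hcon := (glue_union_connected_iff a0 a1).1 hx.2.1
    have hux : u ⟨T, V, Γ₁, Γ₂⟩ = union (blockEquiv T) (blockEquiv V) Γ₁ Γ₂ := rfl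
    have huy : u ⟨T', V', Γ₁', Γ₂'⟩ = union (blockEquiv T') (blockEquiv V') Γ₁' Γ₂' := rfl
    have hside : ∀ (T : Finset (Fin (n + 2))) (V : Finset (Fin N)) (Γ₁ : RibbonGraph T.card V.card)
        (Γ₂ : RibbonGraph Tᶜ.card Vᶜ.card) (l : Fin (n + 2)),
        ((union (blockEquiv T) (blockEquiv V) Γ₁ Γ₂).leg l).1 ∈ V ↔ l ∈ T := by
      intro T V Γ₁ Γ₂ l
      obtain ⟨l, rfl⟩ := (blockEquiv T).surjective l
      rw [union_leg, blockEquiv_mem_iff]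
      cases l <;> simp [blockEquiv_mem_iff]
    -- `V'` is closed and separates the first two legs, so it is the component of leg `0`.
    have hVV : V' = V := by
      have hcl : (union (blockEquiv T) (blockEquiv V) Γ₁ Γ₂).Closed (V' : Set (Fin N)) := by
        rw [← hux, hxy, huy, union_closed_iff]
        constructor
        · intro f _; exact blockEquiv_inl_mem _ _
        · intro f hf; exact absurd hf (blockEquiv_inr_notMem _ _)
      have := eq_range_of_closed_union hcon.1 hcon.2 hcl (v := (Γ₁.leg l₁).1)
        (v' := (Γ₂.leg l₂).1) ?_ ?_
      · rw [range_blockEquiv] at this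
        exact Finset.coe_injective this
      · have := (hside T' V' Γ₁' Γ₂' 0).2 hy.1.1
        rw [← huy, ← hxy, hux, ← a0, union_leg] at this
        exact this
      · have := (hside T' V' Γ₁' Γ₂' 1).not.2 hy.1.2
        rw [← huy, ← hxy, hux, ← a1, union_leg] at this
        exact this
    subst hVV
    have hTT : T' = T := by
      ext l
      rw [← hside T' V' Γ₁' Γ₂' l, ← huy, ← hxy, hux, hside]
    subst hTT
    obtain ⟨rfl, rfl⟩ := union_injective hxy
    rfl
  · simp only [Finset.mem_filter, Finset.mem_univ, true_and] at hΓ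
    obtain ⟨hc, hn⟩ := hΓ
    have hcon := connected_iff.1 hc.1
    -- A closed set that witnesses disconnectedness must separate the two legs, as otherwise it
    -- would be closed in the glued graph. If it contains leg `1`, its complement is taken.
    obtain ⟨C, hC, h0, h1⟩ : ∃ C : Set (Fin N), Γ.Closed C ∧ (Γ.leg 0).1 ∈ C ∧ (Γ.leg 1).1 ∉ C := by
      rw [connected_iff] at hn
      push Not at hn
      obtain ⟨C, hC, hne, hu⟩ := hn hcon.1
      by_cases h0 : (Γ.leg 0).1 ∈ C <;> by_cases h1 : (Γ.leg 1).1 ∈ C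
      · exact absurd (hcon.2 C (glue_closed_iff.2 ⟨hC, by simp [h0, h1]⟩) hne) hu
      · exact ⟨C, hC, h0, h1⟩
      · exact ⟨Cᶜ, hC.compl, h0, fun h => h h1⟩
      · exact absurd (hcon.2 C (glue_closed_iff.2 ⟨hC, by simp [h0, h1]⟩) hne) hu
    let V : Finset (Fin N) := Finset.univ.filter (· ∈ C)
    let T : Finset (Fin (n + 2)) := Finset.univ.filter fun l => (Γ.leg l).1 ∈ C
    have hV : (V : Set (Fin N)) = C := by ext; simp [V]
    obtain ⟨Γ₁, Γ₂, hU⟩ := exists_union (eL := blockEquiv T) (eV := blockEquiv V) (Γ := Γ)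
      (by rw [range_blockEquiv, hV]; exact hC)
      (fun l => by rw [range_blockEquiv, hV, ← blockEquiv_mem_iff T]; simp [T])
    refine ⟨⟨T, V, Γ₁, Γ₂⟩, ?_, hU⟩
    simp only [Finset.mem_filter, Finset.mem_univ, true_and]
    refine ⟨⟨by simpa [T] using h0, by simpa [T] using h1⟩, ?_⟩
    have : u ⟨T, V, Γ₁, Γ₂⟩ = Γ := hU
    rw [this]
    exact hc

end RibbonGraph

theorem kexp_sum {X Y : Type*} [Fintype X] [Fintype Y] {r s : X ⊕ Y → ℕ}
    (hr : ∀ x y, r (Sum.inl x) < r (Sum.inr y)) (hs : ∀ x y, s (Sum.inl x) < s (Sum.inr y))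
    (q : X ⊕ Y → ZMod 2) : kexp r s q = kexp (r ∘ Sum.inl) (s ∘ Sum.inl) (q ∘ Sum.inl) +
      kexp (r ∘ Sum.inr) (s ∘ Sum.inr) (q ∘ Sum.inr) := by
  unfold kexp
  rw [Fintype.sum_sum_type]
  simp only [Fintype.sum_sum_type]
  congr 1
  · refine Finset.sum_congr rfl fun x _ => ?_
    have : ∑ y : Y, (if r (Sum.inl x) < r (Sum.inr y) ∧ s (Sum.inr y) < s (Sum.inl x) then
        q (Sum.inl x) * q (Sum.inr y) else 0) = 0 :=
      Finset.sum_eq_zero fun y _ => if_neg fun h => absurd (hs x y) h.2.not_gt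
    rw [this, add_zero]
    rfl
  · refine Finset.sum_congr rfl fun y _ => ?_
    have : ∑ x : X, (if r (Sum.inr y) < r (Sum.inl x) ∧ s (Sum.inl x) < s (Sum.inr y) then
        q (Sum.inr y) * q (Sum.inl x) else 0) = 0 :=
      Finset.sum_eq_zero fun x _ => if_neg fun h => absurd (hr x y) h.1.not_gt
    rw [this, zero_add]
    rfl

/-! ### The weight of a disjoint union. -/

section union

variable {k J : Type*} [Field k] [Fintype J] {p : J → ZMod 2} {μ : J → J → J → k}
  {η : J → J → k} {n₁ n₂ m N₁ N₂ N : ℕ}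

variable (p) in
/-- The function `w` of `n` letters as a function of two blocks of letters, with the Koszul sign of
moving the second block behind the first. -/
def shuffle (eL : Fin n₁ ⊕ Fin n₂ ≃ Fin m) (w : (Fin m → J) → k) (d₁ : Fin n₁ → J)
    (d₂ : Fin n₂ → J) : k :=
  chi k (kexp (fun i : Fin m => (i : ℕ)) (fun i : Fin m => (finSumFinEquiv (eL.symm i) : ℕ))
    (p ∘ Sum.elim d₁ d₂ ∘ eL.symm)) * w (Sum.elim d₁ d₂ ∘ eL.symm)

theorem vertexProd_union (eV : Fin N₁ ⊕ Fin N₂ ≃ Fin N) (c : Flag N → J) :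
    vertexProd μ c = vertexProd μ (fun f => c (flagEquiv eV (Sum.inl f))) *
      vertexProd μ (fun f => c (flagEquiv eV (Sum.inr f))) := by
  unfold vertexProd
  rw [← eV.prod_comp, Fintype.prod_sum_type]
  rfl

theorem kexp_flagEquiv (h : EvenTensors p μ η) (eV : Fin N₁ ⊕ Fin N₂ ≃ Fin N)
    {r₁ : Flag N₁ → ℕ} {r₂ : Flag N₂ → ℕ} (h₁ : r₁.Injective) (h₂ : r₂.Injective) {M : ℕ}
    (hM : ∀ f, r₁ f < M) {c : Flag N → J} (hc : vertexProd μ c ≠ 0) :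
    kexp (Sum.elim r₁ (fun f => M + r₂ f) ∘ (flagEquiv eV).symm) vpos (p ∘ c) =
      kexp r₁ vpos (p ∘ fun f => c (flagEquiv eV (Sum.inl f))) +
        kexp r₂ vpos (p ∘ fun f => c (flagEquiv eV (Sum.inr f))) := by
  -- `s` lists the vertices of the first graph and then those of the second. Passing from it to
  -- `vpos` moves whole vertices, which is free.
  set s : Flag N₁ ⊕ Flag N₂ → ℕ := Sum.elim vpos (fun f => 3 * N₁ + vpos f) with hs
  have hlt : ∀ f : Flag N₁, vpos f < 3 * N₁ := by
    rintro ⟨v, i⟩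
    have := v.2
    have := i.2
    simp only [vpos]
    omega
  have inj : ∀ {r₁ : Flag N₁ → ℕ} {r₂ : Flag N₂ → ℕ} {M : ℕ}, r₁.Injective → r₂.Injective →
      (∀ f, r₁ f < M) → Function.Injective (Sum.elim r₁ fun f => M + r₂ f) := by
    intro r₁ r₂ M h₁ h₂ hM
    refine Function.Injective.sumElim h₁ (fun a b hab => h₂ (Nat.add_left_cancel hab)) ?_
    intro a b hab
    have := hM a
    omega
  have hsi : Function.Injective s := inj vpos_injective vpos_injective hlt
  have hri : Function.Injective (Sum.elim r₁ fun f => M + r₂ f) := inj h₁ h₂ hM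
  rw [kexp_trans (hri.comp (flagEquiv eV).symm.injective)
    (hsi.comp (flagEquiv eV).symm.injective) vpos_injective,
    kexp_vertex (hsi.comp (flagEquiv eV).symm.injective) vpos_injective ?_ vpos_contig _
      (vertex_even_of_vertexProd_ne_zero h c hc), Finset.sum_eq_zero, add_zero]
  · rw [← kexp_comp (flagEquiv eV)]
    have e : ∀ g : Flag N₁ ⊕ Flag N₂ → ℕ, (g ∘ (flagEquiv eV).symm) ∘ flagEquiv eV = g := by
      intro g
      funext x
      simp
    rw [e, e, kexp_sum]
    · congr 1
      exact kexp_congr (fun x y => by simp) (fun x y => by simp [hs]) _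
    · intro x y
      have := hM x
      simp only [Sum.elim_inl, Sum.elim_inr]
      omega
    · intro x y
      have := hlt x
      simp only [hs, Sum.elim_inl, Sum.elim_inr]
      omega
  · intro v _
    obtain ⟨v, rfl⟩ := eV.surjective v
    refine Finset.sum_eq_zero fun i _ => Finset.sum_eq_zero fun j _ => if_neg ?_
    cases v with
    | inl v =>
      have e : ∀ i : Fin 3, (eV (Sum.inl v), i) = flagEquiv eV (Sum.inl (v, i)) := fun _ => rfl
      simp only [e, Function.comp, Equiv.symm_apply_apply, hs, Sum.elim_inl]
      rw [← e, ← e]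
      simp only [vpos]
      omega
    | inr v =>
      have e : ∀ i : Fin 3, (eV (Sum.inr v), i) = flagEquiv eV (Sum.inr (v, i)) := fun _ => rfl
      simp only [e, Function.comp, Equiv.symm_apply_apply, hs, Sum.elim_inr]
      rw [← e, ← e]
      simp only [vpos]
      omega
  · intro x v i j hx
    obtain ⟨x, rfl⟩ := (flagEquiv eV).surjective x
    obtain ⟨v, rfl⟩ := eV.surjective v
    have e₁ : ∀ (v : Fin N₁) (i : Fin 3), (eV (Sum.inl v), i) = flagEquiv eV (Sum.inl (v, i)) :=
      fun _ _ => rfl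
    have e₂ : ∀ (v : Fin N₂) (i : Fin 3), (eV (Sum.inr v), i) = flagEquiv eV (Sum.inr (v, i)) :=
      fun _ _ => rfl
    cases v with
    | inl v =>
      rw [e₁, e₁]
      simp only [Function.comp, Equiv.symm_apply_apply, hs]
      cases x with
      | inl x =>
        refine vpos_contig x v i j fun e => hx ?_
        rw [← e]; rfl
      | inr x =>
        have := hlt (v, i)
        have := hlt (v, j)
        simp only [Sum.elim_inl, Sum.elim_inr]
        omega
    | inr v =>
      rw [e₂, e₂]
      simp only [Function.comp, Equiv.symm_apply_apply, hs]
      cases x with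
      | inl x =>
        have := hlt x
        simp only [Sum.elim_inl, Sum.elim_inr]
        omega
      | inr x =>
        have := vpos_contig x v i j fun e => hx (by rw [← e]; rfl)
        simp only [Sum.elim_inr]
        omega

/-- Listing all flags of the first graph before those of the second gives an adapted order, in which
the contraction factorises; passing to it costs only the shuffle sign of the legs. -/
theorem weight_union (h : EvenTensors p μ η) (eL : Fin n₁ ⊕ Fin n₂ ≃ Fin m)
    (eV : Fin N₁ ⊕ Fin N₂ ≃ Fin N) (Γ₁ : RibbonGraph n₁ N₁) (Γ₂ : RibbonGraph n₂ N₂)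
    (w : (Fin m → J) → k) :
    weight p μ η (union eL eV Γ₁ Γ₂) w =
      weight p μ η Γ₁ fun d₁ => weight p μ η Γ₂ (shuffle p eL w d₁) := by
  set U := union eL eV Γ₁ Γ₂ with hU
  -- `M` exceeds every place in the first order, so shifting by `M` puts the second graph behind the
  -- first.
  set M : ℕ := ∑ f, Γ₁.ord f + 1 with hM
  have hlt : ∀ f, Γ₁.ord f < M := fun f =>
    Nat.lt_succ_of_le (Finset.single_le_sum (f := Γ₁.ord) (fun _ _ => Nat.zero_le _)
      (Finset.mem_univ f))
  set R : Flag N₁ ⊕ Flag N₂ → ℕ := Sum.elim Γ₁.ord fun f => M + Γ₂.ord f with hR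
  set r : Flag N → ℕ := R ∘ (flagEquiv eV).symm with hr
  have hrf : ∀ x, r (flagEquiv eV x) = R x := fun x => by simp [hr]
  have hRi : Function.Injective R := by
    refine Function.Injective.sumElim Γ₁.ord_injective
      (fun a b hab => Γ₂.ord_injective (Nat.add_left_cancel hab)) ?_
    intro a b hab
    have := hlt a
    omega
  have hA : U.Adapted r := by
    refine ⟨hRi.comp (flagEquiv eV).symm.injective, fun f x h1 h2 => ?_⟩
    obtain ⟨f, rfl⟩ := (flagEquiv eV).surjective f
    obtain ⟨x, rfl⟩ := (flagEquiv eV).surjective x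
    rw [hU, union_edge] at h2 ⊢
    rw [hrf, hrf, hrf]
    have h1 : x ≠ f := fun e => h1 (by rw [e])
    have h2 : x ≠ Sum.map Γ₁.edge Γ₂.edge f := fun e => h2 (by rw [e])
    cases x with
    | inl x =>
      cases f with
      | inl f => exact Γ₁.ord_adapted.contig f x (fun e => h1 (by rw [e])) fun e => h2 (by rw [e]; rfl)
      | inr f =>
        have := hlt x
        simp only [hR, Sum.map_inr, Sum.elim_inl, Sum.elim_inr]
        omega
    | inr x =>
      cases f with
      | inl f =>
        have := hlt f
        have := hlt (Γ₁.edge f)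
        simp only [hR, Sum.map_inl, Sum.elim_inl, Sum.elim_inr]
        omega
      | inr f =>
        have := Γ₂.ord_adapted.contig f x (fun e => h1 (by rw [e])) fun e => h2 (by rw [e]; rfl)
        simp only [hR, Sum.map_inr, Sum.elim_inr]
        omega
  have hleg : ∀ d : Fin m → J, kexp (U.ord ∘ U.leg) (r ∘ U.leg) (p ∘ d) =
      kexp (fun i : Fin m => (i : ℕ)) (fun i : Fin m => (finSumFinEquiv (eL.symm i) : ℕ)) (p ∘ d) := by
    intro d
    refine kexp_congr (fun x y => U.ord_leg_strictMono.lt_iff_lt) (fun x y => ?_) _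
    obtain ⟨x, rfl⟩ := eL.surjective x
    obtain ⟨y, rfl⟩ := eL.surjective y
    simp only [Function.comp, hU, union_leg, hrf, Equiv.symm_apply_apply]
    cases x with
    | inl x =>
      cases y with
      | inl y => simpa [hR] using Γ₁.ord_leg_strictMono.lt_iff_lt (a := x) (b := y)
      | inr y =>
        have := hlt (Γ₁.leg x)
        have := x.2
        simp only [hR, Sum.map_inl, Sum.map_inr, Sum.elim_inl, Sum.elim_inr,
          finSumFinEquiv_apply_left, finSumFinEquiv_apply_right, Fin.val_castAdd, Fin.val_natAdd]
        omega
    | inr x =>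
      cases y with
      | inl y =>
        have := hlt (Γ₁.leg y)
        have := y.2
        simp only [hR, Sum.map_inl, Sum.map_inr, Sum.elim_inl, Sum.elim_inr,
          finSumFinEquiv_apply_left, finSumFinEquiv_apply_right, Fin.val_castAdd, Fin.val_natAdd]
        omega
      | inr y => simpa [hR] using Γ₂.ord_leg_strictMono.lt_iff_lt (a := x) (b := y)
  have hedge : ∀ c : Flag N → J, edgeProd η U r c =
      edgeProd η Γ₁ Γ₁.ord (fun f => c (flagEquiv eV (Sum.inl f))) *
        edgeProd η Γ₂ Γ₂.ord (fun f => c (flagEquiv eV (Sum.inr f))) := by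
    intro c
    unfold edgeProd
    rw [← (flagEquiv eV).prod_comp, Fintype.prod_sum_type]
    simp only [hU, union_edge, hrf]
    congr 1
    refine Finset.prod_congr rfl fun f _ => ?_
    refine if_congr ?_ rfl rfl
    simp [hR]
  unfold weight
  rw [contr_adapted h U U.ord_adapted hA]
  unfold contr
  simp only [Finset.mul_sum]
  rw [← Fintype.sum_prod_type']
  refine Fintype.sum_equiv (((flagEquiv eV).arrowCongr (Equiv.refl J)).symm.trans
    (Equiv.sumArrowEquivProdArrow _ _ _)) _ _ fun c => ?_
  have hd : Sum.elim ((fun f => c (flagEquiv eV (Sum.inl f))) ∘ Γ₁.leg)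
      ((fun f => c (flagEquiv eV (Sum.inr f))) ∘ Γ₂.leg) ∘ eL.symm = c ∘ U.leg := by
    funext l
    obtain ⟨l, rfl⟩ := eL.surjective l
    simp only [Function.comp, Equiv.symm_apply_apply, hU, union_leg]
    cases l <;> rfl
  change _ = chi k (kexp Γ₁.ord vpos (p ∘ fun f => c (flagEquiv eV (Sum.inl f)))) *
    vertexProd μ (fun f => c (flagEquiv eV (Sum.inl f))) *
    edgeProd η Γ₁ Γ₁.ord (fun f => c (flagEquiv eV (Sum.inl f))) *
    (chi k (kexp Γ₂.ord vpos (p ∘ fun f => c (flagEquiv eV (Sum.inr f)))) *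
    vertexProd μ (fun f => c (flagEquiv eV (Sum.inr f))) *
    edgeProd η Γ₂ Γ₂.ord (fun f => c (flagEquiv eV (Sum.inr f))) *
    shuffle p eL w ((fun f => c (flagEquiv eV (Sum.inl f))) ∘ Γ₁.leg)
      ((fun f => c (flagEquiv eV (Sum.inr f))) ∘ Γ₂.leg))
  unfold shuffle
  rw [hd, hleg, hedge]
  by_cases hc : vertexProd μ c = 0
  · have h0 := hc
    rw [vertexProd_union eV] at h0
    rw [hc]
    linear_combination (-(chi k (kexp Γ₁.ord vpos (p ∘ fun f => c (flagEquiv eV (Sum.inl f)))) *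
      edgeProd η Γ₁ Γ₁.ord (fun f => c (flagEquiv eV (Sum.inl f))) *
      chi k (kexp Γ₂.ord vpos (p ∘ fun f => c (flagEquiv eV (Sum.inr f)))) *
      edgeProd η Γ₂ Γ₂.ord (fun f => c (flagEquiv eV (Sum.inr f))) *
      (chi k (kexp (fun i : Fin m => (i : ℕ)) (fun i : Fin m => (finSumFinEquiv (eL.symm i) : ℕ))
        (p ∘ c ∘ U.leg)) * w (c ∘ U.leg)))) * h0
  · rw [hr, hR, kexp_flagEquiv h eV Γ₁.ord_injective Γ₂.ord_injective hlt hc, chi_add,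
      vertexProd_union eV c]
    ring

end union

/-! ### Sums over graphs with two glued legs, split by connectedness. -/

section glueSum

theorem sum_ite_of_unique {X M : Type*} [Fintype X] [AddCommMonoid M] (P : X → Prop)
    [DecidablePred P] [Decidable (∃ x, P x)] (hu : ∀ x y, P x → P y → x = y) (a : M) :
    ∑ x, (if P x then a else 0) = if ∃ x, P x then a else 0 := by
  split_ifs with h
  · obtain ⟨x, hx⟩ := h
    rw [Finset.sum_eq_single x (fun y _ hy => if_neg fun h => hy (hu _ _ h hx)) (by simp), if_pos hx]
  · exact Finset.sum_eq_zero fun x _ => if_neg fun hx => h ⟨x, hx⟩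

variable {k : Type*} [Field k]

/-- The binomial coefficient that counts the vertex sets of a given size converts the normalisation
for `N` vertices into the product of those of the two components. -/
theorem sum_card_card_compl [CharZero k] (N : ℕ) (f : ℕ → ℕ → k) :
    ((N.factorial * 3 ^ N : ℕ) : k)⁻¹ * ∑ V : Finset (Fin N), f V.card Vᶜ.card =
      ∑ x ∈ Finset.HasAntidiagonal.antidiagonal N, (((x.1.factorial * 3 ^ x.1 : ℕ) : k)⁻¹ *
        ((x.2.factorial * 3 ^ x.2 : ℕ) : k)⁻¹) * f x.1 x.2 := by
  have h1 : ∑ V : Finset (Fin N), f V.card Vᶜ.card =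
      ∑ j ∈ Finset.range (N + 1), N.choose j • f j (N - j) := by
    have := Finset.sum_powerset_apply_card (x := (Finset.univ : Finset (Fin N)))
      (fun j => f j (N - j))
    rw [Finset.card_univ, Fintype.card_fin, Finset.powerset_univ] at this
    rw [← this]
    refine Finset.sum_congr rfl fun V _ => ?_
    rw [Finset.card_compl, Fintype.card_fin]
  rw [h1, Finset.Nat.sum_antidiagonal_eq_sum_range_succ (fun a b =>
    (((a.factorial * 3 ^ a : ℕ) : k)⁻¹ * ((b.factorial * 3 ^ b : ℕ) : k)⁻¹) * f a b),
    Finset.mul_sum]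
  refine Finset.sum_congr rfl fun j hj => ?_
  have hj : j ≤ N := Nat.lt_succ_iff.1 (Finset.mem_range.1 hj)
  have hfac := Nat.choose_mul_factorial_mul_factorial hj
  have hpow : (3 : ℕ) ^ N = 3 ^ j * 3 ^ (N - j) := by rw [← pow_add, Nat.add_sub_cancel' hj]
  have e1 : ((j.factorial * 3 ^ j : ℕ) : k) ≠ 0 :=
    Nat.cast_ne_zero.2 (mul_ne_zero (Nat.factorial_ne_zero _) (by positivity))
  have e2 : (((N - j).factorial * 3 ^ (N - j) : ℕ) : k) ≠ 0 :=
    Nat.cast_ne_zero.2 (mul_ne_zero (Nat.factorial_ne_zero _) (by positivity))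
  have e3 : ((N.factorial * 3 ^ N : ℕ) : k) ≠ 0 :=
    Nat.cast_ne_zero.2 (mul_ne_zero (Nat.factorial_ne_zero _) (by positivity))
  have e4 : ((N.factorial * 3 ^ N : ℕ) : k) = (N.choose j : k) * (j.factorial * 3 ^ j : ℕ) *
      ((N - j).factorial * 3 ^ (N - j) : ℕ) := by
    rw [hpow, ← hfac]
    push_cast
    ring
  rw [nsmul_eq_mul]
  field_simp
  rw [e4]
  ring

variable {J : Type*} [Fintype J] {p : J → ZMod 2} {μ : J → J → J → k}
  {η : J → J → k} {n N : ℕ}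

theorem RibbonGraph.Connected.glue {Γ : RibbonGraph (n + 2) N} (h : Γ.Connected) :
    (glue Γ).Connected := by
  rw [connected_iff] at h ⊢
  exact ⟨h.1, fun C hC => h.2 C (glue_closed_iff.1 hC).1⟩

open Classical in
-- The boundary words before gluing exist by `glue_hasBoundary_iff` and are unique, so the sum over
-- `σ'` counts each graph once.
theorem sum_glue_connected (σ : Equiv.Perm (Fin n)) (F : RibbonGraph (n + 2) N → k) :
    ∑ Γ : RibbonGraph (n + 2) N, (if (glue Γ).Contributes σ ∧ Γ.Connected then F Γ else 0) =
      ∑ σ' : Equiv.Perm (Fin (n + 2)), if GluesTo σ' σ then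
        ∑ Γ : RibbonGraph (n + 2) N, (if Γ.Contributes σ' then F Γ else 0) else 0 := by
  have : ∀ σ' : Equiv.Perm (Fin (n + 2)), (if GluesTo σ' σ then
        ∑ Γ : RibbonGraph (n + 2) N, (if Γ.Contributes σ' then F Γ else 0) else 0) =
      ∑ Γ : RibbonGraph (n + 2) N,
        (if GluesTo σ' σ ∧ Γ.Contributes σ' then F Γ else 0) := by
    intro σ'
    split_ifs with h
    · simp [h]
    · simp [h]
  rw [Finset.sum_congr rfl fun σ' _ => this σ', Finset.sum_comm]
  refine Finset.sum_congr rfl fun Γ _ => ?_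
  rw [sum_ite_of_unique _ fun σ₁ σ₂ h₁ h₂ => h₁.2.2.unique h₂.2.2]
  refine if_congr ?_ rfl rfl
  unfold Contributes
  rw [glue_hasBoundary_iff]
  constructor
  · rintro ⟨⟨-, σ', h1, h2⟩, hc⟩
    exact ⟨σ', h2, hc, h1⟩
  · rintro ⟨σ', h2, hc, h1⟩
    exact ⟨⟨hc.glue, σ', h1, h2⟩, hc⟩

theorem glue_union_contributes_iff {n₁ n₂ N₁ N₂ : ℕ} {eL : Fin n₁ ⊕ Fin n₂ ≃ Fin (n + 2)}
    (eV : Fin N₁ ⊕ Fin N₂ ≃ Fin N) {Γ₁ : RibbonGraph n₁ N₁} {Γ₂ : RibbonGraph n₂ N₂}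
    {l₁ : Fin n₁} {l₂ : Fin n₂} (h0 : eL (Sum.inl l₁) = 0) (h1 : eL (Sum.inr l₂) = 1)
    {σ : Equiv.Perm (Fin n)} : (glue (union eL eV Γ₁ Γ₂)).Contributes σ ↔
      ∃ x : Equiv.Perm (Fin n₁) × Equiv.Perm (Fin n₂),
        GluesTo (eL.permCongr (Equiv.Perm.sumCongr x.1 x.2)) σ ∧ Γ₁.Contributes x.1 ∧
          Γ₂.Contributes x.2 := by
  unfold Contributes
  rw [glue_union_connected_iff h0 h1, glue_hasBoundary_iff]
  simp only [union_hasBoundary_iff]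
  constructor
  · rintro ⟨⟨c₁, c₂⟩, σ', ⟨σ₁, σ₂, rfl, b₁, b₂⟩, hg⟩
    exact ⟨(σ₁, σ₂), hg, ⟨c₁, b₁⟩, ⟨c₂, b₂⟩⟩
  · rintro ⟨⟨σ₁, σ₂⟩, hg, ⟨c₁, b₁⟩, ⟨c₂, b₂⟩⟩
    exact ⟨⟨c₁, c₂⟩, _, ⟨σ₁, σ₂, rfl, b₁, b₂⟩, hg⟩

open Classical in
/-- Gluing two legs of a graph: either the graph is connected, or it has two components. -/
theorem sum_glue [CharZero k] (h : EvenTensors p μ η) (σ : Equiv.Perm (Fin n))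
    (w : (Fin (n + 2) → J) → k) :
    ((N.factorial * 3 ^ N : ℕ) : k)⁻¹ * ∑ Γ : RibbonGraph (n + 2) N,
        (if (glue Γ).Contributes σ then weight p μ η Γ w else 0) =
      (∑ σ' : Equiv.Perm (Fin (n + 2)), if GluesTo σ' σ then
        graphSum σ' (fun Γ : RibbonGraph (n + 2) N => weight p μ η Γ w) else 0) +
      ∑ T : Finset (Fin (n + 2)), if 0 ∈ T ∧ 1 ∉ T then
        ∑ σ₁ : Equiv.Perm (Fin T.card), ∑ σ₂ : Equiv.Perm (Fin Tᶜ.card),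
          if GluesTo ((blockEquiv T).permCongr (Equiv.Perm.sumCongr σ₁ σ₂)) σ then
            ∑ x ∈ Finset.HasAntidiagonal.antidiagonal N,
              graphSum σ₁ (fun Γ₁ : RibbonGraph T.card x.1 =>
                graphSum σ₂ fun Γ₂ : RibbonGraph Tᶜ.card x.2 => weight p μ η Γ₁ fun d₁ =>
                  weight p μ η Γ₂ (shuffle p (blockEquiv T) w d₁)) else 0 else 0 := by
  have hsplit : ∑ Γ : RibbonGraph (n + 2) N,
      (if (glue Γ).Contributes σ then weight p μ η Γ w else 0) =
      (∑ Γ : RibbonGraph (n + 2) N,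
        (if (glue Γ).Contributes σ ∧ Γ.Connected then weight p μ η Γ w else 0)) +
      ∑ Γ : RibbonGraph (n + 2) N,
        (if (glue Γ).Contributes σ ∧ ¬ Γ.Connected then weight p μ η Γ w else 0) := by
    rw [← Finset.sum_add_distrib]
    refine Finset.sum_congr rfl fun Γ _ => ?_
    by_cases hc : Γ.Connected <;> simp [hc]
  rw [hsplit, mul_add, sum_glue_connected, sum_not_connected]
  congr 1
  · rw [Finset.mul_sum]
    refine Finset.sum_congr rfl fun σ' _ => ?_
    split_ifs
    · rfl
    · rw [mul_zero]
  · rw [Finset.mul_sum]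
    refine Finset.sum_congr rfl fun T _ => ?_
    split_ifs with hT
    swap
    · rw [mul_zero]
    obtain ⟨y0, e0⟩ := (blockEquiv T).surjective 0
    obtain ⟨y1, e1⟩ := (blockEquiv T).surjective 1
    have h0 := hT.1
    have h1 := hT.2
    rw [← e0, blockEquiv_mem_iff] at h0
    rw [← e1, blockEquiv_mem_iff] at h1
    obtain ⟨l₁, rfl⟩ := Sum.isLeft_iff.1 h0
    obtain ⟨l₂, rfl⟩ := Sum.isRight_iff.1 (Sum.not_isLeft.1 h1)
    let Φ : Equiv.Perm (Fin T.card) → Equiv.Perm (Fin Tᶜ.card) → ℕ → ℕ → k := fun σ₁ σ₂ N₁ N₂ =>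
      ∑ Γ₁ : RibbonGraph T.card N₁, ∑ Γ₂ : RibbonGraph Tᶜ.card N₂,
        if Γ₁.Contributes σ₁ ∧ Γ₂.Contributes σ₂ then weight p μ η Γ₁ fun d₁ =>
          weight p μ η Γ₂ (shuffle p (blockEquiv T) w d₁) else 0
    have hV : ∀ V : Finset (Fin N), (∑ Γ₁ : RibbonGraph T.card V.card,
        ∑ Γ₂ : RibbonGraph Tᶜ.card Vᶜ.card,
        (if (glue (union (blockEquiv T) (blockEquiv V) Γ₁ Γ₂)).Contributes σ then
          weight p μ η (union (blockEquiv T) (blockEquiv V) Γ₁ Γ₂) w else 0)) =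
        ∑ σ₁, ∑ σ₂, if GluesTo ((blockEquiv T).permCongr (Equiv.Perm.sumCongr σ₁ σ₂)) σ then
          Φ σ₁ σ₂ V.card Vᶜ.card else 0 := by
      intro V
      have hprod := Fintype.sum_prod_type' fun (σ₁ : Equiv.Perm (Fin T.card))
        (σ₂ : Equiv.Perm (Fin Tᶜ.card)) =>
        if GluesTo ((blockEquiv T).permCongr (Equiv.Perm.sumCongr σ₁ σ₂)) σ then
          Φ σ₁ σ₂ V.card Vᶜ.card else (0 : k)
      rw [← hprod]
      have : ∀ x : Equiv.Perm (Fin T.card) × Equiv.Perm (Fin Tᶜ.card),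
          (if GluesTo ((blockEquiv T).permCongr (Equiv.Perm.sumCongr x.1 x.2)) σ then
            Φ x.1 x.2 V.card Vᶜ.card else 0) = ∑ Γ₁ : RibbonGraph T.card V.card,
            ∑ Γ₂ : RibbonGraph Tᶜ.card Vᶜ.card,
            if GluesTo ((blockEquiv T).permCongr (Equiv.Perm.sumCongr x.1 x.2)) σ ∧
              Γ₁.Contributes x.1 ∧ Γ₂.Contributes x.2 then weight p μ η Γ₁ fun d₁ =>
              weight p μ η Γ₂ (shuffle p (blockEquiv T) w d₁) else 0 := by
        intro x
        split_ifs with hx <;> simp [hx, Φ]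
      refine Eq.trans ?_ (Finset.sum_congr rfl fun x _ => (this x).symm)
      refine Eq.trans ?_ Finset.sum_comm
      refine Finset.sum_congr rfl fun Γ₁ _ => ?_
      refine Eq.trans ?_ Finset.sum_comm
      refine Finset.sum_congr rfl fun Γ₂ _ => ?_
      rw [sum_ite_of_unique _ fun x y hx hy => Prod.ext (hx.2.1.2.unique hy.2.1.2)
        (hx.2.2.2.unique hy.2.2.2), weight_union h]
      exact if_congr (glue_union_contributes_iff _ e0 e1) rfl rfl
    rw [Finset.sum_congr rfl fun V _ => hV V, Finset.sum_comm, Finset.mul_sum]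
    refine Finset.sum_congr rfl fun σ₁ _ => ?_
    rw [Finset.sum_comm, Finset.mul_sum]
    refine Finset.sum_congr rfl fun σ₂ _ => ?_
    split_ifs with hg
    swap
    · simp
    rw [sum_card_card_compl]
    refine Finset.sum_congr rfl fun x _ => ?_
    unfold graphSum
    rw [mul_assoc]
    congr 1
    rw [Finset.mul_sum]
    refine Finset.sum_congr rfl fun Γ₁ _ => ?_
    split_ifs with hc
    · simp [hc]
    · simp [hc]

end glueSum

/-! ### The inverse tensor of a bilinear form -/

section casimir

variable {k U : Type*} [Field k] [AddCommGroup U] [Module k U] [FiniteDimensional k U]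
  {β : LinearMap.BilinForm k U}

/-- The inverse tensor of a bilinear form, evaluated on two linear functionals. -/
def casimir (β : LinearMap.BilinForm k U) (f g : U →ₗ[k] k) : k :=
  ∑ t, f (Module.finBasis k U t) * g (dualVec β t)

theorem gram_isUnit_det (hn : β.Nondegenerate) : IsUnit (Matrix.of fun i j =>
    β (Module.finBasis k U i) (Module.finBasis k U j)).det := by
  have : (Matrix.of fun i j => β (Module.finBasis k U i) (Module.finBasis k U j)) =
      LinearMap.BilinForm.toMatrix (Module.finBasis k U) β := by
    ext i j
    rw [LinearMap.BilinForm.toMatrix_apply, Matrix.of_apply]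
  rw [this, isUnit_iff_ne_zero]
  exact (LinearMap.BilinForm.nondegenerate_iff_det_ne_zero _).1 hn

theorem form_dualVec (hn : β.Nondegenerate) (i l : Fin (Module.finrank k U)) :
    β (dualVec β i) (Module.finBasis k U l) = if i = l then 1 else 0 := by
  have h := Matrix.nonsing_inv_mul _ (gram_isUnit_det hn)
  have h2 := congrFun (congrFun h i) l
  rw [Matrix.mul_apply, Matrix.one_apply] at h2
  unfold dualVec
  rw [map_sum, LinearMap.sum_apply, ← h2]
  refine Finset.sum_congr rfl fun j _ => ?_
  simp

theorem casimir_comm (hs : β.IsSymm) (f g : U →ₗ[k] k) : casimir β f g = casimir β g f := by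
  set G := Matrix.of fun i j => β (Module.finBasis k U i) (Module.finBasis k U j) with hG
  have hT : G.transpose = G := by
    ext i j
    simp only [hG, Matrix.transpose_apply, Matrix.of_apply]
    exact hs.eq _ _
  have hT' : ∀ i j, G⁻¹ i j = G⁻¹ j i := by
    intro i j
    have := congrFun (congrFun (Matrix.transpose_nonsing_inv G) j) i
    rwa [hT] at this
  unfold casimir dualVec
  simp only [map_sum, map_smul, smul_eq_mul, Finset.mul_sum]
  rw [Finset.sum_comm]
  refine Finset.sum_congr rfl fun i _ => Finset.sum_congr rfl fun j _ => ?_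
  have := hT' i j
  rw [hG] at this
  rw [this]
  ring

/-- The defining property of the inverse tensor. Every functional has the form `β x`, so identities
for `casimir` reduce to this one, without matrix calculations. -/
theorem casimir_form_right (hn : β.Nondegenerate) (hs : β.IsSymm) (f : U →ₗ[k] k) (x : U) :
    casimir β f (β x) = f x := by
  unfold casimir
  conv_rhs => rw [← (Module.finBasis k U).sum_repr x]
  rw [map_sum]
  refine Finset.sum_congr rfl fun t _ => ?_
  have : β x (dualVec β t) = (Module.finBasis k U).repr x t := by
    rw [← hs.eq]
    conv_lhs => rw [← (Module.finBasis k U).sum_repr x]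
    rw [map_sum]
    simp [form_dualVec hn]
  rw [this, map_smul, smul_eq_mul, mul_comm]

theorem exists_eq_form (hn : β.Nondegenerate) (g : U →ₗ[k] k) : ∃ x, g = β x := by
  obtain ⟨x, hx⟩ := (LinearMap.BilinForm.toDual β hn).surjective g
  refine ⟨x, ?_⟩
  rw [← hx]
  ext y
  simp [LinearMap.BilinForm.toDual_def]

theorem casimir_adjoint (hn : β.Nondegenerate) (hs : β.IsSymm) {T T' : U →ₗ[k] U}
    (hT : ∀ x y, β (T x) y = β x (T' y)) (f g : U →ₗ[k] k) :
    casimir β (f ∘ₗ T) g = casimir β f (g ∘ₗ T') := by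
  obtain ⟨x, rfl⟩ := exists_eq_form hn g
  have : (β x : U →ₗ[k] k) ∘ₗ T' = β (T x) := by
    ext y
    simp [hT]
  rw [this, casimir_form_right hn hs, casimir_form_right hn hs]
  rfl

theorem casimir_smul_left (c : k) (f g : U →ₗ[k] k) :
    casimir β (c • f) g = c * casimir β f g := by
  simp [casimir, Finset.mul_sum, mul_assoc]

theorem casimir_smul_right (c : k) (f g : U →ₗ[k] k) :
    casimir β f (c • g) = c * casimir β f g := by
  simp only [casimir, Finset.mul_sum, LinearMap.smul_apply, smul_eq_mul]
  exact Finset.sum_congr rfl fun _ _ => by ring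

theorem casimir_neg_left (f g : U →ₗ[k] k) : casimir β (-f) g = -casimir β f g := by
  simp [casimir]

theorem casimir_neg_right (f g : U →ₗ[k] k) : casimir β f (-g) = -casimir β f g := by
  simp [casimir]

theorem casimir_add_left (f f' g : U →ₗ[k] k) :
    casimir β (f + f') g = casimir β f g + casimir β f' g := by
  simp [casimir, add_mul, Finset.sum_add_distrib]

theorem casimir_sum_left {J : Type*} (S : Finset J) (f : J → U →ₗ[k] k) (g : U →ₗ[k] k) :
    casimir β (∑ j ∈ S, f j) g = ∑ j ∈ S, casimir β (f j) g := by
  simp only [casimir, LinearMap.sum_apply, Finset.sum_mul]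
  exact Finset.sum_comm

theorem casimir_sum_right {J : Type*} (S : Finset J) (f : U →ₗ[k] k) (g : J → U →ₗ[k] k) :
    casimir β f (∑ j ∈ S, g j) = ∑ j ∈ S, casimir β f (g j) := by
  simp only [casimir, LinearMap.sum_apply, Finset.mul_sum]
  exact Finset.sum_comm

theorem eq_sum_coord {J : Type*} [Fintype J] (b : Module.Basis J k U) (f : U →ₗ[k] k) :
    f = ∑ j, f (b j) • b.coord j := by
  classical
  refine b.ext fun i => ?_
  simp [Finsupp.single_apply]

theorem casimir_basis {J : Type*} [Fintype J] (b : Module.Basis J k U) (f g : U →ₗ[k] k) :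
    casimir β f g = ∑ i, ∑ j, casimir β (b.coord i) (b.coord j) * (f (b i) * g (b j)) := by
  conv_lhs => rw [eq_sum_coord b f, eq_sum_coord b g, casimir_sum_left]
  refine Finset.sum_congr rfl fun i _ => ?_
  rw [casimir_sum_right]
  refine Finset.sum_congr rfl fun j _ => ?_
  rw [casimir_smul_left, casimir_smul_right]
  ring

/-- The inverse tensor of the restriction of a form to the image of a self-adjoint idempotent. -/
theorem casimir_restrict (hn : β.Nondegenerate) (hs : β.IsSymm) {P : U →ₗ[k] U}
    (hP : P ∘ₗ P = P) (hPs : ∀ x y, β (P x) y = β x (P y))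
    (hn' : (β.restrict (LinearMap.range P)).Nondegenerate)
    (hs' : (β.restrict (LinearMap.range P)).IsSymm) (f g : U →ₗ[k] k) :
    casimir (β.restrict (LinearMap.range P)) (f ∘ₗ (LinearMap.range P).subtype)
      (g ∘ₗ (LinearMap.range P).subtype) = casimir β (f ∘ₗ P) g := by
  obtain ⟨x, rfl⟩ := exists_eq_form hn g
  have : (β x : U →ₗ[k] k) ∘ₗ (LinearMap.range P).subtype =
      β.restrict (LinearMap.range P) (P.rangeRestrict x) := by
    ext ⟨y, z, rfl⟩
    have h1 : P (P z) = P z := LinearMap.congr_fun hP z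
    simp [LinearMap.BilinForm.restrict_apply, hPs, h1]
  rw [this, casimir_form_right hn' hs', casimir_form_right hn hs]
  rfl

/-- A vector `P z` orthogonal to the image is orthogonal to everything, since `β (P z) y = β (P z)
(P y)`. -/
theorem restrict_nondegenerate (hn : β.Nondegenerate) (hs : β.IsSymm) {P : U →ₗ[k] U}
    (hP : P ∘ₗ P = P) (hPs : ∀ x y, β (P x) y = β x (P y)) :
    (β.restrict (LinearMap.range P)).Nondegenerate := by
  have hs' : (β.restrict (LinearMap.range P)).IsSymm := hs.restrict _
  have key : ∀ x : LinearMap.range P,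
      (∀ y, β.restrict (LinearMap.range P) x y = 0) → x = 0 := by
    rintro ⟨x, z, rfl⟩ h
    have h1 : P (P z) = P z := LinearMap.congr_fun hP z
    have h2 : β (P z) = 0 := by
      ext y
      have := h ⟨P y, y, rfl⟩
      simp only [LinearMap.BilinForm.restrict_apply, LinearMap.domRestrict_apply] at this
      rw [← hPs, h1] at this
      exact this
    have h3 := hn.1 (P z) fun y => by rw [h2]; rfl
    exact Subtype.ext h3
  exact ⟨key, fun y h => key y fun x => by rw [← hs'.eq]; exact h x⟩

end casimir

/-! ### Parities and homogeneous bases. -/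

section parity

theorem zmod_two_cases : ∀ i : ZMod 2, i = 0 ∨ i = 1 := by decide

theorem zmod_two_add_add (i : ZMod 2) : i + 1 + 1 = i := by revert i; decide

theorem zmod_two_eq_of_add_ne_one : ∀ {i j : ZMod 2}, i + j ≠ 1 → j = i := by decide

theorem zmod_two_eq_of_add_eq_one : ∀ {i j : ZMod 2}, i + j = 1 → j = i + 1 := by decide

variable {k A : Type*} [Field k] [AddCommGroup A] [Module k A]
  (𝒜 : ZMod 2 → Submodule k A) [DirectSum.Decomposition 𝒜]

theorem parityProj_of_mem {i : ZMod 2} {x : A} (hx : x ∈ 𝒜 i) : parityProj 𝒜 i x = x :=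
  DirectSum.decompose_of_mem_same 𝒜 hx

theorem parityProj_of_mem_ne {i j : ZMod 2} {x : A} (hx : x ∈ 𝒜 i) (hij : i ≠ j) :
    parityProj 𝒜 j x = 0 :=
  DirectSum.decompose_of_mem_ne 𝒜 hx hij

theorem parityInv_of_mem {i : ZMod 2} {x : A} (hx : x ∈ 𝒜 i) :
    parityInv (parityProj 𝒜) x = chi k i • x := by
  unfold parityInv
  rw [LinearMap.sub_apply]
  rcases zmod_two_cases i with rfl | rfl
  · rw [parityProj_of_mem 𝒜 hx, parityProj_of_mem_ne 𝒜 hx (by decide), sub_zero, chi_zero, one_smul]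
  · rw [parityProj_of_mem 𝒜 hx, parityProj_of_mem_ne 𝒜 hx (by decide), zero_sub, chi_one,
      neg_one_smul]

/-- The function `p` records parities in `ΠA`, hence the shift by one. -/
theorem exists_homogeneous_basis [FiniteDimensional k A] :
    ∃ (n : ZMod 2 → ℕ) (b : Module.Basis (Σ i, Fin (n i)) k A) (p : (Σ i, Fin (n i)) → ZMod 2),
      ∀ j, b j ∈ 𝒜 (p j + 1) := by
  have hI := DirectSum.Decomposition.isInternal 𝒜
  refine ⟨fun i => Module.finrank k (𝒜 i),
    hI.collectedBasis fun i => Module.finBasis k (𝒜 i), fun j => j.1 + 1, fun j => ?_⟩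
  rw [zmod_two_add_add]
  exact hI.collectedBasis_mem _ _

theorem sgn_smul_eq_chi {M : Type*} [AddCommGroup M] [Module k M] (i : ZMod 2) (x : M) :
    sgn i • x = chi k i • x := by
  unfold chi
  rw [Int.cast_smul_eq_zsmul]

end parity

/-- An algebra with an odd scalar product, an odd derivation and an odd homotopy. -/
structure IsHomotopyAlgebra {k A : Type*} [Field k] [NonUnitalRing A] [Module k A]
    (𝒜 : ZMod 2 → Submodule k A) [DirectSum.Decomposition 𝒜] (β : LinearMap.BilinForm k A)
    (I H P : A →ₗ[k] A) : Prop where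
  mul_mem : ∀ i j, ∀ a ∈ 𝒜 i, ∀ b ∈ 𝒜 j, a * b ∈ 𝒜 (i + j)
  symm : β.IsSymm
  nondeg : β.Nondegenerate
  odd : ∀ i, ∀ a ∈ 𝒜 i, ∀ b ∈ 𝒜 i, β a b = 0
  cyclic : ∀ i j l, ∀ a ∈ 𝒜 i, ∀ b ∈ 𝒜 j, ∀ c ∈ 𝒜 l,
    threeTensor 𝒜 β a b c = sgn ((l + 1) * (i + j)) • threeTensor 𝒜 β c a b
  I_odd : ∀ i, ∀ a ∈ 𝒜 i, I a ∈ 𝒜 (i + 1)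
  I_mul : ∀ i, ∀ a ∈ 𝒜 i, ∀ b, I (a * b) = I a * b + sgn i • (a * I b)
  I_form : ∀ i, ∀ a ∈ 𝒜 i, ∀ b, β (I a) b + sgn i • β a (I b) = 0
  H_odd : ∀ i, ∀ a ∈ 𝒜 i, H a ∈ 𝒜 (i + 1)
  H_form : ∀ i, ∀ a ∈ 𝒜 i, ∀ b, β (H a) b = sgn i • β a (H b)
  proj : LinearMap.id - (I ∘ₗ H + H ∘ₗ I) = P
  idem : P ∘ₗ P = P
  comm : I ∘ₗ I ∘ₗ H = H ∘ₗ I ∘ₗ I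

/-! ### The structure tensors of the algebra in a homogeneous basis. -/

namespace IsHomotopyAlgebra

variable {k A : Type*} [Field k] [NonUnitalRing A] [Module k A]
  [IsScalarTower k A A] [SMulCommClass k A A]
  {𝒜 : ZMod 2 → Submodule k A} [DirectSum.Decomposition 𝒜] {β : LinearMap.BilinForm k A}
  {I H P : A →ₗ[k] A} (h : IsHomotopyAlgebra 𝒜 β I H P)

theorem form_eq_zero (h : IsHomotopyAlgebra 𝒜 β I H P) {i j : ZMod 2} {a b : A} (ha : a ∈ 𝒜 i)
    (hb : b ∈ 𝒜 j) (hij : i + j ≠ 1) : β a b = 0 := by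
  have : j = i := zmod_two_eq_of_add_ne_one hij
  subst this
  exact h.odd _ a ha b hb

theorem I_form' (h : IsHomotopyAlgebra 𝒜 β I H P) {i : ZMod 2} {a : A} (ha : a ∈ 𝒜 i) (b : A) :
    β (I a) b = -(chi k i * β a (I b)) := by
  have := h.I_form i a ha b
  rw [sgn_smul_eq_chi (k := k), smul_eq_mul] at this
  exact eq_neg_of_add_eq_zero_left this

theorem H_form' (h : IsHomotopyAlgebra 𝒜 β I H P) {i : ZMod 2} {a : A} (ha : a ∈ 𝒜 i) (b : A) :
    β (H a) b = chi k i * β a (H b) := by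
  have := h.H_form i a ha b
  rwa [sgn_smul_eq_chi (k := k), smul_eq_mul] at this

theorem I_mul' (h : IsHomotopyAlgebra 𝒜 β I H P) {i : ZMod 2} {a : A} (ha : a ∈ 𝒜 i) (b : A) :
    I (a * b) = I a * b + chi k i • (a * I b) := by
  rw [h.I_mul i a ha b, sgn_smul_eq_chi (k := k)]

theorem threeTensor_eq (a : A) {j : ZMod 2} {b : A} (hb : b ∈ 𝒜 j) (c : A) :
    threeTensor 𝒜 β a b c = chi k j * β (a * b) c := by
  unfold threeTensor
  rcases zmod_two_cases j with rfl | rfl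
  · rw [parityProj_of_mem 𝒜 hb, parityProj_of_mem_ne 𝒜 hb (by decide), mul_zero, map_zero,
      LinearMap.zero_apply, sub_zero, chi_zero, one_mul]
  · rw [parityProj_of_mem 𝒜 hb, parityProj_of_mem_ne 𝒜 hb (by decide), mul_zero, map_zero,
      LinearMap.zero_apply, zero_sub, chi_one, neg_one_mul]

theorem cyclic' (h : IsHomotopyAlgebra 𝒜 β I H P) {i j l : ZMod 2} {a b c : A} (ha : a ∈ 𝒜 i)
    (hb : b ∈ 𝒜 j) (hc : c ∈ 𝒜 l) :
    threeTensor 𝒜 β a b c = chi k ((l + 1) * (i + j)) * threeTensor 𝒜 β c a b := by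
  rw [h.cyclic i j l a ha b hb c hc, sgn_smul_eq_chi (k := k), smul_eq_mul]

variable {J : Type*} [Fintype J] (b : Module.Basis J k A) {p : J → ZMod 2}
  (hb : ∀ j, b j ∈ 𝒜 (p j + 1))

/-- The coordinates of the three-tensor. -/
def vertexCoeff (𝒜 : ZMod 2 → Submodule k A) [DirectSum.Decomposition 𝒜]
    (β : LinearMap.BilinForm k A) (b : Module.Basis J k A) (i j l : J) : k :=
  threeTensor 𝒜 β (b i) (b j) (b l)

/-- The coordinates of the tensor `(T ⊗ 1) β^∨`. -/
def pairCoeff [FiniteDimensional k A] (β : LinearMap.BilinForm k A) (b : Module.Basis J k A)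
    (T : A →ₗ[k] A) (i j : J) : k :=
  casimir β (b.coord i ∘ₗ T) (b.coord j)

/-- The matrix of `I`. -/
def opCoeff (b : Module.Basis J k A) (I : A →ₗ[k] A) (i j : J) : k := b.coord i (I (b j))

/-- The additional minus sign arises because `p` is the parity in `ΠA`, whereas the involution is
that of `A`. -/
theorem coord_parityInv (hb : ∀ j, b j ∈ 𝒜 (p j + 1)) (j : J) :
    b.coord j ∘ₗ parityInv (parityProj 𝒜) = -chi k (p j) • b.coord j := by
  refine b.ext fun i => ?_
  classical
  rw [LinearMap.comp_apply, parityInv_of_mem 𝒜 (hb i), map_smul, LinearMap.smul_apply]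
  simp only [Module.Basis.coord_apply, Module.Basis.repr_self, Finsupp.single_apply, chi_add,
    chi_one]
  split_ifs with hij
  · subst hij; simp
  · simp

/-- `β` pairs vectors of opposite parities, so the sign of `x` can be moved to `y` at the cost of a
minus sign. -/
theorem parityInv_form (h : IsHomotopyAlgebra 𝒜 β I H P) {i : ZMod 2} {x : A} (hx : x ∈ 𝒜 i)
    (y : A) : chi k i * β x y = -β x (parityInv (parityProj 𝒜) y) := by
  classical
  rw [← DirectSum.sum_support_decompose 𝒜 y]
  simp only [map_sum, Finset.mul_sum, ← Finset.sum_neg_distrib]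
  refine Finset.sum_congr rfl fun j _ => ?_
  have hy : (DirectSum.decompose 𝒜 y j : A) ∈ 𝒜 j := SetLike.coe_mem _
  rw [parityInv_of_mem 𝒜 hy, map_smul, smul_eq_mul]
  by_cases hij : i + j = 1
  · have : j = i + 1 := zmod_two_eq_of_add_eq_one hij
    subst this
    rw [chi_add, chi_one]
    ring
  · rw [h.form_eq_zero hx hy hij]
    simp

theorem basis_form_ext (hb : ∀ j, b j ∈ 𝒜 (p j + 1)) {T T' : A →ₗ[k] A}
    (hT : ∀ i, ∀ x ∈ 𝒜 i, ∀ y, β (T x) y = β x (T' y)) (x y : A) : β (T x) y = β x (T' y) := by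
  have : β ∘ₗ T = (β.flip ∘ₗ T').flip := by
    refine b.ext fun j => ?_
    ext y
    simpa using hT _ _ (hb j) y
  have := LinearMap.congr_fun (LinearMap.congr_fun this x) y
  simpa using this

theorem H_adjoint (h : IsHomotopyAlgebra 𝒜 β I H P) (hb : ∀ j, b j ∈ 𝒜 (p j + 1)) (x y : A) :
    β (H x) y = β x ((-(parityInv (parityProj 𝒜) ∘ₗ H)) y) :=
  basis_form_ext b hb (fun i x hx y => by
    rw [h.H_form' hx, h.parityInv_form hx]
    simp) x y

theorem I_adjoint (h : IsHomotopyAlgebra 𝒜 β I H P) (hb : ∀ j, b j ∈ 𝒜 (p j + 1)) (x y : A) :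
    β (I x) y = β x ((parityInv (parityProj 𝒜) ∘ₗ I) y) :=
  basis_form_ext b hb (fun i x hx y => by
    rw [h.I_form' hx, h.parityInv_form hx]
    simp) x y

/-- The signs of `I_form` and `H_form` combine to ordinary self-adjointness. It yields the
self-adjointness of `P` and the symmetry of the edge tensor of `[I, H]`. -/
theorem comm_adjoint (h : IsHomotopyAlgebra 𝒜 β I H P) (hb : ∀ j, b j ∈ 𝒜 (p j + 1)) (x y : A) :
    β ((I ∘ₗ H + H ∘ₗ I) x) y = β x ((I ∘ₗ H + H ∘ₗ I) y) :=
  basis_form_ext b hb (fun i x hx y => by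
    simp only [LinearMap.add_apply, LinearMap.comp_apply, map_add]
    rw [h.I_form' (h.H_odd i x hx), h.H_form' hx, h.H_form' (h.I_odd i x hx), h.I_form' hx, chi_add,
      chi_one]
    linear_combination (β x (H (I y)) + β x (I (H y))) * chi_mul_self (k := k) i) x y

theorem proj_adjoint (h : IsHomotopyAlgebra 𝒜 β I H P) (hb : ∀ j, b j ∈ 𝒜 (p j + 1)) (x y : A) :
    β (P x) y = β x (P y) := by
  have := h.comm_adjoint b hb x y
  rw [← h.proj]
  simp only [LinearMap.sub_apply, LinearMap.id_apply, map_sub, this]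

theorem coord_parityProj (hb : ∀ j, b j ∈ 𝒜 (p j + 1)) (i : ZMod 2) (j : J) (x : A) :
    b.coord j (parityProj 𝒜 i x) = if p j + 1 = i then b.coord j x else 0 := by
  classical
  have : b.coord j ∘ₗ parityProj 𝒜 i = if p j + 1 = i then b.coord j else 0 := by
    refine b.ext fun l => ?_
    rw [LinearMap.comp_apply]
    by_cases hl : p l + 1 = i
    · rw [parityProj_of_mem 𝒜 (hl ▸ hb l)]
      split_ifs with hj
      · rfl
      · have : l ≠ j := by rintro rfl; exact hj hl
        simp [this]
    · rw [parityProj_of_mem_ne 𝒜 (hb l) hl, map_zero]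
      split_ifs with hj
      · have : l ≠ j := by rintro rfl; exact hl hj
        simp [this]
      · rfl
  have := LinearMap.congr_fun this x
  rw [LinearMap.comp_apply] at this
  rw [this]
  split_ifs <;> rfl

theorem coord_eq_zero (hb : ∀ j, b j ∈ 𝒜 (p j + 1)) {i : ZMod 2} {x : A} (hx : x ∈ 𝒜 i) {j : J}
    (hj : p j + 1 ≠ i) : b.coord j x = 0 := by
  rw [← parityProj_of_mem 𝒜 hx, coord_parityProj b hb, if_neg hj]

theorem opCoeff_odd (hb : ∀ j, b j ∈ 𝒜 (p j + 1)) {T : A →ₗ[k] A}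
    (hT : ∀ i, ∀ a ∈ 𝒜 i, T a ∈ 𝒜 (i + 1)) (i j : J) (hij : opCoeff b T i j ≠ 0) :
    p i = p j + 1 := by
  by_contra hne
  refine hij (coord_eq_zero b hb (hT _ _ (hb j)) fun e => hne ?_)
  exact add_right_cancel e

/-- The Leibniz rule for `I (x * y)`, paired with `z` by means of the invariance of `β`. -/
theorem vertexDerivation (h : IsHomotopyAlgebra 𝒜 β I H P) (hb : ∀ j, b j ∈ 𝒜 (p j + 1)) :
    VertexDerivation p (vertexCoeff 𝒜 β b) (opCoeff b I) where
  odd := opCoeff_odd b hb h.I_odd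
  inv x y z := by
    have e1 : ∑ i, vertexCoeff 𝒜 β b i y z * opCoeff b I i x =
        threeTensor 𝒜 β (I (b x)) (b y) (b z) := by
      conv_rhs => rw [← b.sum_repr (I (b x))]
      simp only [vertexCoeff, opCoeff, threeTensor_eq _ (hb y), Finset.sum_mul, map_sum,
        LinearMap.sum_apply, smul_mul_assoc, map_smul, LinearMap.smul_apply, smul_eq_mul,
        Module.Basis.coord_apply, Finset.mul_sum]
      exact Finset.sum_congr rfl fun i _ => by ring
    have e2 : ∑ i, vertexCoeff 𝒜 β b x i z * opCoeff b I i y =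
        threeTensor 𝒜 β (b x) (I (b y)) (b z) := by
      rw [threeTensor_eq _ (h.I_odd _ _ (hb y))]
      conv_rhs => rw [← b.sum_repr (I (b y))]
      simp only [Finset.mul_sum, map_sum,
        LinearMap.sum_apply, mul_smul_comm, map_smul, LinearMap.smul_apply, smul_eq_mul]
      refine Finset.sum_congr rfl fun i _ => ?_
      by_cases hi : p i = p y + 1
      · rw [vertexCoeff, threeTensor_eq _ (hb i), hi, opCoeff, Module.Basis.coord_apply]
        ring
      · have : opCoeff b I i y = 0 := not_not.1 fun h' => hi (opCoeff_odd b hb h.I_odd i y h')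
        rw [this]
        rw [opCoeff, Module.Basis.coord_apply] at this
        rw [this]
        ring
    have e3 : ∑ i, vertexCoeff 𝒜 β b x y i * opCoeff b I i z =
        threeTensor 𝒜 β (b x) (b y) (I (b z)) := by
      conv_rhs => rw [← b.sum_repr (I (b z))]
      simp only [vertexCoeff, opCoeff, threeTensor_eq _ (hb y), map_sum, map_smul, smul_eq_mul,
        Module.Basis.coord_apply, Finset.mul_sum]
      exact Finset.sum_congr rfl fun i _ => by ring
    simp only [Finset.sum_add_distrib, ← Finset.mul_sum, e1, e2, e3]
    rw [threeTensor_eq _ (hb y), threeTensor_eq _ (hb y), threeTensor_eq _ (h.I_odd _ _ (hb y))]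
    have f1 := h.I_mul' (hb x) (b y)
    have f2 := h.I_form' (h.mul_mem _ _ _ (hb x) _ (hb y)) (b z)
    rw [f1] at f2
    simp only [map_add, map_smul, LinearMap.add_apply, LinearMap.smul_apply, smul_eq_mul, chi_add,
      chi_one] at f2 ⊢
    have g := chi_mul_self (k := k) (p y)
    linear_combination (-chi k (p y)) * f2

variable [FiniteDimensional k A]

theorem pairCoeff_neg (T : A →ₗ[k] A) (i j : J) : pairCoeff β b (-T) i j = -pairCoeff β b T i j := by
  unfold pairCoeff
  rw [LinearMap.comp_neg, casimir_neg_left]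

theorem pairCoeff_eq (T : A →ₗ[k] A) (i j : J) :
    pairCoeff β b T i j = ∑ l, opCoeff b T i l * pairCoeff β b LinearMap.id l j := by
  classical
  unfold pairCoeff opCoeff
  conv_lhs => rw [eq_sum_coord b (b.coord i ∘ₗ T), casimir_sum_left]
  refine Finset.sum_congr rfl fun l _ => ?_
  rw [casimir_smul_left]
  rfl

theorem coord_comp_parityProj (hb : ∀ j, b j ∈ 𝒜 (p j + 1)) (i : ZMod 2) (j : J) :
    b.coord j ∘ₗ parityProj 𝒜 i = if p j + 1 = i then b.coord j else 0 := by
  ext x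
  rw [LinearMap.comp_apply, coord_parityProj b hb]
  split_ifs <;> rfl

theorem parityProj_adjoint (h : IsHomotopyAlgebra 𝒜 β I H P) (hb : ∀ j, b j ∈ 𝒜 (p j + 1))
    (i : ZMod 2) (x y : A) : β (parityProj 𝒜 i x) y = β x (parityProj 𝒜 (i + 1) y) := by
  have : β ∘ₗ parityProj 𝒜 i = (β.flip ∘ₗ parityProj 𝒜 (i + 1)).flip := by
    refine b.ext fun l => b.ext fun m => ?_
    change β (parityProj 𝒜 i (b l)) (b m) = β (b l) (parityProj 𝒜 (i + 1) (b m))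
    by_cases hlm : p l + 1 + (p m + 1) = 1
    · have hm : p m + 1 = p l + 1 + 1 := zmod_two_eq_of_add_eq_one hlm
      by_cases hl : p l + 1 = i
      · rw [parityProj_of_mem 𝒜 (hl ▸ hb l), parityProj_of_mem 𝒜 (by rw [← hl, ← hm]; exact hb m)]
      · rw [parityProj_of_mem_ne 𝒜 (hb l) hl, parityProj_of_mem_ne 𝒜 (hb m), map_zero, map_zero,
          LinearMap.zero_apply]
        rw [hm]
        exact fun e => hl (add_right_cancel e)
    · have h0 : β (b l) (b m) = 0 := h.form_eq_zero (hb l) (hb m) hlm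
      have h1 : ∀ i, β (parityProj 𝒜 i (b l)) (b m) = 0 := fun i => by
        by_cases hl : p l + 1 = i
        · rw [parityProj_of_mem 𝒜 (hl ▸ hb l), h0]
        · rw [parityProj_of_mem_ne 𝒜 (hb l) hl, map_zero, LinearMap.zero_apply]
      have h2 : ∀ i, β (b l) (parityProj 𝒜 i (b m)) = 0 := fun i => by
        by_cases hm : p m + 1 = i
        · rw [parityProj_of_mem 𝒜 (hm ▸ hb m), h0]
        · rw [parityProj_of_mem_ne 𝒜 (hb m) hm, map_zero]
      rw [h1, h2]
  have := LinearMap.congr_fun (LinearMap.congr_fun this x) y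
  simpa using this

/-- The projection to one parity is adjoint to the projection to the other, so it can be inserted at
one end of the inverse tensor and read off at the other end. -/
theorem pairCoeff_id_odd (h : IsHomotopyAlgebra 𝒜 β I H P) (hb : ∀ j, b j ∈ 𝒜 (p j + 1)) (i j : J)
    (hij : pairCoeff β b LinearMap.id i j ≠ 0) : p i = p j + 1 := by
  by_contra hne
  refine hij ?_
  have h1 := casimir_adjoint h.nondeg h.symm (h.parityProj_adjoint b hb (p i + 1)) (b.coord i)
    (b.coord j)
  rw [coord_comp_parityProj b hb, if_pos rfl, coord_comp_parityProj b hb, zmod_two_add_add,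
    if_neg (Ne.symm hne)] at h1
  unfold pairCoeff
  rw [LinearMap.comp_id, h1]
  simp [casimir]

theorem pairCoeff_odd (h : IsHomotopyAlgebra 𝒜 β I H P) (hb : ∀ j, b j ∈ 𝒜 (p j + 1))
    {T : A →ₗ[k] A} (hT : ∀ i, ∀ a ∈ 𝒜 i, T a ∈ 𝒜 i) (i j : J)
    (hij : pairCoeff β b T i j ≠ 0) : p i = p j + 1 := by
  rw [pairCoeff_eq] at hij
  obtain ⟨l, -, hl⟩ := Finset.exists_ne_zero_of_sum_ne_zero hij
  have h1 := h.pairCoeff_id_odd b hb l j (right_ne_zero_of_mul hl)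
  rw [← h1]
  by_contra hne
  exact left_ne_zero_of_mul hl (coord_eq_zero b hb (hT _ _ (hb l)) fun e => hne (add_right_cancel e))

theorem pairCoeff_even (h : IsHomotopyAlgebra 𝒜 β I H P) (hb : ∀ j, b j ∈ 𝒜 (p j + 1))
    {T : A →ₗ[k] A} (hT : ∀ i, ∀ a ∈ 𝒜 i, T a ∈ 𝒜 (i + 1)) (i j : J)
    (hij : pairCoeff β b T i j ≠ 0) : p i = p j := by
  rw [pairCoeff_eq] at hij
  obtain ⟨l, -, hl⟩ := Finset.exists_ne_zero_of_sum_ne_zero hij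
  have h1 := h.pairCoeff_id_odd b hb l j (right_ne_zero_of_mul hl)
  have h2 := opCoeff_odd b hb hT i l (left_ne_zero_of_mul hl)
  rw [h2, h1, zmod_two_add_add]

theorem pairCoeff_symm (h : IsHomotopyAlgebra 𝒜 β I H P) {T : A →ₗ[k] A}
    (hT : ∀ x y, β (T x) y = β x (T y)) (i j : J) : pairCoeff β b T i j = pairCoeff β b T j i := by
  unfold pairCoeff
  rw [casimir_adjoint h.nondeg h.symm hT, casimir_comm h.symm]

theorem comp_coord_parityInv (hb : ∀ j, b j ∈ 𝒜 (p j + 1)) (T : A →ₗ[k] A) (j : J) :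
    b.coord j ∘ₗ (parityInv (parityProj 𝒜) ∘ₗ T) = -chi k (p j) • (b.coord j ∘ₗ T) := by
  rw [← LinearMap.comp_assoc, coord_parityInv b hb, LinearMap.smul_comp]

/-- The propagator is even, being an odd operator applied to the odd inverse tensor; its graded
symmetry expresses the self-adjointness of `H`. -/
theorem evenTensors (h : IsHomotopyAlgebra 𝒜 β I H P) (hb : ∀ j, b j ∈ 𝒜 (p j + 1)) :
    EvenTensors p (vertexCoeff 𝒜 β b) (pairCoeff β b (-H)) where
  vertex_even i j l hne := by
    by_contra hs
    refine hne ?_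
    rw [vertexCoeff, threeTensor_eq _ (hb j),
      h.form_eq_zero (h.mul_mem _ _ _ (hb i) _ (hb j)) (hb l), mul_zero]
    generalize p i = x at hs ⊢
    generalize p j = y at hs ⊢
    generalize p l = z at hs ⊢
    revert x y z
    decide
  vertex_cyclic i j l := by
    unfold vertexCoeff
    rw [h.cyclic' (hb i) (hb j) (hb l), zmod_two_add_add]
    congr 3
    generalize p i = x
    generalize p j = y
    revert x y
    decide
  edge_even := h.pairCoeff_even b hb fun i a ha => (𝒜 _).neg_mem (h.H_odd i a ha)
  edge_symm i j := by
    by_cases hij : p i = p j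
    · have h1 := casimir_adjoint h.nondeg h.symm (h.H_adjoint b hb) (b.coord i) (b.coord j)
      rw [LinearMap.comp_neg, comp_coord_parityInv b hb, casimir_neg_right, casimir_smul_right,
        casimir_comm h.symm (b.coord i)] at h1
      rw [pairCoeff_neg, pairCoeff_neg, hij]
      unfold pairCoeff
      rw [h1]
      linear_combination casimir β (b.coord j ∘ₗ H) (b.coord i) * chi_mul_self (k := k) (p j)
    · have hT : ∀ i, ∀ a ∈ 𝒜 i, (-H) a ∈ 𝒜 (i + 1) := fun i a ha =>
        (𝒜 _).neg_mem (h.H_odd i a ha)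
      have h1 : pairCoeff β b (-H) i j = 0 := not_not.1 fun e => hij (h.pairCoeff_even b hb hT i j e)
      have h2 : pairCoeff β b (-H) j i = 0 :=
        not_not.1 fun e => hij (h.pairCoeff_even b hb hT j i e).symm
      rw [h1, h2, mul_zero]

/-- `I_adjoint` moves `I` from the second end of the inverse tensor to the first. Thus the action of
`I` on both ends of the propagator of `-H` is the negative of the tensor of `[I, H]`. -/
theorem pairCoeff_comm (h : IsHomotopyAlgebra 𝒜 β I H P) (hb : ∀ j, b j ∈ 𝒜 (p j + 1)) (i j : J) :
    pairCoeff β b (I ∘ₗ H + H ∘ₗ I) i j =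
      -((∑ a, opCoeff b I i a * pairCoeff β b (-H) a j) +
        chi k (p i) * ∑ a, opCoeff b I j a * pairCoeff β b (-H) i a) := by
  have e1 : ∑ a, opCoeff b I i a * pairCoeff β b (-H) a j = pairCoeff β b (I ∘ₗ (-H)) i j := by
    unfold pairCoeff opCoeff
    have : b.coord i ∘ₗ I ∘ₗ (-H) = ∑ a, b.coord i (I (b a)) • (b.coord a ∘ₗ (-H)) := by
      ext x
      have := LinearMap.congr_fun (eq_sum_coord b (b.coord i ∘ₗ I)) ((-H) x)
      simpa using this
    rw [this, casimir_sum_left]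
    refine Finset.sum_congr rfl fun l _ => ?_
    rw [casimir_smul_left]
  have e2 : ∑ a, opCoeff b I j a * pairCoeff β b (-H) i a =
      casimir β (b.coord i ∘ₗ (-H)) (b.coord j ∘ₗ I) := by
    unfold pairCoeff opCoeff
    rw [eq_sum_coord b (b.coord j ∘ₗ I), casimir_sum_right]
    refine Finset.sum_congr rfl fun l _ => ?_
    rw [casimir_smul_right]
    rfl
  have e3 := casimir_adjoint h.nondeg h.symm (h.I_adjoint b hb) (b.coord i ∘ₗ (-H)) (b.coord j)
  rw [comp_coord_parityInv b hb, casimir_smul_right] at e3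
  have e4 : casimir β ((b.coord i ∘ₗ (-H)) ∘ₗ I) (b.coord j) = -pairCoeff β b (H ∘ₗ I) i j := by
    unfold pairCoeff
    rw [← casimir_neg_left]
    congr 1
    ext; simp
  have e5 : pairCoeff β b (I ∘ₗ (-H)) i j = -pairCoeff β b (I ∘ₗ H) i j := by
    unfold pairCoeff
    rw [← casimir_neg_left]
    congr 1
    ext; simp
  have e6 : pairCoeff β b (I ∘ₗ H + H ∘ₗ I) i j =
      pairCoeff β b (I ∘ₗ H) i j + pairCoeff β b (H ∘ₗ I) i j := by
    unfold pairCoeff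
    rw [← casimir_add_left, LinearMap.comp_add]
  have hHI : ∀ i, ∀ a ∈ 𝒜 i, (H ∘ₗ I) a ∈ 𝒜 i := fun i a ha => by
    have := h.H_odd _ _ (h.I_odd i a ha)
    rwa [zmod_two_add_add] at this
  rw [e1, e2, e5, e6]
  rw [e4] at e3
  have c := chi_mul_self (k := k) (p j)
  -- The adjoint produces the sign of `p j`, the statement that of `p i`; they differ by `-1`
  -- wherever the odd coefficient is nonzero.
  by_cases h0 : pairCoeff β b (H ∘ₗ I) i j = 0
  · have : casimir β (b.coord i ∘ₗ (-H)) (b.coord j ∘ₗ I) = 0 := by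
      rw [h0, neg_zero] at e3
      exact (mul_eq_zero.1 e3.symm).resolve_left (neg_ne_zero.2 (chi_ne_zero _))
    rw [h0, this]
    ring
  · rw [h.pairCoeff_odd b hb hHI i j h0, chi_add, chi_one]
    linear_combination -e3

theorem sum_pairCoeff_id (h : IsHomotopyAlgebra 𝒜 β I H P) (x : A) (f : A →ₗ[k] k) :
    ∑ i, ∑ j, pairCoeff β b LinearMap.id i j * (β x (b i) * f (b j)) = f x := by
  unfold pairCoeff
  simp only [LinearMap.comp_id]
  rw [← casimir_basis b, casimir_comm h.symm, casimir_form_right h.nondeg h.symm]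

/-- Cyclic invariance turns the first vertex into `β (x * y)` applied to the joined flag, and
contraction with the inverse tensor then substitutes `x * y` into the second vertex. -/
theorem fourTensor_eq (h : IsHomotopyAlgebra 𝒜 β I H P) (hb : ∀ j, b j ∈ 𝒜 (p j + 1))
    (x y z w : J) : fourTensor p (vertexCoeff 𝒜 β b) (pairCoeff β b LinearMap.id) x y z w =
      chi k (p x + p z) * β (b x * b y * b z) (b w) := by
  have key := h.sum_pairCoeff_id b (b x * b y)
    (LinearMap.lcomp k k (LinearMap.mulRight k (b z)) (β.flip (b w)))
  have hE := h.evenTensors b hb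
  have hl : (LinearMap.lcomp k k (LinearMap.mulRight k (b z)) (β.flip (b w))) (b x * b y) =
      β (b x * b y * b z) (b w) := rfl
  rw [hl] at key
  rw [← key, Finset.mul_sum]
  unfold fourTensor
  refine Finset.sum_congr rfl fun i _ => ?_
  rw [Finset.mul_sum]
  refine Finset.sum_congr rfl fun j _ => ?_
  by_cases hij : pairCoeff β b LinearMap.id i j = 0
  · rw [hij]; ring
  · have hp := h.pairCoeff_id_odd b hb i j hij
    have hc := hE.vertex_cyclic x y i
    have e1 : vertexCoeff 𝒜 β b x y i = chi k (p y + 1) * β (b x * b y) (b i) :=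
      threeTensor_eq _ (hb y) _
    have e2 : vertexCoeff 𝒜 β b j z w = chi k (p z + 1) * β (b j * b z) (b w) :=
      threeTensor_eq _ (hb z) _
    have e3 : (LinearMap.lcomp k k (LinearMap.mulRight k (b z)) (β.flip (b w))) (b j) =
      β (b j * b z) (b w) := rfl
    have c1 := chi_mul_self (k := k) (p i * (p x + p y))
    have e4 : vertexCoeff 𝒜 β b i x y = chi k (p i * (p x + p y)) *
        (chi k (p y + 1) * β (b x * b y) (b i)) := by
      rw [← e1, hc, ← mul_assoc, c1, one_mul]
    rw [e4, e2, e3, hp]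
    have e5 : chi k (p j * (p x + p y)) * chi k ((p j + 1) * (p x + p y)) * chi k (p y + 1) *
        chi k (p z + 1) = chi k (p x + p z) := by
      simp only [← chi_add]
      congr 1
      generalize p x = x
      generalize p y = y
      generalize p z = z
      generalize p j = j
      revert x y z j
      decide
    rw [← e5]
    ring

/-- Associativity enters here. If the total parity is odd, cyclicity of the three-tensor for the
entries `x * y`, `z`, `w` gives `β (x * y * z) w = β (w * x * y) z`, while the prefactors have
exponents `p x + p z` and `p w + p y`, which differ by `1`. Otherwise both sides vanish. -/
theorem fourTensor_anti (h : IsHomotopyAlgebra 𝒜 β I H P) (hb : ∀ j, b j ∈ 𝒜 (p j + 1))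
    (x y z w : J) : fourTensor p (vertexCoeff 𝒜 β b) (pairCoeff β b LinearMap.id) w x y z =
      -fourTensor p (vertexCoeff 𝒜 β b) (pairCoeff β b LinearMap.id) x y z w := by
  rw [h.fourTensor_eq b hb, h.fourTensor_eq b hb]
  have hxy := h.mul_mem _ _ _ (hb x) _ (hb y)
  have hwx := h.mul_mem _ _ _ (hb w) _ (hb x)
  by_cases hs : p x + p y + p z + p w = 1
  · have c := h.cyclic' (k := k) hxy (hb z) (hb w)
    rw [threeTensor_eq _ (hb z), threeTensor_eq _ hxy] at c
    have hw : p w = p x + p y + p z + 1 := by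
      generalize p x = x at hs ⊢
      generalize p y = y at hs ⊢
      generalize p z = z at hs ⊢
      generalize p w = w at hs ⊢
      revert x y z w
      decide
    have e1 : β (b x * b y * b z) (b w) = β (b w * b x * b y) (b z) := by
      have : β (b x * b y * b z) (b w) = chi k (p z + 1) * (chi k (p z + 1) *
          β (b x * b y * b z) (b w)) := by
        rw [← mul_assoc, chi_mul_self, one_mul]
      rw [this, c, ← mul_assoc, ← mul_assoc, ← chi_add, ← chi_add, mul_assoc (b w)]
      have e : p z + 1 + (p w + 1 + 1) * (p x + 1 + (p y + 1) + (p z + 1)) +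
          (p x + 1 + (p y + 1)) = 0 := by
        rw [hw]
        generalize p x = x
        generalize p y = y
        generalize p z = z
        revert x y z
        decide
      rw [e, chi_zero, one_mul]
    rw [e1, hw]
    have e2 : chi k (p x + p y + p z + 1 + p y) = -chi k (p x + p z) := by
      have : p x + p y + p z + 1 + p y = p x + p z + 1 := by
        generalize p x = x
        generalize p y = y
        generalize p z = z
        revert x y z
        decide
      rw [this, chi_add, chi_one]
      ring
    rw [e2]
    ring
  · rw [h.form_eq_zero (h.mul_mem _ _ _ hxy _ (hb z)) (hb w),
      h.form_eq_zero (h.mul_mem _ _ _ hwx _ (hb y)) (hb z)]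
    · ring
    all_goals
      generalize p x = x at hs ⊢
      generalize p y = y at hs ⊢
      generalize p z = z at hs ⊢
      generalize p w = w at hs ⊢
      revert x y z w
      decide

end IsHomotopyAlgebra

/-- The product of the coordinates of the letters. -/
def coordProd {k A J : Type*} [Field k] [AddCommGroup A] [Module k A] {n : ℕ}
    (b : Module.Basis J k A) (a : Fin n → A) (d : Fin n → J) : k :=
  ∏ l, b.coord (d l) (a l)

/-! ### The contraction over a ribbon graph as a state sum. -/

section tensor

variable {k A : Type*} [Field k] [NonUnitalRing A] [Module k A]
  [IsScalarTower k A A] [SMulCommClass k A A] [FiniteDimensional k A]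
  {𝒜 : ZMod 2 → Submodule k A} [DirectSum.Decomposition 𝒜] {β : LinearMap.BilinForm k A}
  {H : A →ₗ[k] A} {J : Type*} [Fintype J] (b : Module.Basis J k A) {p : J → ZMod 2}
  {n N : ℕ}

theorem threeTensor_sum (x y z : A) : threeTensor 𝒜 β x y z =
    ∑ i, ∑ j, ∑ l, IsHomotopyAlgebra.vertexCoeff 𝒜 β b i j l *
      (b.coord i x * b.coord j y * b.coord l z) := by
  have e0 : ∀ x y z, threeTensor 𝒜 β x y z = β (x * parityInv (parityProj 𝒜) y) z := by
    intro x y z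
    unfold threeTensor parityInv
    rw [LinearMap.sub_apply, mul_sub, map_sub, LinearMap.sub_apply]
  have e1 : ∀ x y z, threeTensor 𝒜 β x y z = ∑ i, b.coord i x * threeTensor 𝒜 β (b i) y z := by
    intro x y z
    conv_lhs => rw [e0, ← b.sum_repr x]
    simp only [e0, map_sum, Finset.sum_mul, Finset.mul_sum, LinearMap.sum_apply, smul_mul_assoc,
      mul_smul_comm, map_smul, LinearMap.smul_apply, smul_eq_mul, Module.Basis.coord_apply]
  have e2 : ∀ x y z, threeTensor 𝒜 β x y z = ∑ i, b.coord i y * threeTensor 𝒜 β x (b i) z := by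
    intro x y z
    conv_lhs => rw [e0, ← b.sum_repr y]
    simp only [e0, map_sum, Finset.sum_mul, Finset.mul_sum, LinearMap.sum_apply, smul_mul_assoc,
      mul_smul_comm, map_smul, LinearMap.smul_apply, smul_eq_mul, Module.Basis.coord_apply]
  have e3 : ∀ x y z, threeTensor 𝒜 β x y z = ∑ i, b.coord i z * threeTensor 𝒜 β x y (b i) := by
    intro x y z
    conv_lhs => rw [e0, ← b.sum_repr z]
    simp only [e0, map_sum, Finset.sum_mul, Finset.mul_sum, LinearMap.sum_apply, smul_mul_assoc,
      mul_smul_comm, map_smul, LinearMap.smul_apply, smul_eq_mul, Module.Basis.coord_apply]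
  rw [e1]
  refine Finset.sum_congr rfl fun i _ => ?_
  rw [e2, Finset.mul_sum]
  refine Finset.sum_congr rfl fun j _ => ?_
  rw [e3, Finset.mul_sum, Finset.mul_sum]
  refine Finset.sum_congr rfl fun l _ => ?_
  unfold IsHomotopyAlgebra.vertexCoeff
  ring

theorem prod_flags {M : Type*} [CommMonoid M] (Γ : RibbonGraph n N) (G : Flag N → M) :
    open Classical in
    ∏ f, G f = (∏ f : {f // Γ.IsHead f}, G f.1 * G (Γ.edge f.1)) * ∏ l, G (Γ.leg l) := by
  classical
  have h1 : ∏ f, G f = ∏ f, ((if Γ.IsHead f then G f else 1) *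
      (if Γ.IsHead (Γ.edge f) then G f else 1) * (if Γ.edge f = f then G f else 1)) := by
    refine Finset.prod_congr rfl fun f _ => ?_
    by_cases hf : Γ.edge f = f
    · have : ¬ Γ.IsHead f := fun h => IsHead.ne Γ h hf
      simp [hf, this]
    · simp only [Γ.isHead_edge_iff hf, hf, if_false]
      by_cases h : Γ.IsHead f <;> simp [h]
  have h2 : ∏ f, (if Γ.IsHead (Γ.edge f) then G f else 1) =
      ∏ f, if Γ.IsHead f then G (Γ.edge f) else 1 := by
    rw [← Equiv.prod_comp Γ.edge]
    simp [Γ.edge_edge]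
  have h3 : ∏ f, (if Γ.edge f = f then G f else 1) = ∏ l, G (Γ.leg l) := by
    symm
    refine Fintype.prod_of_injective Γ.leg Γ.leg.injective _ _ (fun f hf => ?_) fun l => ?_
    · exact if_neg fun e => hf ((Γ.edge_eq_self_iff f).1 e)
    · rw [if_pos (Γ.edge_leg l)]
  rw [h1, Finset.prod_mul_distrib, Finset.prod_mul_distrib, h2, h3, ← Finset.prod_mul_distrib]
  congr 1
  have h4 : ∀ f, (if Γ.IsHead f then G f else 1) * (if Γ.IsHead f then G (Γ.edge f) else 1) =
      if Γ.IsHead f then G f * G (Γ.edge f) else 1 := by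
    intro f
    split_ifs <;> simp
  rw [Finset.prod_congr rfl fun f _ => h4 f, ← Finset.prod_filter,
    ← Finset.prod_subtype_eq_prod_filter, Finset.subtype_univ]

/-- The sum over `t` factorises over the internal edges, and each factor is the inverse tensor with
`-H` at its first end. -/
theorem sum_prod_flagVec (Γ : RibbonGraph n N) (a : Fin n → A) (c : Flag N → J) :
    open Classical in
    ∑ t : {f // Γ.IsHead f} → Fin (Module.finrank k A), ∏ f, b.coord (c f) (flagVec β H Γ a t f) =
      edgeProd (IsHomotopyAlgebra.pairCoeff β b (-H)) Γ Γ.ord c * coordProd b a (c ∘ Γ.leg) := by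
  classical
  have h2 : ∀ (t : {f // Γ.IsHead f} → Fin (Module.finrank k A)) (f : {f // Γ.IsHead f}),
      flagVec β H Γ a t f.1 = -H (Module.finBasis k A (t f)) := by
    intro t f
    unfold flagVec
    rw [dif_pos f.2]
  have h3 : ∀ (t : {f // Γ.IsHead f} → Fin (Module.finrank k A)) (f : {f // Γ.IsHead f}),
      flagVec β H Γ a t (Γ.edge f.1) = dualVec β (t f) := by
    intro t f
    have hne : ¬ Γ.IsHead (Γ.edge f.1) := fun h =>
      (Γ.isHead_edge_iff (IsHead.ne Γ f.2)).1 h f.2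
    have he : Γ.IsHead (Γ.edge (Γ.edge f.1)) := by rw [Γ.edge_edge]; exact f.2
    unfold flagVec
    rw [dif_neg hne, dif_pos he]
    congr 2
    exact Subtype.ext (Γ.edge_edge f.1)
  have h4 : ∀ t l, flagVec β H Γ a t (Γ.leg l) = a l := by
    intro t l
    have e := Γ.edge_leg l
    have hne : ¬ Γ.IsHead (Γ.leg l) := fun h => IsHead.ne Γ h e
    unfold flagVec
    rw [dif_neg hne, dif_neg (by rw [e]; exact hne)]
    simp
  simp only [prod_flags Γ, h2, h3, h4]
  rw [← Finset.sum_mul]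
  unfold coordProd
  congr 1
  rw [← Fintype.piFinset_univ, ← Finset.prod_univ_sum (fun _ => Finset.univ)
    (fun (f : {f // Γ.IsHead f}) t => b.coord (c f.1) (-H (Module.finBasis k A t)) *
      b.coord (c (Γ.edge f.1)) (dualVec β t))]
  unfold edgeProd
  simp only [ord_lt_edge_iff]
  rw [← Finset.prod_filter, ← Finset.prod_subtype_eq_prod_filter, Finset.subtype_univ]
  rfl

theorem coord_piProj (hb : ∀ j, b j ∈ 𝒜 (p j + 1)) (q : ZMod 2) (j : J) (x : A) :
    b.coord j (piProj 𝒜 q x) = if p j = q then b.coord j x else 0 := by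
  unfold piProj
  rw [IsHomotopyAlgebra.coord_parityProj b hb]
  exact if_congr ⟨fun e => add_right_cancel e, fun e => by rw [e]⟩ rfl rfl

/-- The projections with parities `q` select the colourings whose parities are `q`. -/
theorem prod_threeTensor (hb : ∀ j, b j ∈ 𝒜 (p j + 1)) (q : Flag N → ZMod 2) (F : Flag N → A) :
    ∏ v : Fin N, threeTensor 𝒜 β (piProj 𝒜 (q (v, 0)) (F (v, 0))) (piProj 𝒜 (q (v, 1)) (F (v, 1)))
        (piProj 𝒜 (q (v, 2)) (F (v, 2))) =
      ∑ c : Flag N → J, if p ∘ c = q then vertexProd (IsHomotopyAlgebra.vertexCoeff 𝒜 β b) c *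
        ∏ f, b.coord (c f) (F f) else 0 := by
  classical
  have h1 : ∀ x y z, threeTensor 𝒜 β x y z = ∑ u : Fin 3 → J,
      IsHomotopyAlgebra.vertexCoeff 𝒜 β b (u 0) (u 1) (u 2) *
      (b.coord (u 0) x * b.coord (u 1) y * b.coord (u 2) z) := by
    intro x y z
    rw [threeTensor_sum b]
    rw [← Equiv.sum_comp (Fin.consEquiv fun _ : Fin 3 => J), Fintype.sum_prod_type]
    refine Finset.sum_congr rfl fun i _ => ?_
    rw [← Equiv.sum_comp (Fin.consEquiv fun _ : Fin 2 => J), Fintype.sum_prod_type]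
    refine Finset.sum_congr rfl fun j _ => ?_
    rw [← Equiv.sum_comp (Equiv.funUnique (Fin 1) J).symm]
    rfl
  simp only [h1]
  rw [Finset.prod_univ_sum, Fintype.piFinset_univ]
  refine Fintype.sum_equiv (Equiv.curry (Fin N) (Fin 3) J).symm _ _ fun u => ?_
  rw [Finset.prod_mul_distrib]
  have h2 : ∏ v, (b.coord (u v 0) (piProj 𝒜 (q (v, 0)) (F (v, 0))) *
      b.coord (u v 1) (piProj 𝒜 (q (v, 1)) (F (v, 1))) *
      b.coord (u v 2) (piProj 𝒜 (q (v, 2)) (F (v, 2)))) =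
      ∏ f : Flag N, if p (u f.1 f.2) = q f then b.coord (u f.1 f.2) (F f) else 0 := by
    rw [Fintype.prod_prod_type]
    refine Finset.prod_congr rfl fun v _ => ?_
    simp only [Fin.prod_univ_three, coord_piProj b hb]
  rw [h2]
  change _ = if (fun f : Flag N => p (u f.1 f.2)) = q then
    vertexProd (IsHomotopyAlgebra.vertexCoeff 𝒜 β b) (fun f => u f.1 f.2) *
      ∏ f : Flag N, b.coord (u f.1 f.2) (F f) else 0
  split_ifs with hq
  · congr 1
    refine Finset.prod_congr rfl fun f _ => ?_
    rw [if_pos (congrFun hq f)]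
  · obtain ⟨f, hf⟩ := Function.ne_iff.1 hq
    rw [Finset.prod_eq_zero (Finset.mem_univ f) (if_neg hf), mul_zero]

theorem ribbonTensor_eq_weight (hb : ∀ j, b j ∈ 𝒜 (p j + 1)) (Γ : RibbonGraph n N)
    (a : Fin n → A) : ribbonTensor 𝒜 β H Γ a =
      weight p (IsHomotopyAlgebra.vertexCoeff 𝒜 β b) (IsHomotopyAlgebra.pairCoeff β b (-H)) Γ
        (coordProd b a) := by
  classical
  have hk : ∀ q : Flag N → ZMod 2, kexp (fun f => Γ.edgeLegOrder.idxOf f)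
      (fun f => (RibbonGraph.vertexOrder N).idxOf f) q = kexp Γ.ord vpos q := fun q =>
    kexp_congr (fun x y => Iff.rfl) (fun x y => vertexOrder_idxOf_lt_iff x y) q
  unfold ribbonTensor
  simp only [prod_threeTensor b hb]
  unfold weight contr
  rw [Finset.sum_congr rfl fun t _ => Finset.sum_congr rfl fun q _ => Finset.smul_sum,
    Finset.sum_congr rfl fun t _ => Finset.sum_comm, Finset.sum_comm]
  refine Finset.sum_congr rfl fun c _ => ?_
  have h1 : ∀ t : {f // Γ.IsHead f} → Fin (Module.finrank k A), ∑ q : Flag N → ZMod 2,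
      koszulSign (fun f => Γ.edgeLegOrder.idxOf f)
        (fun f => (RibbonGraph.vertexOrder N).idxOf f) q • (if p ∘ c = q then
        vertexProd (IsHomotopyAlgebra.vertexCoeff 𝒜 β b) c *
          ∏ f, b.coord (c f) (flagVec β H Γ a t f) else 0) =
      chi k (kexp Γ.ord vpos (p ∘ c)) * vertexProd (IsHomotopyAlgebra.vertexCoeff 𝒜 β b) c *
        ∏ f, b.coord (c f) (flagVec β H Γ a t f) := by
    intro t
    rw [Finset.sum_eq_single (p ∘ c)]
    · rw [if_pos rfl, koszulSign_smul (k := k), hk, smul_eq_mul, mul_assoc]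
    · intro q _ hq
      rw [if_neg (Ne.symm hq), smul_zero]
    · simp
  rw [Finset.sum_congr rfl fun t _ => h1 t, ← Finset.mul_sum, sum_prod_flagVec]
  ring

end tensor

/-! ### Linearity of the weights -/

section linear

variable {k J : Type*} [Field k] [Fintype J] {p : J → ZMod 2} {μ : J → J → J → k}
  {η : J → J → k} {n m N : ℕ}

theorem weight_smul (Γ : RibbonGraph n N) (c : k) (w : (Fin n → J) → k) :
    weight p μ η Γ (fun d => c * w d) = c * weight p μ η Γ w := by
  unfold weight contr
  rw [Finset.mul_sum]
  exact Finset.sum_congr rfl fun _ _ => by ring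

theorem weight_sum {X : Type*} (S : Finset X) (Γ : RibbonGraph n N) (w : X → (Fin n → J) → k) :
    weight p μ η Γ (fun d => ∑ x ∈ S, w x d) = ∑ x ∈ S, weight p μ η Γ (w x) := by
  unfold weight contr
  simp only [Finset.mul_sum]
  exact Finset.sum_comm

theorem weight_add (Γ : RibbonGraph n N) (w w' : (Fin n → J) → k) :
    weight p μ η Γ (fun d => w d + w' d) = weight p μ η Γ w + weight p μ η Γ w' := by
  unfold weight contr
  rw [← Finset.sum_add_distrib]
  exact Finset.sum_congr rfl fun _ _ => by ring

theorem weight_sub (Γ : RibbonGraph n N) (w w' : (Fin n → J) → k) :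
    weight p μ η Γ (fun d => w d - w' d) = weight p μ η Γ w - weight p μ η Γ w' := by
  unfold weight contr
  rw [← Finset.sum_sub_distrib]
  exact Finset.sum_congr rfl fun _ _ => by ring

/-- In a colouring that contributes, all vertices and all internal edges are even; hence so is the
total parity of the legs. -/
theorem weight_congr_of_even (h : EvenTensors p μ η) (Γ : RibbonGraph n N)
    {w w' : (Fin n → J) → k} (hw : ∀ d, ∑ l, p (d l) = 0 → w d = w' d) :
    weight p μ η Γ w = weight p μ η Γ w' := by
  classical
  unfold weight contr
  refine Finset.sum_congr rfl fun c _ => ?_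
  by_cases hv : vertexProd μ c = 0
  · simp [hv]
  by_cases he : edgeProd η Γ Γ.ord c = 0
  · simp [he]
  rw [hw]
  have h1 : ∑ f : Flag N, p (c f) = 0 := by
    rw [Fintype.sum_prod_type]
    refine Finset.sum_eq_zero fun v _ => ?_
    rw [Fin.sum_univ_three]
    exact vertex_even_of_vertexProd_ne_zero h c hv v
  have h2 := sum_even_of_edge Γ (fun f => Γ.edge f ≠ f) (fun f hf => by
    rw [Γ.edge_edge]; exact hf.symm) (fun f hf => hf) (fun f => p (c f)) fun f _ =>
      edge_even_of_edgeProd_ne_zero h Γ Γ.ord_injective c he f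
  have h3 := Γ.sum_fixed fun f => p (c f)
  have h4 : ∑ f : Flag N, p (c f) = (∑ f, if Γ.edge f ≠ f then p (c f) else 0) +
      ∑ f, if Γ.edge f = f then p (c f) else 0 := by
    rw [← Finset.sum_add_distrib]
    refine Finset.sum_congr rfl fun f _ => ?_
    by_cases hf : Γ.edge f = f <;> simp [hf]
  rw [h1, h2, h3, zero_add] at h4
  exact h4.symm

theorem graphSum_smul (σ : Equiv.Perm (Fin n)) (c : k) (F : RibbonGraph n N → k) :
    graphSum σ (fun Γ => c * F Γ) = c * graphSum σ F := by
  unfold graphSum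
  rw [mul_left_comm, Finset.mul_sum _ _ c]
  congr 1
  refine Finset.sum_congr rfl fun Γ _ => ?_
  split_ifs <;> simp

theorem graphSum_add (σ : Equiv.Perm (Fin n)) (F G : RibbonGraph n N → k) :
    graphSum σ (fun Γ => F Γ + G Γ) = graphSum σ F + graphSum σ G := by
  unfold graphSum
  rw [← mul_add, ← Finset.sum_add_distrib]
  congr 1
  refine Finset.sum_congr rfl fun Γ _ => ?_
  split_ifs <;> simp

theorem graphSum_sum {X : Type*} (S : Finset X) (σ : Equiv.Perm (Fin n))
    (F : X → RibbonGraph n N → k) :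
    graphSum σ (fun Γ => ∑ x ∈ S, F x Γ) = ∑ x ∈ S, graphSum σ (F x) := by
  unfold graphSum
  rw [← Finset.mul_sum]
  congr 1
  rw [Finset.sum_comm]
  refine Finset.sum_congr rfl fun Γ _ => ?_
  split_ifs <;> simp

theorem graphSum_zero (σ : Equiv.Perm (Fin n)) : graphSum σ (fun _ : RibbonGraph n N => (0 : k)) = 0 := by
  simp [graphSum]

theorem graphSum_relabel (h : EvenTensors p μ η) (σ g : Equiv.Perm (Fin n)) (w : (Fin n → J) → k) :
    graphSum (g * σ * g⁻¹) (fun Γ : RibbonGraph n N => weight p μ η Γ w) =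
      graphSum σ (fun Γ : RibbonGraph n N => weight p μ η Γ fun d =>
        chi k (kexp (fun i : Fin n => (i : ℕ)) (fun i => (g i : ℕ)) (p ∘ d)) *
          w (fun i => d (g.symm i))) := by
  classical
  unfold graphSum
  congr 1
  rw [← Equiv.sum_comp (relabelEquiv g)]
  refine Finset.sum_congr rfl fun Γ _ => ?_
  have : relabelEquiv g Γ = relabel g Γ := rfl
  rw [this]
  dsimp only
  rw [weight_relabel h]
  exact if_congr (and_congr relabel_connected_iff relabel_hasBoundary_iff) rfl rfl

/-- A product of sums over ribbon graphs as a sum over pairs of ribbon graphs. -/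
theorem graphSum_mul_graphSum {n₁ n₂ N₁ N₂ : ℕ} (σ₁ : Equiv.Perm (Fin n₁))
    (σ₂ : Equiv.Perm (Fin n₂)) (w₁ : (Fin n₁ → J) → k) (w₂ : (Fin n₂ → J) → k) :
    graphSum σ₁ (fun Γ₁ : RibbonGraph n₁ N₁ => weight p μ η Γ₁ w₁) *
      graphSum σ₂ (fun Γ₂ : RibbonGraph n₂ N₂ => weight p μ η Γ₂ w₂) =
    graphSum σ₁ (fun Γ₁ : RibbonGraph n₁ N₁ => graphSum σ₂ fun Γ₂ : RibbonGraph n₂ N₂ =>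
      weight p μ η Γ₁ fun d₁ => weight p μ η Γ₂ fun d₂ => w₁ d₁ * w₂ d₂) := by
  have : ∀ (Γ₁ : RibbonGraph n₁ N₁) (Γ₂ : RibbonGraph n₂ N₂),
      (weight p μ η Γ₁ fun d₁ => weight p μ η Γ₂ fun d₂ => w₁ d₁ * w₂ d₂) =
        weight p μ η Γ₁ w₁ * weight p μ η Γ₂ w₂ := by
    intro Γ₁ Γ₂
    simp only [weight_smul]
    rw [mul_comm, ← weight_smul]
    congr 1
    funext d₁
    rw [mul_comm]
  simp only [this, graphSum_smul]
  simp only [mul_comm (weight p μ η _ w₁), graphSum_smul]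
  rw [mul_comm]

end linear

/-! ### The coefficients of the sum over ribbon graphs -/

section ribbonSum

variable {k A : Type*} [Field k] [CharZero k] [NonUnitalRing A] [Module k A]
  [IsScalarTower k A A] [SMulCommClass k A A] [FiniteDimensional k A]
  {𝒜 : ZMod 2 → Submodule k A} [DirectSum.Decomposition 𝒜] {β : LinearMap.BilinForm k A}
  {I H P : A →ₗ[k] A} {J : Type*} [Fintype J] (b : Module.Basis J k A) {p : J → ZMod 2}
  {n : ℕ}

variable (𝒜 β H p) in
/-- The sum over the ribbon graphs with `N` vertices, evaluated on letters. -/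
def graphForm (b : Module.Basis J k A) (N : ℕ) (σ : Equiv.Perm (Fin n)) (w : (Fin n → J) → k) : k :=
  graphSum σ fun Γ : RibbonGraph n N => weight p (IsHomotopyAlgebra.vertexCoeff 𝒜 β b)
    (IsHomotopyAlgebra.pairCoeff β b (-H)) Γ w

theorem ribbonTensor_iso (h : IsHomotopyAlgebra 𝒜 β I H P) {N : ℕ} {Γ Γ' : RibbonGraph n N}
    (hi : Γ.Iso Γ') (a : Fin n → A) : ribbonTensor 𝒜 β H Γ a = ribbonTensor 𝒜 β H Γ' a := by
  obtain ⟨_, b, p, hb⟩ := exists_homogeneous_basis 𝒜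
  obtain ⟨g, hg, rfl⟩ := iso_iff.1 hi
  rw [ribbonTensor_eq_weight b hb, ribbonTensor_eq_weight b hb, weight_mapFlags (h.evenTensors b hb) Γ hg]

theorem coeff_ribbonSum (h : IsHomotopyAlgebra 𝒜 β I H P) (hb : ∀ j, b j ∈ 𝒜 (p j + 1))
    (σ : Equiv.Perm (Fin n)) (a : Fin n → LinearMap.range P) (e : ℕ) :
    PowerSeries.coeff e (ribbonSum 𝒜 β H P n σ a) = if 2 ≤ n + 2 * e then
      graphForm 𝒜 β H p b (n + 2 * e - 2) σ (coordProd b fun l => (a l : A)) else 0 := by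
  unfold ribbonSum
  rw [PowerSeries.coeff_mk, finsum_isoClass σ
    (F := fun N Γ => ribbonTensor 𝒜 β H Γ fun l => (a l : A))
    (fun N Γ Γ' hi => ribbonTensor_iso h hi _)]
  unfold graphForm
  simp only [ribbonTensor_eq_weight b hb]

theorem coeff_ribbonSum_of_eq (h : IsHomotopyAlgebra 𝒜 β I H P) (hb : ∀ j, b j ∈ 𝒜 (p j + 1))
    (σ : Equiv.Perm (Fin n)) (a : Fin n → LinearMap.range P) {e N : ℕ} (hN : N + 2 = n + 2 * e) :
    PowerSeries.coeff e (ribbonSum 𝒜 β H P n σ a) =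
      graphForm 𝒜 β H p b N σ (coordProd b fun l => (a l : A)) := by
  obtain rfl : N = n + 2 * e - 2 := by omega
  rw [coeff_ribbonSum b h hb, if_pos (by omega)]

theorem coordProd_update_add (a : Fin n → A) (i : Fin n) (x y : A) (d : Fin n → J) :
    coordProd b (Function.update a i (x + y)) d = coordProd b (Function.update a i x) d +
      coordProd b (Function.update a i y) d :=
  MultilinearMap.map_update_add ((MultilinearMap.mkPiAlgebra k (Fin n) k).compLinearMap
    fun l => b.coord (d l)) a i x y

theorem coordProd_update_smul (a : Fin n → A) (i : Fin n) (c : k) (x : A) (d : Fin n → J) :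
    coordProd b (Function.update a i (c • x)) d = c * coordProd b (Function.update a i x) d :=
  MultilinearMap.map_update_smul ((MultilinearMap.mkPiAlgebra k (Fin n) k).compLinearMap
    fun l => b.coord (d l)) a i c x

namespace IsHomotopyAlgebra

theorem P_mem (h : IsHomotopyAlgebra 𝒜 β I H P) {i : ZMod 2} {x : A} (hx : x ∈ 𝒜 i) : P x ∈ 𝒜 i := by
  rw [← h.proj]
  have h1 := h.I_odd _ _ (h.H_odd i x hx)
  have h2 := h.H_odd _ _ (h.I_odd i x hx)
  rw [zmod_two_add_add] at h1 h2
  exact (𝒜 i).sub_mem hx ((𝒜 i).add_mem h1 h2)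

theorem P_coe (h : IsHomotopyAlgebra 𝒜 β I H P) (x : LinearMap.range P) : P (x : A) = x := by
  obtain ⟨x, y, rfl⟩ := x
  exact LinearMap.congr_fun h.idem y

theorem coe_piProjRange (h : IsHomotopyAlgebra 𝒜 β I H P) (q : ZMod 2) (x : LinearMap.range P) :
    (piProjRange 𝒜 P q x : A) = piProj 𝒜 q x := by
  obtain ⟨_, b, p, hb⟩ := exists_homogeneous_basis 𝒜
  have key : P ∘ₗ piProj 𝒜 q = piProj 𝒜 q ∘ₗ P := by
    refine b.ext fun j => ?_
    simp only [LinearMap.comp_apply, piProj]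
    by_cases hj : p j + 1 = q + 1
    · rw [parityProj_of_mem 𝒜 (hj ▸ hb j), parityProj_of_mem 𝒜 (hj ▸ h.P_mem (hb j))]
    · rw [parityProj_of_mem_ne 𝒜 (hb j) hj, parityProj_of_mem_ne 𝒜 (h.P_mem (hb j)) hj, map_zero]
  have := LinearMap.congr_fun key (x : A)
  simp only [LinearMap.comp_apply, h.P_coe] at this
  exact this

/-- `I² H = H I²` makes `I` commute with `[I, H]`, hence with `P`, so `I` preserves the image of
`P`. -/
theorem coe_onRange_I (h : IsHomotopyAlgebra 𝒜 β I H P) (x : LinearMap.range P) :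
    (onRange P I x : A) = I x := by
  have key : P ∘ₗ I = I ∘ₗ P := by
    have := h.comm
    rw [← h.proj]
    ext y
    have := LinearMap.congr_fun this y
    simp only [LinearMap.comp_apply, LinearMap.sub_apply, LinearMap.add_apply, LinearMap.id_apply,
      map_sub, map_add] at this ⊢
    rw [this]
    abel
  have := LinearMap.congr_fun key (x : A)
  simp only [LinearMap.comp_apply, h.P_coe] at this
  exact this

end IsHomotopyAlgebra

theorem coordProd_ne_zero (h : IsHomotopyAlgebra 𝒜 β I H P) (hb : ∀ j, b j ∈ 𝒜 (p j + 1))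
    {a : Fin n → LinearMap.range P} {q : Fin n → ZMod 2}
    (hq : ∀ i, piProjRange 𝒜 P (q i) (a i) = a i) {d : Fin n → J}
    (hd : coordProd b (fun l => (a l : A)) d ≠ 0) : p ∘ d = q := by
  funext l
  have h1 := Finset.prod_ne_zero_iff.1 hd l (Finset.mem_univ l)
  dsimp only at h1
  rw [← hq l, h.coe_piProjRange, coord_piProj b hb] at h1
  by_contra hne
  exact h1 (if_neg hne)

/-- Multilinearity comes from the coordinates of the letters, equivariance from renumbering the legs
of all graphs, and evenness from `weight_congr_of_even`. -/
theorem isEvenCyclicForm_ribbonSum (h : IsHomotopyAlgebra 𝒜 β I H P) :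
    IsEvenCyclicForm (piProjRange 𝒜 P) (ribbonSum 𝒜 β H P) := by
  obtain ⟨_, b, p, hb⟩ := exists_homogeneous_basis 𝒜
  have hE := h.evenTensors b hb
  have hup : ∀ {n : ℕ} (a : Fin n → LinearMap.range P) (i : Fin n) (x : LinearMap.range P),
      (fun l => ((Function.update a i x l : LinearMap.range P) : A)) =
        Function.update (fun l => (a l : A)) i x := by
    intro n a i x
    funext l
    by_cases hl : l = i
    · subst hl; simp
    · simp [hl]
  refine ⟨fun n σ => ?_, fun n σ g a q hq => ?_, fun n σ a q hq hs => ?_⟩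
  · refine ⟨⟨ribbonSum 𝒜 β H P n σ, ?_, ?_⟩, fun a => rfl⟩
    · intro inst a i x y
      obtain rfl := Subsingleton.elim inst (instDecidableEqFin n)
      ext e
      rw [map_add]
      simp only [coeff_ribbonSum b h hb, hup, Submodule.coe_add]
      split_ifs
      · unfold graphForm
        rw [← graphSum_add]
        congr 1
        funext Γ
        rw [← weight_add]
        congr 1
        exact funext fun d => coordProd_update_add b _ i _ _ d
      · simp
    · intro inst a i c x
      obtain rfl := Subsingleton.elim inst (instDecidableEqFin n)
      ext e
      simp only [PowerSeries.coeff_smul, coeff_ribbonSum b h hb, hup, Submodule.coe_smul]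
      split_ifs
      · unfold graphForm
        have : coordProd b (Function.update (fun l => (a l : A)) i (c • (x : A))) =
            fun d => c * coordProd b (Function.update (fun l => (a l : A)) i x) d :=
          funext fun d => coordProd_update_smul b _ i c x d
        simp only [this, weight_smul, graphSum_smul, smul_eq_mul]
      · simp
  · ext e
    rw [koszulSign_smul (k := k), PowerSeries.coeff_smul, coeff_ribbonSum b h hb, coeff_ribbonSum b h hb]
    split_ifs
    · unfold graphForm
      rw [graphSum_relabel hE, smul_eq_mul, ← graphSum_smul]
      congr 1
      funext Γ
      rw [← weight_smul]
      congr 1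
      funext d
      have h1 : coordProd b (fun l => (a (g⁻¹ l) : A)) (fun i => d (g.symm i)) =
          coordProd b (fun l => (a l : A)) d :=
        Equiv.prod_comp g.symm fun l => b.coord (d l) (a l : A)
      rw [h1]
      by_cases hd : coordProd b (fun l => (a l : A)) d = 0
      · rw [hd, mul_zero, mul_zero]
      · rw [coordProd_ne_zero b h hb hq hd]
    · simp
  · ext e
    rw [coeff_ribbonSum b h hb, map_zero]
    split_ifs
    · unfold graphForm
      rw [← graphSum_zero σ]
      congr 1
      funext Γ
      have := weight_smul (p := p) (μ := IsHomotopyAlgebra.vertexCoeff 𝒜 β b)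
        (η := IsHomotopyAlgebra.pairCoeff β b (-H)) Γ 0 fun _ => 0
      simp only [mul_zero, zero_mul] at this
      rw [← this]
      refine weight_congr_of_even hE Γ fun d hd => ?_
      by_contra hne
      rw [← coordProd_ne_zero b h hb hq hne] at hs
      simp only [Function.comp_apply] at hs
      rw [hd] at hs
      exact zero_ne_one hs
    · rfl

end ribbonSum

/-! ### The coefficients of the terms of the equation -/

theorem chi_sum {k X : Type*} [Field k] (S : Finset X) (q : X → ZMod 2) :
    chi k (∑ x ∈ S, q x) = ∏ x ∈ S, chi k (q x) := by
  simp [chi, sgn_sum]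

/-- In the sum over `q` only the parities of the given colours survive, so the sign of `tensorAt`
becomes that of `shuffle`. -/
theorem sum_chi_prod {k J : Type*} [Field k] {p : J → ZMod 2} {m n₁ n₂ : ℕ} (e : Fin n₁ ⊕ Fin n₂ ≃ Fin m) (u : Fin m → J → k)
    (d₁ : Fin n₁ → J) (d₂ : Fin n₂ → J) :
    ∑ q : Fin m → ZMod 2, chi k (kexp (fun i : Fin m => (i : ℕ))
        (fun i : Fin m => (finSumFinEquiv (e.symm i) : ℕ)) q) *
      ((∏ i, if p (d₁ i) = q (e (Sum.inl i)) then u (e (Sum.inl i)) (d₁ i) else 0) *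
        ∏ i, if p (d₂ i) = q (e (Sum.inr i)) then u (e (Sum.inr i)) (d₂ i) else 0) =
      shuffle p e (fun D => ∏ i, u i (D i)) d₁ d₂ := by
  classical
  set D : Fin m → J := Sum.elim d₁ d₂ ∘ e.symm with hD
  have key : ∀ q : Fin m → ZMod 2,
      (∏ i, if p (d₁ i) = q (e (Sum.inl i)) then u (e (Sum.inl i)) (d₁ i) else 0) *
        (∏ i, if p (d₂ i) = q (e (Sum.inr i)) then u (e (Sum.inr i)) (d₂ i) else 0) =
      if p ∘ D = q then ∏ i, u i (D i) else 0 := by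
    intro q
    have h1 : (∏ i, if p (d₁ i) = q (e (Sum.inl i)) then u (e (Sum.inl i)) (d₁ i) else 0) *
        (∏ i, if p (d₂ i) = q (e (Sum.inr i)) then u (e (Sum.inr i)) (d₂ i) else 0) =
        ∏ i : Fin m, if p (D i) = q i then u i (D i) else 0 := by
      rw [← e.prod_comp, Fintype.prod_sum_type]
      simp only [hD, Function.comp_apply, Equiv.symm_apply_apply, Sum.elim_inl, Sum.elim_inr]
    rw [h1]
    by_cases hq : p ∘ D = q
    · subst hq
      simp
    · rw [if_neg hq]
      obtain ⟨i, hi⟩ := Function.ne_iff.1 hq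
      exact Finset.prod_eq_zero (Finset.mem_univ i) (if_neg hi)
  simp only [key, mul_ite, mul_zero]
  rw [Finset.sum_ite_eq Finset.univ (p ∘ D), if_pos (Finset.mem_univ _)]
  rfl

/-! ### The three terms of the equation, for a fixed power of `ħ`. -/

section coefficients

variable {k A : Type*} [Field k] [CharZero k] [NonUnitalRing A] [Module k A]
  [IsScalarTower k A A] [SMulCommClass k A A] [FiniteDimensional k A]
  {𝒜 : ZMod 2 → Submodule k A} [DirectSum.Decomposition 𝒜] {β : LinearMap.BilinForm k A}
  {I H P : A →ₗ[k] A} {J : Type*} [Fintype J] (b : Module.Basis J k A) {p : J → ZMod 2}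
  {n m N : ℕ}

theorem graphForm_sum {X : Type*} (S : Finset X) (σ : Equiv.Perm (Fin n))
    (w : X → (Fin n → J) → k) : graphForm 𝒜 β H p b N σ (fun d => ∑ x ∈ S, w x d) =
      ∑ x ∈ S, graphForm 𝒜 β H p b N σ (w x) := by
  unfold graphForm
  simp only [weight_sum, graphSum_sum]

theorem graphForm_eq_zero {σ : Equiv.Perm (Fin n)} (hN : ∀ g : ℕ, N + 2 ≠ n + 2 * g)
    (w : (Fin n → J) → k) : graphForm 𝒜 β H p b N σ w = 0 := graphSum_eq_zero hN

/-- By `casimir_restrict` the inverse tensor on `B` is the inverse tensor on `A` with `P` applied at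
one end, so its coordinates are those of `P`. -/
theorem sum_coordProd_insert (h : IsHomotopyAlgebra 𝒜 β I H P) (hb : ∀ j, b j ∈ 𝒜 (p j + 1))
    (a : Fin n → LinearMap.range P) (d : Fin (n + 2) → J) :
    ∑ i, coordProd b (fun l => ((Matrix.vecCons (Module.finBasis k (LinearMap.range P) i)
      (Matrix.vecCons (dualVec (β.restrict (LinearMap.range P)) i) a) l : LinearMap.range P) : A)) d =
      insertTwo (IsHomotopyAlgebra.pairCoeff β b P) (coordProd b fun l => (a l : A)) d := by
  have := casimir_restrict h.nondeg h.symm h.idem (h.proj_adjoint b hb)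
    (restrict_nondegenerate h.nondeg h.symm h.idem (h.proj_adjoint b hb)) (h.symm.restrict _)
    (b.coord (d 0)) (b.coord (d 1))
  unfold insertTwo IsHomotopyAlgebra.pairCoeff
  rw [← this]
  unfold casimir
  rw [Finset.sum_mul]
  refine Finset.sum_congr rfl fun i _ => ?_
  unfold coordProd
  rw [Fin.prod_univ_succ, Fin.prod_univ_succ, mul_assoc]
  rfl

theorem coeff_sum_ribbonSum_insert (h : IsHomotopyAlgebra 𝒜 β I H P)
    (hb : ∀ j, b j ∈ 𝒜 (p j + 1)) (σ : Equiv.Perm (Fin (n + 2))) (a : Fin n → LinearMap.range P)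
    {e : ℕ} (hN : N + 2 = n + 2 + 2 * e) :
    ∑ i, PowerSeries.coeff e (ribbonSum 𝒜 β H P (n + 2) σ
      (Matrix.vecCons (Module.finBasis k (LinearMap.range P) i)
        (Matrix.vecCons (dualVec (β.restrict (LinearMap.range P)) i) a))) =
      graphForm 𝒜 β H p b N σ
        (insertTwo (IsHomotopyAlgebra.pairCoeff β b P) (coordProd b fun l => (a l : A))) := by
  simp only [coeff_ribbonSum_of_eq b h hb _ _ hN]
  rw [← graphForm_sum]
  congr 1
  exact funext fun d => sum_coordProd_insert b h hb a d

open Classical in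
-- Two more letters and one power of `ħ` less leave the number `N` of vertices unchanged.
theorem coeff_bvDelta (h : IsHomotopyAlgebra 𝒜 β I H P) (hb : ∀ j, b j ∈ 𝒜 (p j + 1))
    (σ : Equiv.Perm (Fin n)) (a : Fin n → LinearMap.range P) {e : ℕ} (hN : N + 2 = n + 2 * e) :
    PowerSeries.coeff e ((PowerSeries.X : k⟦X⟧) *
        bvDelta (β.restrict (LinearMap.range P)) (ribbonSum 𝒜 β H P) n σ a) =
      2⁻¹ * ∑ σ' : Equiv.Perm (Fin (n + 2)), if GluesTo σ' σ then
        graphForm 𝒜 β H p b N σ'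
          (insertTwo (IsHomotopyAlgebra.pairCoeff β b P) (coordProd b fun l => (a l : A))) else 0 := by
  cases e with
  | zero =>
    rw [PowerSeries.coeff_zero_X_mul, Finset.sum_eq_zero, mul_zero]
    intro σ' _
    -- Here `N + 2 = n`, too few vertices for a connected graph with `n + 2` legs.
    rw [graphForm_eq_zero b (by omega), ite_self]
  | succ e =>
    rw [PowerSeries.coeff_succ_X_mul]
    unfold bvDelta
    rw [PowerSeries.coeff_smul, smul_eq_mul, map_sum]
    congr 1
    refine Finset.sum_congr rfl fun σ' _ => ?_
    split_ifs
    · rw [map_sum, coeff_sum_ribbonSum_insert b h hb σ' a (N := N) (by omega)]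
    · exact map_zero _

/-- Reindexing of a product of two sums over the powers of `ħ` by numbers of vertices. -/
theorem sum_antidiagonal_eq {n₁ n₂ e : ℕ} (hN : N + 4 = n₁ + n₂ + 2 * e) {G₁ G₂ : ℕ → k}
    (h₁ : ∀ N₁, (∀ g, N₁ + 2 ≠ n₁ + 2 * g) → G₁ N₁ = 0)
    (h₂ : ∀ N₂, (∀ g, N₂ + 2 ≠ n₂ + 2 * g) → G₂ N₂ = 0) :
    ∑ y ∈ Finset.HasAntidiagonal.antidiagonal e,
      (if 2 ≤ n₁ + 2 * y.1 then G₁ (n₁ + 2 * y.1 - 2) else 0) *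
        (if 2 ≤ n₂ + 2 * y.2 then G₂ (n₂ + 2 * y.2 - 2) else 0) =
      ∑ y ∈ Finset.HasAntidiagonal.antidiagonal N, G₁ y.1 * G₂ y.2 := by
  have hle : ∀ y : ℕ × ℕ, (if 2 ≤ n₁ + 2 * y.1 then G₁ (n₁ + 2 * y.1 - 2) else 0) *
        (if 2 ≤ n₂ + 2 * y.2 then G₂ (n₂ + 2 * y.2 - 2) else 0) ≠ 0 →
      2 ≤ n₁ + 2 * y.1 ∧ 2 ≤ n₂ + 2 * y.2 := by
    intro y hy
    constructor
    · by_contra hc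
      exact hy (by rw [if_neg hc, zero_mul])
    · by_contra hc
      exact hy (by rw [if_neg hc, mul_zero])
  refine Finset.sum_bij_ne_zero (fun y _ _ => (n₁ + 2 * y.1 - 2, n₂ + 2 * y.2 - 2)) ?_ ?_ ?_ ?_
  · intro y hy hne
    have := hle y hne
    rw [Finset.HasAntidiagonal.mem_antidiagonal] at hy ⊢
    dsimp only
    omega
  · intro y _ hne z _ hne' hyz
    have := hle y hne
    have := hle z hne'
    rw [Prod.mk.injEq] at hyz
    ext <;> omega
  · intro y hy hne
    rw [Finset.HasAntidiagonal.mem_antidiagonal] at hy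
    obtain ⟨g₁, hg₁⟩ : ∃ g, y.1 + 2 = n₁ + 2 * g := by
      by_contra! hc
      exact hne (by rw [h₁ _ hc, zero_mul])
    obtain ⟨g₂, hg₂⟩ : ∃ g, y.2 + 2 = n₂ + 2 * g := by
      by_contra! hc
      exact hne (by rw [h₂ _ hc, mul_zero])
    have e₁ : n₁ + 2 * g₁ - 2 = y.1 := by omega
    have e₂ : n₂ + 2 * g₂ - 2 = y.2 := by omega
    refine ⟨(g₁, g₂), ?_, ?_, ?_⟩
    · rw [Finset.HasAntidiagonal.mem_antidiagonal]
      dsimp only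
      omega
    · dsimp only
      rw [if_pos (by omega), if_pos (by omega), e₁, e₂]
      exact hne
    · dsimp only
      rw [e₁, e₂]
  · intro y _ hne
    have := hle y hne
    rw [if_pos this.1, if_pos this.2]

/-- The relations `N₁ + 2 = n₁ + 2 * e₁` and `N₂ + 2 = n₂ + 2 * e₂` add up to `N + 4 = m + 2 * e`,
so splitting the power of `ħ` amounts to splitting the number of vertices. -/
theorem coeff_tensorAt (h : IsHomotopyAlgebra 𝒜 β I H P) (hb : ∀ j, b j ∈ 𝒜 (p j + 1))
    (T : Finset (Fin m)) (σ₁ : Equiv.Perm (Fin T.card)) (σ₂ : Equiv.Perm (Fin Tᶜ.card))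
    (x : Fin m → LinearMap.range P) {e : ℕ} (hN : N + 4 = m + 2 * e) :
    PowerSeries.coeff e (tensorAt (piProjRange 𝒜 P) (ribbonSum 𝒜 β H P) (ribbonSum 𝒜 β H P)
        T σ₁ σ₂ x) =
      ∑ y ∈ Finset.HasAntidiagonal.antidiagonal N,
        graphSum σ₁ (fun Γ₁ : RibbonGraph T.card y.1 =>
          graphSum σ₂ fun Γ₂ : RibbonGraph Tᶜ.card y.2 =>
            weight p (IsHomotopyAlgebra.vertexCoeff 𝒜 β b)
              (IsHomotopyAlgebra.pairCoeff β b (-H)) Γ₁ fun d₁ =>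
            weight p (IsHomotopyAlgebra.vertexCoeff 𝒜 β b)
              (IsHomotopyAlgebra.pairCoeff β b (-H)) Γ₂
              (shuffle p (blockEquiv T) (coordProd b fun l => (x l : A)) d₁)) := by
  have hm : T.card + Tᶜ.card = m := by
    rw [Finset.card_add_card_compl, Fintype.card_fin]
  unfold tensorAt
  rw [map_sum]
  simp only [koszulSign_smul (k := k), PowerSeries.coeff_smul, PowerSeries.coeff_mul,
    coeff_ribbonSum b h hb]
  have h1 : ∀ q : Fin m → ZMod 2, _ := fun q => sum_antidiagonal_eq (k := k)
    (n₁ := T.card) (n₂ := Tᶜ.card) (N := N) (e := e) (by omega)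
    (G₁ := fun N₁ => graphForm 𝒜 β H p b N₁ σ₁ (coordProd b fun i =>
      (piProjRange 𝒜 P (q (blockEquiv T (Sum.inl i))) (x (blockEquiv T (Sum.inl i))) : A)))
    (G₂ := fun N₂ => graphForm 𝒜 β H p b N₂ σ₂ (coordProd b fun i =>
      (piProjRange 𝒜 P (q (blockEquiv T (Sum.inr i))) (x (blockEquiv T (Sum.inr i))) : A)))
    (fun N₁ hN₁ => graphForm_eq_zero b hN₁ _) (fun N₂ hN₂ => graphForm_eq_zero b hN₂ _)
  simp only [h1, Finset.smul_sum]
  rw [Finset.sum_comm]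
  refine Finset.sum_congr rfl fun y _ => ?_
  unfold graphForm
  simp only [graphSum_mul_graphSum, smul_eq_mul]
  simp only [← graphSum_smul, ← weight_smul]
  rw [← graphSum_sum]
  congr 1
  funext Γ₁
  rw [← graphSum_sum]
  congr 1
  funext Γ₂
  rw [← weight_sum]
  congr 1
  funext d₁
  rw [← weight_sum]
  congr 1
  funext d₂
  have h2 := sum_chi_prod (p := p) (blockEquiv T) (fun i j => b.coord j (x i : A)) d₁ d₂
  simp only [coordProd, h.coe_piProjRange, coord_piProj b hb]
  exact h2

/-- One of the two blocks then has `nᵢ + 2 * eᵢ < 2`, and its coefficient is zero. -/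
theorem coeff_tensorAt_of_lt (h : IsHomotopyAlgebra 𝒜 β I H P) (T : Finset (Fin m))
    (σ₁ : Equiv.Perm (Fin T.card)) (σ₂ : Equiv.Perm (Fin Tᶜ.card))
    (x : Fin m → LinearMap.range P) {e : ℕ} (hN : m + 2 * e < 4) :
    PowerSeries.coeff e (tensorAt (piProjRange 𝒜 P) (ribbonSum 𝒜 β H P) (ribbonSum 𝒜 β H P)
        T σ₁ σ₂ x) = 0 := by
  obtain ⟨_, b, p, hb⟩ := exists_homogeneous_basis 𝒜
  have hm : T.card + Tᶜ.card = m := by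
    rw [Finset.card_add_card_compl, Fintype.card_fin]
  unfold tensorAt
  rw [map_sum]
  refine Finset.sum_eq_zero fun q _ => ?_
  rw [koszulSign_smul (k := k), PowerSeries.coeff_smul, PowerSeries.coeff_mul,
    Finset.sum_eq_zero, smul_zero]
  intro y hy
  rw [Finset.HasAntidiagonal.mem_antidiagonal] at hy
  rw [coeff_ribbonSum b h hb, coeff_ribbonSum b h hb]
  by_cases h1 : 2 ≤ T.card + 2 * y.1
  · rw [if_neg (c := 2 ≤ Tᶜ.card + 2 * y.2) (by omega), mul_zero]
  · rw [if_neg h1, zero_mul]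

open Classical in
theorem coeff_bvBracket (h : IsHomotopyAlgebra 𝒜 β I H P) (hb : ∀ j, b j ∈ 𝒜 (p j + 1))
    (σ : Equiv.Perm (Fin n)) (a : Fin n → LinearMap.range P) {e : ℕ} (hN : N + 2 = n + 2 * e) :
    PowerSeries.coeff e (bvBracket (piProjRange 𝒜 P) (β.restrict (LinearMap.range P))
        (ribbonSum 𝒜 β H P) (ribbonSum 𝒜 β H P) n σ a) =
      ∑ T : Finset (Fin (n + 2)), if 0 ∈ T ∧ 1 ∉ T then
        ∑ σ₁ : Equiv.Perm (Fin T.card), ∑ σ₂ : Equiv.Perm (Fin Tᶜ.card),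
          if GluesTo ((blockEquiv T).permCongr (Equiv.Perm.sumCongr σ₁ σ₂)) σ then
            ∑ y ∈ Finset.HasAntidiagonal.antidiagonal N,
              graphSum σ₁ (fun Γ₁ : RibbonGraph T.card y.1 =>
                graphSum σ₂ fun Γ₂ : RibbonGraph Tᶜ.card y.2 =>
                  weight p (IsHomotopyAlgebra.vertexCoeff 𝒜 β b)
                    (IsHomotopyAlgebra.pairCoeff β b (-H)) Γ₁ fun d₁ =>
                  weight p (IsHomotopyAlgebra.vertexCoeff 𝒜 β b)
                    (IsHomotopyAlgebra.pairCoeff β b (-H)) Γ₂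
                    (shuffle p (blockEquiv T) (insertTwo (IsHomotopyAlgebra.pairCoeff β b P)
                      (coordProd b fun l => (a l : A))) d₁)) else 0 else 0 := by
  unfold bvBracket
  rw [map_sum]
  refine Finset.sum_congr rfl fun T _ => ?_
  rw [apply_ite (PowerSeries.coeff e), map_zero]
  refine if_congr Iff.rfl ?_ rfl
  rw [map_sum]
  refine Finset.sum_congr rfl fun σ₁ _ => ?_
  rw [map_sum]
  refine Finset.sum_congr rfl fun σ₂ _ => ?_
  rw [apply_ite (PowerSeries.coeff e), map_zero]
  refine if_congr Iff.rfl ?_ rfl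
  rw [map_sum]
  simp only [coeff_tensorAt b h hb T σ₁ σ₂ _ (show N + 4 = n + 2 + 2 * e by omega)]
  rw [Finset.sum_comm]
  refine Finset.sum_congr rfl fun y _ => ?_
  rw [← graphSum_sum]
  congr 1
  funext Γ₁
  rw [← graphSum_sum]
  congr 1
  funext Γ₂
  rw [← weight_sum]
  congr 1
  funext d₁
  rw [← weight_sum]
  congr 1
  funext d₂
  unfold shuffle
  rw [← Finset.mul_sum, sum_coordProd_insert b h hb]

theorem coord_parityInv_range (h : IsHomotopyAlgebra 𝒜 β I H P) (hb : ∀ j, b j ∈ 𝒜 (p j + 1))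
    (j : J) (x : LinearMap.range P) :
    b.coord j (parityInv (piProjRange 𝒜 P) x : A) = chi k (p j) * b.coord j (x : A) := by
  unfold parityInv
  rw [LinearMap.sub_apply, Submodule.coe_sub, map_sub, h.coe_piProjRange, h.coe_piProjRange,
    coord_piProj b hb, coord_piProj b hb]
  rcases zmod_two_cases (p j) with hj | hj
  · rw [hj, if_pos rfl, if_neg (by decide), sub_zero, chi_zero, one_mul]
  · rw [hj, if_pos rfl, if_neg (by decide), zero_sub, chi_one, neg_one_mul]

theorem sum_coordProd_dualAction (h : IsHomotopyAlgebra 𝒜 β I H P)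
    (hb : ∀ j, b j ∈ 𝒜 (p j + 1)) (a : Fin n → LinearMap.range P) (d : Fin n → J) :
    ∑ l, coordProd b (fun j => ((if j < l then parityInv (piProjRange 𝒜 P) (a j) else
        if j = l then onRange P I (a j) else a j : LinearMap.range P) : A)) d =
      legAct p (IsHomotopyAlgebra.opCoeff b I) (coordProd b fun l => (a l : A)) d := by
  unfold legAct
  refine Finset.sum_congr rfl fun l _ => ?_
  have h1 : ∀ i : J, ∀ x : A, b.coord i (I x) =
      ∑ j, IsHomotopyAlgebra.opCoeff b I i j * b.coord j x := by
    intro i x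
    conv_lhs => rw [← b.sum_repr x]
    simp only [map_sum, map_smul, smul_eq_mul]
    exact Finset.sum_congr rfl fun j _ => mul_comm _ _
  have h2 : ∀ j, coordProd b (fun l => (a l : A)) (Function.update d l j) =
      b.coord j (a l : A) * ∏ i ∈ Finset.univ.erase l, b.coord (d i) (a i : A) := by
    intro j
    unfold coordProd
    rw [← Finset.mul_prod_erase _ _ (Finset.mem_univ l), Function.update_self]
    congr 1
    refine Finset.prod_congr rfl fun i hi => ?_
    rw [Function.update_of_ne (Finset.ne_of_mem_erase hi)]
  simp only [h2, ← mul_assoc]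
  rw [← Finset.sum_mul, ← h1, chi_sum]
  unfold coordProd
  rw [← Finset.mul_prod_erase _ _ (Finset.mem_univ l)]
  dsimp only
  rw [if_neg (lt_irrefl l), if_pos rfl, h.coe_onRange_I, ← Finset.mul_prod_erase _ (fun i => chi k (if i < l then p (d i) else 0))
      (Finset.mem_univ l), if_neg (lt_irrefl l), chi_zero, one_mul, mul_left_comm,
    ← Finset.prod_mul_distrib]
  congr 1
  refine Finset.prod_congr rfl fun i hi => ?_
  by_cases hil : i < l
  · rw [if_pos hil, if_pos hil, coord_parityInv_range b h hb]
  · rw [if_neg hil, if_neg hil, if_neg (Finset.ne_of_mem_erase hi), chi_zero, one_mul]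

theorem coeff_dualAction (h : IsHomotopyAlgebra 𝒜 β I H P) (hb : ∀ j, b j ∈ 𝒜 (p j + 1))
    (σ : Equiv.Perm (Fin n)) (a : Fin n → LinearMap.range P) {e : ℕ} (hN : N + 2 = n + 2 * e) :
    PowerSeries.coeff e (dualAction (piProjRange 𝒜 P) (onRange P I) (ribbonSum 𝒜 β H P) n σ a) =
      graphForm 𝒜 β H p b N σ
        (legAct p (IsHomotopyAlgebra.opCoeff b I) (coordProd b fun l => (a l : A))) := by
  unfold dualAction
  rw [map_sum]
  simp only [coeff_ribbonSum_of_eq b h hb _ _ hN]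
  rw [← graphForm_sum]
  congr 1
  exact funext fun d => sum_coordProd_dualAction b h hb a d

open Classical in
-- The action of `I` on the legs inserts `[I, H] = Id - P` at a glued pair of legs; the `Id` part
-- vanishes by `sum_weight_flip`.
theorem graphForm_legAct (h : IsHomotopyAlgebra 𝒜 β I H P) (hb : ∀ j, b j ∈ 𝒜 (p j + 1))
    (σ : Equiv.Perm (Fin n)) (w : (Fin n → J) → k) :
    graphForm 𝒜 β H p b N σ (legAct p (IsHomotopyAlgebra.opCoeff b I) w) =
      -(2⁻¹ * (((N.factorial * 3 ^ N : ℕ) : k)⁻¹ * ∑ Γ : RibbonGraph (n + 2) N,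
        (if (glue Γ).Contributes σ then weight p (IsHomotopyAlgebra.vertexCoeff 𝒜 β b)
          (IsHomotopyAlgebra.pairCoeff β b (-H)) Γ
          (insertTwo (IsHomotopyAlgebra.pairCoeff β b P) w) else 0))) := by
  have hE := h.evenTensors b hb
  have hT : ∀ i, ∀ a ∈ 𝒜 i, (I ∘ₗ H + H ∘ₗ I) a ∈ 𝒜 i := by
    intro i a ha
    have h1 := h.I_odd _ _ (h.H_odd i a ha)
    have h2 := h.H_odd _ _ (h.I_odd i a ha)
    rw [zmod_two_add_add] at h1 h2
    exact (𝒜 i).add_mem h1 h2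
  have hsub : ∀ i j, IsHomotopyAlgebra.pairCoeff β b (I ∘ₗ H + H ∘ₗ I) i j =
      IsHomotopyAlgebra.pairCoeff β b LinearMap.id i j - IsHomotopyAlgebra.pairCoeff β b P i j := by
    intro i j
    have e1 : I ∘ₗ H + H ∘ₗ I = LinearMap.id + -P := by rw [← h.proj]; abel
    rw [e1]
    unfold IsHomotopyAlgebra.pairCoeff
    rw [LinearMap.comp_add, casimir_add_left, LinearMap.comp_neg, casimir_neg_left, sub_eq_add_neg]
  have hins : insertTwo (IsHomotopyAlgebra.pairCoeff β b (I ∘ₗ H + H ∘ₗ I)) w =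
      fun d => insertTwo (IsHomotopyAlgebra.pairCoeff β b LinearMap.id) w d -
        insertTwo (IsHomotopyAlgebra.pairCoeff β b P) w d := by
    funext d
    unfold insertTwo
    rw [hsub, sub_mul]
  have hflip := sum_weight_flip (N := N) hE (h.pairCoeff_id_odd b hb) (h.fourTensor_anti b hb) σ w
  have hleg := sum_weight_legAct (N := N) hE (h.vertexDerivation b hb) (h.pairCoeff_comm b hb)
    (h.pairCoeff_odd b hb hT) (h.pairCoeff_symm b (h.comm_adjoint b hb)) σ w
  unfold graphForm graphSum
  rw [hleg, hins]
  have hs : ∀ Γ : RibbonGraph (n + 2) N, (if (glue Γ).Contributes σ then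
        weight p (IsHomotopyAlgebra.vertexCoeff 𝒜 β b) (IsHomotopyAlgebra.pairCoeff β b (-H)) Γ
          (fun d => insertTwo (IsHomotopyAlgebra.pairCoeff β b LinearMap.id) w d -
            insertTwo (IsHomotopyAlgebra.pairCoeff β b P) w d) else 0) =
      (if (glue Γ).Contributes σ then
        weight p (IsHomotopyAlgebra.vertexCoeff 𝒜 β b) (IsHomotopyAlgebra.pairCoeff β b (-H)) Γ
          (insertTwo (IsHomotopyAlgebra.pairCoeff β b LinearMap.id) w) else 0) -
      (if (glue Γ).Contributes σ then
        weight p (IsHomotopyAlgebra.vertexCoeff 𝒜 β b) (IsHomotopyAlgebra.pairCoeff β b (-H)) Γ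
          (insertTwo (IsHomotopyAlgebra.pairCoeff β b P) w) else 0) := by
    intro Γ
    split_ifs
    · exact weight_sub _ _ _
    · exact (sub_zero 0).symm
  rw [Finset.sum_congr rfl fun Γ _ => hs Γ, Finset.sum_sub_distrib, hflip]
  ring

/-- The equivariant noncommutative Batalin-Vilkovisky equation. -/
theorem equivariant_equation (h : IsHomotopyAlgebra 𝒜 β I H P) :
    bvLHS (piProjRange 𝒜 P) (β.restrict (LinearMap.range P)) (ribbonSum 𝒜 β H P) +
      dualAction (piProjRange 𝒜 P) (onRange P I) (ribbonSum 𝒜 β H P) = 0 := by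
  classical
  obtain ⟨_, b, p, hb⟩ := exists_homogeneous_basis 𝒜
  funext n σ a
  ext e
  simp only [bvLHS, Pi.add_apply, Pi.smul_apply, Pi.zero_apply, map_add, PowerSeries.coeff_smul,
    smul_eq_mul, map_zero]
  -- In the main case all terms are sums over graphs with `n + 2 * e - 2` vertices. Otherwise `e =
  -- 0` and `n ≤ 1`, and every term vanishes separately.
  by_cases hN : 2 ≤ n + 2 * e
  · have hN' : n + 2 * e - 2 + 2 = n + 2 * e := by omega
    rw [coeff_bvDelta b h hb σ a hN', coeff_bvBracket b h hb σ a hN', coeff_dualAction b h hb σ a hN',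
      graphForm_legAct b h hb, sum_glue (h.evenTensors b hb)]
    unfold graphForm
    ring
  · obtain rfl : e = 0 := by omega
    rw [PowerSeries.coeff_zero_X_mul, zero_add]
    have h1 : PowerSeries.coeff 0 (bvBracket (piProjRange 𝒜 P) (β.restrict (LinearMap.range P))
        (ribbonSum 𝒜 β H P) (ribbonSum 𝒜 β H P) n σ a) = 0 := by
      unfold bvBracket
      rw [map_sum]
      refine Finset.sum_eq_zero fun T _ => ?_
      split_ifs
      · rw [map_sum]
        refine Finset.sum_eq_zero fun σ₁ _ => ?_
        rw [map_sum]
        refine Finset.sum_eq_zero fun σ₂ _ => ?_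
        split_ifs
        · rw [map_sum]
          exact Finset.sum_eq_zero fun i _ => coeff_tensorAt_of_lt h T σ₁ σ₂ _ (by omega)
        · exact map_zero _
      · exact map_zero _
    have h2 : PowerSeries.coeff 0
        (dualAction (piProjRange 𝒜 P) (onRange P I) (ribbonSum 𝒜 β H P) n σ a) = 0 := by
      unfold dualAction
      rw [map_sum]
      refine Finset.sum_eq_zero fun l _ => ?_
      rw [coeff_ribbonSum b h hb, if_neg hN]
    rw [h1, h2, mul_zero, add_zero]

end coefficients

/-! ### The bracket in coordinates -/

section bracket

variable {k J : Type*} [Field k] [Fintype J] {p : J → ZMod 2} {n m n₁ n₂ : ℕ}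

variable (p) in
/-- The coordinates of an even element of the dual of the symmetric algebra of cyclic words. -/
structure EvenCoeffs (f : ∀ n : ℕ, Equiv.Perm (Fin n) → (Fin n → J) → k⟦X⟧) : Prop where
  equivariant : ∀ (n : ℕ) (σ g : Equiv.Perm (Fin n)) (d : Fin n → J),
    f n (g * σ * g⁻¹) (fun i => d (g.symm i)) =
      chi k (kexp (fun i : Fin n => (i : ℕ)) (fun i => (g i : ℕ)) (p ∘ d)) • f n σ d
  even : ∀ (n : ℕ) (σ : Equiv.Perm (Fin n)) (d : Fin n → J), f n σ d ≠ 0 → ∑ i, p (d i) = 0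

variable (p) in
/-- The contribution to the bracket of a numbering of two blocks of letters. -/
def bracketAt (f g : ∀ n : ℕ, Equiv.Perm (Fin n) → (Fin n → J) → k⟦X⟧)
    (e : Fin n₁ ⊕ Fin n₂ ≃ Fin (n + 2)) (σ : Equiv.Perm (Fin n)) (W : (Fin (n + 2) → J) → k) :
    k⟦X⟧ :=
  open Classical in
  ∑ σ₁ : Equiv.Perm (Fin n₁), ∑ σ₂ : Equiv.Perm (Fin n₂),
    if GluesTo (e.permCongr (Equiv.Perm.sumCongr σ₁ σ₂)) σ then
      ∑ d₁, ∑ d₂, shuffle p e W d₁ d₂ • (f n₁ σ₁ d₁ * g n₂ σ₂ d₂) else 0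

theorem finSumFinEquiv_injective_comp (e : Fin m ≃ Fin n₁ ⊕ Fin n₂) :
    Function.Injective fun i => (finSumFinEquiv (e i) : ℕ) :=
  Fin.val_injective.comp (finSumFinEquiv.injective.comp e.injective)

theorem shuffle_sumCongr (g₁ : Equiv.Perm (Fin n₁)) (g₂ : Equiv.Perm (Fin n₂))
    (e : Fin n₁ ⊕ Fin n₂ ≃ Fin m) (W : (Fin m → J) → k) (d₁ : Fin n₁ → J) (d₂ : Fin n₂ → J) :
    shuffle p ((Equiv.sumCongr g₁ g₂).trans e) W d₁ d₂ =
      shuffle p e W (fun i => d₁ (g₁.symm i)) (fun i => d₂ (g₂.symm i)) *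
        (chi k (kexp (fun i : Fin n₁ => (i : ℕ)) (fun i => (g₁ i : ℕ)) (p ∘ d₁)) *
          chi k (kexp (fun i : Fin n₂ => (i : ℕ)) (fun i => (g₂ i : ℕ)) (p ∘ d₂))) := by
  have hD : Sum.elim d₁ d₂ ∘ ((Equiv.sumCongr g₁ g₂).trans e).symm =
      Sum.elim (fun i => d₁ (g₁.symm i)) (fun i => d₂ (g₂.symm i)) ∘ e.symm := by
    funext i
    simp only [Function.comp_apply, Equiv.symm_trans_apply]
    cases e.symm i <;> rfl
  unfold shuffle
  rw [hD, kexp_trans Fin.val_injective (finSumFinEquiv_injective_comp e.symm)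
    (finSumFinEquiv_injective_comp _), chi_add]
  have h2 : kexp (fun i : Fin m => (finSumFinEquiv (e.symm i) : ℕ))
      (fun i : Fin m => (finSumFinEquiv (((Equiv.sumCongr g₁ g₂).trans e).symm i) : ℕ))
      (p ∘ Sum.elim (fun i => d₁ (g₁.symm i)) (fun i => d₂ (g₂.symm i)) ∘ e.symm) =
      kexp (fun i : Fin n₁ => (i : ℕ)) (fun i => (g₁ i : ℕ)) (p ∘ d₁) +
        kexp (fun i : Fin n₂ => (i : ℕ)) (fun i => (g₂ i : ℕ)) (p ∘ d₂) := by
    rw [← hD, ← kexp_comp ((Equiv.sumCongr g₁ g₂).trans e), kexp_comm]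
    have e1 : (p ∘ Sum.elim d₁ d₂ ∘ ((Equiv.sumCongr g₁ g₂).trans e).symm) ∘
        ((Equiv.sumCongr g₁ g₂).trans e) = p ∘ Sum.elim d₁ d₂ := by
      funext x
      simp
    rw [e1, kexp_sum]
    · congr 1
      · exact kexp_congr (fun x y => by simp) (fun x y => by simp) _
      · exact kexp_congr (fun x y => by simp) (fun x y => by simp) _
    · intro x y
      simp only [Function.comp_apply, Equiv.symm_apply_apply, finSumFinEquiv_apply_left,
        finSumFinEquiv_apply_right, Fin.val_castAdd, Fin.val_natAdd]
      omega
    · intro x y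
      simp only [Function.comp_apply, Equiv.trans_apply, Equiv.sumCongr_apply, Sum.map_inl,
        Sum.map_inr, Equiv.symm_apply_apply, finSumFinEquiv_apply_left,
        finSumFinEquiv_apply_right, Fin.val_castAdd, Fin.val_natAdd]
      omega
  rw [h2, chi_add]
  ring

/-- Renumbering inside the blocks changes the shuffle by the very signs in the equivariance of `f`
and `g`. Hence any numbering of the blocks, not only the increasing one, computes the bracket. -/
theorem bracketAt_sumCongr {f g : ∀ n : ℕ, Equiv.Perm (Fin n) → (Fin n → J) → k⟦X⟧}
    (hf : EvenCoeffs p f) (hg : EvenCoeffs p g) (g₁ : Equiv.Perm (Fin n₁))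
    (g₂ : Equiv.Perm (Fin n₂)) (e : Fin n₁ ⊕ Fin n₂ ≃ Fin (n + 2)) (σ : Equiv.Perm (Fin n))
    (W : (Fin (n + 2) → J) → k) :
    bracketAt p f g ((Equiv.sumCongr g₁ g₂).trans e) σ W = bracketAt p f g e σ W := by
  classical
  unfold bracketAt
  conv_rhs => rw [← (MulAut.conj g₁).toEquiv.sum_comp]
  refine Finset.sum_congr rfl fun σ₁ _ => ?_
  conv_rhs => rw [← (MulAut.conj g₂).toEquiv.sum_comp]
  refine Finset.sum_congr rfl fun σ₂ _ => ?_
  have hperm : ((Equiv.sumCongr g₁ g₂).trans e).permCongr (Equiv.Perm.sumCongr σ₁ σ₂) =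
      e.permCongr (Equiv.Perm.sumCongr (g₁ * σ₁ * g₁⁻¹) (g₂ * σ₂ * g₂⁻¹)) := by
    ext i
    simp only [Equiv.permCongr_apply, Equiv.symm_trans_apply, Equiv.trans_apply]
    cases e.symm i <;> rfl
  refine if_congr (by rw [hperm]; rfl) ?_ rfl
  conv_rhs => rw [← (g₁.arrowCongr (Equiv.refl J)).sum_comp]
  refine Finset.sum_congr rfl fun d₁ _ => ?_
  conv_rhs => rw [← (g₂.arrowCongr (Equiv.refl J)).sum_comp]
  refine Finset.sum_congr rfl fun d₂ _ => ?_
  have h1 := hf.equivariant n₁ σ₁ g₁ d₁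
  have h2 := hg.equivariant n₂ σ₂ g₂ d₂
  change _ = shuffle p e W (fun i => d₁ (g₁.symm i)) (fun i => d₂ (g₂.symm i)) •
    (f n₁ (g₁ * σ₁ * g₁⁻¹) (fun i => d₁ (g₁.symm i)) *
      g n₂ (g₂ * σ₂ * g₂⁻¹) (fun i => d₂ (g₂.symm i)))
  rw [h1, h2, shuffle_sumCongr, smul_mul_smul_comm, smul_smul]

theorem kexp_exchange (q : Fin n₁ ⊕ Fin n₂ → ZMod 2) :
    kexp (Sum.elim (fun i : Fin n₁ => (i : ℕ)) fun i : Fin n₂ => n₁ + (i : ℕ))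
      (Sum.elim (fun i : Fin n₁ => n₂ + (i : ℕ)) fun i : Fin n₂ => (i : ℕ)) q =
      (∑ x, q (Sum.inl x)) * ∑ y, q (Sum.inr y) := by
  have key : ∀ x y, (if Sum.elim (fun i : Fin n₁ => (i : ℕ)) (fun i : Fin n₂ => n₁ + (i : ℕ)) x <
        Sum.elim (fun i : Fin n₁ => (i : ℕ)) (fun i : Fin n₂ => n₁ + (i : ℕ)) y ∧
      Sum.elim (fun i : Fin n₁ => n₂ + (i : ℕ)) (fun i : Fin n₂ => (i : ℕ)) y <
        Sum.elim (fun i : Fin n₁ => n₂ + (i : ℕ)) (fun i : Fin n₂ => (i : ℕ)) x then q x * q y else 0) =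
      Sum.elim (q ∘ Sum.inl) (fun _ => 0) x * Sum.elim (fun _ => 0) (q ∘ Sum.inr) y := by
    rintro (x | x) (y | y)
    · rw [if_neg (by simp only [Sum.elim_inl]; omega)]
      simp
    · rw [if_pos (by simp only [Sum.elim_inl, Sum.elim_inr]; omega)]
      rfl
    · rw [if_neg (by simp only [Sum.elim_inl, Sum.elim_inr]; omega)]
      simp
    · rw [if_neg (by simp only [Sum.elim_inr]; omega)]
      simp
  unfold kexp
  rw [Finset.sum_congr rfl fun x _ => Finset.sum_congr rfl fun y _ => key x y,
    ← Finset.sum_mul_sum, Fintype.sum_sum_type, Fintype.sum_sum_type]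
  simp

/-- Exchanging two blocks costs the product of their total parities, and the first block is even. -/
theorem shuffle_sumComm (e : Fin n₁ ⊕ Fin n₂ ≃ Fin m) (W : (Fin m → J) → k) (d₁ : Fin n₁ → J)
    (d₂ : Fin n₂ → J) (h : ∑ i, p (d₁ i) = 0) :
    shuffle p ((Equiv.sumComm _ _).trans e) W d₂ d₁ = shuffle p e W d₁ d₂ := by
  have hD : Sum.elim d₂ d₁ ∘ ((Equiv.sumComm _ _).trans e).symm = Sum.elim d₁ d₂ ∘ e.symm := by
    funext i
    simp only [Function.comp_apply, Equiv.symm_trans_apply]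
    cases e.symm i <;> rfl
  unfold shuffle
  rw [hD, kexp_trans Fin.val_injective (finSumFinEquiv_injective_comp e.symm)
    (finSumFinEquiv_injective_comp ((Equiv.sumComm (Fin n₂) (Fin n₁)).trans e).symm)]
  have h2 : kexp (fun i : Fin m => (finSumFinEquiv (e.symm i) : ℕ))
      (fun i : Fin m => (finSumFinEquiv (((Equiv.sumComm (Fin n₂) (Fin n₁)).trans e).symm i) : ℕ))
      (p ∘ Sum.elim d₁ d₂ ∘ e.symm) = 0 := by
    have e0 := kexp_congr (X := Fin n₁ ⊕ Fin n₂)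
      (r := (fun i : Fin m => (finSumFinEquiv (e.symm i) : ℕ)) ∘ e)
      (s := (fun i : Fin m =>
        (finSumFinEquiv (((Equiv.sumComm (Fin n₂) (Fin n₁)).trans e).symm i) : ℕ)) ∘ e)
      (r' := Sum.elim (fun i => (i : ℕ)) fun i => n₁ + (i : ℕ))
      (s' := Sum.elim (fun i => n₂ + (i : ℕ)) fun i => (i : ℕ))
      (by rintro (x | x) (y | y) <;> simp) (by rintro (x | x) (y | y) <;> simp)
      ((p ∘ Sum.elim d₁ d₂ ∘ e.symm) ∘ e)
    rw [← kexp_comp e, e0, kexp_exchange]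
    have e1 : ∑ x, ((p ∘ Sum.elim d₁ d₂ ∘ e.symm) ∘ e) (Sum.inl x) = 0 := by
      rw [← h]
      exact Finset.sum_congr rfl fun x _ => by simp
    rw [e1, zero_mul]
  rw [h2, add_zero]

theorem bracketAt_sumComm {f : ∀ n : ℕ, Equiv.Perm (Fin n) → (Fin n → J) → k⟦X⟧}
    (hf : EvenCoeffs p f) (g : ∀ n : ℕ, Equiv.Perm (Fin n) → (Fin n → J) → k⟦X⟧)
    (e : Fin n₁ ⊕ Fin n₂ ≃ Fin (n + 2)) (σ : Equiv.Perm (Fin n)) (W : (Fin (n + 2) → J) → k) :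
    bracketAt p g f ((Equiv.sumComm _ _).trans e) σ W = bracketAt p f g e σ W := by
  classical
  unfold bracketAt
  rw [Finset.sum_comm]
  refine Finset.sum_congr rfl fun σ₁ _ => Finset.sum_congr rfl fun σ₂ _ => ?_
  have hperm : ((Equiv.sumComm _ _).trans e).permCongr (Equiv.Perm.sumCongr σ₂ σ₁) =
      e.permCongr (Equiv.Perm.sumCongr σ₁ σ₂) := by
    ext i
    simp only [Equiv.permCongr_apply, Equiv.symm_trans_apply, Equiv.trans_apply]
    cases e.symm i <;> rfl
  refine if_congr (by rw [hperm]) ?_ rfl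
  rw [Finset.sum_comm]
  refine Finset.sum_congr rfl fun d₁ _ => Finset.sum_congr rfl fun d₂ _ => ?_
  by_cases h0 : f n₁ σ₁ d₁ = 0
  · rw [h0, mul_zero, zero_mul, smul_zero, smul_zero]
  · rw [shuffle_sumComm e W d₁ d₂ (hf.even _ _ _ h0), mul_comm]

theorem gluesTo_swap {σ' : Equiv.Perm (Fin (n + 2))} {σ : Equiv.Perm (Fin n)} :
    GluesTo ((Equiv.swap 0 1).permCongr σ') σ ↔ GluesTo σ' σ := by
  unfold GluesTo
  rw [induces_iff, induces_iff,
    ← FirstReturn.congr_iff (π := σ' * Equiv.swap 0 1) (Equiv.swap (0 : Fin (n + 2)) 1)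
      (Equiv.refl (Fin n))]
  have h1 : (Equiv.swap (0 : Fin (n + 2)) 1).permCongr (σ' * Equiv.swap 0 1) =
      (Equiv.swap 0 1).permCongr σ' * Equiv.swap 0 1 := by
    ext i
    simp
  have h2 : (Equiv.swap (0 : Fin (n + 2)) 1) ∘ (fun i : Fin n => i.succ.succ) ∘
      (Equiv.refl (Fin n)).symm = fun i : Fin n => i.succ.succ := by
    funext i
    exact Equiv.swap_apply_of_ne_of_ne (succ_succ_ne_zero i) (succ_succ_ne_one i)
  have h3 : (Equiv.refl (Fin n)).permCongr σ = σ := by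
    ext i
    simp
  rw [h1, h2, h3]

/-- Where `W` does not vanish, the letters `0` and `1` have opposite parities, so transposing them
costs no sign. -/
theorem bracketAt_swap (f g : ∀ n : ℕ, Equiv.Perm (Fin n) → (Fin n → J) → k⟦X⟧)
    (e : Fin n₁ ⊕ Fin n₂ ≃ Fin (n + 2)) (σ : Equiv.Perm (Fin n)) {W : (Fin (n + 2) → J) → k}
    (hW : ∀ d, W (d ∘ Equiv.swap 0 1) = W d) (hW' : ∀ d, W d ≠ 0 → p (d 0) = p (d 1) + 1) :
    bracketAt p f g (e.trans (Equiv.swap 0 1)) σ W = bracketAt p f g e σ W := by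
  classical
  unfold bracketAt
  refine Finset.sum_congr rfl fun σ₁ _ => Finset.sum_congr rfl fun σ₂ _ => ?_
  have hperm : (e.trans (Equiv.swap 0 1)).permCongr (Equiv.Perm.sumCongr σ₁ σ₂) =
      (Equiv.swap 0 1).permCongr (e.permCongr (Equiv.Perm.sumCongr σ₁ σ₂)) := by
    ext i
    simp
  refine if_congr (by rw [hperm, gluesTo_swap]) ?_ rfl
  refine Finset.sum_congr rfl fun d₁ _ => Finset.sum_congr rfl fun d₂ _ => ?_
  congr 1
  unfold shuffle
  have hD : Sum.elim d₁ d₂ ∘ (e.trans (Equiv.swap 0 1)).symm =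
      (Sum.elim d₁ d₂ ∘ e.symm) ∘ Equiv.swap 0 1 := by
    funext i
    simp
  rw [hD, hW]
  by_cases h0 : W (Sum.elim d₁ d₂ ∘ e.symm) = 0
  · rw [h0, mul_zero, mul_zero]
  congr 2
  rw [← kexp_comp (Equiv.swap (0 : Fin (n + 2)) 1)]
  have e1 : (p ∘ (Sum.elim d₁ d₂ ∘ e.symm) ∘ Equiv.swap (0 : Fin (n + 2)) 1) ∘
      Equiv.swap (0 : Fin (n + 2)) 1 = p ∘ Sum.elim d₁ d₂ ∘ e.symm := by
    funext i
    simp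
  have e2 : (fun i : Fin (n + 2) => (finSumFinEquiv ((e.trans (Equiv.swap 0 1)).symm i) : ℕ)) ∘
      Equiv.swap (0 : Fin (n + 2)) 1 = fun i => (finSumFinEquiv (e.symm i) : ℕ) := by
    funext i
    simp
  rw [e1, e2, kexp_trans (Fin.val_injective.comp (Equiv.swap (0 : Fin (n + 2)) 1).injective)
    Fin.val_injective (finSumFinEquiv_injective_comp e.symm), kexp_comm]
  have e3 := kexp_swap (p ∘ Sum.elim d₁ d₂ ∘ e.symm)
  have e4 : (p ∘ Sum.elim d₁ d₂ ∘ e.symm) 0 * (p ∘ Sum.elim d₁ d₂ ∘ e.symm) 1 = 0 := by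
    have h1 := hW' _ h0
    simp only [Function.comp_apply] at h1 ⊢
    rw [h1]
    have : ∀ a : ZMod 2, (a + 1) * a = 0 := by decide
    exact this _
  rw [e4] at e3
  have e5 : kexp (fun i : Fin (n + 2) => (i : ℕ)) ((fun i : Fin (n + 2) => (i : ℕ)) ∘
      Equiv.swap (0 : Fin (n + 2)) 1) (p ∘ Sum.elim d₁ d₂ ∘ e.symm) = 0 := e3
  rw [e5, zero_add]

/-- Two numberings with the same blocks differ by a permutation within each block. -/
theorem bracketAt_blockEquiv {f g : ∀ n : ℕ, Equiv.Perm (Fin n) → (Fin n → J) → k⟦X⟧}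
    (hf : EvenCoeffs p f) (hg : EvenCoeffs p g) (T : Finset (Fin (n + 2)))
    (e : Fin n₁ ⊕ Fin n₂ ≃ Fin (n + 2)) (h₁ : ∀ i, e (Sum.inl i) ∈ T)
    (h₂ : ∀ i, e (Sum.inr i) ∉ T) (σ : Equiv.Perm (Fin n)) (W : (Fin (n + 2) → J) → k) :
    bracketAt p f g (blockEquiv T) σ W = bracketAt p f g e σ W := by
  have hT : T = Finset.univ.map (Function.Embedding.inl.trans e.toEmbedding) := by
    ext x
    simp only [Finset.mem_map, Finset.mem_univ, true_and]
    obtain ⟨y | y, rfl⟩ := e.surjective x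
    · exact iff_of_true (h₁ y) ⟨y, rfl⟩
    · exact iff_of_false (h₂ y) fun ⟨z, hz⟩ => Sum.inl_ne_inr (e.injective hz)
  have hc : T.card = n₁ := by rw [hT, Finset.card_map, Finset.card_fin]
  have hc' : Tᶜ.card = n₂ := by
    have := Fintype.card_congr e
    rw [Fintype.card_sum, Fintype.card_fin, Fintype.card_fin, Fintype.card_fin] at this
    rw [Finset.card_compl, Fintype.card_fin, hc]
    omega
  clear hT
  subst hc
  subst hc'
  obtain ⟨⟨g₁, g₂⟩, hgg⟩ := Equiv.Perm.mem_sumCongrHom_range_of_perm_mapsTo_inl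
    (σ := e.trans (blockEquiv T).symm) (by
      rintro _ ⟨i, rfl⟩
      rw [Equiv.trans_apply]
      have hi := h₁ i
      obtain ⟨y | y, hy⟩ := (blockEquiv T).surjective (e (Sum.inl i))
      · exact ⟨y, by rw [← hy, Equiv.symm_apply_apply]⟩
      · rw [← hy] at hi
        unfold blockEquiv at hi
        rw [finSumEquivOfFinset_inr] at hi
        exact absurd hi (Finset.mem_compl.1 (Finset.orderEmbOfFin_mem _ _ _)))
  have he : e = (Equiv.sumCongr g₁ g₂).trans (blockEquiv T) := by
    ext x
    have := (Equiv.symm_apply_eq (blockEquiv T)).1 (Equiv.congr_fun hgg x).symm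
    exact congrArg Fin.val this
  rw [he, bracketAt_sumCongr hf hg]

/-- The bracket of even elements is symmetric. -/
theorem sum_bracketAt_comm {f g : ∀ n : ℕ, Equiv.Perm (Fin n) → (Fin n → J) → k⟦X⟧}
    (hf : EvenCoeffs p f) (hg : EvenCoeffs p g) (σ : Equiv.Perm (Fin n))
    {W : (Fin (n + 2) → J) → k}
    (hW : ∀ d, W (d ∘ Equiv.swap 0 1) = W d) (hW' : ∀ d, W d ≠ 0 → p (d 0) = p (d 1) + 1) :
    (∑ T : Finset (Fin (n + 2)),
      if 0 ∈ T ∧ 1 ∉ T then bracketAt p f g (blockEquiv T) σ W else 0) =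
    ∑ T : Finset (Fin (n + 2)),
      if 0 ∈ T ∧ 1 ∉ T then bracketAt p g f (blockEquiv T) σ W else 0 := by
  -- Exchanging the two factors complements `T`; the transposition of the letters `0` and `1`
  -- restores the condition `0 ∈ T ∧ 1 ∉ T`.
  have hinv : Function.Involutive fun T : Finset (Fin (n + 2)) =>
      Tᶜ.map (Equiv.swap (0 : Fin (n + 2)) 1).toEmbedding := by
    intro T
    ext x
    simp [Finset.mem_map_equiv]
  set ψ := Function.Involutive.toPerm _ hinv
  rw [← Equiv.sum_comp ψ]
  refine Finset.sum_congr rfl fun T _ => ?_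
  have hmem : ∀ x, x ∈ ψ T ↔ Equiv.swap 0 1 x ∉ T := by
    intro x
    change x ∈ Tᶜ.map _ ↔ _
    rw [Finset.mem_map_equiv, Equiv.symm_swap, Finset.mem_compl]
  refine if_congr ?_ ?_ rfl
  · rw [hmem, hmem, Equiv.swap_apply_left, Equiv.swap_apply_right, not_not, and_comm]
  · have hl : ∀ i, blockEquiv T (Sum.inl i) ∈ T := fun i => by
      unfold blockEquiv
      rw [finSumEquivOfFinset_inl]
      exact Finset.orderEmbOfFin_mem _ _ _
    have hr : ∀ i, blockEquiv T (Sum.inr i) ∉ T := fun i => by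
      unfold blockEquiv
      rw [finSumEquivOfFinset_inr]
      exact Finset.mem_compl.1 (Finset.orderEmbOfFin_mem _ _ _)
    rw [bracketAt_blockEquiv hf hg _
      (((Equiv.sumComm _ _).trans (blockEquiv T)).trans (Equiv.swap 0 1)), bracketAt_swap _ _ _ _ hW hW',
      bracketAt_sumComm hg]
    · intro i
      rw [hmem]
      simpa using hr i
    · intro i
      rw [hmem]
      simpa using hl i

end bracket

/-! ### Even cyclic forms in coordinates -/

section forms

variable {k U : Type*} [Field k] [AddCommGroup U] [Module k U]
  {J : Type*} [Fintype J] (b : Module.Basis J k U) {p : J → ZMod 2} {pr : ZMod 2 → U →ₗ[k] U}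
  {F G : WordForm k U} {n m : ℕ}

/-- The values of a form on basis vectors. -/
def formCoeffs (F : WordForm k U) (n : ℕ) (σ : Equiv.Perm (Fin n)) (d : Fin n → J) : k⟦X⟧ :=
  F n σ fun i => b (d i)

theorem form_eq_sum (hF : ∀ n σ, ∃ M : MultilinearMap k (fun _ : Fin n => U) k⟦X⟧, ∀ a, F n σ a = M a)
    (σ : Equiv.Perm (Fin n)) (a : Fin n → U) :
    F n σ a = ∑ d, coordProd b a d • formCoeffs b F n σ d := by
  classical
  obtain ⟨M, hM⟩ := hF n σ
  unfold formCoeffs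
  simp only [hM]
  conv_lhs => rw [show a = fun i => ∑ j, b.coord j (a i) • b j from
    funext fun i => (b.sum_repr (a i)).symm]
  rw [M.map_sum]
  refine Finset.sum_congr rfl fun d _ => ?_
  rw [M.map_smul_univ]
  rfl

theorem coord_pr (hpr : ∀ q j, pr q (b j) = if p j = q then b j else 0) (q : ZMod 2) (j : J) (x : U) :
    b.coord j (pr q x) = if p j = q then b.coord j x else 0 := by
  classical
  have : b.coord j ∘ₗ pr q = if p j = q then b.coord j else 0 := by
    refine b.ext fun i => ?_
    rw [LinearMap.comp_apply, hpr]
    by_cases hij : i = j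
    · subst hij
      split_ifs <;> simp
    · split_ifs <;> simp [hij]
  have := LinearMap.congr_fun this x
  rw [LinearMap.comp_apply] at this
  rw [this]
  split_ifs <;> rfl

theorem evenCoeffs (hpr : ∀ q j, pr q (b j) = if p j = q then b j else 0)
    (hF : IsEvenCyclicForm pr F) : EvenCoeffs p (formCoeffs b F) where
  equivariant n σ g d := by
    have := hF.equivariant n σ g (fun i => b (d i)) (p ∘ d) fun i => by
      rw [hpr, Function.comp_apply, if_pos rfl]
    rw [koszulSign_smul (k := k)] at this
    exact this
  even n σ d hd := by
    by_contra hne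
    refine hd (hF.even n σ (fun i => b (d i)) (p ∘ d) (fun i => by
      rw [hpr, Function.comp_apply, if_pos rfl]) ?_)
    exact (zmod_two_cases _).resolve_left hne

theorem tensorAt_eq (hpr : ∀ q j, pr q (b j) = if p j = q then b j else 0)
    (hF : IsEvenCyclicForm pr F) (hG : IsEvenCyclicForm pr G) (T : Finset (Fin m))
    (σ₁ : Equiv.Perm (Fin T.card)) (σ₂ : Equiv.Perm (Fin Tᶜ.card)) (x : Fin m → U) :
    tensorAt pr F G T σ₁ σ₂ x = ∑ d₁, ∑ d₂, shuffle p (blockEquiv T) (coordProd b x) d₁ d₂ •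
      (formCoeffs b F _ σ₁ d₁ * formCoeffs b G _ σ₂ d₂) := by
  unfold tensorAt
  simp only [koszulSign_smul (k := k), form_eq_sum b hF.multilinear σ₁,
    form_eq_sum b hG.multilinear σ₂, Finset.sum_mul_sum, Finset.smul_sum]
  rw [Finset.sum_comm]
  refine Finset.sum_congr rfl fun d₁ _ => ?_
  rw [Finset.sum_comm]
  refine Finset.sum_congr rfl fun d₂ _ => ?_
  have h2 := sum_chi_prod (k := k) (p := p) (blockEquiv T) (fun i j => b.coord j (x i)) d₁ d₂
  change _ = shuffle p (blockEquiv T) (fun D => ∏ i, b.coord (D i) (x i)) d₁ d₂ • _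
  rw [← h2, Finset.sum_smul]
  refine Finset.sum_congr rfl fun q _ => ?_
  rw [smul_mul_smul_comm, smul_smul]
  simp only [coordProd, coord_pr b hpr]

variable [FiniteDimensional k U] {β : LinearMap.BilinForm k U}

theorem sum_coordProd_vecCons (a : Fin n → U) (d : Fin (n + 2) → J) :
    ∑ i, coordProd b (Matrix.vecCons (Module.finBasis k U i) (Matrix.vecCons (dualVec β i) a)) d =
      insertTwo (fun i j => casimir β (b.coord i) (b.coord j)) (coordProd b a) d := by
  unfold insertTwo casimir
  rw [Finset.sum_mul]
  refine Finset.sum_congr rfl fun i _ => ?_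
  unfold coordProd
  rw [Fin.prod_univ_succ, Fin.prod_univ_succ, mul_assoc]
  rfl

theorem bvBracket_eq (hpr : ∀ q j, pr q (b j) = if p j = q then b j else 0)
    (hF : IsEvenCyclicForm pr F) (hG : IsEvenCyclicForm pr G) (σ : Equiv.Perm (Fin n))
    (a : Fin n → U) : bvBracket pr β F G n σ a = ∑ T : Finset (Fin (n + 2)),
      if 0 ∈ T ∧ 1 ∉ T then bracketAt p (formCoeffs b F) (formCoeffs b G) (blockEquiv T) σ
        (insertTwo (fun i j => casimir β (b.coord i) (b.coord j)) (coordProd b a)) else 0 := by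
  classical
  unfold bvBracket
  refine Finset.sum_congr rfl fun T _ => if_congr Iff.rfl ?_ rfl
  unfold bracketAt
  refine Finset.sum_congr rfl fun σ₁ _ => Finset.sum_congr rfl fun σ₂ _ => ?_
  refine if_congr Iff.rfl ?_ rfl
  simp only [tensorAt_eq b hpr hF hG]
  rw [Finset.sum_comm]
  refine Finset.sum_congr rfl fun d₁ _ => ?_
  rw [Finset.sum_comm]
  refine Finset.sum_congr rfl fun d₂ _ => ?_
  rw [← Finset.sum_smul]
  congr 1
  unfold shuffle
  rw [← Finset.mul_sum, sum_coordProd_vecCons]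

variable (p pr β) in
/-- An odd nondegenerate symmetric form on a super space, and an odd operator which preserves it. -/
structure IsOddOperator (I : U →ₗ[k] U) : Prop where
  pr_basis : ∀ q j, pr q (b j) = if p j = q then b j else 0
  symm : β.IsSymm
  nondeg : β.Nondegenerate
  odd : ∀ i j, β (b i) (b j) ≠ 0 → p i = p j + 1
  adjoint : ∀ x y, β (I (parityInv pr x)) y = β x (I y)
  coord_odd : ∀ i j, b.coord i (I (b j)) ≠ 0 → p i = p j + 1

namespace IsOddOperator

variable {b} {I : U →ₗ[k] U}

theorem form_pr (h : IsOddOperator b p pr β I) (q : ZMod 2) (x y : U) :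
    β (pr q x) y = β x (pr (q + 1) y) := by
  have : β ∘ₗ pr q = (β.flip ∘ₗ pr (q + 1)).flip := by
    refine b.ext fun i => b.ext fun j => ?_
    change β (pr q (b i)) (b j) = β (b i) (pr (q + 1) (b j))
    rw [h.pr_basis, h.pr_basis]
    by_cases h0 : β (b i) (b j) = 0
    · split_ifs <;> simp [h0]
    · have h1 := h.odd i j h0
      have h2 : p i = q ↔ p j = q + 1 := by
        rw [h1]
        generalize p j = x
        revert x q
        decide
      by_cases hq : p i = q
      · rw [if_pos hq, if_pos (h2.1 hq)]
      · rw [if_neg hq, if_neg fun e => hq (h2.2 e), map_zero, map_zero, LinearMap.zero_apply]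
  have := LinearMap.congr_fun (LinearMap.congr_fun this x) y
  exact this

theorem casimir_odd (h : IsOddOperator b p pr β I) (i j : J)
    (hij : casimir β (b.coord i) (b.coord j) ≠ 0) : p i = p j + 1 := by
  by_contra hne
  refine hij ?_
  have h1 := casimir_adjoint h.nondeg h.symm (h.form_pr (p i)) (b.coord i) (b.coord j)
  have e1 : b.coord i ∘ₗ pr (p i) = b.coord i := by
    ext x
    rw [LinearMap.comp_apply, coord_pr b h.pr_basis, if_pos rfl]
  have e2 : b.coord j ∘ₗ pr (p i + 1) = 0 := by
    ext x
    rw [LinearMap.comp_apply, coord_pr b h.pr_basis, if_neg fun e => hne (by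
      rw [e, zmod_two_add_add]), LinearMap.zero_apply]
  rw [e1, e2] at h1
  rw [h1]
  simp [casimir]

theorem insertTwo_swap (h : IsOddOperator b p pr β I) (w : (Fin n → J) → k) (d : Fin (n + 2) → J) :
    insertTwo (fun i j => casimir β (b.coord i) (b.coord j)) w (d ∘ Equiv.swap 0 1) =
      insertTwo (fun i j => casimir β (b.coord i) (b.coord j)) w d := by
  unfold insertTwo
  simp only [Function.comp_apply, Equiv.swap_apply_left, Equiv.swap_apply_right]
  rw [casimir_comm h.symm]
  congr 2

theorem bvBracket_comm (h : IsOddOperator b p pr β I) (hF : IsEvenCyclicForm pr F)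
    (hG : IsEvenCyclicForm pr G) : bvBracket pr β F G = bvBracket pr β G F := by
  funext n σ a
  rw [bvBracket_eq b h.pr_basis hF hG, bvBracket_eq b h.pr_basis hG hF,
    sum_bracketAt_comm (evenCoeffs b h.pr_basis hF) (evenCoeffs b h.pr_basis hG) σ
      (h.insertTwo_swap _)]
  intro d hd
  exact h.casimir_odd _ _ (left_ne_zero_of_mul hd)

/-- Both `β` and `I` are odd, so together they pair only vectors of equal parity. -/
theorem form_eq_zero (h : IsOddOperator b p pr β I) {q₁ q₂ : ZMod 2} {x y : U} (hx : pr q₁ x = x)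
    (hy : pr q₂ y = y) (hq : q₁ ≠ q₂) : β x (I y) = 0 := by
  have h1 : pr (q₂ + 1) (I y) = I y := by
    have key : pr (q₂ + 1) ∘ₗ I ∘ₗ pr q₂ = I ∘ₗ pr q₂ := by
      refine b.ext fun j => ?_
      simp only [LinearMap.comp_apply]
      rw [h.pr_basis]
      split_ifs with hj
      · refine b.ext_elem fun i => ?_
        change b.coord i _ = b.coord i _
        rw [coord_pr b h.pr_basis]
        split_ifs with hi
        · rfl
        · by_contra hne
          exact hi (hj ▸ h.coord_odd i j (Ne.symm hne))
      · simp
    have := LinearMap.congr_fun key y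
    simp only [LinearMap.comp_apply, hy] at this
    exact this
  have h2 : q₂ + 1 + 1 ≠ q₁ := by
    rw [zmod_two_add_add]
    exact hq.symm
  have h3 : ∀ {q q' : ZMod 2}, q ≠ q' → ∀ z, pr q (pr q' z) = 0 := by
    intro q q' hne z
    refine b.ext_elem fun i => ?_
    change b.coord i _ = b.coord i _
    rw [coord_pr b h.pr_basis, coord_pr b h.pr_basis, map_zero]
    split_ifs with e1 e2
    · exact absurd (e1.symm.trans e2) hne
    · rfl
    · rfl
  rw [← hx, h.form_pr, ← h1, h3 (fun e => hq (add_right_cancel e)), map_zero]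

theorem parityInv_eq (h : IsOddOperator b p pr β I) {q : ZMod 2} {x : U} (hx : pr q x = x) :
    parityInv pr x = chi k q • x := by
  refine b.ext_elem fun i => ?_
  change b.coord i _ = b.coord i _
  have e : b.coord i x = if p i = q then b.coord i x else 0 := by
    rw [← coord_pr b h.pr_basis, hx]
  unfold parityInv
  rw [LinearMap.sub_apply, map_sub, map_smul, coord_pr b h.pr_basis, coord_pr b h.pr_basis, smul_eq_mul]
  by_cases hi : p i = q
  · rw [hi]
    rcases zmod_two_cases q with rfl | rfl <;> simp
  · rw [if_neg hi] at e
    rw [e]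
    simp

theorem quadraticTerm_two (h : IsOddOperator b p pr β I) (σ : Equiv.Perm (Fin 2)) (a : Fin 2 → U) :
    quadraticTerm pr β I 2 σ a =
      if σ = Equiv.swap 0 1 then PowerSeries.C (β (a 0) (I (a 1))) else 0 := by
  unfold quadraticTerm
  simp only [h.adjoint]

theorem quadraticTerm_of_ne (hn : n ≠ 2) (σ : Equiv.Perm (Fin n)) (a : Fin n → U) :
    quadraticTerm pr β I n σ a = 0 := by
  match n, hn with
  | 0, _ => rfl
  | 1, _ => rfl
  | n + 3, _ => rfl

theorem isEvenCyclicForm_quadraticTerm (h : IsOddOperator b p pr β I) :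
    IsEvenCyclicForm pr (quadraticTerm pr β I) := by
  refine ⟨fun n σ => ?_, fun n σ g a q hq => ?_, fun n σ a q hq hs => ?_⟩
  · by_cases hn : n = 2
    · subst hn
      by_cases hσ : σ = Equiv.swap 0 1
      · refine ⟨⟨quadraticTerm pr β I 2 σ, ?_, ?_⟩, fun a => rfl⟩
        · intro inst a i x y
          obtain rfl := Subsingleton.elim inst (instDecidableEqFin 2)
          simp only [h.quadraticTerm_two, if_pos hσ]
          fin_cases i <;> simp
        · intro inst a i c x
          obtain rfl := Subsingleton.elim inst (instDecidableEqFin 2)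
          simp only [h.quadraticTerm_two, if_pos hσ]
          fin_cases i <;> simp [← PowerSeries.smul_eq_C_mul]
      · exact ⟨0, fun a => by rw [h.quadraticTerm_two, if_neg hσ]; rfl⟩
    · exact ⟨0, fun a => by rw [quadraticTerm_of_ne hn]; rfl⟩
  · by_cases hn : n = 2
    · subst hn
      rw [koszulSign_smul (k := k), h.quadraticTerm_two, h.quadraticTerm_two]
      -- The group on two letters is commutative, so conjugation does not affect the word.
      have h1 : g * σ * g⁻¹ = Equiv.swap 0 1 ↔ σ = Equiv.swap 0 1 := by
        revert g σ
        decide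
      rw [if_congr h1 rfl rfl]
      split_ifs
      · have h2 : ∀ g : Equiv.Perm (Fin 2), g = 1 ∨ g = Equiv.swap 0 1 := by decide
        rcases h2 g with rfl | rfl
        · have h3 : kexp (fun i : Fin 2 => (i : ℕ)) (fun i => ((1 : Equiv.Perm (Fin 2)) i : ℕ)) q = 0 :=
            Finset.sum_eq_zero fun x _ => Finset.sum_eq_zero fun y _ =>
              if_neg fun h => absurd h.1 h.2.not_gt
          rw [h3, chi_zero, one_smul]
          rfl
        · rw [kexp_swap (n := 0)]
          simp only [Equiv.swap_inv, Equiv.swap_apply_left, Equiv.swap_apply_right]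
          -- For equal parities the Koszul sign has exponent `q 0 * q 1 = q 0`, which is the sign
          -- that `adjoint` produces; for different parities both values vanish.
          by_cases h01 : q 0 = q 1
          · have h4 : q 0 * q 1 = q 0 := by
              rw [h01]
              generalize q 1 = x
              revert x
              decide
            rw [h4, ← h.adjoint, h.parityInv_eq (hq 1), h.symm.eq, map_smul, map_smul, smul_eq_mul, h01,
              map_mul, PowerSeries.smul_eq_C_mul]
          · rw [h.form_eq_zero (hq 0) (hq 1) h01, h.form_eq_zero (hq 1) (hq 0) (Ne.symm h01)]
            simp
      · rw [smul_zero]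
    · rw [quadraticTerm_of_ne hn, quadraticTerm_of_ne hn, smul_zero]
  · by_cases hn : n = 2
    · subst hn
      rw [h.quadraticTerm_two]
      split_ifs
      · rw [h.form_eq_zero (hq 0) (hq 1), map_zero]
        intro e
        rw [Fin.sum_univ_two, e, CharTwo.add_self_eq_zero] at hs
        exact zero_ne_one hs
      · rfl
    · rw [quadraticTerm_of_ne hn]

end IsOddOperator

end forms

/-! ### The quadratic term -/

section transposition

variable {n : ℕ}

/-- Each letter strictly between the two places is passed by both of them and contributes its parity
times `q 1 + q l.succ.succ = 1`; the two letters themselves contribute the product of opposite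
parities, which is zero. -/
theorem kexp_transposition (q : Fin (n + 2) → ZMod 2) (l : Fin n)
    (hq : q 1 = q l.succ.succ + 1) :
    kexp (fun i : Fin (n + 2) => (i : ℕ)) (fun i => (Equiv.swap 1 l.succ.succ i : ℕ)) q =
      ∑ j, if j < l then q j.succ.succ else 0 := by
  set v : Fin (n + 2) := l.succ.succ with hv
  have hv1 : (1 : Fin (n + 2)) < v := by simp [hv, Fin.lt_def]
  have h1 : ∀ x : Fin (n + 2), x = 1 → Equiv.swap 1 v x = v := fun x hx => by simp [hx]
  have h2 : ∀ x : Fin (n + 2), x = v → Equiv.swap 1 v x = 1 := fun x hx => by simp [hx]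
  have h3 : ∀ x : Fin (n + 2), x ≠ 1 → x ≠ v → Equiv.swap 1 v x = x := fun x hx hx' =>
    Equiv.swap_apply_of_ne_of_ne hx hx'
  have key : ∀ x y : Fin (n + 2),
      (if (x : ℕ) < y ∧ (Equiv.swap 1 v y : ℕ) < (Equiv.swap 1 v x : ℕ) then q x * q y else 0) =
      (if x = 1 then (if y = v then q 1 * q v else 0) else 0) +
      (if x = 1 then q 1 * (if 1 < y ∧ y < v then q y else 0) else 0) +
      (if y = v then (if 1 < x ∧ x < v then q x else 0) * q v else 0) := by
    intro x y
    rw [Fin.lt_def] at hv1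
    by_cases hx1 : x = 1
    · subst hx1
      rw [h1 1 rfl, if_pos rfl, if_pos rfl]
      by_cases hyv : y = v
      · subst hyv
        rw [h2 _ rfl, if_pos ⟨hv1, hv1⟩, if_pos rfl, if_pos rfl]
        simp
      · rw [if_neg hyv, if_neg hyv]
        by_cases hy1 : y = 1
        · subst hy1
          rw [h1 1 rfl]
          simp
        · rw [h3 y hy1 hyv]
          simp only [Fin.lt_def, mul_ite, mul_zero, zero_add, add_zero]
    · rw [if_neg hx1, if_neg hx1]
      by_cases hyv : y = v
      · subst hyv
        rw [h2 _ rfl, if_pos rfl]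
        by_cases hxv : x = v
        · subst hxv
          rw [h2 _ rfl]
          simp
        · rw [h3 x hx1 hxv]
          simp only [Fin.lt_def, ite_mul, zero_mul, zero_add, and_comm]
      · rw [if_neg hyv]
        refine (if_neg ?_).trans (by simp)
        by_cases hxv : x = v
        · subst hxv
          rw [h2 _ rfl]
          by_cases hy1 : y = 1
          · subst hy1
            omega
          · rw [h3 y hy1 hyv]
            omega
        · rw [h3 x hx1 hxv]
          by_cases hy1 : y = 1
          · subst hy1
            rw [h1 1 rfl]
            omega
          · rw [h3 y hy1 hyv]
            omega
  have hs : ∑ x : Fin (n + 2), (if 1 < x ∧ x < v then q x else 0) =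
      ∑ j, if j < l then q j.succ.succ else 0 := by
    rw [Fin.sum_univ_succ, Fin.sum_univ_succ, if_neg fun h => Fin.not_lt_zero _ h.1,
      if_neg fun h => lt_irrefl _ h.1, zero_add, zero_add]
    refine Finset.sum_congr rfl fun j _ => if_congr ?_ rfl rfl
    rw [hv, Fin.succ_lt_succ_iff, Fin.succ_lt_succ_iff]
    exact and_iff_right (Fin.succ_lt_succ_iff.2 (Fin.succ_pos j))
  unfold kexp
  simp only [key, Finset.sum_add_distrib]
  have e1 : ∑ x : Fin (n + 2), ∑ y : Fin (n + 2),
      (if x = 1 then (if y = v then q 1 * q v else 0) else 0) = q 1 * q v := by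
    rw [Finset.sum_eq_single 1 (fun x _ hx => by simp [hx]) (by simp)]
    simp
  have e2 : ∑ x : Fin (n + 2), ∑ y : Fin (n + 2),
      (if x = 1 then q 1 * (if 1 < y ∧ y < v then q y else 0) else 0) =
        q 1 * ∑ j, if j < l then q j.succ.succ else 0 := by
    rw [Finset.sum_eq_single 1 (fun x _ hx => by simp [hx]) (by simp), ← hs, Finset.mul_sum]
    simp
  have e3 : ∑ x : Fin (n + 2), ∑ y : Fin (n + 2),
      (if y = v then (if 1 < x ∧ x < v then q x else 0) * q v else 0) =
        (∑ j, if j < l then q j.succ.succ else 0) * q v := by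
    rw [Finset.sum_comm, Finset.sum_eq_single v (fun x _ hx => by simp [hx]) (by simp), ← hs,
      Finset.sum_mul]
    simp
  rw [e1, e2, e3, hq]
  generalize q v = s
  generalize (∑ j, if j < l then q j.succ.succ else 0) = t
  revert s t
  decide

/-- The letters `0` and `l + 2` form the first block, the other letters the second block; the letter
`1` takes the place of `l + 2`. -/
def pairEquiv (l : Fin n) : Fin 2 ⊕ Fin n ≃ Fin (n + 2) :=
  (finSumFinEquiv.trans (finCongr (Nat.add_comm 2 n))).trans (Equiv.swap 1 l.succ.succ)

theorem finCongr_inl (i : Fin 2) :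
    finCongr (Nat.add_comm 2 n) (finSumFinEquiv (Sum.inl i)) = Fin.castLE (by omega) i := by
  ext
  simp

theorem finCongr_inr (i : Fin n) :
    finCongr (Nat.add_comm 2 n) (finSumFinEquiv (Sum.inr i)) = i.succ.succ := by
  ext
  simp only [finSumFinEquiv_apply_right, finCongr_apply, Fin.val_cast, Fin.val_natAdd, Fin.val_succ]
  omega

theorem pairEquiv_inl_zero (l : Fin n) : pairEquiv l (Sum.inl 0) = 0 := by
  unfold pairEquiv
  rw [Equiv.trans_apply, Equiv.trans_apply, finCongr_inl]
  exact Equiv.swap_apply_of_ne_of_ne (by simp [Fin.ext_iff]) (by simp [Fin.ext_iff])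

theorem pairEquiv_inl_one (l : Fin n) : pairEquiv l (Sum.inl 1) = l.succ.succ := by
  unfold pairEquiv
  rw [Equiv.trans_apply, Equiv.trans_apply, finCongr_inl]
  exact Equiv.swap_apply_left _ _

theorem pairEquiv_inr (l i : Fin n) :
    pairEquiv l (Sum.inr i) = if i = l then 1 else i.succ.succ := by
  unfold pairEquiv
  rw [Equiv.trans_apply, Equiv.trans_apply, finCongr_inr]
  split_ifs with h
  · rw [h, Equiv.swap_apply_right]
  · exact Equiv.swap_apply_of_ne_of_ne (succ_succ_ne_one i) fun e =>
      h (Fin.succ_injective _ (Fin.succ_injective _ e))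

theorem finSumFinEquiv_pairEquiv_symm (l : Fin n) (i : Fin (n + 2)) :
    (finSumFinEquiv ((pairEquiv l).symm i) : ℕ) = Equiv.swap 1 l.succ.succ i := by
  unfold pairEquiv
  simp

/-- In the word of the second block the letter `1` stands in the place of `l + 2`; gluing it to the
letter `0` of the two-letter word puts `l + 2` back into this place. -/
theorem gluesTo_pairEquiv (l : Fin n) (τ : Equiv.Perm (Fin n)) :
    GluesTo ((pairEquiv l).permCongr (Equiv.Perm.sumCongr (Equiv.swap 0 1) τ)) τ := by
  set π := (pairEquiv l).permCongr (Equiv.Perm.sumCongr (Equiv.swap 0 1) τ) * Equiv.swap 0 1 with hπ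
  have h0 : π 0 = pairEquiv l (Sum.inr (τ l)) := by
    have : (1 : Fin (n + 2)) = pairEquiv l (Sum.inr l) := by rw [pairEquiv_inr, if_pos rfl]
    rw [hπ, Equiv.Perm.mul_apply, Equiv.swap_apply_left, this, Equiv.permCongr_apply,
      Equiv.symm_apply_apply]
    rfl
  have h1 : π 1 = l.succ.succ := by
    have : (0 : Fin (n + 2)) = pairEquiv l (Sum.inl 0) := (pairEquiv_inl_zero l).symm
    rw [hπ, Equiv.Perm.mul_apply, Equiv.swap_apply_right, this, Equiv.permCongr_apply,
      Equiv.symm_apply_apply, ← pairEquiv_inl_one]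
    rfl
  have hl : π l.succ.succ = 0 := by
    rw [hπ, Equiv.Perm.mul_apply, Equiv.swap_apply_of_ne_of_ne (succ_succ_ne_zero l)
      (succ_succ_ne_one l), ← pairEquiv_inl_one, Equiv.permCongr_apply, Equiv.symm_apply_apply,
      ← pairEquiv_inl_zero l]
    rfl
  have hi : ∀ i, i ≠ l → π i.succ.succ = pairEquiv l (Sum.inr (τ i)) := by
    intro i hil
    have : i.succ.succ = pairEquiv l (Sum.inr i) := by rw [pairEquiv_inr, if_neg hil]
    rw [hπ, Equiv.Perm.mul_apply, Equiv.swap_apply_of_ne_of_ne (succ_succ_ne_zero i)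
      (succ_succ_ne_one i), this, Equiv.permCongr_apply, Equiv.symm_apply_apply]
    rfl
  have n0 : (0 : Fin (n + 2)) ∉ Set.range fun i : Fin n => i.succ.succ := by
    rintro ⟨i, hi⟩
    exact succ_succ_ne_zero i hi
  have n1 : (1 : Fin (n + 2)) ∉ Set.range fun i : Fin n => i.succ.succ := by
    rintro ⟨i, hi⟩
    exact succ_succ_ne_one i hi
  refine ⟨fun x => ?_, fun i => ?_⟩
  · refine Fin.cases ?_ (fun x => Fin.cases ?_ (fun x => ?_) x) x
    · exact ⟨l, 1, by rw [pow_one, hl]⟩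
    · change ∃ i r, (π ^ r) _ = (1 : Fin (n + 2))
      by_cases hτ : τ l = l
      · exact ⟨l, 2, by rw [pow_two, Equiv.Perm.mul_apply, hl, h0, hτ, pairEquiv_inr, if_pos rfl]⟩
      · refine ⟨τ.symm l, 1, ?_⟩
        rw [pow_one, hi _ fun e => hτ ((Equiv.symm_apply_eq _).1 e).symm, Equiv.apply_symm_apply,
          pairEquiv_inr, if_pos rfl]
    · exact ⟨x, 0, rfl⟩
  · change ∃ r, 0 < r ∧ (π ^ r) _ = _ ∧ _
    -- The way from `i` to `τ i` passes through the letter `0` when `i = l` and through `1` when `τ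
    -- i = l`; the return time is accordingly `1`, `2` or `3`.
    by_cases hil : i = l
    · subst hil
      by_cases hτ : τ i = i
      · refine ⟨3, by norm_num, ?_, fun s hs hs' => ?_⟩
        · rw [pow_succ, pow_two, Equiv.Perm.mul_apply, Equiv.Perm.mul_apply, hl, h0, hτ,
            pairEquiv_inr, if_pos rfl, h1]
        · change (π ^ s) _ ∉ _
          interval_cases s
          · rw [pow_one, hl]
            exact n0
          · rw [pow_two, Equiv.Perm.mul_apply, hl, h0, hτ, pairEquiv_inr, if_pos rfl]
            exact n1
      · refine ⟨2, by norm_num, ?_, fun s hs hs' => ?_⟩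
        · rw [pow_two, Equiv.Perm.mul_apply, hl, h0, pairEquiv_inr, if_neg hτ]
        · change (π ^ s) _ ∉ _
          interval_cases s
          rw [pow_one, hl]
          exact n0
    · by_cases hτ : τ i = l
      · refine ⟨2, by norm_num, ?_, fun s hs hs' => ?_⟩
        · rw [pow_two, Equiv.Perm.mul_apply, hi _ hil, hτ, pairEquiv_inr, if_pos rfl, h1]
        · change (π ^ s) _ ∉ _
          interval_cases s
          rw [pow_one, hi _ hil, hτ, pairEquiv_inr, if_pos rfl]
          exact n1
      · refine ⟨1, by norm_num, ?_, fun s hs hs' => ?_⟩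
        · rw [pow_one, hi _ hil, pairEquiv_inr, if_neg hτ]
        · omega

theorem gluesTo_pairEquiv_iff (l : Fin n) (σ τ : Equiv.Perm (Fin n)) :
    GluesTo ((pairEquiv l).permCongr (Equiv.Perm.sumCongr (Equiv.swap 0 1) τ)) σ ↔ τ = σ := by
  refine ⟨fun h => ?_, fun h => h ▸ gluesTo_pairEquiv l τ⟩
  exact FirstReturn.unique ((Fin.succ_injective _).comp (Fin.succ_injective _))
    (gluesTo_pairEquiv l τ) h

end transposition

/-! ### The bracket with the quadratic term is the action of the operator. -/

section quadratic

variable {k U : Type*} [Field k] [AddCommGroup U] [Module k U]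
  {J : Type*} [Fintype J] {b : Module.Basis J k U} {p : J → ZMod 2} {pr : ZMod 2 → U →ₗ[k] U}
  {F G : WordForm k U} {n m : ℕ} [FiniteDimensional k U] {β : LinearMap.BilinForm k U}
  {I : U →ₗ[k] U}

theorem bracketAt_eq_zero {n₁ n₂ : ℕ} {f g : ∀ n : ℕ, Equiv.Perm (Fin n) → (Fin n → J) → k⟦X⟧}
    (hf : ∀ σ d, f n₁ σ d = 0) (e : Fin n₁ ⊕ Fin n₂ ≃ Fin (n + 2)) (σ : Equiv.Perm (Fin n))
    (W : (Fin (n + 2) → J) → k) : bracketAt p f g e σ W = 0 := by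
  unfold bracketAt
  simp [hf]

/-- Only pairs of letters contribute to the bracket with a quadratic term. -/
theorem sum_bracketAt_pair {f g : ∀ n : ℕ, Equiv.Perm (Fin n) → (Fin n → J) → k⟦X⟧}
    (hf : EvenCoeffs p f) (hg : EvenCoeffs p g) (hf' : ∀ n, n ≠ 2 → ∀ σ d, f n σ d = 0)
    (σ : Equiv.Perm (Fin n)) (W : (Fin (n + 2) → J) → k) :
    (∑ T : Finset (Fin (n + 2)),
      if 0 ∈ T ∧ 1 ∉ T then bracketAt p f g (blockEquiv T) σ W else 0) =
    ∑ l, bracketAt p f g (pairEquiv l) σ W := by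
  classical
  have hT : ∀ (l : Fin n) (x : Fin 2 ⊕ Fin n),
      pairEquiv l x ∈ ({0, l.succ.succ} : Finset (Fin (n + 2))) ↔ x.isLeft := by
    rintro l (x | x)
    · rw [Finset.mem_insert, Finset.mem_singleton]
      fin_cases x
      · simp [pairEquiv_inl_zero]
      · simp [pairEquiv_inl_one]
    · rw [Finset.mem_insert, Finset.mem_singleton, pairEquiv_inr]
      by_cases hx : x = l
      · simp [hx, Fin.ext_iff]
      · rw [if_neg hx]
        refine iff_of_false ?_ (by simp)
        rintro (e | e)
        · exact succ_succ_ne_zero x e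
        · exact hx (Fin.succ_injective _ (Fin.succ_injective _ e))
  have hinj : Function.Injective fun l : Fin n => ({0, l.succ.succ} : Finset (Fin (n + 2))) := by
    intro l l' hll
    have : l.succ.succ ∈ ({0, l'.succ.succ} : Finset (Fin (n + 2))) := by
      rw [← show ({0, l.succ.succ} : Finset (Fin (n + 2))) = {0, l'.succ.succ} from hll]
      simp
    rw [Finset.mem_insert, Finset.mem_singleton] at this
    exact Fin.succ_injective _ (Fin.succ_injective _ (this.resolve_left (succ_succ_ne_zero l)))
  -- Only sets `T` with two elements matter, and those containing `0` but not `1` are the sets `{0,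
  -- l + 2}`.
  rw [← Finset.sum_subset (Finset.subset_univ
    (Finset.univ.image fun l : Fin n => ({0, l.succ.succ} : Finset (Fin (n + 2)))))]
  · rw [Finset.sum_image fun l _ l' _ h => hinj h]
    refine Finset.sum_congr rfl fun l _ => ?_
    rw [if_pos ⟨by simp, by simp [Fin.ext_iff]⟩]
    refine bracketAt_blockEquiv hf hg _ _ (fun i => (hT l _).2 rfl) (fun i h => ?_) σ W
    exact absurd ((hT l _).1 h) (by simp)
  · intro T _ hne
    split_ifs with h01
    · refine bracketAt_eq_zero (hf' _ fun hc => hne ?_) _ _ _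
      obtain ⟨x, y, hxy, rfl⟩ := Finset.card_eq_two.1 hc
      rw [Finset.mem_image]
      have key : ∀ z : Fin (n + 2), z ≠ 0 → z ≠ 1 → ∃ l : Fin n, z = l.succ.succ := by
        intro z
        refine Fin.cases (fun h => absurd rfl h) (fun z => ?_) z
        refine Fin.cases (fun _ h => absurd rfl h) (fun z _ _ => ⟨z, rfl⟩) z
      simp only [Finset.mem_insert, Finset.mem_singleton, not_or] at h01
      rcases h01.1 with rfl | rfl
      · obtain ⟨l, rfl⟩ := key y (Ne.symm hxy) (Ne.symm h01.2.2)
        exact ⟨l, Finset.mem_univ _, rfl⟩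
      · obtain ⟨l, rfl⟩ := key x hxy (Ne.symm h01.2.1)
        exact ⟨l, Finset.mem_univ _, Finset.pair_comm _ _⟩
    · rfl

namespace IsOddOperator

theorem formCoeffs_quadraticTerm (h : IsOddOperator b p pr β I) (σ : Equiv.Perm (Fin 2))
    (d : Fin 2 → J) : formCoeffs b (quadraticTerm pr β I) 2 σ d =
      if σ = Equiv.swap 0 1 then PowerSeries.C (β (b (d 0)) (I (b (d 1)))) else 0 :=
  h.quadraticTerm_two σ _

theorem form_basis_ne_zero (h : IsOddOperator b p pr β I) {i j : J} (hij : β (b i) (I (b j)) ≠ 0) :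
    p i = p j := by
  by_contra hne
  refine hij (h.form_eq_zero (q₁ := p i) (q₂ := p j) ?_ ?_ hne)
  · rw [h.pr_basis, if_pos rfl]
  · rw [h.pr_basis, if_pos rfl]

theorem coord_parityInv (h : IsOddOperator b p pr β I) (j : J) (x : U) :
    b.coord j (parityInv pr x) = chi k (p j) * b.coord j x := by
  unfold parityInv
  rw [LinearMap.sub_apply, map_sub, coord_pr b h.pr_basis, coord_pr b h.pr_basis]
  rcases zmod_two_cases (p j) with hj | hj
  · rw [hj, if_pos rfl, if_neg (by decide), sub_zero, chi_zero, one_mul]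
  · rw [hj, if_pos rfl, if_neg (by decide), zero_sub, chi_one, neg_one_mul]

/-- Where the quadratic form and the inverse tensor are nonzero, the letters `1` and `l + 2` have
opposite parities. So `kexp_transposition` applies, and its sign is the one in `dualAction`. -/
theorem shuffle_pairEquiv (h : IsOddOperator b p pr β I) (l : Fin n) (a : Fin n → U)
    (d₁ : Fin 2 → J) (d₂ : Fin n → J) :
    shuffle p (pairEquiv l) (insertTwo (fun i j => casimir β (b.coord i) (b.coord j))
        (coordProd b a)) d₁ d₂ * β (b (d₁ 0)) (I (b (d₁ 1))) =
      (casimir β (b.coord (d₁ 0)) (b.coord (d₂ l)) * β (b (d₁ 0)) (I (b (d₁ 1)))) *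
        b.coord (d₁ 1) (a l) * (chi k (∑ j, if j < l then p (d₂ j) else 0) *
          ∏ j ∈ Finset.univ.erase l, b.coord (d₂ j) (a j)) := by
  set D : Fin (n + 2) → J := Sum.elim d₁ d₂ ∘ (pairEquiv l).symm with hD
  have hD0 : D 0 = d₁ 0 := by
    rw [hD, Function.comp_apply, ← pairEquiv_inl_zero l, Equiv.symm_apply_apply]
    rfl
  have hDl : D l.succ.succ = d₁ 1 := by
    rw [hD, Function.comp_apply, ← pairEquiv_inl_one l, Equiv.symm_apply_apply]
    rfl
  have hD1 : D 1 = d₂ l := by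
    have : (1 : Fin (n + 2)) = pairEquiv l (Sum.inr l) := by rw [pairEquiv_inr, if_pos rfl]
    rw [hD, Function.comp_apply, this, Equiv.symm_apply_apply]
    rfl
  have hDj : ∀ j, j ≠ l → D j.succ.succ = d₂ j := by
    intro j hj
    have : j.succ.succ = pairEquiv l (Sum.inr j) := by rw [pairEquiv_inr, if_neg hj]
    rw [hD, Function.comp_apply, this, Equiv.symm_apply_apply]
    rfl
  unfold shuffle
  rw [← hD]
  by_cases hβ : β (b (d₁ 0)) (I (b (d₁ 1))) = 0
  · simp [hβ]
  unfold insertTwo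
  rw [hD0, hD1]
  by_cases hc : casimir β (b.coord (d₁ 0)) (b.coord (d₂ l)) = 0
  · simp [hc]
  have h1 := h.form_basis_ne_zero hβ
  have h2 := h.casimir_odd _ _ hc
  have h3 : (p ∘ D) 1 = (p ∘ D) l.succ.succ + 1 := by
    rw [Function.comp_apply, Function.comp_apply, hD1, hDl, ← h1, h2, zmod_two_add_add]
  simp only [finSumFinEquiv_pairEquiv_symm]
  rw [kexp_transposition (p ∘ D) l h3]
  have h4 : (∑ j, if j < l then (p ∘ D) j.succ.succ else 0) = ∑ j, if j < l then p (d₂ j) else 0 := by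
    refine Finset.sum_congr rfl fun j _ => ?_
    split_ifs with hj
    · rw [Function.comp_apply, hDj j hj.ne]
    · rfl
  rw [h4]
  unfold coordProd
  rw [← Finset.mul_prod_erase _ _ (Finset.mem_univ l)]
  dsimp only
  rw [hDl, Finset.prod_congr rfl fun j hj => by rw [hDj j (Finset.ne_of_mem_erase hj)]]
  ring

/-- Contracting the inverse tensor with the functional `β (I ·)` returns `I`, by its defining
property. -/
theorem sum_shuffle_pairEquiv (h : IsOddOperator b p pr β I) (l : Fin n) (a : Fin n → U)
    (d₂ : Fin n → J) :
    ∑ d₁ : Fin 2 → J, shuffle p (pairEquiv l)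
      (insertTwo (fun i j => casimir β (b.coord i) (b.coord j)) (coordProd b a)) d₁ d₂ *
        β (b (d₁ 0)) (I (b (d₁ 1))) =
      coordProd b (fun j => if j < l then parityInv pr (a j) else
        if j = l then I (a j) else a j) d₂ := by
  simp only [h.shuffle_pairEquiv]
  rw [← Finset.sum_mul, ← (finTwoArrowEquiv J).symm.sum_comp, Fintype.sum_prod_type_right]
  have h1 : ∀ j, ∑ i, casimir β (b.coord i) (b.coord (d₂ l)) * β (b i) (I (b j)) =
      b.coord (d₂ l) (I (b j)) := by
    intro j
    have e1 := casimir_form_right h.nondeg h.symm (b.coord (d₂ l)) (I (b j))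
    rw [casimir_comm h.symm, eq_sum_coord b (β (I (b j))), casimir_sum_left] at e1
    rw [← e1]
    refine Finset.sum_congr rfl fun i _ => ?_
    rw [casimir_smul_left, h.symm.eq, mul_comm]
  have h2 : ∑ j, ∑ i, casimir β (b.coord ((finTwoArrowEquiv J).symm (i, j) 0)) (b.coord (d₂ l)) *
      β (b ((finTwoArrowEquiv J).symm (i, j) 0)) (I (b ((finTwoArrowEquiv J).symm (i, j) 1))) *
        b.coord ((finTwoArrowEquiv J).symm (i, j) 1) (a l) = b.coord (d₂ l) (I (a l)) := by
    conv_rhs => rw [← b.sum_repr (a l), map_sum, map_sum]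
    refine Finset.sum_congr rfl fun j _ => ?_
    rw [map_smul, map_smul, ← h1, smul_eq_mul, Finset.mul_sum]
    refine Finset.sum_congr rfl fun i _ => ?_
    exact mul_comm _ _
  rw [h2, chi_sum]
  unfold coordProd
  conv_rhs => rw [← Finset.mul_prod_erase _ _ (Finset.mem_univ l)]
  dsimp only
  rw [if_neg (lt_irrefl l), if_pos rfl,
    ← Finset.mul_prod_erase _ (fun i => chi k (if i < l then p (d₂ i) else 0))
      (Finset.mem_univ l), if_neg (lt_irrefl l), chi_zero, one_mul, ← Finset.prod_mul_distrib]
  congr 1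
  refine Finset.prod_congr rfl fun i hi => ?_
  by_cases hil : i < l
  · rw [if_pos hil, if_pos hil, h.coord_parityInv]
  · rw [if_neg hil, if_neg hil, if_neg (Finset.ne_of_mem_erase hi), chi_zero, one_mul]

theorem bvBracket_quadraticTerm (h : IsOddOperator b p pr β I) (hF : IsEvenCyclicForm pr F) :
    bvBracket pr β (quadraticTerm pr β I) F = dualAction pr I F := by
  classical
  have hQ := h.isEvenCyclicForm_quadraticTerm
  funext n σ a
  rw [bvBracket_eq b h.pr_basis hQ hF, sum_bracketAt_pair (evenCoeffs b h.pr_basis hQ)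
    (evenCoeffs b h.pr_basis hF) (fun n hn σ d => quadraticTerm_of_ne hn σ _)]
  unfold dualAction
  refine Finset.sum_congr rfl fun l _ => ?_
  rw [form_eq_sum b hF.multilinear]
  unfold bracketAt
  rw [Finset.sum_eq_single (Equiv.swap 0 1), Finset.sum_eq_single σ]
  · rw [if_pos (gluesTo_pairEquiv l σ), Finset.sum_comm]
    refine Finset.sum_congr rfl fun d₂ _ => ?_
    rw [← h.sum_shuffle_pairEquiv, Finset.sum_smul]
    refine Finset.sum_congr rfl fun d₁ _ => ?_
    rw [h.formCoeffs_quadraticTerm, if_pos rfl, ← PowerSeries.smul_eq_C_mul, smul_smul]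
  · intro τ _ hτ
    rw [if_neg (mt (gluesTo_pairEquiv_iff l σ τ).1 hτ)]
  · simp
  · intro τ _ hτ
    refine Finset.sum_eq_zero fun σ₂ _ => ?_
    split_ifs
    · refine Finset.sum_eq_zero fun d₁ _ => Finset.sum_eq_zero fun d₂ _ => ?_
      rw [h.formCoeffs_quadraticTerm, if_neg hτ, zero_mul, smul_zero]
    · rfl
  · simp

/-- Moving `I` across `β` turns both terms into values of `I ∘ I`. -/
theorem dualAction_quadraticTerm (h : IsOddOperator b p pr β I) (hI : ∀ x, I (I x) = 0) :
    dualAction pr I (quadraticTerm pr β I) = 0 := by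
  funext n σ a
  by_cases hn : n = 2
  · subst hn
    have h0 : parityInv pr (parityInv pr (a 0)) = a 0 := by
      refine b.ext_elem fun i => ?_
      change b.coord i _ = b.coord i _
      rw [h.coord_parityInv, h.coord_parityInv, ← mul_assoc, chi_mul_self, one_mul]
    have h1 : β (I (a 0)) (I (a 1)) = 0 := by
      rw [← h0, h.adjoint, hI, map_zero]
    unfold dualAction
    rw [Fin.sum_univ_two, h.quadraticTerm_two, h.quadraticTerm_two]
    simp [hI, h1]
  · unfold dualAction
    exact Finset.sum_eq_zero fun l _ => quadraticTerm_of_ne hn σ _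

theorem bvDelta_quadraticTerm : bvDelta β (quadraticTerm pr β I) = 0 := by
  classical
  funext n σ a
  unfold bvDelta
  rw [Finset.sum_eq_zero, smul_zero]
  · rfl
  intro σ' _
  split_ifs with hσ
  · refine Finset.sum_eq_zero fun i _ => ?_
    -- The quadratic term is evaluated on two letters only when `n = 0`; then gluing would leave an
    -- empty word, which `GluesTo` excludes.
    by_cases hn : n = 0
    · subst hn
      obtain ⟨l, -⟩ := hσ.1 0
      exact l.elim0
    · exact quadraticTerm_of_ne (by omega) _ _
  · rfl

end IsOddOperator

theorem IsEvenCyclicForm.add (hF : IsEvenCyclicForm pr F) (hG : IsEvenCyclicForm pr G) :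
    IsEvenCyclicForm pr (F + G) where
  multilinear n σ := by
    obtain ⟨M, hM⟩ := hF.multilinear n σ
    obtain ⟨M', hM'⟩ := hG.multilinear n σ
    exact ⟨M + M', fun a => by simp [hM, hM']⟩
  equivariant n σ g a q hq := by
    simp only [Pi.add_apply, smul_add, hF.equivariant n σ g a q hq, hG.equivariant n σ g a q hq]
  even n σ a q hq hs := by
    simp only [Pi.add_apply, hF.even n σ a q hq hs, hG.even n σ a q hq hs, add_zero]

theorem bvDelta_add : bvDelta β (F + G) = bvDelta β F + bvDelta β G := by
  classical
  funext n σ a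
  unfold bvDelta
  simp only [Pi.add_apply, Finset.sum_add_distrib, ← smul_add]
  rw [← Finset.sum_add_distrib]
  congr 1
  refine Finset.sum_congr rfl fun σ' _ => ?_
  split_ifs <;> simp

theorem tensorAt_add_left (F' : WordForm k U) (T : Finset (Fin m)) (σ₁ : Equiv.Perm (Fin T.card))
    (σ₂ : Equiv.Perm (Fin Tᶜ.card)) (x : Fin m → U) :
    tensorAt pr (F + F') G T σ₁ σ₂ x = tensorAt pr F G T σ₁ σ₂ x + tensorAt pr F' G T σ₁ σ₂ x := by
  unfold tensorAt
  simp only [Pi.add_apply, add_mul, smul_add, Finset.sum_add_distrib]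

theorem bvBracket_add_left (F' : WordForm k U) :
    bvBracket pr β (F + F') G = bvBracket pr β F G + bvBracket pr β F' G := by
  classical
  funext n σ a
  unfold bvBracket
  simp only [Pi.add_apply, tensorAt_add_left]
  rw [← Finset.sum_add_distrib]
  refine Finset.sum_congr rfl fun T _ => ?_
  split_ifs
  · rw [← Finset.sum_add_distrib]
    refine Finset.sum_congr rfl fun σ₁ _ => ?_
    rw [← Finset.sum_add_distrib]
    refine Finset.sum_congr rfl fun σ₂ _ => ?_
    split_ifs
    · exact Finset.sum_add_distrib
    · exact (add_zero 0).symm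
  · exact (add_zero 0).symm

namespace IsOddOperator

/-- Adding the quadratic term turns the equivariant equation into the plain one. -/
theorem bvLHS_add_quadraticTerm [CharZero k] (h : IsOddOperator b p pr β I)
    (hF : IsEvenCyclicForm pr F) (hI : ∀ x, I (I x) = 0) :
    bvLHS pr β (F + quadraticTerm pr β I) = bvLHS pr β F + dualAction pr I F := by
  have hQ := h.isEvenCyclicForm_quadraticTerm
  unfold bvLHS
  rw [bvDelta_add, bvDelta_quadraticTerm, add_zero, bvBracket_add_left,
    h.bvBracket_comm hF (hF.add hQ), bvBracket_add_left, h.bvBracket_quadraticTerm hF,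
    h.bvBracket_quadraticTerm (hF.add hQ)]
  have h1 : dualAction pr I (F + quadraticTerm pr β I) = dualAction pr I F := by
    rw [← add_zero (dualAction pr I F), ← h.dualAction_quadraticTerm hI]
    funext n σ a
    exact Finset.sum_add_distrib
  rw [h1, add_assoc, add_assoc, ← two_smul k (dualAction pr I F), smul_add, smul_smul,
    inv_mul_cancel₀ two_ne_zero, one_smul]

end IsOddOperator

end quadratic

/-! ### The image of the projection -/

namespace IsHomotopyAlgebra

variable {k A : Type*} [Field k] [CharZero k] [NonUnitalRing A] [Module k A]
  [IsScalarTower k A A] [SMulCommClass k A A] [FiniteDimensional k A]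
  {𝒜 : ZMod 2 → Submodule k A} [DirectSum.Decomposition 𝒜] {β : LinearMap.BilinForm k A}
  {I H P : A →ₗ[k] A}

/-- A basis of `B` is selected from the images under `P` of a homogeneous basis of `A`. As `P` is
even, its members are homogeneous. -/
theorem exists_isOddOperator (h : IsHomotopyAlgebra 𝒜 β I H P) :
    ∃ (J : Set (LinearMap.range P)) (_ : Fintype J) (b : Module.Basis J k (LinearMap.range P))
      (p : J → ZMod 2), IsOddOperator b p (piProjRange 𝒜 P) (β.restrict (LinearMap.range P))
        (onRange P I) := by
  obtain ⟨_, b₀, p₀, hb₀⟩ := exists_homogeneous_basis 𝒜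
  have hspan : ⊤ ≤ Submodule.span k (Set.range fun j => P.rangeRestrict (b₀ j)) := by
    have h1 : Set.range (fun j => P.rangeRestrict (b₀ j)) = P.rangeRestrict '' Set.range b₀ :=
      Set.range_comp _ _
    rw [h1, Submodule.span_image, b₀.span_eq, Submodule.map_top, LinearMap.range_rangeRestrict]
  have hb : ∀ j, ∃ q, (Module.Basis.ofSpan hspan j : A) ∈ 𝒜 (q + 1) := by
    intro j
    obtain ⟨i, hi⟩ := Module.Basis.ofSpan_subset hspan ⟨j, rfl⟩
    exact ⟨p₀ i, by rw [← hi]; exact h.P_mem (hb₀ i)⟩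
  choose p hp using hb
  have hfin : Fintype _ := FiniteDimensional.fintypeBasisIndex (Module.Basis.ofSpan hspan)
  refine ⟨_, hfin, Module.Basis.ofSpan hspan, p, ?_⟩
  generalize Module.Basis.ofSpan hspan = b at hp
  have hpr : ∀ q j, piProjRange 𝒜 P q (b j) = if p j = q then b j else 0 := by
    intro q j
    refine Subtype.ext ?_
    rw [h.coe_piProjRange]
    unfold piProj
    split_ifs with hj
    · exact parityProj_of_mem 𝒜 (hj ▸ hp j)
    · exact parityProj_of_mem_ne 𝒜 (hp j) fun e => hj (add_right_cancel e)
  have hadj : ∀ x y, β (P x) y = β x (P y) := h.proj_adjoint b₀ hb₀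
  refine ⟨hpr, h.symm.restrict _, restrict_nondegenerate h.nondeg h.symm h.idem hadj,
    fun i j hij => ?_, fun x y => ?_, fun i j hij => ?_⟩
  · by_contra hne
    refine hij (h.form_eq_zero (hp i) (hp j) fun e => hne ?_)
    generalize p i = x at e ⊢
    generalize p j = y at e ⊢
    revert x y
    decide
  · have key : (β.restrict (LinearMap.range P)) ∘ₗ onRange P I ∘ₗ parityInv (piProjRange 𝒜 P) =
        ((β.restrict (LinearMap.range P)).flip ∘ₗ onRange P I).flip := by
      refine b.ext fun j => LinearMap.ext fun y => ?_
      have e1 : parityInv (piProjRange 𝒜 P) (b j) = chi k (p j) • b j := by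
        unfold parityInv
        rw [LinearMap.sub_apply, hpr, hpr]
        rcases zmod_two_cases (p j) with hj | hj <;> simp [hj]
      simp only [LinearMap.comp_apply, e1, map_smul, LinearMap.smul_apply]
      change chi k (p j) • β (onRange P I (b j) : A) y = β (b j : A) (onRange P I y : A)
      rw [h.coe_onRange_I, h.coe_onRange_I, h.I_form' (hp j), chi_add, chi_one, smul_eq_mul]
      linear_combination β (b j : A) (I y) * chi_mul_self (k := k) (p j)
    exact LinearMap.congr_fun (LinearMap.congr_fun key x) y
  · by_contra hne
    refine hij ?_
    have e1 : piProjRange 𝒜 P (p j + 1) (onRange P I (b j)) = onRange P I (b j) := by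
      refine Subtype.ext ?_
      rw [h.coe_piProjRange, h.coe_onRange_I]
      exact parityProj_of_mem 𝒜 (h.I_odd _ _ (hp j))
    rw [← e1, coord_pr b hpr, if_neg hne]

end IsHomotopyAlgebra

end NCBV

end

theorem mainTheorem1 {k A : Type*} [Field k] [IsAlgClosed k] [CharZero k]
    [NonUnitalRing A] [Module k A] [IsScalarTower k A A] [SMulCommClass k A A]
    [FiniteDimensional k A]
    (𝒜 : ZMod 2 → Submodule k A) [DirectSum.Decomposition 𝒜] [SetLike.GradedMul 𝒜]
    -- the odd scalar product
    (β : LinearMap.BilinForm k A) (hβ_symm : β.IsSymm) (hβ_nondeg : β.Nondegenerate)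
    (hβ_odd : ∀ i, ∀ a ∈ 𝒜 i, ∀ b ∈ 𝒜 i, β a b = 0)
    (hβ_cyclic : ∀ i j l, ∀ a ∈ 𝒜 i, ∀ b ∈ 𝒜 j, ∀ c ∈ 𝒜 l,
      NCBV.threeTensor 𝒜 β a b c =
        NCBV.sgn ((l + 1) * (i + j)) • NCBV.threeTensor 𝒜 β c a b)
    -- the odd derivation, which preserves the scalar product
    (I : A →ₗ[k] A) (hI_odd : ∀ i, ∀ a ∈ 𝒜 i, I a ∈ 𝒜 (i + 1))
    (hI_deriv : ∀ i, ∀ a ∈ 𝒜 i, ∀ b, I (a * b) = I a * b + NCBV.sgn i • (a * I b))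
    (hI_β : ∀ i, ∀ a ∈ 𝒜 i, ∀ b, β (I a) b + NCBV.sgn i • β a (I b) = 0)
    -- the odd self-adjoint homotopy
    (H : A →ₗ[k] A) (hH_odd : ∀ i, ∀ a ∈ 𝒜 i, H a ∈ 𝒜 (i + 1))
    (hH_selfAdj : ∀ i, ∀ a ∈ 𝒜 i, ∀ b, β (H a) b = NCBV.sgn i • β a (H b))
    (P : A →ₗ[k] A) (hP : LinearMap.id - (I ∘ₗ H + H ∘ₗ I) = P) (hP_idem : P ∘ₗ P = P)
    (hH_comm : I ∘ₗ I ∘ₗ H = H ∘ₗ I ∘ₗ I) :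
    -- the tensors of ribbon graphs depend only on the isomorphism class
    (∀ (n N : ℕ) (Γ Γ' : NCBV.RibbonGraph n N), Γ.Iso Γ' →
      ∀ a, NCBV.ribbonTensor 𝒜 β H Γ a = NCBV.ribbonTensor 𝒜 β H Γ' a) ∧
    -- `S` lies in the space of the equation and solves the equivariant equation
    NCBV.IsEvenCyclicForm (NCBV.piProjRange 𝒜 P) (NCBV.ribbonSum 𝒜 β H P) ∧
    NCBV.bvLHS (NCBV.piProjRange 𝒜 P) (β.restrict (LinearMap.range P)) (NCBV.ribbonSum 𝒜 β H P) +
      NCBV.dualAction (NCBV.piProjRange 𝒜 P) (NCBV.onRange P I) (NCBV.ribbonSum 𝒜 β H P) = 0 ∧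
    -- if `I` vanishes on the image of `P`, then `S` solves the plain equation
    ((∀ x ∈ LinearMap.range P, I x = 0) →
      NCBV.bvLHS (NCBV.piProjRange 𝒜 P) (β.restrict (LinearMap.range P))
        (NCBV.ribbonSum 𝒜 β H P) = 0) ∧
    -- if `I²` vanishes on the image of `P`, then `S + S₀₂` solves the plain equation
    ((∀ x ∈ LinearMap.range P, I (I x) = 0) →
      NCBV.IsEvenCyclicForm (NCBV.piProjRange 𝒜 P)
        (NCBV.ribbonSum 𝒜 β H P +
          NCBV.quadraticTerm (NCBV.piProjRange 𝒜 P) (β.restrict (LinearMap.range P))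
            (NCBV.onRange P I)) ∧
      NCBV.bvLHS (NCBV.piProjRange 𝒜 P) (β.restrict (LinearMap.range P))
        (NCBV.ribbonSum 𝒜 β H P +
          NCBV.quadraticTerm (NCBV.piProjRange 𝒜 P) (β.restrict (LinearMap.range P))
            (NCBV.onRange P I)) = 0) := by
  have h : NCBV.IsHomotopyAlgebra 𝒜 β I H P :=
    { mul_mem := fun _ _ _ ha _ hb => SetLike.GradedMul.mul_mem ha hb
      symm := hβ_symm
      nondeg := hβ_nondeg
      odd := hβ_odd
      cyclic := hβ_cyclic
      I_odd := hI_odd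
      I_mul := hI_deriv
      I_form := hI_β
      H_odd := hH_odd
      H_form := hH_selfAdj
      proj := hP
      idem := hP_idem
      comm := hH_comm }
  have hS := NCBV.isEvenCyclicForm_ribbonSum h
  have hE := NCBV.equivariant_equation h
  obtain ⟨J, _, b, p, hb⟩ := h.exists_isOddOperator
  refine ⟨fun n N Γ Γ' hi a => NCBV.ribbonTensor_iso h hi a, hS, hE, fun hI => ?_, fun hI => ?_⟩
  · have h0 : NCBV.onRange P I = 0 := by
      ext x
      rw [h.coe_onRange_I, hI x x.2]
      rfl
    have h1 : NCBV.dualAction (NCBV.piProjRange 𝒜 P) (NCBV.onRange P I)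
        (NCBV.ribbonSum 𝒜 β H P) = 0 := by
      funext n σ a
      refine Finset.sum_eq_zero fun l _ => ?_
      obtain ⟨M, hM⟩ := hS.multilinear n σ
      rw [hM]
      exact M.map_coord_zero l (by simp [h0])
    rw [h1, add_zero] at hE
    exact hE
  · have hI' : ∀ x, NCBV.onRange P I (NCBV.onRange P I x) = 0 := fun x => by
      refine Subtype.ext ?_
      rw [h.coe_onRange_I, h.coe_onRange_I, hI x x.2]
      rfl
    refine ⟨hS.add hb.isEvenCyclicForm_quadraticTerm, ?_⟩
    rw [hb.bvLHS_add_quadraticTerm hS hI', hE]
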